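/- Let $A$ be a principal ideal domain. Let $X$ be a pointed path-connected topological space (for example a connected CW complex) or a pointed connected simplicial set, whose fundamental group $\pi=\pi_1(X,*)$ (of the geometric realization, if $X$ is a simplicial set) is finitely generated. Let $C(X)=C^{\le 2}(X;A)$ be the truncation to degrees $\le 2$ of the algebra of normalized singular (respectively simplicial) cochains with the cup product, as an augmented dg algebra with augmentation the restriction to the base point. Let $H(X)=H^0_{Bar}(C(X))$ be the degree-$0$ cohomology of the bar construction on the augmentation ideal of $C(X)$, with the increasing weight filtration $F_0\subseteq F_1\subseteq\cdots$ by number of tensor factors and the maps induced by deconcatenation and by the counit $\eta$ (the weight-$0$ component). Let $I\subset A[\pi]$ be the augmentation ideal and $A[\pi]^\wedge_I=\varprojlim_n A[\pi]/I^n$. For a singular bar class $T$ and a loop $\gamma$ at $*$, let $\ell_T(\gamma)\in A$ be the letter-braiding number, i.e. the linear coefficient of $\gamma^*T\in H^0_{Bar}(S^1;A)=A[t]$, and put $\langle T,\gamma\rangle=\eta(T)+\ell_T(\gamma)$. **1 (functionals of finite type).** The map $H^0_{Bar}(C^{\le2}(\mathrm{Sing}|X|;A))\to H(X)$ induced by $X\to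 \mathrm{Sing}|X|$ (the identity for spaces) is bijective. Deconcatenation and $\eta$ make $H(X)$ a filtered coalgebra, with $\Delta F_n\subseteq\sum_{i+j=n}F_i\otimes F_j$ and $\bigcup_n F_n = H(X)$. The functionals $\varphi\colon A[\pi]\to A$ of finite type, i.e. those that vanish on some $I^n$, form a coalgebra with $\langle\Delta\varphi,x\otimes y\rangle=\varphi(xy)$ and counit $\varphi\mapsto\varphi(1)$. The letter-braiding pairing $T\mapsto\langle T,-\rangle$ is well defined on $\pi$ and is an isomorphism of coalgebras $$H(X)\;\cong\;\varinjlim_n \mathrm{Hom}_A(A[\pi]/I^n,A),$$ under which $F_n$ corresponds to $\mathrm{Hom}_A(A[\pi]/I^{n+1},A)$. **2 (the completed group ring and the dual algebra).** There is a homomorphism $\Psi$ of $A$-algebras from $A[\pi]^\wedge_I$ to the convolution algebra $\mathrm{Hom}_A(H(X),A)$ with $\Psi(s)(T)=\langle T,x\rangle$ whenever $T\in F_n$ and $x\in A[\pi]$ represents the component $s_{n+1}\in A[\pi]/I^{n+1}$. It is surjective; $\Psi(s)$ vanishes on $F_n$ if and only if $s_{n+1}$ is an $A$-torsion element; and $\Psi$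 is open: for every $n$ there is an $m$ such that every functional vanishing on $F_m$ is $\Psi(s)$ for some $s$ with $s_n=0$. If all $A[\pi]/I^n$ are torsion-free over $A$ (for example if $A$ is a field), $\Psi$ is bijective, hence a topological isomorphism. **3 (determination of the completed group ring).** Let $X$ and $Y$ be two such objects (each a space or a simplicial set), and let $F\colon C(X)\to C(Y)$ be any isomorphism of augmented dg algebras. Then there is an isomorphism of $A$-algebras $\Theta\colon A[\pi_1(Y,*)]^\wedge_I\to A[\pi_1(X,*)]^\wedge_I$ with $(\Theta s)_n=0\iff s_n=0$ for all $n$ and $s$, which is compatible with letter-braiding: for every $n$, $T\in F_nH(X)$ and $s$, one has $\langle T,x\rangle=\langle F_*T,y\rangle$ for all representatives $x$ of $(\Theta s)_{n+1}$ and $y$ of $s_{n+1}$. -/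

import Mathlib

open CategoryTheory TensorProduct DirectSum

universe u u' v w w'

namespace LetterBraiding

/-- Augmented associative differential graded algebras over `A`, graded by `ℕ`, with differential
of degree `+1`. -/
structure AugDGA (A : Type v) [CommRing A] where
  carrier : Type w
  [ring : Ring carrier]
  [algebra : Algebra A carrier]
  /-- `grading n` is the submodule of homogeneous elements of degree `n`. -/
  grading : ℕ → Submodule A carrier
  [graded : GradedAlgebra grading]
  d : carrier →ₗ[A] carrier
  d_mem : ∀ n, ∀ c ∈ grading n, d c ∈ grading (n + 1)
  d_d : ∀ c, d (d c) = 0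
  leibniz : ∀ n, ∀ a ∈ grading n, ∀ b, d (a * b) = d a * b + (-1 : A) ^ n • (a * d b)
  aug : carrier →ₐ[A] A
  aug_d : ∀ c, aug (d c) = 0
  aug_pos : ∀ n, 0 < n → ∀ c ∈ grading n, aug c = 0

attribute [instance] AugDGA.ring AugDGA.algebra AugDGA.graded

namespace AugDGA

variable {A : Type v} [CommRing A]

/-- Homomorphisms of augmented dg algebras. -/
structure Hom (C : AugDGA.{v, w} A) (C' : AugDGA.{v, w'} A) where
  toAlgHom : C.carrier →ₐ[A] C'.carrier
  map_grading : ∀ n, ∀ c ∈ C.grading n, toAlgHom c ∈ C'.grading n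
  map_d : ∀ c, toAlgHom (C.d c) = C'.d (toAlgHom c)
  map_aug : ∀ c, C'.aug (toAlgHom c) = C.aug c

section Bar

variable (C : AugDGA.{v, w} A)

/-- The augmentation ideal, as an `A`-module. -/
def augIdeal : Type w := LinearMap.ker C.aug.toLinearMap

instance : AddCommGroup C.augIdeal :=
  inferInstanceAs (AddCommGroup (LinearMap.ker C.aug.toLinearMap))

instance : Module A C.augIdeal :=
  inferInstanceAs (Module A (LinearMap.ker C.aug.toLinearMap))

/-- The inclusion of the augmentation ideal. -/
def incl : C.augIdeal →ₗ[A] C.carrier := (LinearMap.ker C.aug.toLinearMap).subtype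

lemma aug_incl (a : C.augIdeal) : C.aug (C.incl a) = 0 := a.2

lemma incl_injective : Function.Injective C.incl := Subtype.val_injective

/-- An element of augmentation zero, as an element of the augmentation ideal. -/
def toAugIdeal (c : C.carrier) (hc : C.aug c = 0) : C.augIdeal := ⟨c, hc⟩

@[simp] lemma incl_toAugIdeal (c : C.carrier) (hc : C.aug c = 0) :
    C.incl (C.toAugIdeal c hc) = c := rfl

/-- The Koszul sign operator of the desuspension `𝐬⁻¹C`: multiplication by `(-1) ^ (n - 1)`, that is
by `(-1) ^ (n + 1)`, on elements of `C` of degree `n`. -/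
noncomputable def sgnFull : C.carrier →ₗ[A] C.carrier :=
  DirectSum.toModule A ℕ C.carrier (fun n => (-1 : A) ^ (n + 1) • (C.grading n).subtype) ∘ₗ
    (DirectSum.decomposeLinearEquiv C.grading).toLinearMap

variable {C} in
lemma sgnFull_of_mem {n : ℕ} {c : C.carrier} (hc : c ∈ C.grading n) :
    C.sgnFull c = (-1 : A) ^ (n + 1) • c := by
  have h : DirectSum.decomposeLinearEquiv C.grading c =
      DirectSum.lof A ℕ (fun n => C.grading n) n ⟨c, hc⟩ := DirectSum.decompose_of_mem _ hc
  rw [sgnFull, LinearMap.comp_apply, LinearEquiv.coe_coe, h, DirectSum.toModule_lof]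
  rfl

lemma aug_sgnFull (c : C.carrier) : C.aug (C.sgnFull c) = - C.aug c := by
  induction c using DirectSum.Decomposition.inductionOn C.grading with
  | zero => simp
  | @homogeneous n m =>
    rw [sgnFull_of_mem m.2]
    rcases Nat.eq_zero_or_pos n with rfl | hn
    · simp
    · simp [C.aug_pos n hn m.1 m.2]
  | add a b ha hb => simp [ha, hb, add_comm]

/-- The sign operator on the augmentation ideal. -/
noncomputable def sgn : C.augIdeal →ₗ[A] C.augIdeal :=
  C.sgnFull.restrict fun c hc => by
    have : C.aug c = 0 := hc
    simp [aug_sgnFull, this]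

@[simp] lemma incl_sgn (a : C.augIdeal) : C.incl (C.sgn a) = C.sgnFull (C.incl a) := rfl

/-- The differential on the augmentation ideal. -/
def dBar : C.augIdeal →ₗ[A] C.augIdeal :=
  C.d.restrict fun c _ => by simpa using C.aug_d c

@[simp] lemma incl_dBar (a : C.augIdeal) : C.incl (C.dBar a) = C.d (C.incl a) := rfl

/-- The product on the augmentation ideal. -/
def mulBar : C.augIdeal →ₗ[A] C.augIdeal →ₗ[A] C.augIdeal :=
  LinearMap.mk₂ A (fun a b => C.toAugIdeal (C.incl a * C.incl b) (by simp [aug_incl]))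
    (fun _ _ _ => C.incl_injective (by simp [add_mul]))
    (fun _ _ _ => C.incl_injective (by simp))
    (fun _ _ _ => C.incl_injective (by simp [mul_add]))
    (fun _ _ _ => C.incl_injective (by simp))

@[simp] lemma incl_mulBar (a b : C.augIdeal) :
    C.incl (C.mulBar a b) = C.incl a * C.incl b := rfl

/-- The underlying module of the bar construction: the sum of all tensor powers of the
augmentation ideal. The summand with index `p` consists of the tensors of weight `p`. -/
def Bar : Type (max v w) := ⨁ p : ℕ, (⨂[A]^p C.augIdeal)

noncomputable instance : AddCommGroup C.Bar :=
  inferInstanceAs (AddCommGroup (⨁ p : ℕ, (⨂[A]^p C.augIdeal)))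

noncomputable instance : Module A C.Bar :=
  inferInstanceAs (Module A (⨁ p : ℕ, (⨂[A]^p C.augIdeal)))

/-- The inclusion of the tensors of weight `p`. -/
noncomputable def ofWeight (p : ℕ) : (⨂[A]^p C.augIdeal) →ₗ[A] C.Bar :=
  DirectSum.lof A ℕ (fun p => ⨂[A]^p C.augIdeal) p

/-- The component of weight `p`. -/
noncomputable def weightComponent (p : ℕ) : C.Bar →ₗ[A] (⨂[A]^p C.augIdeal) :=
  DirectSum.component A ℕ (fun p => ⨂[A]^p C.augIdeal) p

/-- The linear map on the bar construction with given restrictions to all weights. -/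
noncomputable def liftWeights {N : Type*} [AddCommGroup N] [Module A N]
    (f : ∀ p : ℕ, (⨂[A]^p C.augIdeal) →ₗ[A] N) : C.Bar →ₗ[A] N :=
  DirectSum.toModule A ℕ N f

@[simp] lemma liftWeights_ofWeight {N : Type*} [AddCommGroup N] [Module A N]
    (f : ∀ p : ℕ, (⨂[A]^p C.augIdeal) →ₗ[A] N) (p : ℕ) (x : ⨂[A]^p C.augIdeal) :
    C.liftWeights f (C.ofWeight p x) = f p x := by
  have := DirectSum.toModule_lof (M := fun p => ⨂[A]^p C.augIdeal) A (φ := f) p x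
  exact this

lemma bar_hom_ext {N : Type*} [AddCommGroup N] [Module A N] {f g : C.Bar →ₗ[A] N}
    (h : ∀ p (c : Fin p → C.augIdeal), f (C.ofWeight p (PiTensorProduct.tprod A c)) =
      g (C.ofWeight p (PiTensorProduct.tprod A c))) : f = g := by
  refine DirectSum.linearMap_ext A fun p => ?_
  ext c
  exact h p c

@[simp] lemma weightComponent_ofWeight_self (p : ℕ) (x : ⨂[A]^p C.augIdeal) :
    C.weightComponent p (C.ofWeight p x) = x := by
  have := DirectSum.component.lof_self A (M := fun p => ⨂[A]^p C.augIdeal) p x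
  exact this

lemma weightComponent_ofWeight_of_ne {p q : ℕ} (h : p ≠ q) (x : ⨂[A]^p C.augIdeal) :
    C.weightComponent q (C.ofWeight p x) = 0 := by
  have := DirectSum.component.of (R := A) (M := fun p => ⨂[A]^p C.augIdeal) q p x
  rw [dif_neg h] at this
  exact this

/-- The summand of total degree `k` of the bar construction: a tensor `c₁ | ⋯ | cₚ` of homogeneous
elements has total degree `∑ i, (|cᵢ| - 1)`. -/
noncomputable def barDeg (k : ℤ) : Submodule A C.Bar :=
  Submodule.span A {z | ∃ (p : ℕ) (n : Fin p → ℕ) (c : Fin p → C.augIdeal),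
    (∀ i, C.incl (c i) ∈ C.grading (n i)) ∧ ∑ i, ((n i : ℤ) - 1) = k ∧
    z = C.ofWeight p (PiTensorProduct.tprod A c)}

/-- The vertical bar differential on tensors of weight `p`:
`c₁ | ⋯ | cₚ ↦ - ∑ i, ± c₁ | ⋯ | d cᵢ | ⋯ | cₚ` with the sign `∏ j < i, (-1) ^ (|cⱼ| - 1)`. -/
noncomputable def d₁ (p : ℕ) : (⨂[A]^p C.augIdeal) →ₗ[A] (⨂[A]^p C.augIdeal) :=
  - ∑ i : Fin p, PiTensorProduct.map
      (fun j => if j < i then C.sgn else if j = i then C.dBar else LinearMap.id)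

/-- The entries of the tensor `± c₁ | ⋯ | cᵢ cᵢ₊₁ | ⋯ | cₚ₊₁`, with the sign
`∏ j ≤ i, (-1) ^ (|cⱼ| - 1)`. -/
noncomputable def contract {p : ℕ} (i : Fin p) (c : Fin (p + 1) → C.augIdeal) (j : Fin p) :
    C.augIdeal :=
  if j < i then C.sgn (c j.castSucc)
  else if j = i then C.mulBar (C.sgn (c i.castSucc)) (c i.succ)
  else c j.succ

lemma contract_update_of_ne {p : ℕ} (i : Fin p) (c : Fin (p + 1) → C.augIdeal) (k : Fin (p + 1))
    (x : C.augIdeal) (j : Fin p) (h : j ≠ i.predAbove k) :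
    C.contract i (Function.update c k x) j = C.contract i c j := by
  have key : ∀ l : Fin (p + 1), l ≠ k → Function.update c k x l = c l :=
    fun l hl => Function.update_of_ne hl _ _
  have hp : (i.predAbove k : ℕ) = if (i : ℕ) < k then (k : ℕ) - 1 else k := by
    unfold Fin.predAbove
    split_ifs with h1 h2 h2 <;> simp only [Fin.lt_def, Fin.val_castSucc] at h1 <;>
      simp <;> omega
  have hj : (j : ℕ) ≠ (i.predAbove k : ℕ) := fun e => h (Fin.ext e)
  rw [hp] at hj
  unfold contract
  have hkk := k.2
  split_ifs with h1 h2
  · rw [key]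
    intro e
    rw [Fin.ext_iff] at e; rw [Fin.lt_def] at h1
    simp only [Fin.val_castSucc] at e
    split_ifs at hj <;> omega
  · subst h2
    rw [key, key]
    · intro e
      rw [Fin.ext_iff] at e
      simp only [Fin.val_succ] at e
      split_ifs at hj <;> omega
    · intro e
      rw [Fin.ext_iff] at e
      simp only [Fin.val_castSucc] at e
      split_ifs at hj <;> omega
  · rw [key]
    intro e
    rw [Fin.ext_iff] at e h2; rw [Fin.lt_def] at h1
    simp only [Fin.val_succ] at e
    split_ifs at hj <;> omega

lemma contract_update {p : ℕ} (i : Fin p) (c : Fin (p + 1) → C.augIdeal) (k : Fin (p + 1))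
    (x : C.augIdeal) :
    C.contract i (Function.update c k x) =
      Function.update (C.contract i c) (i.predAbove k)
        (C.contract i (Function.update c k x) (i.predAbove k)) := by
  funext j
  by_cases h : j = i.predAbove k
  · subst h; simp
  · rw [Function.update_of_ne h, contract_update_of_ne _ _ _ _ _ _ h]

lemma exists_contract_update {p : ℕ} (i : Fin p) (c : Fin (p + 1) → C.augIdeal)
    (k : Fin (p + 1)) : ∃ L : C.augIdeal →ₗ[A] C.augIdeal, ∀ x,
      C.contract i (Function.update c k x) = Function.update (C.contract i c) (i.predAbove k)
        (L x) := by
  suffices h : ∃ L : C.augIdeal →ₗ[A] C.augIdeal, ∀ x,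
      C.contract i (Function.update c k x) (i.predAbove k) = L x by
    obtain ⟨L, hL⟩ := h
    exact ⟨L, fun x => by rw [← hL]; exact C.contract_update i c k x⟩
  rcases lt_trichotomy k i.castSucc with h | h | h
  · have e : i.predAbove k < i ∧ k = (i.predAbove k).castSucc := by
      rw [Fin.predAbove_of_le_castSucc _ _ h.le]
      exact ⟨by simpa [Fin.lt_def] using h, by simp⟩
    obtain ⟨e1, e2⟩ := e
    generalize i.predAbove k = j at *
    subst e2
    exact ⟨C.sgn, fun x => by simp [contract, e1]⟩
  · subst h
    have hne : i.succ ≠ i.castSucc := (Fin.castSucc_lt_succ).ne'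
    exact ⟨(C.mulBar.flip (c i.succ)) ∘ₗ C.sgn, fun x => by
      simp [contract, Function.update_of_ne hne]⟩
  · have e : k = (i.predAbove k).succ := by
      rw [Fin.predAbove_of_castSucc_lt _ _ h]; simp
    generalize i.predAbove k = j at *
    subst e
    have hle : i ≤ j := by simpa [Fin.lt_def, Nat.lt_succ_iff] using h
    rcases hle.eq_or_lt with rfl | hlt
    · have hne : i.castSucc ≠ i.succ := (Fin.castSucc_lt_succ).ne
      exact ⟨C.mulBar (C.sgn (c i.castSucc)), fun x => by
        simp [contract, Function.update_of_ne hne]⟩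
    · exact ⟨LinearMap.id, fun x => by simp [contract, hlt.not_gt, hlt.ne']⟩

/-- The `i`-th summand of the horizontal bar differential, up to the global sign:
`c₁ | ⋯ | cₚ₊₁ ↦ ± c₁ | ⋯ | cᵢ cᵢ₊₁ | ⋯ | cₚ₊₁`. -/
noncomputable def contractMap {p : ℕ} (i : Fin p) :
    (⨂[A]^(p + 1) C.augIdeal) →ₗ[A] (⨂[A]^p C.augIdeal) :=
  PiTensorProduct.lift
    { toFun := fun c => PiTensorProduct.tprod A (C.contract i c)
      map_update_add' := by
        intro inst c k x y
        obtain rfl : inst = instDecidableEqFin _ := Subsingleton.elim _ _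
        obtain ⟨L, hL⟩ := C.exists_contract_update i c k
        simp only [hL, map_add, MultilinearMap.map_update_add]
      map_update_smul' := by
        intro inst c k a x
        obtain rfl : inst = instDecidableEqFin _ := Subsingleton.elim _ _
        obtain ⟨L, hL⟩ := C.exists_contract_update i c k
        simp only [hL, map_smul, MultilinearMap.map_update_smul] }

@[simp] lemma contractMap_tprod {p : ℕ} (i : Fin p) (c : Fin (p + 1) → C.augIdeal) :
    C.contractMap i (PiTensorProduct.tprod A c) = PiTensorProduct.tprod A (C.contract i c) := by
  simp [contractMap]

/-- The horizontal bar differential on tensors of positive weight `p + 1`. -/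
noncomputable def d₂ (p : ℕ) : (⨂[A]^(p + 1) C.augIdeal) →ₗ[A] (⨂[A]^p C.augIdeal) :=
  - ∑ i : Fin p, C.contractMap i

/-- The bar differential restricted to tensors of weight `p`. -/
noncomputable def barDiffAux : (p : ℕ) → (⨂[A]^p C.augIdeal) →ₗ[A] C.Bar
  | 0 => C.ofWeight 0 ∘ₗ C.d₁ 0
  | p + 1 => C.ofWeight (p + 1) ∘ₗ C.d₁ (p + 1) + C.ofWeight p ∘ₗ C.d₂ p

/-- The bar differential, of degree `+1`. -/
noncomputable def barDiff : C.Bar →ₗ[A] C.Bar := C.liftWeights C.barDiffAux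

/-- The degree `0` cocycles of the bar construction. -/
noncomputable def Z0 : Submodule A C.Bar := C.barDeg 0 ⊓ LinearMap.ker C.barDiff

/-- The degree `0` coboundaries, as a submodule of the cocycles. -/
noncomputable def B0 : Submodule A C.Z0 :=
  ((C.barDeg (-1)).map C.barDiff).comap C.Z0.subtype

/-- The degree `0` bar cohomology `H⁰_Bar(C)`. -/
abbrev H0 := C.Z0 ⧸ C.B0

/-- The class of a cocycle. -/
noncomputable abbrev cls : C.Z0 →ₗ[A] C.H0 := C.B0.mkQ

/-- The weight filtration on `H⁰_Bar(C)`: the classes that are represented by cocycles of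
weight `≤ n`, equivalently the kernel of `H⁰(Bar) → H⁰(Bar / Bar_{≤ n})`. -/
noncomputable def weightFiltration (n : ℕ) : Submodule A C.H0 :=
  (⨅ p ∈ Set.Ioi n, LinearMap.ker (C.weightComponent p ∘ₗ C.Z0.subtype)).map C.cls

/-- The counit of the bar construction: the weight `0` component. -/
noncomputable def barCounit : C.Bar →ₗ[A] A :=
  (PiTensorProduct.isEmptyEquiv (Fin 0)).toLinearMap ∘ₗ C.weightComponent 0

lemma barCounit_barDiff (z : C.Bar) : C.barCounit (C.barDiff z) = 0 := by
  suffices h : C.barCounit ∘ₗ C.barDiff = 0 from LinearMap.congr_fun h z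
  refine C.bar_hom_ext fun p c => ?_
  rcases p with _ | _ | p
  · simp [barDiff, barDiffAux, barCounit, d₁]
  · simp [barDiff, barDiffAux, barCounit, d₂, weightComponent_ofWeight_of_ne]
  · simp [barDiff, barDiffAux, barCounit, weightComponent_ofWeight_of_ne]

/-- The counit of `H⁰_Bar(C)`. -/
noncomputable def counitH0 : C.H0 →ₗ[A] A :=
  C.B0.liftQ (C.barCounit ∘ₗ C.Z0.subtype) (by
    rintro z ⟨s, -, hs⟩
    have hs' : C.barDiff s = z.1 := hs
    simp [← hs', barCounit_barDiff])

/-- Deconcatenation of tensors of weight `p`: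
`c₁ | ⋯ | cₚ ↦ ∑ i, (c₁ | ⋯ | cᵢ) ⊗ (cᵢ₊₁ | ⋯ | cₚ)`, where `0 ≤ i ≤ p`. -/
noncomputable def deconcatAux (p : ℕ) : (⨂[A]^p C.augIdeal) →ₗ[A] C.Bar ⊗[A] C.Bar :=
  ∑ i : Fin (p + 1),
    TensorProduct.map (C.ofWeight i) (C.ofWeight (p - i)) ∘ₗ
      (TensorPower.mulEquiv (R := A) (M := C.augIdeal) (n := i) (m := p - i)).symm.toLinearMap ∘ₗ
      (TensorPower.cast A C.augIdeal (show p = i + (p - i) by omega)).toLinearMap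

/-- The deconcatenation coproduct of the bar construction. -/
noncomputable def deconcat : C.Bar →ₗ[A] C.Bar ⊗[A] C.Bar :=
  C.liftWeights C.deconcatAux

/-- The sign operator `(-1) ^ k` on elements of total degree `k` of the bar construction. -/
noncomputable def barSgn : C.Bar →ₗ[A] C.Bar :=
  C.liftWeights fun p => C.ofWeight p ∘ₗ PiTensorProduct.map fun _ => C.sgn

/-- The differential `x ⊗ y ↦ dx ⊗ y + (-1) ^ |x| x ⊗ dy` on `Bar(C) ⊗ Bar(C)`. -/
noncomputable def barDiff₂ : C.Bar ⊗[A] C.Bar →ₗ[A] C.Bar ⊗[A] C.Bar :=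
  TensorProduct.map C.barDiff LinearMap.id + TensorProduct.map C.barSgn C.barDiff

/-- The summand of total degree `k` of `Bar(C) ⊗ Bar(C)`. -/
noncomputable def barDeg₂ (k : ℤ) : Submodule A (C.Bar ⊗[A] C.Bar) :=
  Submodule.span A {z | ∃ i j : ℤ, i + j = k ∧ ∃ x ∈ C.barDeg i, ∃ y ∈ C.barDeg j, z = x ⊗ₜ y}

/-- `Δ` is the coproduct that deconcatenation induces on `H⁰_Bar(C)`: for every cocycle `z`, the
Künneth map `H⁰(Bar) ⊗ H⁰(Bar) → H⁰(Bar ⊗ Bar)` sends `Δ [z]` to the class of the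
deconcatenation of `z`. -/
def IsBarCoproduct (Δ : C.H0 →ₗ[A] C.H0 ⊗[A] C.H0) : Prop :=
  ∀ z : C.Z0, ∃ t : C.Z0 ⊗[A] C.Z0, TensorProduct.map C.cls C.cls t = Δ (C.cls z) ∧
    C.deconcat z - TensorProduct.map C.Z0.subtype C.Z0.subtype t ∈
      (C.barDeg₂ (-1)).map C.barDiff₂

end Bar

section Functoriality

variable {C : AugDGA.{v, w} A} {C' : AugDGA.{v, w'} A} (F : Hom C C')

namespace Hom

/-- The map on augmentation ideals. -/
def mapAug : C.augIdeal →ₗ[A] C'.augIdeal :=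
  F.toAlgHom.toLinearMap.restrict fun c hc => by
    have : C.aug c = 0 := hc
    simpa [F.map_aug] using this

@[simp] lemma incl_mapAug (a : C.augIdeal) :
    C'.incl (F.mapAug a) = F.toAlgHom (C.incl a) := rfl

lemma map_sgnFull (c : C.carrier) : F.toAlgHom (C.sgnFull c) = C'.sgnFull (F.toAlgHom c) := by
  induction c using DirectSum.Decomposition.inductionOn C.grading with
  | zero => simp
  | @homogeneous n m =>
    rw [sgnFull_of_mem m.2, sgnFull_of_mem (F.map_grading n m.1 m.2), map_smul]
  | add a b ha hb => simp [ha, hb]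

lemma mapAug_sgn (a : C.augIdeal) : F.mapAug (C.sgn a) = C'.sgn (F.mapAug a) :=
  C'.incl_injective (by simp [map_sgnFull])

lemma mapAug_dBar (a : C.augIdeal) : F.mapAug (C.dBar a) = C'.dBar (F.mapAug a) :=
  C'.incl_injective (by simp [F.map_d])

lemma mapAug_mulBar (a b : C.augIdeal) :
    F.mapAug (C.mulBar a b) = C'.mulBar (F.mapAug a) (F.mapAug b) :=
  C'.incl_injective (by simp)

/-- The map induced on bar constructions. -/
noncomputable def barMap : C.Bar →ₗ[A] C'.Bar :=
  C.liftWeights fun p => C'.ofWeight p ∘ₗ PiTensorProduct.map fun _ => F.mapAug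

@[simp] lemma barMap_ofWeight (p : ℕ) (c : Fin p → C.augIdeal) :
    F.barMap (C.ofWeight p (PiTensorProduct.tprod A c)) =
      C'.ofWeight p (PiTensorProduct.tprod A fun i => F.mapAug (c i)) := by
  simp [barMap]

lemma barMap_ofWeight_d₁ (p : ℕ) (c : Fin p → C.augIdeal) :
    F.barMap (C.ofWeight p (C.d₁ p (PiTensorProduct.tprod A c))) =
      C'.ofWeight p (C'.d₁ p (PiTensorProduct.tprod A fun i => F.mapAug (c i))) := by
  simp only [d₁, LinearMap.neg_apply, LinearMap.sum_apply, map_neg, map_sum,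
    PiTensorProduct.map_tprod, barMap_ofWeight]
  congr 1
  refine Finset.sum_congr rfl fun i _ => ?_
  congr 2
  funext j
  split_ifs <;> simp [mapAug_sgn, mapAug_dBar]

lemma barMap_ofWeight_d₂ (p : ℕ) (c : Fin (p + 1) → C.augIdeal) :
    F.barMap (C.ofWeight p (C.d₂ p (PiTensorProduct.tprod A c))) =
      C'.ofWeight p (C'.d₂ p (PiTensorProduct.tprod A fun i => F.mapAug (c i))) := by
  simp only [d₂, LinearMap.neg_apply, LinearMap.sum_apply, map_neg, map_sum,
    contractMap_tprod, barMap_ofWeight]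
  congr 1
  refine Finset.sum_congr rfl fun i _ => ?_
  congr 2
  funext j
  simp only [contract]
  split_ifs <;> simp [mapAug_sgn, mapAug_mulBar]

lemma barMap_barDiff (z : C.Bar) : F.barMap (C.barDiff z) = C'.barDiff (F.barMap z) := by
  suffices h : F.barMap ∘ₗ C.barDiff = C'.barDiff ∘ₗ F.barMap from LinearMap.congr_fun h z
  refine C.bar_hom_ext fun p c => ?_
  rcases p with _ | p
  · simp [barDiff, barDiffAux, barMap_ofWeight_d₁]
  · simp [barDiff, barDiffAux, barMap_ofWeight_d₁, barMap_ofWeight_d₂]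

lemma barMap_barDeg (k : ℤ) {z : C.Bar} (hz : z ∈ C.barDeg k) : F.barMap z ∈ C'.barDeg k := by
  suffices h : C.barDeg k ≤ (C'.barDeg k).comap F.barMap from h hz
  refine Submodule.span_le.2 ?_
  rintro _ ⟨p, n, c, hc, hn, rfl⟩
  refine Submodule.subset_span ⟨p, n, fun i => F.mapAug (c i), fun i => ?_, hn, by simp⟩
  exact F.map_grading _ _ (hc i)

/-- The map induced on cocycles. -/
noncomputable def mapZ0 : C.Z0 →ₗ[A] C'.Z0 :=
  F.barMap.restrict fun z hz => ⟨F.barMap_barDeg 0 hz.1, by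
    have : C.barDiff z = 0 := hz.2
    simp [← barMap_barDiff, this]⟩

/-- The map induced on `H⁰_Bar`. -/
noncomputable def mapH0 : C.H0 →ₗ[A] C'.H0 :=
  C.B0.mapQ C'.B0 F.mapZ0 (by
    rintro z ⟨s, hs, hz⟩
    refine ⟨F.barMap s, F.barMap_barDeg _ hs, ?_⟩
    rw [← barMap_barDiff, hz]
    rfl)

end Hom

end Functoriality
end AugDGA

section Cochains

open Simplicial

/-- Normalized simplicial cochains of degree at most `2` on a simplicial set `X`: functions on
simplices of dimension at most `2` that vanish on the degenerate simplices of positive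
dimension. -/
@[ext]
structure Cochains2 (X : SSet.{u}) (A : Type v) [Zero A] where
  c0 : X _⦋0⦌ → A
  c1 : X _⦋1⦌ → A
  c2 : X _⦋2⦌ → A
  c1_σ : ∀ v, c1 (X.σ 0 v) = 0
  c2_σ : ∀ i e, c2 (X.σ i e) = 0

namespace Cochains2

variable {X : SSet.{u}} {A : Type v} [CommRing A]

lemma c2_σ0 (c : Cochains2 X A) (e : X _⦋1⦌) : c.c2 (X.σ 0 e) = 0 := c.c2_σ 0 e
lemma c2_σ1 (c : Cochains2 X A) (e : X _⦋1⦌) : c.c2 (X.σ 1 e) = 0 := c.c2_σ 1 e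

lemma δ0_σ0 (v : X _⦋0⦌) : X.δ 0 (X.σ 0 v) = v := X.δ_comp_σ_self_apply 0 v
lemma δ1_σ0 (v : X _⦋0⦌) : X.δ 1 (X.σ 0 v) = v := X.δ_comp_σ_succ_apply 0 v
lemma δ0_σ0' (e : X _⦋1⦌) : X.δ 0 (X.σ 0 e) = e := X.δ_comp_σ_self_apply 0 e
lemma δ1_σ0' (e : X _⦋1⦌) : X.δ 1 (X.σ 0 e) = e := X.δ_comp_σ_succ_apply 0 e
lemma δ2_σ0' (e : X _⦋1⦌) : X.δ 2 (X.σ 0 e) = X.σ 0 (X.δ 1 e) :=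
  X.δ_comp_σ_of_gt_apply (i := 1) (j := 0) (by decide) e
lemma δ0_σ1' (e : X _⦋1⦌) : X.δ 0 (X.σ 1 e) = X.σ 0 (X.δ 0 e) :=
  X.δ_comp_σ_of_le_apply (i := 0) (j := 0) (by decide) e
lemma δ1_σ1' (e : X _⦋1⦌) : X.δ 1 (X.σ 1 e) = e := X.δ_comp_σ_self_apply 1 e
lemma δ2_σ1' (e : X _⦋1⦌) : X.δ 2 (X.σ 1 e) = e := X.δ_comp_σ_succ_apply 1 e
lemma δ0_δ1 (s : X _⦋2⦌) : X.δ 0 (X.δ 1 s) = X.δ 0 (X.δ 0 s) :=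
  X.δ_comp_δ_apply (i := 0) (j := 0) le_rfl s
lemma δ0_δ2 (s : X _⦋2⦌) : X.δ 0 (X.δ 2 s) = X.δ 1 (X.δ 0 s) :=
  X.δ_comp_δ_apply (i := 0) (j := 1) (by decide) s
lemma δ1_δ2 (s : X _⦋2⦌) : X.δ 1 (X.δ 2 s) = X.δ 1 (X.δ 1 s) :=
  X.δ_comp_δ_apply (i := 1) (j := 1) le_rfl s

instance : Zero (Cochains2 X A) := ⟨⟨0, 0, 0, fun _ => rfl, fun _ _ => rfl⟩⟩
instance : One (Cochains2 X A) := ⟨⟨1, 0, 0, fun _ => rfl, fun _ _ => rfl⟩⟩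
instance : Add (Cochains2 X A) := ⟨fun c c' => ⟨c.c0 + c'.c0, c.c1 + c'.c1, c.c2 + c'.c2,
  fun v => by simp [c1_σ], fun i e => by simp [c2_σ]⟩⟩
instance : Neg (Cochains2 X A) := ⟨fun c => ⟨-c.c0, -c.c1, -c.c2,
  fun v => by simp [c1_σ], fun i e => by simp [c2_σ]⟩⟩
instance : SMul A (Cochains2 X A) := ⟨fun a c => ⟨a • c.c0, a • c.c1, a • c.c2,
  fun v => by simp [c1_σ], fun i e => by simp [c2_σ]⟩⟩

/-- The cup product (Alexander-Whitney), truncated above degree `2`. -/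
instance : Mul (Cochains2 X A) := ⟨fun c c' =>
  { c0 := fun v => c.c0 v * c'.c0 v
    c1 := fun e => c.c0 (X.δ 1 e) * c'.c1 e + c.c1 e * c'.c0 (X.δ 0 e)
    c2 := fun s => c.c0 (X.δ 1 (X.δ 2 s)) * c'.c2 s + c.c1 (X.δ 2 s) * c'.c1 (X.δ 0 s) +
      c.c2 s * c'.c0 (X.δ 0 (X.δ 0 s))
    c1_σ := fun v => by simp [c1_σ]
    c2_σ := fun i e => by
      fin_cases i
      · simp [c2_σ0, δ2_σ0', c1_σ]
      · simp [c2_σ1, δ0_σ1', c1_σ] }⟩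

@[simp] lemma zero_c0 : (0 : Cochains2 X A).c0 = 0 := rfl
@[simp] lemma zero_c1 : (0 : Cochains2 X A).c1 = 0 := rfl
@[simp] lemma zero_c2 : (0 : Cochains2 X A).c2 = 0 := rfl
@[simp] lemma one_c0 : (1 : Cochains2 X A).c0 = 1 := rfl
@[simp] lemma one_c1 : (1 : Cochains2 X A).c1 = 0 := rfl
@[simp] lemma one_c2 : (1 : Cochains2 X A).c2 = 0 := rfl
@[simp] lemma add_c0 (c c' : Cochains2 X A) : (c + c').c0 = c.c0 + c'.c0 := rfl
@[simp] lemma add_c1 (c c' : Cochains2 X A) : (c + c').c1 = c.c1 + c'.c1 := rfl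
@[simp] lemma add_c2 (c c' : Cochains2 X A) : (c + c').c2 = c.c2 + c'.c2 := rfl
@[simp] lemma neg_c0 (c : Cochains2 X A) : (-c).c0 = -c.c0 := rfl
@[simp] lemma neg_c1 (c : Cochains2 X A) : (-c).c1 = -c.c1 := rfl
@[simp] lemma neg_c2 (c : Cochains2 X A) : (-c).c2 = -c.c2 := rfl
@[simp] lemma smul_c0 (a : A) (c : Cochains2 X A) : (a • c).c0 = a • c.c0 := rfl
@[simp] lemma smul_c1 (a : A) (c : Cochains2 X A) : (a • c).c1 = a • c.c1 := rfl
@[simp] lemma smul_c2 (a : A) (c : Cochains2 X A) : (a • c).c2 = a • c.c2 := rfl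
@[simp] lemma mul_c0 (c c' : Cochains2 X A) (v : X _⦋0⦌) :
    (c * c').c0 v = c.c0 v * c'.c0 v := rfl
@[simp] lemma mul_c1 (c c' : Cochains2 X A) (e : X _⦋1⦌) :
    (c * c').c1 e = c.c0 (X.δ 1 e) * c'.c1 e + c.c1 e * c'.c0 (X.δ 0 e) := rfl
@[simp] lemma mul_c2 (c c' : Cochains2 X A) (s : X _⦋2⦌) :
    (c * c').c2 s = c.c0 (X.δ 1 (X.δ 2 s)) * c'.c2 s + c.c1 (X.δ 2 s) * c'.c1 (X.δ 0 s) +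
      c.c2 s * c'.c0 (X.δ 0 (X.δ 0 s)) := rfl

instance : AddCommGroup (Cochains2 X A) where
  add_assoc a b c := by ext <;> simp [add_assoc]
  zero_add a := by ext <;> simp
  add_zero a := by ext <;> simp
  add_comm a b := by ext <;> simp [add_comm]
  neg_add_cancel a := by ext <;> simp
  nsmul := nsmulRec
  zsmul := zsmulRec

instance : Ring (Cochains2 X A) where
  mul_assoc a b c := by
    ext x
    · simp [mul_assoc]
    · simp; ring
    · simp [δ0_δ2]; ring
  one_mul a := by ext <;> simp
  mul_one a := by ext <;> simp
  zero_mul a := by ext <;> simp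
  mul_zero a := by ext <;> simp
  left_distrib a b c := by ext <;> simp <;> ring
  right_distrib a b c := by ext <;> simp <;> ring
  neg_add_cancel a := neg_add_cancel a
  zsmul := zsmulRec

instance : Module A (Cochains2 X A) where
  one_smul a := by ext <;> simp
  mul_smul a b c := by ext <;> simp [mul_assoc]
  smul_zero a := by ext <;> simp
  smul_add a b c := by ext <;> simp [mul_add]
  add_smul a b c := by ext <;> simp [add_mul]
  zero_smul a := by ext <;> simp

instance : Algebra A (Cochains2 X A) := Algebra.ofModule
  (fun a c c' => by ext <;> simp <;> ring) (fun a c c' => by ext <;> simp <;> ring)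

/-- The simplicial coboundary, truncated above degree `2`. -/
def d : Cochains2 X A →ₗ[A] Cochains2 X A where
  toFun c :=
    { c0 := 0
      c1 := fun e => c.c0 (X.δ 0 e) - c.c0 (X.δ 1 e)
      c2 := fun s => c.c1 (X.δ 0 s) - c.c1 (X.δ 1 s) + c.c1 (X.δ 2 s)
      c1_σ := fun v => by rw [δ0_σ0, δ1_σ0, sub_self]
      c2_σ := fun i e => by
        fin_cases i
        · simp [δ2_σ0', δ1_σ0', δ0_σ0', c1_σ]
        · simp [δ0_σ1', δ1_σ1', δ2_σ1', c1_σ] }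
  map_add' c c' := by ext <;> simp <;> ring
  map_smul' a c := by ext <;> simp <;> ring

@[simp] lemma d_c0 (c : Cochains2 X A) : (d c).c0 = 0 := rfl
@[simp] lemma d_c1 (c : Cochains2 X A) (e : X _⦋1⦌) :
    (d c).c1 e = c.c0 (X.δ 0 e) - c.c0 (X.δ 1 e) := rfl
@[simp] lemma d_c2 (c : Cochains2 X A) (s : X _⦋2⦌) :
    (d c).c2 s = c.c1 (X.δ 0 s) - c.c1 (X.δ 1 s) + c.c1 (X.δ 2 s) := rfl

variable (X A) in
/-- The cochains of degree `n`. -/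
def grading (n : ℕ) : Submodule A (Cochains2 X A) where
  carrier := {c | (n ≠ 0 → c.c0 = 0) ∧ (n ≠ 1 → c.c1 = 0) ∧ (n ≠ 2 → c.c2 = 0)}
  add_mem' ha hb := ⟨fun h => by simp [ha.1 h, hb.1 h], fun h => by simp [ha.2.1 h, hb.2.1 h],
    fun h => by simp [ha.2.2 h, hb.2.2 h]⟩
  zero_mem' := by simp
  smul_mem' a c hc := ⟨fun h => by simp [hc.1 h], fun h => by simp [hc.2.1 h],
    fun h => by simp [hc.2.2 h]⟩

lemma mem_grading {n : ℕ} {c : Cochains2 X A} : c ∈ grading X A n ↔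
    (n ≠ 0 → c.c0 = 0) ∧ (n ≠ 1 → c.c1 = 0) ∧ (n ≠ 2 → c.c2 = 0) := Iff.rfl

variable (X A) in
/-- The homogeneous component of degree `n`. -/
def proj (n : ℕ) : Cochains2 X A →ₗ[A] grading X A n where
  toFun c := ⟨⟨if n = 0 then c.c0 else 0, if n = 1 then c.c1 else 0, if n = 2 then c.c2 else 0,
    fun v => by split_ifs <;> simp [c1_σ], fun i e => by split_ifs <;> simp [c2_σ]⟩,
    fun h => by simp [h], fun h => by simp [h], fun h => by simp [h]⟩
  map_add' c c' := by ext <;> simp <;> split_ifs <;> simp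
  map_smul' a c := by ext <;> simp <;> split_ifs <;> simp

@[simp] lemma proj_c0 (n : ℕ) (c : Cochains2 X A) :
    (proj X A n c).1.c0 = if n = 0 then c.c0 else 0 := rfl
@[simp] lemma proj_c1 (n : ℕ) (c : Cochains2 X A) :
    (proj X A n c).1.c1 = if n = 1 then c.c1 else 0 := rfl
@[simp] lemma proj_c2 (n : ℕ) (c : Cochains2 X A) :
    (proj X A n c).1.c2 = if n = 2 then c.c2 else 0 := rfl

noncomputable instance : DirectSum.Decomposition (grading X A) :=
  DirectSum.Decomposition.ofLinearMap (grading X A)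
    (∑ n ∈ Finset.range 3, DirectSum.lof A ℕ (fun n => grading X A n) n ∘ₗ proj X A n)
    (by
      ext c x <;> simp [Finset.sum_range_succ])
    (by
      refine DirectSum.linearMap_ext A fun n => LinearMap.ext fun c => ?_
      have h : ∀ k, proj X A k c.1 = if h : n = k then h ▸ c else 0 := by
        intro k
        obtain ⟨h0, h1, h2⟩ := mem_grading.1 c.2
        split_ifs with h
        · subst h
          ext <;> simp <;> split_ifs <;> simp_all
        · ext <;> simp <;> split_ifs with hk <;> first | rfl | (subst hk; simp_all)
      obtain ⟨h0, h1, h2⟩ := mem_grading.1 c.2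
      simp only [LinearMap.comp_apply, DirectSum.coeLinearMap_lof, LinearMap.sum_apply, h,
        LinearMap.id_apply]
      by_cases hn : n < 3
      · rw [Finset.sum_eq_single_of_mem n (Finset.mem_range.2 hn)]
        · simp
        · intro k _ hk
          simp [hk.symm]
      · have : c = 0 := by
          ext <;> simp [h0 (by omega), h1 (by omega), h2 (by omega)]
        refine (Finset.sum_eq_zero fun k hk => ?_).trans (by simp [this])
        rw [dif_neg (by have := Finset.mem_range.1 hk; omega), map_zero])

instance : SetLike.GradedMonoid (grading X A) where
  one_mem := by simp [mem_grading]
  mul_mem {i j} c c' hc hc' := by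
    rw [mem_grading] at *
    refine ⟨fun h => ?_, fun h => ?_, fun h => ?_⟩
    · ext v
      by_cases hi : i = 0
      · simp [hc'.1 (by omega)]
      · simp [hc.1 hi]
    · ext e
      by_cases hi : i = 0
      · simp [hc'.2.1 (by omega), hc.2.1 (by omega)]
      · by_cases hi : i = 1
        · simp [hc.1 (by omega), hc'.1 (by omega)]
        · simp [hc.1 (by omega), hc.2.1 (by omega)]
    · ext s
      by_cases hi : i = 0
      · simp [hc'.2.2 (by omega), hc.2.1 (by omega), hc.2.2 (by omega)]
      · by_cases hi : i = 1
        · simp [hc.1 (by omega), hc.2.2 (by omega), hc'.2.1 (by omega)]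
        · by_cases hi : i = 2
          · simp [hc.1 (by omega), hc.2.1 (by omega), hc'.1 (by omega)]
          · simp [hc.1 (by omega), hc.2.1 (by omega), hc.2.2 (by omega)]

noncomputable instance : GradedAlgebra (grading X A) where

end Cochains2

/-- The augmented dg algebra `C^{≤2}(X; A)` of normalized simplicial cochains of degree at most `2`
on a pointed simplicial set, augmented by restriction to the base point. -/
noncomputable def cochains2 (A : Type v) [CommRing A] (X : SSet.{u}) (x : X _⦋0⦌) :
    AugDGA.{v, max u v} A where
  carrier := Cochains2 X A
  grading := Cochains2.grading X A
  d := Cochains2.d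
  d_mem n c hc := by
    rw [Cochains2.mem_grading] at *
    refine ⟨fun _ => rfl, fun h => ?_, fun h => ?_⟩
    · have := hc.1 (by omega)
      ext; simp [this]
    · have := hc.2.1 (by omega)
      ext; simp [this]
  d_d c := by ext <;> simp [Cochains2.δ0_δ1, Cochains2.δ0_δ2, Cochains2.δ1_δ2]
  leibniz n a ha b := by
    rw [Cochains2.mem_grading] at ha
    have h0 := ha.1
    have h1 := ha.2.1
    ext s
    · simp
    · by_cases hn : n = 0
      · subst hn
        simp; ring
      · by_cases hn' : n = 1
        · simp [h0 hn, hn']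
        · simp [h0 hn, h1 hn']
    · by_cases hn : n = 0
      · subst hn
        simp [h1, Cochains2.δ0_δ1, Cochains2.δ0_δ2, Cochains2.δ1_δ2]; ring
      · by_cases hn' : n = 1
        · simp [h0 hn, hn', Cochains2.δ0_δ1, Cochains2.δ0_δ2, Cochains2.δ1_δ2]; ring
        · simp [h0 hn, h1 hn']
  aug := AlgHom.ofLinearMap
    { toFun := fun c => c.c0 x, map_add' := fun _ _ => rfl, map_smul' := fun _ _ => rfl }
    rfl (fun _ _ => rfl)
  aug_d c := rfl
  aug_pos n hn c hc := by
    have := hc.1 hn.ne'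
    exact congrFun this x

end Cochains

section Pullback

open Simplicial Opposite

variable (A : Type v) [CommRing A]

variable {A} in
/-- The pullback of cochains along a simplicial map. -/
def Cochains2.pull {X Y : SSet.{u}} (f : X ⟶ Y) (c : Cochains2 Y A) : Cochains2 X A where
  c0 v := c.c0 (f.app (op ⦋0⦌) v)
  c1 e := c.c1 (f.app (op ⦋1⦌) e)
  c2 s := c.c2 (f.app (op ⦋2⦌) s)
  c1_σ v := by rw [SSet.σ_naturality_apply, c.c1_σ]
  c2_σ i e := by rw [SSet.σ_naturality_apply, c.c2_σ]

lemma Cochains2.pull_mul {X Y : SSet.{u}} (f : X ⟶ Y) (c c' : Cochains2 Y A) :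
    pull f (c * c') = pull f c * pull f c' := by
  ext s <;> simp [pull, SSet.δ_naturality_apply]

lemma Cochains2.pull_d {X Y : SSet.{u}} (f : X ⟶ Y) (c : Cochains2 Y A) :
    pull f (d c) = d (pull f c) := by
  ext s <;> simp [pull, SSet.δ_naturality_apply]

/-- The pullback of cochains along a map of pointed simplicial sets, as a homomorphism. -/
noncomputable def pullback {X Y : SSet.{u}} (f : X ⟶ Y) {x : X _⦋0⦌} {y : Y _⦋0⦌}
    (h : f.app (op ⦋0⦌) x = y) : AugDGA.Hom (cochains2 A Y y) (cochains2 A X x) where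
  toAlgHom := AlgHom.ofLinearMap
    { toFun := Cochains2.pull f
      map_add' := fun _ _ => rfl
      map_smul' := fun _ _ => rfl }
    rfl (Cochains2.pull_mul A f)
  map_grading n c hc := by
    obtain ⟨h0, h1, h2⟩ := hc
    refine ⟨fun h => ?_, fun h => ?_, fun h => ?_⟩ <;> funext s
    · exact congrFun (h0 h) _
    · exact congrFun (h1 h) _
    · exact congrFun (h2 h) _
  map_d c := Cochains2.pull_d A f c
  map_aug c := by
    subst h
    rfl

/-- The vertices of a simplicial set. -/
abbrev Vertices (X : SSet.{u}) : Type u := X _⦋0⦌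

end Pullback

section Loops

open Simplicial

variable {A : Type v} [CommRing A] {X : SSet.{u}} {x : X _⦋0⦌}

/-- The value of a cochain of augmentation zero on an edge. -/
noncomputable def evalEdge (e : X _⦋1⦌) : (cochains2 A X x).augIdeal →ₗ[A] A where
  toFun c := Cochains2.c1 ((cochains2 A X x).incl c) e
  map_add' _ _ := rfl
  map_smul' _ _ := rfl

/-- The pullback of tensors in `Bar(C^{≤2}(X; A))` along a loop `e : Δ¹/∂Δ¹ → X`. The reduced
normalized cochains of the simplicial circle are the free module on the dual `t` of its edge, with
zero differential and product, so the tensor powers of `t` are a basis `1, t, t², …` of the bar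
construction and of its cohomology `H⁰_Bar(S¹; A) = A[t]`. -/
noncomputable def barPoly (e : X _⦋1⦌) : (cochains2 A X x).Bar →ₗ[A] Polynomial A :=
  (cochains2 A X x).liftWeights fun p => Polynomial.monomial p ∘ₗ PiTensorProduct.lift
    ((MultilinearMap.mkPiAlgebra A (Fin p) A).compLinearMap fun _ => evalEdge e)

lemma barPoly_ofWeight (e : X _⦋1⦌) (p : ℕ) (c : Fin p → (cochains2 A X x).augIdeal) :
    barPoly e ((cochains2 A X x).ofWeight p (PiTensorProduct.tprod A c)) =
      Polynomial.monomial p (∏ i, evalEdge e (c i)) := by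
  simp [barPoly]

variable {e : X _⦋1⦌}

lemma evalEdge_dBar (h₀ : X.δ 0 e = x) (h₁ : X.δ 1 e = x)
    (c : (cochains2 A X x).augIdeal) :
    evalEdge e ((cochains2 A X x).dBar c) = 0 := by
  have h := Cochains2.d_c1 (A := A) ((cochains2 A X x).incl c : Cochains2 X A) e
  rw [h₀, h₁, sub_self] at h
  exact h

lemma c0_incl (c : (cochains2 A X x).augIdeal) :
    Cochains2.c0 ((cochains2 A X x).incl c) x = 0 := (cochains2 A X x).aug_incl c

lemma evalEdge_mulBar (h₀ : X.δ 0 e = x) (h₁ : X.δ 1 e = x)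
    (c c' : (cochains2 A X x).augIdeal) :
    evalEdge e ((cochains2 A X x).mulBar c c') = 0 := by
  have h := Cochains2.mul_c1 (A := A) ((cochains2 A X x).incl c : Cochains2 X A)
    ((cochains2 A X x).incl c' : Cochains2 X A) e
  rw [h₀, h₁, c0_incl, c0_incl, zero_mul, mul_zero, add_zero] at h
  exact h

lemma barPoly_barDiff (h₀ : X.δ 0 e = x) (h₁ : X.δ 1 e = x)
    (z : (cochains2 A X x).Bar) :
    barPoly e ((cochains2 A X x).barDiff z) = 0 := by
  have key₁ : ∀ p (c : Fin p → (cochains2 A X x).augIdeal), barPoly e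
      ((cochains2 A X x).ofWeight p ((cochains2 A X x).d₁ p (PiTensorProduct.tprod A c))) = 0 := by
    intro p c
    simp only [AugDGA.d₁, LinearMap.neg_apply, LinearMap.sum_apply, map_neg, map_sum,
      PiTensorProduct.map_tprod, barPoly_ofWeight]
    rw [Finset.sum_eq_zero fun i _ => ?_, neg_zero]
    rw [Finset.prod_eq_zero (Finset.mem_univ i) (by simp [evalEdge_dBar h₀ h₁]), map_zero]
  have key₂ : ∀ p (c : Fin (p + 1) → (cochains2 A X x).augIdeal), barPoly e
      ((cochains2 A X x).ofWeight p ((cochains2 A X x).d₂ p (PiTensorProduct.tprod A c))) = 0 := by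
    intro p c
    simp only [AugDGA.d₂, LinearMap.neg_apply, LinearMap.sum_apply, map_neg, map_sum,
      AugDGA.contractMap_tprod, barPoly_ofWeight]
    rw [Finset.sum_eq_zero fun i _ => ?_, neg_zero]
    rw [Finset.prod_eq_zero (Finset.mem_univ i)
      (by simp [AugDGA.contract, evalEdge_mulBar h₀ h₁]), map_zero]
  suffices h : barPoly e ∘ₗ (cochains2 A X x).barDiff = 0 from LinearMap.congr_fun h z
  refine (cochains2 A X x).bar_hom_ext fun p c => ?_
  rcases p with _ | p
  · simp [AugDGA.barDiff, AugDGA.barDiffAux, key₁]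
  · simp [AugDGA.barDiff, AugDGA.barDiffAux, key₁, key₂]

/-- The letter-braiding polynomial of a loop `e`: the pullback
`H⁰_Bar(X; A) → H⁰_Bar(S¹; A) = A[t]`. -/
noncomputable def letterPoly (h₀ : X.δ 0 e = x) (h₁ : X.δ 1 e = x) :
    (cochains2 A X x).H0 →ₗ[A] Polynomial A :=
  (cochains2 A X x).B0.liftQ (barPoly e ∘ₗ (cochains2 A X x).Z0.subtype) (by
    rintro z ⟨s, -, hs⟩
    have hs' : (cochains2 A X x).barDiff s = z.1 := hs
    simp [← hs', barPoly_barDiff h₀ h₁])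

/-- The letter-braiding number `ℓ_T(e)`: the linear coefficient of the letter-braiding
polynomial. -/
noncomputable def letterNumber (h₀ : X.δ 0 e = x) (h₁ : X.δ 1 e = x)
    (T : (cochains2 A X x).H0) : A := (letterPoly h₀ h₁ T).coeff 1

end Loops

section Models

/-- A pointed topological space or a pointed simplicial set. -/
inductive PointedModel : Type (u + 1)
  | space (X : TopCat.{u}) (x : X)
  | simplicial (X : SSet.{u}) (x : Vertices X)

namespace PointedModel

/-- The simplicial set whose cochains are considered: the singular simplicial set of a space, a
simplicial set itself. -/
noncomputable def sset : PointedModel.{u} → SSet.{u}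
  | space X _ => TopCat.toSSet.obj X
  | simplicial X _ => X

/-- The base vertex. -/
noncomputable def vertex : (P : PointedModel.{u}) → Vertices P.sset
  | space _ x => TopCat.toSSetObj₀Equiv.symm x
  | simplicial _ x => x

/-- The topological space: a space itself, the geometric realization of a simplicial set. -/
noncomputable def top : PointedModel.{u} → TopCat.{u}
  | space X _ => X
  | simplicial X _ => SSet.toTop.obj X

/-- The base point of the topological space. -/
noncomputable def base : (P : PointedModel.{u}) → P.top
  | space _ x => x
  | simplicial X x => TopCat.toSSetObj₀Equiv ((sSetTopAdj.unit.app X).app _ x)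

/-- The identity for spaces, the canonical map `X → Sing |X|` for simplicial sets. -/
noncomputable def toSing : (P : PointedModel.{u}) → (P.sset ⟶ TopCat.toSSet.obj P.top)
  | space _ _ => 𝟙 _
  | simplicial X _ => sSetTopAdj.unit.app X

lemma toSing_vertex (P : PointedModel.{u}) :
    P.toSing.app _ P.vertex = TopCat.toSSetObj₀Equiv.symm P.base := by
  cases P with
  | space X x => rfl
  | simplicial X x => exact (Equiv.symm_apply_apply _ _).symm

/-- Connectedness. -/
def IsConnected : PointedModel.{u} → Prop
  | space X _ => PathConnectedSpace X
  | simplicial X _ => X.IsConnected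

/-- The fundamental group, in which the product of the classes of `γ` and `γ'` is the class of the
loop that runs first through `γ` and then through `γ'`. -/
abbrev Pi1 (P : PointedModel.{u}) := (FundamentalGroup P.top P.base)ᵐᵒᵖ

/-- The class of a loop. -/
noncomputable def loopClass (P : PointedModel.{u}) (γ : Path P.base P.base) : P.Pi1 :=
  MulOpposite.op (FundamentalGroup.fromPath (Path.Homotopic.Quotient.mk γ))

lemma loopClass_trans (P : PointedModel.{u}) (γ γ' : Path P.base P.base) :
    P.loopClass (γ.trans γ') = P.loopClass γ * P.loopClass γ' := rfl

/-- The `2`-truncated cochain algebra: of singular cochains of a space, of simplicial cochains of a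
simplicial set. -/
noncomputable abbrev cochains (P : PointedModel.{u}) (A : Type v) [CommRing A] :
    AugDGA.{v, max u v} A := cochains2 A P.sset P.vertex

/-- The `2`-truncated algebra of singular cochains of the underlying topological space. -/
noncomputable abbrev singCochains (P : PointedModel.{u}) (A : Type v) [CommRing A] :
    AugDGA.{v, max u v} A :=
  cochains2 A (TopCat.toSSet.obj P.top) (TopCat.toSSetObj₀Equiv.symm P.base)

/-- The comparison between singular and simplicial bar cohomology. -/
noncomputable def comparison (P : PointedModel.{u}) (A : Type v) [CommRing A] :
    (P.singCochains A).H0 →ₗ[A] (P.cochains A).H0 :=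
  (pullback A P.toSing P.toSing_vertex).mapH0

/-- A loop as an edge of the singular simplicial set. -/
noncomputable def loopEdge (P : PointedModel.{u}) (γ : Path P.base P.base) :
    SSet.Edge (TopCat.toSSetObj₀Equiv.symm P.base) (TopCat.toSSetObj₀Equiv.symm P.base) :=
  TopCat.toSSetObjEdgeEquiv.symm (TopCat.pathEquiv.symm γ)

/-- The pairing of a singular bar class with a loop: the value of the counit plus the
letter-braiding number of the loop. -/
noncomputable def loopPairing (P : PointedModel.{u}) {A : Type v} [CommRing A]
    (T : (P.singCochains A).H0) (γ : Path P.base P.base) : A :=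
  (P.singCochains A).counitH0 T +
    letterNumber (P.loopEdge γ).tgt_eq (P.loopEdge γ).src_eq T

variable (P : PointedModel.{u}) (A : Type v) [CommRing A]

/-- The group ring `A[π₁]`. -/
abbrev GroupRing := MonoidAlgebra A P.Pi1

/-- The augmentation ideal of the group ring. -/
noncomputable def augmentationIdeal : Ideal (P.GroupRing A) :=
  RingHom.ker (MonoidAlgebra.lift A A P.Pi1 1)

instance : (P.augmentationIdeal A).IsTwoSided :=
  inferInstanceAs (RingHom.ker _).IsTwoSided

/-- The functionals on `A[π₁] / I ^ n`, as functionals on `A[π₁]`. -/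
def killing (n : ℕ) : Submodule A (Module.Dual A (P.GroupRing A)) where
  carrier := {φ | ∀ x ∈ P.augmentationIdeal A ^ n, φ x = 0}
  add_mem' ha hb x hx := by simp [ha x hx, hb x hx]
  zero_mem' := by simp
  smul_mem' a φ h x hx := by simp [h x hx]

lemma killing_mono : Monotone (P.killing A) :=
  fun _ _ h _ hφ x hx => hφ x (Ideal.pow_le_pow_right h hx)

/-- The functionals of finite type `colim Hom(A[π₁] / I ^ n, A)`. -/
def FiniteType : Submodule A (Module.Dual A (P.GroupRing A)) where
  carrier := {φ | ∃ n, φ ∈ P.killing A n}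
  add_mem' := by
    rintro a b ⟨m, hm⟩ ⟨n, hn⟩
    exact ⟨max m n, add_mem (P.killing_mono A (le_max_left _ _) hm)
      (P.killing_mono A (le_max_right _ _) hn)⟩
  zero_mem' := ⟨0, zero_mem _⟩
  smul_mem' a _ := fun ⟨n, hn⟩ => ⟨n, Submodule.smul_mem _ a hn⟩

/-- The completed group ring `lim A[π₁] / I ^ n`. -/
noncomputable def completion :
    Subalgebra A (∀ n : ℕ, P.GroupRing A ⧸ P.augmentationIdeal A ^ n) where
  carrier := {s | ∀ m n (h : m ≤ n), Ideal.Quotient.factor (Ideal.pow_le_pow_right h) (s n) = s m}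
  mul_mem' := fun ha hb m n h => by simp [ha m n h, hb m n h]
  add_mem' := fun ha hb m n h => by simp [ha m n h, hb m n h]
  algebraMap_mem' := fun a m n h => rfl

/-- `Φ` is the letter-braiding pairing between `H⁰_Bar` and `A[π₁]`: on bar classes that come from
singular cochains, it takes the class of a loop `γ` to the pairing with `γ`. -/
def IsLetterPairing (Φ : (P.cochains A).H0 →ₗ[A] Module.Dual A (P.GroupRing A)) : Prop :=
  ∀ (T : (P.singCochains A).H0) (γ : Path P.base P.base),
    Φ (P.comparison A T) (MonoidAlgebra.of A P.Pi1 (P.loopClass γ)) = P.loopPairing T γ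

/-- `Δ` is dual to the product of the group ring: `⟨Δ φ, x ⊗ y⟩ = φ (x y)`. -/
def IsDualCoproduct (Δ : P.FiniteType A →ₗ[A] P.FiniteType A ⊗[A] P.FiniteType A) : Prop :=
  ∀ (φ : P.FiniteType A) (x y : P.GroupRing A),
    TensorProduct.lid A A (TensorProduct.map
      (Module.Dual.eval A (P.GroupRing A) x ∘ₗ (P.FiniteType A).subtype)
      (Module.Dual.eval A (P.GroupRing A) y ∘ₗ (P.FiniteType A).subtype) (Δ φ)) = φ.1 (x * y)

end PointedModel
end Models

/-- Exhaustive increasing filtrations that are compatible with a coproduct: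
`Δ (F n) ⊆ ∑ i + j = n, F i ⊗ F j`. -/
def IsCoalgebraFiltration {A : Type v} [CommRing A] {M : Type w} [AddCommGroup M] [Module A M]
    (Δ : M →ₗ[A] M ⊗[A] M) (F : ℕ → Submodule A M) : Prop :=
  Monotone F ∧ (∀ x, ∃ n, x ∈ F n) ∧ ∀ n, ∀ x ∈ F n,
    Δ x ∈ ⨆ (i : ℕ) (j : ℕ) (_ : i + j = n),
      LinearMap.range (TensorProduct.map (F i).subtype (F j).subtype)

end LetterBraiding

universe w''

namespace LetterBraiding

namespace AugDGA

variable {A : Type v} [CommRing A] (C : AugDGA.{v, w} A)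

section BarCalculus

/-- The empty tensor. -/
noncomputable def barOne : C.Bar := C.ofWeight 0 (PiTensorProduct.tprod A Fin.elim0)

/-- The operator that puts a letter in front of a tensor. -/
noncomputable def barCons : C.augIdeal →ₗ[A] C.Bar →ₗ[A] C.Bar where
  toFun a := C.liftWeights (fun p => C.ofWeight (p + 1) ∘ₗ
      PiTensorProduct.lift
        ((PiTensorProduct.tprod A (s := fun _ : Fin (p + 1) => C.augIdeal)).curryLeft a))
  map_add' a b := C.bar_hom_ext fun p c => by simp
  map_smul' r a := C.bar_hom_ext fun p c => by simp

lemma barCons_ofWeight (a : C.augIdeal) (p : ℕ) (c : Fin p → C.augIdeal) :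
    C.barCons a (C.ofWeight p (PiTensorProduct.tprod A c)) =
      C.ofWeight (p + 1) (PiTensorProduct.tprod A (Fin.cons a c : Fin (p + 1) → C.augIdeal)) := by
  simp [barCons]

/-- Linear maps on tensors of positive weight, defined by their behaviour on the first letter. -/
noncomputable def uncons {p : ℕ} {N : Type*} [AddCommGroup N] [Module A N]
    (f : C.augIdeal →ₗ[A] (⨂[A]^p C.augIdeal) →ₗ[A] N) : (⨂[A]^(p + 1) C.augIdeal) →ₗ[A] N :=
  PiTensorProduct.lift (LinearMap.uncurryLeft
    ((PiTensorProduct.lift (R := A) (s := fun _ : Fin p => C.augIdeal)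
      (E := N)).symm.toLinearMap ∘ₗ f))

lemma uncons_tprod {p : ℕ} {N : Type*} [AddCommGroup N] [Module A N]
    (f : C.augIdeal →ₗ[A] (⨂[A]^p C.augIdeal) →ₗ[A] N) (a : C.augIdeal)
    (c : Fin p → C.augIdeal) :
    C.uncons f (PiTensorProduct.tprod A (Fin.cons a c : Fin (p + 1) → C.augIdeal)) =
      f a (PiTensorProduct.tprod A c) := by
  simp [uncons, PiTensorProduct.lift_symm]

/-- Linear maps on the bar construction, defined by their value on the empty tensor and their
behaviour on the first letter. -/
noncomputable def barRec {N : Type*} [AddCommGroup N] [Module A N] (n : N)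
    (f : C.augIdeal →ₗ[A] C.Bar →ₗ[A] N) : C.Bar →ₗ[A] N :=
  C.liftWeights fun p => match p with
    | 0 => LinearMap.toSpanSingleton A N n ∘ₗ (PiTensorProduct.isEmptyEquiv (Fin 0)).toLinearMap
    | p + 1 => C.uncons ((LinearMap.lcomp A N (C.ofWeight p)) ∘ₗ f)

section
variable {N : Type*} [AddCommGroup N] [Module A N] (n : N)
    (f : C.augIdeal →ₗ[A] C.Bar →ₗ[A] N)

@[simp] lemma barRec_one : C.barRec n f C.barOne = n := by
  simp [barRec, barOne]

@[elab_as_elim]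
lemma bar_induction {motive : C.Bar → Prop} (u : C.Bar) (zero : motive 0)
    (add : ∀ u u', motive u → motive u' → motive (u + u'))
    (smul : ∀ (r : A) u, motive u → motive (r • u))
    (one : motive C.barOne) (cons : ∀ a u, motive u → motive (C.barCons a u)) : motive u := by
  have h : ∀ p (c : Fin p → C.augIdeal),
      motive (C.ofWeight p (PiTensorProduct.tprod A c)) := by
    intro p
    induction p with
    | zero =>
      intro c
      rw [Subsingleton.elim c Fin.elim0]
      exact one
    | succ p ih =>
      intro c
      rw [← Fin.cons_self_tail c, ← barCons_ofWeight]
      exact cons _ _ (ih _)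
  let S : Submodule A C.Bar :=
    { carrier := {u | motive u}, add_mem' := fun ha hb => add _ _ ha hb, zero_mem' := zero,
      smul_mem' := fun r u hu => smul r u hu }
  have hS : S.mkQ = 0 := C.bar_hom_ext fun p c => by
    simpa using (show _ ∈ S from h p c)
  have : u ∈ S := by
    rw [← Submodule.Quotient.mk_eq_zero, ← Submodule.mkQ_apply, hS]; rfl
  exact this

@[simp] lemma barRec_cons (a : C.augIdeal) (u : C.Bar) :
    C.barRec n f (C.barCons a u) = f a u := by
  rw [← LinearMap.comp_apply]
  congr 1
  refine C.bar_hom_ext fun p c => ?_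
  rw [LinearMap.comp_apply, barCons_ofWeight, barRec, liftWeights_ofWeight]
  exact C.uncons_tprod _ _ _

variable {C} in
lemma bar_ext {f g : C.Bar →ₗ[A] N} (one : f C.barOne = g C.barOne)
    (cons : ∀ a u, f u = g u → f (C.barCons a u) = g (C.barCons a u)) : f = g := by
  ext u
  induction u using C.bar_induction with
  | zero => simp
  | add u u' h h' => simp [h, h']
  | smul r u h => simp [h]
  | one => exact one
  | cons a u h => exact cons a u h

end

/-- The operator that applies a functional to the first letter. -/
noncomputable def contr (α : C.augIdeal →ₗ[A] A) : C.Bar →ₗ[A] C.Bar :=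
  C.barRec 0 (α.smulRight LinearMap.id)

@[simp] lemma contr_one (α : C.augIdeal →ₗ[A] A) : C.contr α C.barOne = 0 := by simp [contr]

@[simp] lemma contr_cons (α : C.augIdeal →ₗ[A] A) (a : C.augIdeal) (u : C.Bar) :
    C.contr α (C.barCons a u) = α a • u := by simp [contr]

/-- The operator that multiplies the first letter from the left. -/
noncomputable def mulHead : C.augIdeal →ₗ[A] C.Bar →ₗ[A] C.Bar where
  toFun c := C.barRec 0 (C.barCons ∘ₗ C.mulBar c)
  map_add' _ _ := bar_ext (by simp) fun _ _ _ => by simp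
  map_smul' _ _ := bar_ext (by simp) fun _ _ _ => by simp

@[simp] lemma mulHead_one (c : C.augIdeal) : C.mulHead c C.barOne = 0 := by simp [mulHead]

@[simp] lemma mulHead_cons (c a : C.augIdeal) (u : C.Bar) :
    C.mulHead c (C.barCons a u) = C.barCons (C.mulBar c a) u := by simp [mulHead]

@[simp] lemma barCounit_one : C.barCounit C.barOne = 1 := by
  simp [barCounit, barOne]

@[simp] lemma barCounit_cons (a : C.augIdeal) (u : C.Bar) :
    C.barCounit (C.barCons a u) = 0 := by
  rw [← LinearMap.comp_apply]
  suffices h : C.barCounit ∘ₗ C.barCons a = 0 by rw [h]; rfl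
  refine C.bar_hom_ext fun p c => ?_
  simp [barCons_ofWeight, barCounit, weightComponent_ofWeight_of_ne]

/-- The part of the bar differential that preserves the weight. -/
noncomputable def barVert : C.Bar →ₗ[A] C.Bar := C.liftWeights fun p => C.ofWeight p ∘ₗ C.d₁ p

/-- The part of the bar differential that lowers the weight. -/
noncomputable def barHor : C.Bar →ₗ[A] C.Bar := C.liftWeights fun p => match p with
  | 0 => 0
  | p + 1 => C.ofWeight p ∘ₗ C.d₂ p

lemma barDiff_eq : C.barDiff = C.barVert + C.barHor := by
  refine C.bar_hom_ext fun p c => ?_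
  rcases p with _ | p <;> simp [barDiff, barDiffAux, barVert, barHor]

@[simp] lemma barVert_one : C.barVert C.barOne = 0 := by
  simp [barVert, barOne, d₁]

@[simp] lemma barHor_one : C.barHor C.barOne = 0 := by
  simp [barHor, barOne]

@[simp] lemma barDiff_one : C.barDiff C.barOne = 0 := by
  simp [barDiff_eq]

/-- Derivation-like operators on tensors: the operator `β` is applied to one letter, the operator
`α` to all letters before it and the operator `γ` to all letters after it. -/
lemma map_ite_cons {p : ℕ} (α β γ : C.augIdeal →ₗ[A] C.augIdeal) (a : C.augIdeal)
    (c : Fin p → C.augIdeal) (i : Fin p) :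
    (fun j => (if j < i.succ then α else if j = i.succ then β else γ)
      ((Fin.cons a c : Fin (p + 1) → C.augIdeal) j)) =
    (Fin.cons (α a) (fun j => (if j < i then α else if j = i then β else γ) (c j)) :
      Fin (p + 1) → C.augIdeal) := by
  funext j
  refine Fin.cases ?_ (fun j => ?_) j
  · simp
  · simp [Fin.succ_lt_succ_iff]

lemma map_ite_cons_zero {p : ℕ} (α β γ : C.augIdeal →ₗ[A] C.augIdeal) (a : C.augIdeal)
    (c : Fin p → C.augIdeal) :
    (fun j => (if j < 0 then α else if j = 0 then β else γ)
      ((Fin.cons a c : Fin (p + 1) → C.augIdeal) j)) =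
    (Fin.cons (β a) (fun j => γ (c j)) : Fin (p + 1) → C.augIdeal) := by
  funext j
  refine Fin.cases ?_ (fun j => ?_) j
  · simp
  · simp [Fin.succ_ne_zero]

@[simp] lemma barVert_cons (a : C.augIdeal) (u : C.Bar) :
    C.barVert (C.barCons a u) =
      - C.barCons (C.dBar a) u + C.barCons (C.sgn a) (C.barVert u) := by
  rw [← LinearMap.comp_apply, ← LinearMap.comp_apply (C.barCons (C.sgn a)), ← LinearMap.neg_apply,
    ← LinearMap.add_apply]
  congr 1
  refine C.bar_hom_ext fun p c => ?_
  simp only [LinearMap.comp_apply, barCons_ofWeight, barVert, liftWeights_ofWeight, d₁,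
    LinearMap.neg_apply, LinearMap.sum_apply, Fin.sum_univ_succ, LinearMap.add_apply,
    PiTensorProduct.map_tprod, map_neg, map_add, map_sum, map_ite_cons, map_ite_cons_zero]
  simp
  abel

lemma contract_cons_succ {p : ℕ} (a : C.augIdeal) (c : Fin (p + 1) → C.augIdeal) (i : Fin p) :
    C.contract i.succ (Fin.cons a c : Fin (p + 2) → C.augIdeal) =
      (Fin.cons (C.sgn a) (C.contract i c) : Fin (p + 1) → C.augIdeal) := by
  funext j
  refine Fin.cases ?_ (fun j => ?_) j
  · simp [contract]
  · simp only [contract, Fin.succ_lt_succ_iff, Fin.succ_inj, Fin.cons_succ]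
    rw [← Fin.succ_castSucc, ← Fin.succ_castSucc]
    simp

lemma contract_cons_zero {p : ℕ} (a b : C.augIdeal) (c : Fin p → C.augIdeal) :
    C.contract 0 (Fin.cons a (Fin.cons b c : Fin (p + 1) → C.augIdeal) :
      Fin (p + 2) → C.augIdeal) =
      (Fin.cons (C.mulBar (C.sgn a) b) c : Fin (p + 1) → C.augIdeal) := by
  funext j
  refine Fin.cases ?_ (fun j => ?_) j
  · simp [contract]
  · simp [contract, Fin.succ_ne_zero]

@[simp] lemma barHor_cons (a : C.augIdeal) (u : C.Bar) :
    C.barHor (C.barCons a u) = C.barCons (C.sgn a) (C.barHor u) - C.mulHead (C.sgn a) u := by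
  rw [← LinearMap.comp_apply, ← LinearMap.comp_apply (C.barCons (C.sgn a)), ← LinearMap.sub_apply]
  congr 1
  refine C.bar_hom_ext fun p c => ?_
  rcases p with _ | p
  · have : C.ofWeight 0 (PiTensorProduct.tprod A c) = C.barOne := by
      rw [barOne, Subsingleton.elim c Fin.elim0]
    simp only [LinearMap.comp_apply, LinearMap.sub_apply, this, barHor_one, mulHead_one, map_zero]
    simp [barOne, barCons_ofWeight, barHor, d₂]
  · obtain ⟨b, c, rfl⟩ : ∃ b c', c = Fin.cons b c' := ⟨_, _, (Fin.cons_self_tail c).symm⟩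
    rw [LinearMap.sub_apply, ← C.barCons_ofWeight b, mulHead_cons, barCons_ofWeight]
    simp only [LinearMap.comp_apply, barCons_ofWeight, barHor, liftWeights_ofWeight, d₂,
      LinearMap.neg_apply, LinearMap.sum_apply, contractMap_tprod, map_neg, map_sum]
    rw [Fin.sum_univ_succ, contract_cons_zero]
    simp only [contract_cons_succ]
    abel

lemma barDiff_cons (a : C.augIdeal) (u : C.Bar) :
    C.barDiff (C.barCons a u) = - C.barCons (C.dBar a) u + C.barCons (C.sgn a) (C.barDiff u)
      - C.mulHead (C.sgn a) u := by
  simp [barDiff_eq]; abel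

lemma sgn_sgn (a : C.augIdeal) : C.sgn (C.sgn a) = a := by
  apply C.incl_injective
  rw [incl_sgn, incl_sgn]
  generalize C.incl a = c
  induction c using DirectSum.Decomposition.inductionOn C.grading with
  | zero => simp
  | @homogeneous n m =>
    rw [sgnFull_of_mem m.2, map_smul, sgnFull_of_mem m.2, smul_smul, ← mul_pow]; simp
  | add a b ha hb => simp [ha, hb]

lemma dBar_dBar (a : C.augIdeal) : C.dBar (C.dBar a) = 0 := C.incl_injective (by simp [C.d_d])

lemma sgn_dBar (a : C.augIdeal) : C.sgn (C.dBar a) = - C.dBar (C.sgn a) := by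
  apply C.incl_injective
  rw [incl_sgn, incl_dBar, map_neg, incl_dBar, incl_sgn]
  generalize C.incl a = c
  induction c using DirectSum.Decomposition.inductionOn C.grading with
  | zero => simp
  | @homogeneous n m =>
    rw [sgnFull_of_mem m.2, map_smul, sgnFull_of_mem (C.d_mem n m.1 m.2), pow_succ]; simp
  | add a b ha hb => simp [ha, hb]; abel

lemma sgn_mulBar (a b : C.augIdeal) :
    C.sgn (C.mulBar a b) = - C.mulBar (C.sgn a) (C.sgn b) := by
  apply C.incl_injective
  rw [incl_sgn, incl_mulBar, map_neg, incl_mulBar, incl_sgn, incl_sgn]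
  generalize C.incl a = c
  generalize C.incl b = c'
  induction c using DirectSum.Decomposition.inductionOn C.grading with
  | zero => simp
  | @homogeneous n m =>
    induction c' using DirectSum.Decomposition.inductionOn C.grading with
    | zero => simp
    | @homogeneous k l =>
      rw [sgnFull_of_mem m.2, sgnFull_of_mem l.2, sgnFull_of_mem (SetLike.mul_mem_graded m.2 l.2),
        smul_mul_smul_comm, ← neg_smul]
      congr 1
      ring
    | add a b ha hb => simp only [mul_add, map_add, ha, hb, neg_add]
  | add a b ha hb => simp only [add_mul, map_add, ha, hb, neg_add]

lemma dBar_mulBar_sgn (a b : C.augIdeal) : C.dBar (C.mulBar (C.sgn a) b) =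
    - C.mulBar (C.sgn (C.dBar a)) b - C.mulBar a (C.dBar b) := by
  rw [sgn_dBar]
  apply C.incl_injective
  rw [incl_dBar, map_sub, map_neg, incl_mulBar, incl_mulBar, incl_mulBar, map_neg, incl_dBar,
    incl_dBar, incl_sgn]
  generalize C.incl a = c
  induction c using DirectSum.Decomposition.inductionOn C.grading with
  | zero => simp
  | @homogeneous n m =>
    rw [sgnFull_of_mem m.2, smul_mul_assoc, map_smul, C.leibniz n m.1 m.2, smul_add, smul_smul,
      map_smul, ← pow_add, show n + 1 + n = 2 * n + 1 by ring, pow_succ, pow_succ, pow_mul]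
    simp [sub_eq_add_neg]
  | add a b ha hb => simp only [add_mul, map_add, ha, hb, neg_add, neg_mul]; noncomm_ring

lemma mulBar_assoc (a b c : C.augIdeal) :
    C.mulBar (C.mulBar a b) c = C.mulBar a (C.mulBar b c) :=
  C.incl_injective (by simp [mul_assoc])

lemma mulHead_mulHead (a b : C.augIdeal) (u : C.Bar) :
    C.mulHead a (C.mulHead b u) = C.mulHead (C.mulBar a b) u := by
  rw [← LinearMap.comp_apply]
  congr 1
  exact bar_ext (by simp) fun c u _ => by simp [mulBar_assoc]

lemma barDiff_mulHead (a : C.augIdeal) (u : C.Bar) : C.barDiff (C.mulHead (C.sgn a) u) =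
    C.mulHead (C.sgn (C.dBar a)) u - C.mulHead a (C.barDiff u) := by
  rw [← LinearMap.comp_apply, ← LinearMap.comp_apply (C.mulHead a), ← LinearMap.sub_apply]
  congr 1
  refine bar_ext (by simp) fun b u _ => ?_
  simp only [LinearMap.comp_apply, LinearMap.sub_apply, mulHead_cons, barDiff_cons,
    dBar_mulBar_sgn, sgn_mulBar, sgn_sgn, map_neg, map_sub, map_add, mulHead_mulHead,
    LinearMap.neg_apply, LinearMap.sub_apply]
  abel

lemma barDiff_barDiff (u : C.Bar) : C.barDiff (C.barDiff u) = 0 := by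
  rw [← LinearMap.comp_apply]
  suffices h : C.barDiff ∘ₗ C.barDiff = 0 by rw [h]; rfl
  refine bar_ext (by simp) fun a u h => ?_
  have h' : C.barDiff (C.barDiff u) = 0 := h
  simp only [LinearMap.comp_apply, LinearMap.zero_apply, barDiff_cons, map_add, map_sub, map_neg,
    map_zero, dBar_dBar, sgn_sgn, barDiff_mulHead, h', sgn_dBar, LinearMap.neg_apply, LinearMap.zero_apply]
  abel

end BarCalculus

end AugDGA
end LetterBraiding

namespace LetterBraiding

namespace AugDGA

variable {A : Type v} [CommRing A] (C : AugDGA.{v, w} A)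

section BarFiltrations

lemma ofWeight_zero (c : Fin 0 → C.augIdeal) :
    C.ofWeight 0 (PiTensorProduct.tprod A c) = C.barOne := by
  rw [barOne, Subsingleton.elim c Fin.elim0]

/-- The tensors of weight at most `n` with letters in `M`. -/
noncomputable def barSpan (M : Submodule A C.augIdeal) : ℕ → Submodule A C.Bar
  | 0 => A ∙ C.barOne
  | n + 1 => (A ∙ C.barOne) ⊔
      Submodule.span A {z | ∃ a ∈ M, ∃ u ∈ barSpan M n, z = C.barCons a u}

variable {C}

lemma barOne_mem_barSpan (M : Submodule A C.augIdeal) (n : ℕ) : C.barOne ∈ C.barSpan M n := by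
  cases n with
  | zero => exact Submodule.mem_span_singleton_self _
  | succ n => exact Submodule.mem_sup_left (Submodule.mem_span_singleton_self _)

lemma barCons_mem_barSpan {M : Submodule A C.augIdeal} {n : ℕ} {a : C.augIdeal} (ha : a ∈ M)
    {u : C.Bar} (hu : u ∈ C.barSpan M n) : C.barCons a u ∈ C.barSpan M (n + 1) :=
  Submodule.mem_sup_right (Submodule.subset_span ⟨a, ha, u, hu, rfl⟩)

lemma barSpan_zero_le {M : Submodule A C.augIdeal} {S : Submodule A C.Bar}
    (h : C.barOne ∈ S) : C.barSpan M 0 ≤ S :=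
  (Submodule.span_singleton_le_iff_mem _ _).2 h

lemma barSpan_succ_le {M : Submodule A C.augIdeal} {n : ℕ} {S : Submodule A C.Bar}
    (h : C.barOne ∈ S) (h' : ∀ a ∈ M, ∀ u ∈ C.barSpan M n, C.barCons a u ∈ S) :
    C.barSpan M (n + 1) ≤ S := by
  refine sup_le ((Submodule.span_singleton_le_iff_mem _ _).2 h) (Submodule.span_le.2 ?_)
  rintro _ ⟨a, ha, u, hu, rfl⟩
  exact h' a ha u hu

/-- Induction over tensors with letters in `M` of bounded weight. -/
lemma barSpan_le_of {M : Submodule A C.augIdeal} {S : ℕ → Submodule A C.Bar}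
    (h : ∀ n, C.barOne ∈ S n) (h' : ∀ a ∈ M, ∀ n, ∀ u ∈ S n, C.barCons a u ∈ S (n + 1)) (n : ℕ) :
    C.barSpan M n ≤ S n := by
  induction n with
  | zero => exact barSpan_zero_le (h 0)
  | succ n ih => exact barSpan_succ_le (h _) fun a ha u hu => h' a ha n u (ih hu)

lemma barSpan_le_succ (M : Submodule A C.augIdeal) (n : ℕ) :
    C.barSpan M n ≤ C.barSpan M (n + 1) :=
  barSpan_le_of (S := fun n => C.barSpan M (n + 1)) (fun _ => barOne_mem_barSpan _ _)
    (fun _ ha _ _ hu => barCons_mem_barSpan ha hu) n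

lemma barSpan_mono (M : Submodule A C.augIdeal) : Monotone (C.barSpan M) :=
  monotone_nat_of_le_succ (barSpan_le_succ M)

lemma barSpan_mono_left {M M' : Submodule A C.augIdeal} (h : M ≤ M') (n : ℕ) :
    C.barSpan M n ≤ C.barSpan M' n :=
  barSpan_le_of (S := fun n => C.barSpan M' n) (fun _ => barOne_mem_barSpan _ _)
    (fun _ ha _ _ hu => barCons_mem_barSpan (h ha) hu) n

lemma ofWeight_mem_barSpan (p : ℕ) (x : ⨂[A]^p C.augIdeal) :
    C.ofWeight p x ∈ C.barSpan ⊤ p := by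
  have key : ∀ c : Fin p → C.augIdeal,
      C.ofWeight p (PiTensorProduct.tprod A c) ∈ C.barSpan ⊤ p := by
    induction p with
    | zero => intro c; rw [ofWeight_zero]; exact barOne_mem_barSpan _ _
    | succ p ih =>
      intro c
      rw [← Fin.cons_self_tail c, ← barCons_ofWeight]
      exact barCons_mem_barSpan Submodule.mem_top (ih 0 _)
  have : x ∈ (⊤ : Submodule A (⨂[A]^p C.augIdeal)) := trivial
  rw [← PiTensorProduct.span_tprod_eq_top] at this
  have h : Submodule.span A (Set.range (PiTensorProduct.tprod A)) ≤
      (C.barSpan ⊤ p).comap (C.ofWeight p) := by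
    rw [Submodule.span_le]
    rintro _ ⟨c, rfl⟩
    exact key c
  exact h this

lemma mem_barSpan_top_iff {n : ℕ} {u : C.Bar} :
    u ∈ C.barSpan ⊤ n ↔ ∀ p, n < p → C.weightComponent p u = 0 := by
  constructor
  · have h1 : C.barSpan ⊤ n ≤ ⨆ (p : ℕ) (_ : p ≤ n), LinearMap.range (C.ofWeight p) := by
      refine barSpan_le_of (S := fun n => ⨆ (p : ℕ) (_ : p ≤ n), LinearMap.range (C.ofWeight p))
        (fun n => ?_) (fun a _ n u hu => ?_) n
      · exact Submodule.mem_iSup_of_mem 0 (Submodule.mem_iSup_of_mem (Nat.zero_le _) ⟨_, rfl⟩)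
      · have : (⨆ (p : ℕ) (_ : p ≤ n), LinearMap.range (C.ofWeight p)) ≤
            (⨆ (p : ℕ) (_ : p ≤ n + 1), LinearMap.range (C.ofWeight p)).comap (C.barCons a) := by
          refine iSup₂_le fun p hp => ?_
          rintro _ ⟨x, rfl⟩
          refine Submodule.mem_iSup_of_mem (p + 1) (Submodule.mem_iSup_of_mem (by omega) ?_)
          exact ⟨PiTensorProduct.lift
            ((PiTensorProduct.tprod A (s := fun _ : Fin (p + 1) => C.augIdeal)).curryLeft a) x,
            by simp [barCons]⟩
        exact this hu
    intro hu p hp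
    have h2 : (⨆ (p : ℕ) (_ : p ≤ n), LinearMap.range (C.ofWeight p)) ≤
        LinearMap.ker (C.weightComponent p) := by
      refine iSup₂_le fun q hq => ?_
      rintro _ ⟨x, rfl⟩
      exact C.weightComponent_ofWeight_of_ne (by omega) x
    exact h2 (h1 hu)
  · intro h
    classical
    have : u = ∑ p ∈ DFinsupp.support (β := fun p => ⨂[A]^p C.augIdeal) u,
        C.ofWeight p (C.weightComponent p u) :=
      (DirectSum.sum_support_of (β := fun p => ⨂[A]^p C.augIdeal) u).symm
    rw [this]
    refine Submodule.sum_mem _ fun p _ => ?_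
    by_cases hp : p ≤ n
    · exact barSpan_mono _ hp (ofWeight_mem_barSpan _ _)
    · rw [h p (by omega), map_zero]; exact zero_mem _

lemma exists_mem_barSpan (u : C.Bar) : ∃ n, u ∈ C.barSpan ⊤ n := by
  induction u using C.bar_induction with
  | zero => exact ⟨0, zero_mem _⟩
  | add u u' h h' =>
    obtain ⟨n, h⟩ := h
    obtain ⟨n', h'⟩ := h'
    exact ⟨max n n', add_mem (barSpan_mono _ (le_max_left _ _) h)
      (barSpan_mono _ (le_max_right _ _) h')⟩
  | smul r u h => exact h.imp fun n h => Submodule.smul_mem _ r h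
  | one => exact ⟨0, barOne_mem_barSpan _ _⟩
  | cons a u h =>
    obtain ⟨n, h⟩ := h
    exact ⟨n + 1, barCons_mem_barSpan Submodule.mem_top h⟩

lemma mem_weightFiltration {n : ℕ} {T : C.H0} : T ∈ C.weightFiltration n ↔
    ∃ z : C.Z0, z.1 ∈ C.barSpan ⊤ n ∧ C.cls z = T := by
  simp only [weightFiltration, Submodule.mem_map, Submodule.mem_iInf, mem_barSpan_top_iff]
  exact Iff.rfl

lemma barOne_mem_barDeg : C.barOne ∈ C.barDeg 0 :=
  Submodule.subset_span ⟨0, Fin.elim0, Fin.elim0, fun i => i.elim0, by simp, rfl⟩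

lemma barCons_mem_barDeg {n : ℕ} {a : C.augIdeal} (ha : C.incl a ∈ C.grading n) {k l : ℤ}
    {u : C.Bar} (hu : u ∈ C.barDeg k) (hl : l = k + n - 1) : C.barCons a u ∈ C.barDeg l := by
  suffices h : C.barDeg k ≤ (C.barDeg l).comap (C.barCons a) from h hu
  refine Submodule.span_le.2 ?_
  rintro _ ⟨p, m, c, hc, hm, rfl⟩
  refine Submodule.subset_span ⟨p + 1, Fin.cons n m, Fin.cons a c, fun i => ?_, ?_,
    C.barCons_ofWeight a p c⟩
  · refine Fin.cases ?_ (fun i => ?_) i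
    · simpa using ha
    · simpa using hc i
  · rw [Fin.sum_univ_succ]
    simp [hm, hl]
    ring

/-- Induction over homogeneous tensors. -/
lemma barDeg_le_of {S : ℤ → Submodule A C.Bar} (h : C.barOne ∈ S 0)
    (h' : ∀ (n : ℕ) (a : C.augIdeal), C.incl a ∈ C.grading n → ∀ k l : ℤ, l = k + n - 1 →
      ∀ u ∈ S k, C.barCons a u ∈ S l) (k : ℤ) : C.barDeg k ≤ S k := by
  refine Submodule.span_le.2 ?_
  rintro _ ⟨p, m, c, hc, hm, rfl⟩
  induction p generalizing k with
  | zero => simp at hm; subst hm; rw [ofWeight_zero]; exact h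
  | succ p ih =>
    rw [← Fin.cons_self_tail c, ← barCons_ofWeight]
    rw [Fin.sum_univ_succ] at hm
    refine h' (m 0) (c 0) (hc 0) (k - (m 0 - 1)) k (by ring) _
      (ih _ _ _ (fun i => hc i.succ) (by rw [← hm]; ring))

lemma incl_sgn_mem {n : ℕ} {a : C.augIdeal} (ha : C.incl a ∈ C.grading n) :
    C.incl (C.sgn a) ∈ C.grading n := by
  rw [incl_sgn, sgnFull_of_mem ha]
  exact Submodule.smul_mem _ _ ha

lemma mulHead_mem_barDeg {n : ℕ} {a : C.augIdeal} (ha : C.incl a ∈ C.grading n) {k : ℤ}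
    {u : C.Bar} (hu : u ∈ C.barDeg k) : C.mulHead a u ∈ C.barDeg (k + n) := by
  have h := barDeg_le_of (S := fun k => C.barDeg k ⊓ (C.barDeg (k + n)).comap (C.mulHead a))
    ⟨barOne_mem_barDeg, by simp⟩ (fun m b hb k l hl u hu =>
      ⟨barCons_mem_barDeg hb hu.1 hl, ?_⟩) k
  · exact (h hu).2
  · change C.mulHead a (C.barCons b u) ∈ C.barDeg (l + n)
    rw [mulHead_cons]
    exact barCons_mem_barDeg (n := n + m) (SetLike.mul_mem_graded ha hb) hu.1
      (by push_cast; rw [hl]; ring)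

lemma contr_mem_barSpan {M : Submodule A C.augIdeal} (α : C.augIdeal →ₗ[A] A) {n : ℕ} {u : C.Bar}
    (hu : u ∈ C.barSpan M (n + 1)) : C.contr α u ∈ C.barSpan M n := by
  suffices h : C.barSpan M (n + 1) ≤ (C.barSpan M n).comap (C.contr α) from h hu
  refine barSpan_succ_le (by simp) fun a ha u hu => ?_
  rw [Submodule.mem_comap, contr_cons]
  exact Submodule.smul_mem _ _ hu

lemma contr_of_mem_barSpan_zero {M : Submodule A C.augIdeal} (α : C.augIdeal →ₗ[A] A) {u : C.Bar}
    (hu : u ∈ C.barSpan M 0) : C.contr α u = 0 := by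
  suffices h : C.barSpan M 0 ≤ LinearMap.ker (C.contr α) from h hu
  exact barSpan_zero_le (by simp)

lemma mulHead_mem_barSpan {M M' : Submodule A C.augIdeal} {c : C.augIdeal}
    (hc : ∀ a ∈ M, C.mulBar c a ∈ M') (hM : M ≤ M') {n : ℕ} {u : C.Bar}
    (hu : u ∈ C.barSpan M n) : C.mulHead c u ∈ C.barSpan M' n := by
  suffices h : C.barSpan M n ≤ (C.barSpan M' n).comap (C.mulHead c) from h hu
  cases n with
  | zero => exact barSpan_zero_le (by simp)
  | succ n =>
    refine barSpan_succ_le (by simp) fun a ha u hu => ?_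
    rw [Submodule.mem_comap, mulHead_cons]
    exact barCons_mem_barSpan (hc a ha) (barSpan_mono_left hM n hu)

variable (C)

@[simp] lemma barSgn_one : C.barSgn C.barOne = C.barOne := by
  rw [barOne, barSgn, liftWeights_ofWeight, LinearMap.comp_apply, PiTensorProduct.map_tprod,
    ofWeight_zero, ofWeight_zero]

@[simp] lemma barSgn_cons (a : C.augIdeal) (u : C.Bar) :
    C.barSgn (C.barCons a u) = C.barCons (C.sgn a) (C.barSgn u) := by
  rw [← LinearMap.comp_apply, ← LinearMap.comp_apply (C.barCons (C.sgn a))]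
  congr 1
  refine C.bar_hom_ext fun p c => ?_
  simp only [LinearMap.comp_apply, barCons_ofWeight, barSgn, liftWeights_ofWeight,
    PiTensorProduct.map_tprod]
  congr 2
  funext i
  refine Fin.cases ?_ (fun i => ?_) i <;> simp

lemma ofWeight_congr {p q : ℕ} (h : p = q) (c : Fin p → C.augIdeal) (c' : Fin q → C.augIdeal)
    (hc : ∀ i, c i = c' (Fin.cast h i)) :
    C.ofWeight p (PiTensorProduct.tprod A c) = C.ofWeight q (PiTensorProduct.tprod A c') := by
  subst h
  congr 2
  funext i
  exact hc i

lemma mulEquiv_symm_tprod {M : Type*} [AddCommGroup M] [Module A M] {i j : ℕ}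
    (c : Fin (i + j) → M) :
    (TensorPower.mulEquiv (R := A) (M := M) (n := i) (m := j)).symm
      (PiTensorProduct.tprod A c) =
      (PiTensorProduct.tprod A fun k => c (Fin.castAdd j k)) ⊗ₜ
        (PiTensorProduct.tprod A fun k => c (Fin.natAdd i k)) := by
  rw [LinearEquiv.symm_apply_eq, ← TensorPower.gMul_def, TensorPower.tprod_mul_tprod,
    Fin.append_castAdd_natAdd]

lemma deconcat_ofWeight (p : ℕ) (c : Fin p → C.augIdeal) :
    C.deconcat (C.ofWeight p (PiTensorProduct.tprod A c)) =
      ∑ i : Fin (p + 1),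
        C.ofWeight i (PiTensorProduct.tprod A fun k : Fin i => c ⟨k, by omega⟩) ⊗ₜ[A]
        C.ofWeight (p - i) (PiTensorProduct.tprod A fun k : Fin (p - i) => c ⟨i + k, by omega⟩) := by
  simp only [deconcat, liftWeights_ofWeight, deconcatAux, LinearMap.sum_apply]
  refine Finset.sum_congr rfl fun i _ => ?_
  simp only [LinearMap.comp_apply, LinearEquiv.coe_coe, TensorPower.cast_tprod]
  rw [mulEquiv_symm_tprod, TensorProduct.map_tmul]
  rfl

@[simp] lemma deconcat_one : C.deconcat C.barOne = C.barOne ⊗ₜ C.barOne := by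
  rw [barOne, deconcat_ofWeight]
  simp [ofWeight_zero]

lemma deconcat_cons (a : C.augIdeal) (u : C.Bar) :
    C.deconcat (C.barCons a u) = C.barOne ⊗ₜ C.barCons a u +
      TensorProduct.map (C.barCons a) LinearMap.id (C.deconcat u) := by
  have : C.deconcat ∘ₗ C.barCons a = TensorProduct.mk A _ _ C.barOne ∘ₗ C.barCons a +
      TensorProduct.map (C.barCons a) LinearMap.id ∘ₗ C.deconcat := by
    refine C.bar_hom_ext fun p c => ?_
    simp only [LinearMap.comp_apply, LinearMap.add_apply, TensorProduct.mk_apply, barCons_ofWeight,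
      deconcat_ofWeight, map_sum, TensorProduct.map_tmul, LinearMap.id_apply]
    rw [Fin.sum_univ_succ]
    congr 1
    · congr 1
      · exact C.ofWeight_zero _
      · exact C.ofWeight_congr (by simp) _ _ fun i => by
          congr 1; ext; simp; rfl
    · refine Finset.sum_congr rfl fun i _ => ?_
      congr 1
      · refine C.ofWeight_congr rfl _ _ fun k => ?_
        refine Fin.cases rfl (fun k => rfl) k
      · refine C.ofWeight_congr (by simp) _ _ fun k => ?_
        have : (⟨(i.succ : ℕ) + k, by have := k.2; simp at this ⊢; omega⟩ : Fin (p + 1)) =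
            Fin.succ ⟨i + k, by have := k.2; simp at this ⊢; omega⟩ := by
          ext; simp; omega
        rw [this, Fin.cons_succ]
        rfl
  exact LinearMap.congr_fun this u

lemma map_mulHead_deconcat (c : C.augIdeal) (u : C.Bar) :
    C.deconcat (C.mulHead c u) = C.barOne ⊗ₜ C.mulHead c u +
      TensorProduct.map (C.mulHead c) LinearMap.id (C.deconcat u) := by
  have : C.deconcat ∘ₗ C.mulHead c = TensorProduct.mk A _ _ C.barOne ∘ₗ C.mulHead c +
      TensorProduct.map (C.mulHead c) LinearMap.id ∘ₗ C.deconcat := by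
    refine bar_ext (by simp) fun a u _ => ?_
    simp only [LinearMap.comp_apply, LinearMap.add_apply, TensorProduct.mk_apply, mulHead_cons,
      deconcat_cons, map_add, TensorProduct.map_tmul, mulHead_one, TensorProduct.zero_tmul,
      zero_add]
    rw [← LinearMap.comp_apply (TensorProduct.map (C.mulHead c) _), ← TensorProduct.map_comp]
    congr 3
    exact LinearMap.ext fun x => by simp
  exact LinearMap.congr_fun this u

lemma deconcat_barDiff (u : C.Bar) : C.deconcat (C.barDiff u) = C.barDiff₂ (C.deconcat u) := by
  have : C.deconcat ∘ₗ C.barDiff = C.barDiff₂ ∘ₗ C.deconcat := by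
    refine bar_ext (by simp [barDiff₂]) fun a u h => ?_
    have h : C.deconcat (C.barDiff u) = C.barDiff₂ (C.deconcat u) := h
    simp only [LinearMap.comp_apply, barDiff_cons, map_add, map_sub, map_neg, deconcat_cons, h,
      map_mulHead_deconcat]
    have e : C.barDiff₂ ∘ₗ TensorProduct.map (C.barCons a) LinearMap.id =
        - TensorProduct.map (C.barCons (C.dBar a)) LinearMap.id +
          TensorProduct.map (C.barCons (C.sgn a)) LinearMap.id ∘ₗ C.barDiff₂ -
          TensorProduct.map (C.mulHead (C.sgn a)) LinearMap.id := by
      refine TensorProduct.ext' fun x y => ?_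
      simp [barDiff₂, barDiff_cons, TensorProduct.add_tmul, TensorProduct.sub_tmul,
        TensorProduct.neg_tmul]
      abel
    have e' := LinearMap.congr_fun e (C.deconcat u)
    simp only [LinearMap.comp_apply, LinearMap.sub_apply, LinearMap.add_apply,
      LinearMap.neg_apply] at e'
    rw [e']
    simp [barDiff₂, barDiff_cons, TensorProduct.tmul_add, TensorProduct.tmul_sub,
        TensorProduct.tmul_neg]
    abel
  exact LinearMap.congr_fun this u

lemma contr_deconcat (α : C.augIdeal →ₗ[A] A) (u : C.Bar) :
    TensorProduct.map (C.contr α) LinearMap.id (C.deconcat u) = C.deconcat (C.contr α u) := by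
  have : TensorProduct.map (C.contr α) LinearMap.id ∘ₗ C.deconcat = C.deconcat ∘ₗ C.contr α := by
    refine bar_ext (by simp) fun a u _ => ?_
    simp only [LinearMap.comp_apply, deconcat_cons, map_add, TensorProduct.map_tmul, contr_one,
      contr_cons, TensorProduct.zero_tmul, zero_add, map_smul]
    rw [← LinearMap.comp_apply (TensorProduct.map _ _), ← TensorProduct.map_comp]
    have : C.contr α ∘ₗ C.barCons a = α a • LinearMap.id := LinearMap.ext fun x => by simp
    rw [this, LinearMap.comp_id, TensorProduct.map_smul_left, TensorProduct.map_id]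
    rfl
  exact LinearMap.congr_fun this u

lemma barCounit_deconcat (u : C.Bar) :
    TensorProduct.lid A C.Bar (TensorProduct.map C.barCounit LinearMap.id (C.deconcat u)) = u := by
  have : (TensorProduct.lid A C.Bar).toLinearMap ∘ₗ
      TensorProduct.map C.barCounit LinearMap.id ∘ₗ C.deconcat = LinearMap.id := by
    refine bar_ext (by simp) fun a u _ => ?_
    simp only [LinearMap.comp_apply, deconcat_cons, map_add, TensorProduct.map_tmul]
    rw [← LinearMap.comp_apply (TensorProduct.map _ _), ← TensorProduct.map_comp]
    have : C.barCounit ∘ₗ C.barCons a = 0 := LinearMap.ext fun x => by simp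
    rw [this]
    simp
  exact LinearMap.congr_fun this u

lemma deconcat_mem_barDeg₂ {k : ℤ} {u : C.Bar} (hu : u ∈ C.barDeg k) :
    C.deconcat u ∈ C.barDeg₂ k := by
  have h := barDeg_le_of (C := C)
    (S := fun k => C.barDeg k ⊓ (C.barDeg₂ k).comap C.deconcat) ⟨barOne_mem_barDeg, ?_⟩
    (fun m a ha k l hl u hu => ⟨barCons_mem_barDeg ha hu.1 hl, ?_⟩) k
  · exact (h hu).2
  · change C.deconcat C.barOne ∈ C.barDeg₂ 0
    rw [deconcat_one]
    exact Submodule.subset_span ⟨0, 0, rfl, _, barOne_mem_barDeg, _, barOne_mem_barDeg, rfl⟩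
  · change C.deconcat (C.barCons a u) ∈ C.barDeg₂ l
    rw [deconcat_cons]
    refine add_mem (Submodule.subset_span ⟨0, l, by ring, _, barOne_mem_barDeg, _,
      barCons_mem_barDeg ha hu.1 hl, rfl⟩) ?_
    have : C.barDeg₂ k ≤ (C.barDeg₂ l).comap (TensorProduct.map (C.barCons a) LinearMap.id) := by
      refine Submodule.span_le.2 ?_
      rintro _ ⟨i, j, hij, x, hx, y, hy, rfl⟩
      exact Submodule.subset_span ⟨i + m - 1, j, by rw [hl, ← hij]; ring, _,
        barCons_mem_barDeg ha hx rfl, y, hy, rfl⟩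
    exact this hu.2

lemma deconcat_mem_barSpan {M : Submodule A C.augIdeal} {n : ℕ} {u : C.Bar}
    (hu : u ∈ C.barSpan M n) : C.deconcat u ∈
      LinearMap.range (TensorProduct.map (C.barSpan M n).subtype (C.barSpan M n).subtype) := by
  have h := barSpan_le_of (C := C) (M := M) (S := fun n => C.barSpan M n ⊓ (LinearMap.range
    (TensorProduct.map (C.barSpan M n).subtype (C.barSpan M n).subtype)).comap C.deconcat)
    (fun n => ⟨barOne_mem_barSpan _ _, ?_⟩)
    (fun a ha n u hu => ⟨barCons_mem_barSpan ha hu.1, ?_⟩) n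
  · exact (h hu).2
  · change C.deconcat C.barOne ∈ LinearMap.range
      (TensorProduct.map (C.barSpan M n).subtype (C.barSpan M n).subtype)
    rw [deconcat_one]
    exact ⟨⟨_, barOne_mem_barSpan _ _⟩ ⊗ₜ ⟨_, barOne_mem_barSpan _ _⟩, rfl⟩
  · change C.deconcat (C.barCons a u) ∈ LinearMap.range
      (TensorProduct.map (C.barSpan M (n + 1)).subtype (C.barSpan M (n + 1)).subtype)
    rw [deconcat_cons]
    refine add_mem ⟨⟨_, barOne_mem_barSpan _ _⟩ ⊗ₜ ⟨_, barCons_mem_barSpan ha hu.1⟩, rfl⟩ ?_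
    obtain ⟨t, ht⟩ := hu.2
    rw [← ht]
    refine ⟨TensorProduct.map ((C.barCons a).restrict fun u hu => barCons_mem_barSpan ha hu)
      (Submodule.inclusion (barSpan_le_succ M n)) t, ?_⟩
    rw [← LinearMap.comp_apply, ← LinearMap.comp_apply, ← TensorProduct.map_comp,
      ← TensorProduct.map_comp]
    rfl

end BarFiltrations

namespace Hom

variable {C} {C' : AugDGA.{v, w'} A} (F : Hom C C')

@[simp] lemma barMap_one : F.barMap C.barOne = C'.barOne := by
  rw [barOne, barMap_ofWeight, ofWeight_zero]

@[simp] lemma barMap_cons (a : C.augIdeal) (u : C.Bar) :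
    F.barMap (C.barCons a u) = C'.barCons (F.mapAug a) (F.barMap u) := by
  rw [← LinearMap.comp_apply, ← LinearMap.comp_apply (C'.barCons _)]
  congr 1
  refine C.bar_hom_ext fun p c => ?_
  simp only [LinearMap.comp_apply, barCons_ofWeight, barMap_ofWeight]
  congr 2
  funext i
  refine Fin.cases ?_ (fun i => ?_) i <;> simp

end Hom

end AugDGA
end LetterBraiding

namespace LetterBraiding

namespace AugDGA

variable {A : Type v} [CommRing A] (C : AugDGA.{v, w} A)

section Fold

variable {N : Type*} [AddCommGroup N] [Module A N] (n : N)
    (g : C.augIdeal →ₗ[A] N →ₗ[A] N)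

/-- Auxiliary construction for `barFold`. -/
noncomputable def barFoldAux : (p : ℕ) → (⨂[A]^p C.augIdeal) →ₗ[A] N
  | 0 => LinearMap.toSpanSingleton A N n ∘ₗ (PiTensorProduct.isEmptyEquiv (Fin 0)).toLinearMap
  | p + 1 => C.uncons ((LinearMap.lcomp A N (barFoldAux p)) ∘ₗ g)

/-- The linear map on the bar construction that is given by an action of the letters. -/
noncomputable def barFold : C.Bar →ₗ[A] N := C.liftWeights (C.barFoldAux n g)

@[simp] lemma barFold_one : C.barFold n g C.barOne = n := by
  simp [barFold, barFoldAux, barOne]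

@[simp] lemma barFold_cons (a : C.augIdeal) (u : C.Bar) :
    C.barFold n g (C.barCons a u) = g a (C.barFold n g u) := by
  rw [← LinearMap.comp_apply, ← LinearMap.comp_apply (g a)]
  congr 1
  refine C.bar_hom_ext fun p c => ?_
  rw [LinearMap.comp_apply, LinearMap.comp_apply, barCons_ofWeight, barFold, liftWeights_ofWeight,
    liftWeights_ofWeight, barFoldAux]
  exact C.uncons_tprod _ _ _

end Fold

section Truncation

/-- The projection to the tensors of weight at most `m`. -/
noncomputable def truncWeight (m : ℕ) : C.Bar →ₗ[A] C.Bar :=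
  C.liftWeights fun p => if p ≤ m then C.ofWeight p else 0

variable {C}

lemma truncWeight_one (m : ℕ) : C.truncWeight m C.barOne = C.barOne := by
  simp [truncWeight, barOne]

lemma truncWeight_zero_cons (a : C.augIdeal) (u : C.Bar) :
    C.truncWeight 0 (C.barCons a u) = 0 := by
  suffices h : C.truncWeight 0 ∘ₗ C.barCons a = 0 from LinearMap.congr_fun h u
  refine C.bar_hom_ext fun p c => ?_
  simp [truncWeight, barCons_ofWeight]

lemma truncWeight_succ_cons (m : ℕ) (a : C.augIdeal) (u : C.Bar) :
    C.truncWeight (m + 1) (C.barCons a u) = C.barCons a (C.truncWeight m u) := by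
  suffices h : C.truncWeight (m + 1) ∘ₗ C.barCons a = C.barCons a ∘ₗ C.truncWeight m from
    LinearMap.congr_fun h u
  refine C.bar_hom_ext fun p c => ?_
  simp only [truncWeight, LinearMap.comp_apply, barCons_ofWeight, liftWeights_ofWeight,
    Nat.add_le_add_iff_right]
  split_ifs <;> simp [barCons_ofWeight]

lemma truncWeight_of_mem {m : ℕ} {u : C.Bar} (hu : u ∈ C.barSpan ⊤ m) : C.truncWeight m u = u := by
  have := barSpan_le_of (M := ⊤) (S := fun m => LinearMap.eqLocus (C.truncWeight m) LinearMap.id)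
    (fun m => truncWeight_one m)
    (fun a _ m u hu => (truncWeight_succ_cons m a u).trans (congrArg _ hu)) m
  exact this hu

lemma truncWeight_mem {M : Submodule A C.augIdeal} {n : ℕ} {u : C.Bar} (hu : u ∈ C.barSpan M n)
    (m : ℕ) : C.truncWeight m u ∈ C.barSpan M m := by
  have := barSpan_le_of (M := M) (S := fun _ => ⨅ m, (C.barSpan M m).comap (C.truncWeight m))
    (fun _ => Submodule.mem_iInf _ |>.2 fun m => by
      simpa [truncWeight_one] using barOne_mem_barSpan M m)
    (fun a ha _ u hu => Submodule.mem_iInf _ |>.2 fun m => by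
      rw [Submodule.mem_iInf] at hu
      rw [Submodule.mem_comap]
      cases m with
      | zero => rw [truncWeight_zero_cons]; exact zero_mem _
      | succ m => rw [truncWeight_succ_cons]; exact barCons_mem_barSpan ha (hu m)) n
  exact Submodule.mem_iInf _ |>.1 (this hu) m

lemma mem_barSpan_of_mem_top {M : Submodule A C.augIdeal} {m n : ℕ} {u : C.Bar}
    (hu : u ∈ C.barSpan ⊤ m) (hu' : u ∈ C.barSpan M n) : u ∈ C.barSpan M m := by
  rw [← truncWeight_of_mem hu]
  exact truncWeight_mem hu' m

end Truncation

/-- A contraction of the augmentation ideal in degree `0`: an operator of degree `-1` from degree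
`1` to degree `0` that is a left inverse of the differential. -/
structure Contraction where
  h : C.augIdeal →ₗ[A] C.augIdeal
  h_mem : ∀ a, C.incl (h a) ∈ C.grading 0
  h_of_mem : ∀ n ≠ 1, ∀ a, C.incl a ∈ C.grading n → h a = 0
  h_sgn : ∀ a, h (C.sgn a) = h a
  h_d : ∀ a, C.incl a ∈ C.grading 0 → h (C.dBar a) = a

namespace Contraction

variable {C} (K : Contraction C)

/-- The letters of degree `1` that the contraction annihilates. -/
def letters : Submodule A C.augIdeal := (C.grading 1).comap C.incl ⊓ LinearMap.ker K.h

lemma h_h (a : C.augIdeal) : K.h (K.h a) = 0 := K.h_of_mem 0 (by simp) _ (K.h_mem a)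

lemma h_dBar_h (a : C.augIdeal) : K.h (C.dBar (K.h a)) = K.h a := K.h_d _ (K.h_mem a)

lemma sgn_h (a : C.augIdeal) : C.sgn (K.h a) = - K.h (C.sgn a) := by
  rw [K.h_sgn]
  refine C.incl_injective ?_
  rw [incl_sgn, sgnFull_of_mem (K.h_mem a)]
  simp

/-- The projection `1 - d h - h d`. -/
def proj : C.augIdeal →ₗ[A] C.augIdeal :=
  LinearMap.id - C.dBar ∘ₗ K.h - K.h ∘ₗ C.dBar

lemma proj_apply (a : C.augIdeal) : K.proj a = a - C.dBar (K.h a) - K.h (C.dBar a) := rfl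

lemma h_proj (a : C.augIdeal) : K.h (K.proj a) = 0 := by
  simp [proj_apply, K.h_h, K.h_dBar_h]

lemma proj_dBar (a : C.augIdeal) : K.proj (C.dBar a) = C.dBar (K.proj a) := by
  simp [proj_apply, C.dBar_dBar]

lemma sgn_proj (a : C.augIdeal) : C.sgn (K.proj a) = K.proj (C.sgn a) := by
  simp [proj_apply, C.sgn_dBar, K.sgn_h]

lemma proj_of_mem_zero {a : C.augIdeal} (ha : C.incl a ∈ C.grading 0) : K.proj a = 0 := by
  rw [proj_apply, K.h_of_mem 0 (by simp) a ha, K.h_d a ha]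
  simp

lemma proj_mem_letters {a : C.augIdeal} (ha : C.incl a ∈ C.grading 1) : K.proj a ∈ K.letters := by
  refine ⟨?_, K.h_proj a⟩
  change C.incl (K.proj a) ∈ C.grading 1
  rw [proj_apply, K.h_of_mem 2 (by simp) (C.dBar a) (C.d_mem 1 _ ha), sub_zero, map_sub]
  exact sub_mem ha (C.d_mem 0 _ (K.h_mem a))

/-- The projection and the homotopy on the bar construction. -/
noncomputable def barAux : C.Bar →ₗ[A] C.Bar × C.Bar :=
  C.barFold (C.barOne, 0) (LinearMap.mk₂ A
    (fun a x => (C.barCons (K.proj a) x.1, C.barCons (C.sgn a) x.2 - C.barCons (K.h a) x.1))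
    (fun a b x => by ext <;> simp; abel) (fun r a x => by ext <;> simp [smul_sub])
    (fun a x y => by ext <;> simp; abel) (fun r a x => by ext <;> simp [smul_sub]))

/-- The projection on the bar construction. -/
noncomputable def barProj : C.Bar →ₗ[A] C.Bar := LinearMap.fst A _ _ ∘ₗ K.barAux

/-- The homotopy on the bar construction. -/
noncomputable def barHomotopy : C.Bar →ₗ[A] C.Bar := LinearMap.snd A _ _ ∘ₗ K.barAux

@[simp] lemma barProj_one : K.barProj C.barOne = C.barOne := by simp [barProj, barAux]

@[simp] lemma barProj_cons (a : C.augIdeal) (u : C.Bar) :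
    K.barProj (C.barCons a u) = C.barCons (K.proj a) (K.barProj u) := by simp [barProj, barAux]

@[simp] lemma barHomotopy_one : K.barHomotopy C.barOne = 0 := by simp [barHomotopy, barAux]

@[simp] lemma barHomotopy_cons (a : C.augIdeal) (u : C.Bar) :
    K.barHomotopy (C.barCons a u) =
      C.barCons (C.sgn a) (K.barHomotopy u) - C.barCons (K.h a) (K.barProj u) := by
  simp [barHomotopy, barProj, barAux]

lemma barProj_barVert (u : C.Bar) : K.barProj (C.barVert u) = C.barVert (K.barProj u) := by
  suffices h : K.barProj ∘ₗ C.barVert = C.barVert ∘ₗ K.barProj from LinearMap.congr_fun h u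
  refine bar_ext (by simp) fun a u h => ?_
  simp only [LinearMap.comp_apply] at h
  simp [h, K.proj_dBar, K.sgn_proj]

lemma barVert_barHomotopy (u : C.Bar) :
    C.barVert (K.barHomotopy u) + K.barHomotopy (C.barVert u) = u - K.barProj u := by
  suffices h : C.barVert ∘ₗ K.barHomotopy + K.barHomotopy ∘ₗ C.barVert =
    LinearMap.id - K.barProj from LinearMap.congr_fun h u
  refine bar_ext (by simp) fun a u h => ?_
  simp only [LinearMap.add_apply, LinearMap.comp_apply, LinearMap.sub_apply,
    LinearMap.id_apply] at h ⊢
  have h' : C.barVert (K.barHomotopy u) = u - K.barProj u - K.barHomotopy (C.barVert u) := by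
    rw [← h]; abel
  simp only [barHomotopy_cons, barVert_cons, map_sub, map_add, map_neg, h', C.sgn_sgn,
    barProj_cons, K.sgn_h, C.sgn_dBar, K.h_sgn, LinearMap.neg_apply, K.proj_apply,
    LinearMap.sub_apply, K.barProj_barVert]
  abel

lemma barProj_mem_barSpan {m : ℕ} {u : C.Bar} (hu : u ∈ C.barSpan ⊤ m) :
    K.barProj u ∈ C.barSpan ⊤ m := by
  have := barSpan_le_of (M := ⊤) (S := fun m => (C.barSpan ⊤ m).comap K.barProj)
    (fun m => by simpa using barOne_mem_barSpan ⊤ m)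
    (fun a _ m u hu => by simpa using barCons_mem_barSpan Submodule.mem_top hu) m
  exact this hu

lemma barHomotopy_mem_barSpan {m : ℕ} {u : C.Bar} (hu : u ∈ C.barSpan ⊤ m) :
    K.barHomotopy u ∈ C.barSpan ⊤ m := by
  have := barSpan_le_of (M := ⊤)
    (S := fun m => (C.barSpan ⊤ m).comap K.barProj ⊓ (C.barSpan ⊤ m).comap K.barHomotopy)
    (fun m => ⟨by simpa using barOne_mem_barSpan ⊤ m, by simp⟩)
    (fun a _ m u hu => ⟨by simpa using barCons_mem_barSpan Submodule.mem_top hu.1, by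
      simpa using sub_mem (barCons_mem_barSpan (a := C.sgn a) Submodule.mem_top hu.2)
        (barCons_mem_barSpan (a := K.h a) Submodule.mem_top hu.1)⟩) m
  exact (this hu).2

lemma barHor_mem_barSpan {m : ℕ} {u : C.Bar} (hu : u ∈ C.barSpan ⊤ (m + 1)) :
    C.barHor u ∈ C.barSpan ⊤ m := by
  have key : ∀ m, C.barSpan ⊤ m ≤ (C.barSpan ⊤ (m - 1)).comap C.barHor := by
    intro m
    induction m with
    | zero => exact barSpan_zero_le (by simp)
    | succ m ih =>
      refine barSpan_succ_le (by simp) fun a _ u hu => ?_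
      rw [Submodule.mem_comap, barHor_cons]
      refine sub_mem ?_ (mulHead_mem_barSpan (fun _ _ => Submodule.mem_top) le_rfl hu)
      cases m with
      | zero =>
        have : C.barSpan ⊤ 0 ≤ LinearMap.ker C.barHor := barSpan_zero_le (by simp)
        rw [show C.barHor u = 0 from this hu]
        simp
      | succ m => exact barCons_mem_barSpan Submodule.mem_top (ih hu)
  exact key _ hu

lemma exists_barSpan_of_barHomotopy_eq_zero {n : ℕ} {u : C.Bar}
    (hu : u ∈ C.barSpan (LinearMap.ker K.h) n) : K.barHomotopy u = 0 := by
  have := barSpan_le_of (M := LinearMap.ker K.h) (S := fun _ => LinearMap.ker K.barHomotopy)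
    (fun m => by simp) (fun a ha m u hu => by
      have ha : K.h a = 0 := ha
      have hu : K.barHomotopy u = 0 := hu
      simp [ha, hu]) n
  exact this hu

lemma sgn_of_mem_letters {a : C.augIdeal} (ha : a ∈ K.letters) : C.sgn a = a := by
  refine C.incl_injective ?_
  rw [incl_sgn, sgnFull_of_mem ha.1]
  simp

lemma barDiff_mem_barSpan {n : ℕ} {u : C.Bar} (hu : u ∈ C.barSpan K.letters n) :
    C.barDiff u ∈ C.barSpan (LinearMap.ker K.h) n := by
  have hl : K.letters ≤ LinearMap.ker K.h := inf_le_right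
  have := barSpan_le_of (M := K.letters)
    (S := fun n => C.barSpan K.letters n ⊓ (C.barSpan (LinearMap.ker K.h) n).comap C.barDiff)
    (fun m => ⟨barOne_mem_barSpan _ _, by simp⟩) (fun a ha m u hu => ⟨barCons_mem_barSpan ha hu.1, by
      change C.barDiff (C.barCons a u) ∈ C.barSpan (LinearMap.ker K.h) (m + 1)
      rw [barDiff_cons, K.sgn_of_mem_letters ha]
      refine sub_mem (add_mem (neg_mem (barCons_mem_barSpan ?_ (barSpan_mono_left hl _ hu.1)))
        (barCons_mem_barSpan (hl ha) hu.2)) (barSpan_le_succ _ _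
        (mulHead_mem_barSpan (fun b hb => ?_) hl hu.1))
      · exact K.h_of_mem 2 (by simp) _ (C.d_mem 1 _ ha.1)
      · exact K.h_of_mem 2 (by simp) _
          (SetLike.mul_mem_graded (A := C.grading) (i := 1) (j := 1) ha.1 hb.1)⟩) n
  exact (this hu).2

lemma letters_mem_barDeg {n : ℕ} {u : C.Bar} (hu : u ∈ C.barSpan K.letters n) :
    u ∈ C.barDeg 0 :=
  barSpan_le_of (S := fun _ => C.barDeg 0) (fun _ => barOne_mem_barDeg)
    (fun a (ha : a ∈ K.letters) _ _ hu => barCons_mem_barDeg (n := 1) ha.1 hu (by simp)) n hu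

lemma barProj_of_mem_barDeg {u : C.Bar} (hu : u ∈ C.barDeg 0) :
    ∃ n, K.barProj u ∈ C.barSpan K.letters n := by
  let T : Submodule A C.Bar := ⨆ n, C.barSpan K.letters n
  have hT : ∀ {u}, u ∈ T ↔ ∃ n, u ∈ C.barSpan K.letters n := fun {u} =>
    Submodule.mem_iSup_of_directed _ (barSpan_mono K.letters).directed_le
  have := barDeg_le_of (C := C) (S := fun k => if k < 0 then LinearMap.ker K.barProj else
    if k = 0 then T.comap K.barProj else ⊤) (by
      simpa using hT.2 ⟨0, barOne_mem_barSpan _ _⟩) (fun n a ha k l hl u hu => by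
        rcases n with _ | _ | n
        · have : C.barCons a u ∈ LinearMap.ker K.barProj := by simp [K.proj_of_mem_zero ha]
          split_ifs
          · exact this
          · rw [Submodule.mem_comap, show K.barProj _ = 0 from this]; exact zero_mem _
          · trivial
        · obtain rfl : l = k := by rw [hl]; simp
          split_ifs at hu ⊢ with h1 h2
          · have hu : K.barProj u = 0 := hu
            simp [hu]
          · obtain ⟨n, hn⟩ := hT.1 hu
            rw [Submodule.mem_comap, barProj_cons]
            exact hT.2 ⟨n + 1, barCons_mem_barSpan (K.proj_mem_letters ha) hn⟩
          · trivial
        · have : l ≤ 0 → C.barCons a u ∈ LinearMap.ker K.barProj := fun h => by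
            have : k < 0 := by push_cast at hl; omega
            rw [if_pos this] at hu
            have hu : K.barProj u = 0 := hu
            simp [hu]
          split_ifs with h1 h2
          · exact this h1.le
          · rw [Submodule.mem_comap, show K.barProj _ = 0 from this h2.le]; exact zero_mem _
          · trivial) 0
  have h := this hu
  simp only [lt_irrefl, if_false, if_true] at h
  exact hT.1 h

lemma barHomotopy_mem_barDeg {k : ℤ} {u : C.Bar} (hu : u ∈ C.barDeg k) :
    K.barHomotopy u ∈ C.barDeg (k - 1) := by
  have hP : ∀ n (a : C.augIdeal), C.incl a ∈ C.grading n → C.incl (K.proj a) ∈ C.grading n := by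
    intro n a ha
    rcases n with _ | _ | n
    · rw [K.proj_of_mem_zero ha, map_zero]; exact zero_mem _
    · exact (K.proj_mem_letters ha).1
    · rw [proj_apply, K.h_of_mem _ (by omega) _ ha, K.h_of_mem _ (by omega) _ (C.d_mem _ _ ha)]
      simpa using ha
  have := barDeg_le_of (C := C) (S := fun k => C.barDeg k ⊓ ((C.barDeg k).comap K.barProj ⊓
    (C.barDeg (k - 1)).comap K.barHomotopy))
    ⟨barOne_mem_barDeg, by simpa using barOne_mem_barDeg, by simp⟩
    (fun n a ha k l hl u hu => ⟨barCons_mem_barDeg ha hu.1 hl, by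
      simpa using barCons_mem_barDeg (hP n a ha) hu.2.1 hl, by
      change K.barHomotopy (C.barCons a u) ∈ C.barDeg (l - 1)
      rw [barHomotopy_cons]
      refine sub_mem (barCons_mem_barDeg (incl_sgn_mem ha) hu.2.2 (by rw [hl]; ring)) ?_
      by_cases hn : n = 1
      · exact barCons_mem_barDeg (K.h_mem a) hu.2.1 (by rw [hl, hn]; push_cast; ring)
      · rw [K.h_of_mem n hn a ha]; simp⟩) k
  exact (this hu).2.2

lemma barHor_mem_barDeg {k : ℤ} {u : C.Bar} (hu : u ∈ C.barDeg k) :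
    C.barHor u ∈ C.barDeg (k + 1) := by
  have := barDeg_le_of (C := C) (S := fun k => C.barDeg k ⊓ (C.barDeg (k + 1)).comap C.barHor)
    ⟨barOne_mem_barDeg, by simp⟩
    (fun n a ha k l hl u hu => ⟨barCons_mem_barDeg ha hu.1 hl, by
      change C.barHor (C.barCons a u) ∈ C.barDeg (l + 1)
      rw [barHor_cons]
      refine sub_mem (barCons_mem_barDeg (incl_sgn_mem ha) hu.2 (by rw [hl]; ring)) ?_
      have := mulHead_mem_barDeg (incl_sgn_mem ha) hu.1
      convert this using 2
      rw [hl]; ring⟩) k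
  exact (this hu).2

/-- Every cocycle is cohomologous to one with letters in `K.letters`, of the same weight. -/
theorem exists_normalized {n : ℕ} {z : C.Bar} (hz : z ∈ C.barDeg 0) (hn : z ∈ C.barSpan ⊤ n)
    (hd : C.barDiff z = 0) : ∃ w ∈ C.barDeg (-1), z - C.barDiff w ∈ C.barSpan K.letters n := by
  suffices key : ∀ m ≤ n, ∀ z', z' ∈ C.barSpan K.letters n → ∀ r ∈ C.barDeg 0, r ∈ C.barSpan ⊤ m →
      C.barDiff (z' + r) = 0 →
      ∃ w ∈ C.barDeg (-1), z' + r - C.barDiff w ∈ C.barSpan K.letters n by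
    obtain ⟨w, hw, h⟩ := key n le_rfl 0 (zero_mem _) z hz hn (by rw [zero_add, hd])
    exact ⟨w, hw, by simpa using h⟩
  intro m
  induction m with
  | zero =>
    intro _ z' hz' r _ hr _
    refine ⟨0, zero_mem _, ?_⟩
    rw [map_zero, sub_zero]
    exact add_mem hz' (barSpan_zero_le (barOne_mem_barSpan _ _) hr)
  | succ m ih =>
    intro hm z' hz' r hr hrm hzr
    have h1 : K.barHomotopy (C.barDiff z') = 0 :=
      K.exists_barSpan_of_barHomotopy_eq_zero (K.barDiff_mem_barSpan hz')
    have h2 : K.barHomotopy (C.barVert r) = - K.barHomotopy (C.barHor r) := by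
      have : K.barHomotopy (C.barDiff (z' + r)) = 0 := by rw [hzr, map_zero]
      rw [map_add, map_add, h1, zero_add, barDiff_eq, LinearMap.add_apply, map_add] at this
      exact eq_neg_of_add_eq_zero_left this
    have h3 := K.barVert_barHomotopy r
    rw [h2] at h3
    obtain ⟨k, hk⟩ := K.barProj_of_mem_barDeg hr
    have hP : K.barProj r ∈ C.barSpan K.letters n := barSpan_mono _ hm
      (mem_barSpan_of_mem_top (K.barProj_mem_barSpan hrm) hk)
    have hD : z' + r - C.barDiff (K.barHomotopy r) = (z' + K.barProj r) +
        -(K.barHomotopy (C.barHor r) + C.barHor (K.barHomotopy r)) := by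
      rw [barDiff_eq, LinearMap.add_apply]
      have : C.barVert (K.barHomotopy r) = r - K.barProj r + K.barHomotopy (C.barHor r) := by
        rw [← h3]; abel
      rw [this]; abel
    obtain ⟨w, hw, h⟩ := ih (by omega) (z' + K.barProj r) (add_mem hz' hP)
      (-(K.barHomotopy (C.barHor r) + C.barHor (K.barHomotopy r)))
      (neg_mem (add_mem (by simpa using K.barHomotopy_mem_barDeg (barHor_mem_barDeg hr))
        (by simpa using barHor_mem_barDeg (K.barHomotopy_mem_barDeg hr))))
      (neg_mem (add_mem (K.barHomotopy_mem_barSpan (barHor_mem_barSpan hrm))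
        (barHor_mem_barSpan (K.barHomotopy_mem_barSpan hrm))))
      (by rw [← hD, map_sub, hzr, C.barDiff_barDiff, sub_zero])
    refine ⟨K.barHomotopy r + w, add_mem (by simpa using K.barHomotopy_mem_barDeg hr) hw, ?_⟩
    rwa [map_add, ← sub_sub, hD]

end Contraction

end AugDGA
end LetterBraiding

namespace LetterBraiding

section Separation

variable {A : Type v} [CommRing A] [IsDomain A] [IsPrincipalIdealRing A]

/-- Over a principal ideal domain, product functionals separate the elements of a tensor product if
functionals separate the elements of the factors. -/
theorem tensor_eq_zero_of_separating {M N : Type*} [AddCommGroup M] [Module A M] [AddCommGroup N]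
    [Module A N] {ι κ : Type*} (α : ι → M →ₗ[A] A) (β : κ → N →ₗ[A] A)
    (hα : ∀ m, (∀ i, α i m = 0) → m = 0) (hβ : ∀ n, (∀ k, β k n = 0) → n = 0) (t : M ⊗[A] N)
    (h : ∀ i k, TensorProduct.lid A A (TensorProduct.map (α i) (β k) t) = 0) : t = 0 := by
  obtain ⟨M', hM', ht⟩ := TensorProduct.exists_finite_submodule_left_of_setFinite {t}
    (Set.finite_singleton t)
  obtain ⟨t', rfl⟩ := ht rfl
  have : Module.IsTorsionFree A M := by
    rw [Module.isTorsionFree_iff_smul_eq_zero]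
    intro r m hr
    by_cases h0 : r = 0
    · exact .inl h0
    · refine .inr (hα m fun i => ?_)
      have : r * α i m = 0 := by rw [← smul_eq_mul, ← map_smul, hr, map_zero]
      exact (mul_eq_zero.1 this).resolve_left h0
  obtain ⟨k, b⟩ := Module.basisOfFiniteTypeTorsionFree' (R := A) (M := M')
  obtain ⟨n, rfl⟩ := TensorProduct.eq_repr_basis_left b t'
  suffices hn : n = 0 by simp [hn]
  ext j
  refine hβ _ fun l => ?_
  have key : ∑ j, β l (n j) • b j = 0 := by
    refine Subtype.val_injective (hα _ fun i => ?_)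
    have := h i l
    rw [Finsupp.sum_fintype _ _ (by simp)] at this
    simp only [map_sum, LinearMap.rTensor_tmul, TensorProduct.map_tmul, TensorProduct.lid_tmul,
      Submodule.subtype_apply] at this
    rw [Submodule.coe_sum, map_sum, ← this]
    exact Finset.sum_congr rfl fun j _ => by simp [mul_comm]
  exact Fintype.linearIndependent_iff.1 b.linearIndependent _ key j

namespace AugDGA

variable {C : AugDGA.{v, w} A} {ι : Type*}

lemma exists_of_mem_barSpan_succ {A : Type v} [CommRing A] {C : AugDGA.{v, w} A} {M : Submodule A C.augIdeal} {n : ℕ} {u : C.Bar}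
    (hu : u ∈ C.barSpan M (n + 1)) : ∃ (c : A) (t : M ⊗[A] C.barSpan M n), u = c • C.barOne +
      TensorProduct.lift ((C.barCons.comp M.subtype).compl₂ (C.barSpan M n).subtype) t := by
  have := barSpan_succ_le (M := M) (n := n) (S := LinearMap.range
    ((LinearMap.toSpanSingleton A _ C.barOne).coprod
    (TensorProduct.lift ((C.barCons.comp M.subtype).compl₂ (C.barSpan M n).subtype))))
    ⟨(1, 0), by simp⟩ (fun a ha u hu => ⟨(0, ⟨a, ha⟩ ⊗ₜ ⟨u, hu⟩), by simp⟩)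
  obtain ⟨⟨c, t⟩, h⟩ := this hu
  exact ⟨c, t, by rw [← h]; simp⟩

/-- The successive contraction with the functionals of a word. -/
noncomputable def contrWord {A : Type v} [CommRing A] {C : AugDGA.{v, w} A}
    (α : ι → C.augIdeal →ₗ[A] A) : List ι → C.Bar →ₗ[A] C.Bar
  | [] => LinearMap.id
  | i :: l => contrWord α l ∘ₗ C.contr (α i)

/-- The contractions with words of functionals that separate the letters separate the tensors. -/
theorem eq_zero_of_contrWord {M : Submodule A C.augIdeal} (α : ι → C.augIdeal →ₗ[A] A)
    (hα : ∀ a ∈ M, (∀ i, α i a = 0) → a = 0) {n : ℕ} {u : C.Bar} (hu : u ∈ C.barSpan M n)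
    (h : ∀ l, C.barCounit (contrWord α l u) = 0) : u = 0 := by
  induction n generalizing u with
  | zero =>
    obtain ⟨c, rfl⟩ := Submodule.mem_span_singleton.1 hu
    have := h []
    simp only [contrWord, LinearMap.id_apply, map_smul, barCounit_one, smul_eq_mul, mul_one] at this
    simp [this]
  | succ n ih =>
    obtain ⟨c, t, rfl⟩ := exists_of_mem_barSpan_succ hu
    have ht : ∀ t, C.barCounit (TensorProduct.lift
        ((C.barCons.comp M.subtype).compl₂ (C.barSpan M n).subtype) t) = 0 := by
      intro t
      induction t with
      | zero => simp
      | add t t' ht ht' => simp [ht, ht']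
      | tmul a u => simp
    have hc : c = 0 := by
      have := h []
      simpa [contrWord, ht] using this
    subst hc
    rw [zero_smul, zero_add]
    suffices t = 0 by simp [this]
    refine tensor_eq_zero_of_separating (fun i => α i ∘ₗ M.subtype)
      (fun l => C.barCounit ∘ₗ contrWord α l ∘ₗ (C.barSpan M n).subtype)
      (fun m hm => Subtype.val_injective (hα m m.2 hm))
      (fun n hn => Subtype.val_injective (ih n.2 hn)) t fun i l => ?_
    have := h (i :: l)
    rw [zero_smul, zero_add] at this
    rw [← this]
    clear this h hu ht
    induction t with
    | zero => simp
    | add t t' ht ht' => simp only [map_add, ht, ht']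
    | tmul a u => simp [contrWord]

end AugDGA

end Separation

open Simplicial

/-- A spanning tree of the vertices of a simplicial set, with a root. -/
structure RootedTree (X : SSet.{u}) (x : X _⦋0⦌) where
  parent : X _⦋0⦌ → X _⦋0⦌
  edge : X _⦋0⦌ → X _⦋1⦌
  rank : X _⦋0⦌ → ℕ
  rank_parent : ∀ v, v ≠ x → rank (parent v) < rank v
  ends : ∀ v, v ≠ x → (X.δ 1 (edge v) = parent v ∧ X.δ 0 (edge v) = v) ∨
    (X.δ 0 (edge v) = parent v ∧ X.δ 1 (edge v) = v)

namespace RootedTree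

variable {X : SSet.{u}} {x : X _⦋0⦌} (T : RootedTree X x)

lemma induction {p : X _⦋0⦌ → Prop} (root : p x)
    (up : ∀ v, v ≠ x → p (X.δ 1 (T.edge v)) → p (X.δ 0 (T.edge v)))
    (down : ∀ v, v ≠ x → p (X.δ 0 (T.edge v)) → p (X.δ 1 (T.edge v))) (v : X _⦋0⦌) : p v := by
  induction hn : T.rank v using Nat.strong_induction_on generalizing v with
  | _ n ih =>
    subst hn
    by_cases hv : v = x
    · rwa [hv]
    · have hp := ih _ (T.rank_parent v hv) _ rfl
      rcases T.ends v hv with ⟨h1, h2⟩ | ⟨h1, h2⟩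
      · rw [← h1] at hp
        rw [← h2]
        exact up v hv hp
      · rw [← h1] at hp
        rw [← h2]
        exact down v hv hp

section Solution

variable {Γ : Type*} [Group Γ] (c : X _⦋1⦌ → Γ)

open Classical in
/-- The function on the vertices with value `1` at the root that changes by `c` along the edges of
the tree. -/
noncomputable def sol (v : X _⦋0⦌) : Γ :=
  if _h : v = x then 1 else
    if X.δ 0 (T.edge v) = v then sol (T.parent v) * c (T.edge v)
    else sol (T.parent v) * (c (T.edge v))⁻¹
termination_by T.rank v
decreasing_by all_goals exact T.rank_parent v ‹_›

@[simp] lemma sol_root : T.sol c x = 1 := by rw [sol]; simp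

lemma sol_edge (v : X _⦋0⦌) (hv : v ≠ x) :
    T.sol c (X.δ 0 (T.edge v)) = T.sol c (X.δ 1 (T.edge v)) * c (T.edge v) := by
  rcases T.ends v hv with ⟨h1, h2⟩ | ⟨h1, h2⟩
  · rw [h1, h2, sol, dif_neg hv, if_pos h2]
  · have : T.parent v ≠ v := fun h => by
      have := T.rank_parent v hv
      rw [h] at this
      exact lt_irrefl _ this
    have e : T.sol c v = T.sol c (T.parent v) * (c (T.edge v))⁻¹ := by
      rw [sol, dif_neg hv, if_neg (by rw [h1]; exact this)]
    rw [h1, h2, e, inv_mul_cancel_right]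

variable {c} in
lemma eq_sol {f : X _⦋0⦌ → Γ} (hx : f x = 1)
    (h : ∀ v, v ≠ x → f (X.δ 0 (T.edge v)) = f (X.δ 1 (T.edge v)) * c (T.edge v)) :
    f = T.sol c := by
  funext v
  refine T.induction (p := fun v => f v = T.sol c v) (by rw [hx, sol_root]) (fun v hv hp => ?_)
    (fun v hv hp => ?_) v
  · rw [h v hv, T.sol_edge c v hv, hp]
  · rw [h v hv, T.sol_edge c v hv] at hp
    exact mul_right_cancel hp

end Solution

variable (A : Type v) [CommRing A]

/-- The additive form of `sol`, as a linear map. -/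
noncomputable def potential : (X _⦋1⦌ → A) →ₗ[A] (X _⦋0⦌ → A) where
  toFun c v := (T.sol (Γ := Multiplicative A) (fun e => Multiplicative.ofAdd (c e)) v).toAdd
  map_add' c c' := by
    refine congrArg (fun f v => Multiplicative.toAdd (f v)) (T.eq_sol (Γ := Multiplicative A)
      (c := fun e => Multiplicative.ofAdd ((c + c') e))
      (f := fun v => T.sol (fun e => Multiplicative.ofAdd (c e)) v *
        T.sol (fun e => Multiplicative.ofAdd (c' e)) v) (by simp) fun v hv => ?_).symm
    rw [T.sol_edge _ v hv, T.sol_edge _ v hv, Pi.add_apply, ofAdd_add]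
    exact mul_mul_mul_comm _ _ _ _
  map_smul' r c := by
    refine congrArg (fun f v => Multiplicative.toAdd (f v)) (T.eq_sol (Γ := Multiplicative A)
      (c := fun e => Multiplicative.ofAdd ((r • c) e))
      (f := fun v => Multiplicative.ofAdd (r *
        (T.sol (fun e => Multiplicative.ofAdd (c e)) v).toAdd)) (by simp) fun v hv => ?_).symm
    rw [T.sol_edge _ v hv, toAdd_mul, mul_add, ofAdd_add]
    rfl

lemma eq_potential {c : X _⦋1⦌ → A} {f : X _⦋0⦌ → A} (hx : f x = 0)
    (h : ∀ v, v ≠ x → f (X.δ 0 (T.edge v)) = f (X.δ 1 (T.edge v)) + c (T.edge v)) :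
    f = T.potential A c :=
  T.eq_sol (Γ := Multiplicative A) (c := fun e => Multiplicative.ofAdd (c e))
    (f := fun v => Multiplicative.ofAdd (f v)) hx h

@[simp] lemma potential_root (c : X _⦋1⦌ → A) : T.potential A c x = 0 :=
  T.sol_root (Γ := Multiplicative A) _

lemma potential_edge (c : X _⦋1⦌ → A) (v : X _⦋0⦌) (hv : v ≠ x) :
    T.potential A c (X.δ 0 (T.edge v)) = T.potential A c (X.δ 1 (T.edge v)) + c (T.edge v) :=
  T.sol_edge (Γ := Multiplicative A) _ v hv

end RootedTree

section Evaluation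

variable {A : Type v} [CommRing A] {X : SSet.{u}} {x : X _⦋0⦌}

/-- The value of a cochain of augmentation zero at a vertex. -/
noncomputable def evalVertex (e : X _⦋0⦌) : (cochains2 A X x).augIdeal →ₗ[A] A where
  toFun c := Cochains2.c0 ((cochains2 A X x).incl c) e
  map_add' _ _ := rfl
  map_smul' _ _ := rfl

/-- The value of a cochain of augmentation zero on a triangle. -/
noncomputable def evalTri (s : X _⦋2⦌) : (cochains2 A X x).augIdeal →ₗ[A] A where
  toFun c := Cochains2.c2 ((cochains2 A X x).incl c) s
  map_add' _ _ := rfl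
  map_smul' _ _ := rfl

lemma augIdeal_ext {a b : (cochains2 A X x).augIdeal} (h0 : ∀ v, evalVertex v a = evalVertex v b)
    (h1 : ∀ e, evalEdge e a = evalEdge e b) (h2 : ∀ s, evalTri s a = evalTri s b) : a = b :=
  (cochains2 A X x).incl_injective
    (Cochains2.ext (X := X) (A := A) (funext h0) (funext h1) (funext h2))

lemma incl_mem_grading {a : (cochains2 A X x).augIdeal} {n : ℕ} :
    (cochains2 A X x).incl a ∈ (cochains2 A X x).grading n ↔ (n ≠ 0 → ∀ v, evalVertex v a = 0) ∧
      (n ≠ 1 → ∀ e, evalEdge e a = 0) ∧ (n ≠ 2 → ∀ s, evalTri s a = 0) := by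
  refine Cochains2.mem_grading.trans ?_
  simp only [funext_iff]
  rfl

@[simp] lemma evalVertex_dBar (v : X _⦋0⦌) (a : (cochains2 A X x).augIdeal) :
    evalVertex v ((cochains2 A X x).dBar a) = 0 := rfl

@[simp] lemma evalEdge_dBar' (e : X _⦋1⦌) (a : (cochains2 A X x).augIdeal) :
    evalEdge e ((cochains2 A X x).dBar a) = evalVertex (X.δ 0 e) a - evalVertex (X.δ 1 e) a := rfl

@[simp] lemma evalTri_dBar (s : X _⦋2⦌) (a : (cochains2 A X x).augIdeal) :
    evalTri s ((cochains2 A X x).dBar a) =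
      evalEdge (X.δ 0 s) a - evalEdge (X.δ 1 s) a + evalEdge (X.δ 2 s) a := rfl

@[simp] lemma evalVertex_mulBar (v : X _⦋0⦌) (a b : (cochains2 A X x).augIdeal) :
    evalVertex v ((cochains2 A X x).mulBar a b) = evalVertex v a * evalVertex v b := rfl

@[simp] lemma evalEdge_mulBar' (e : X _⦋1⦌) (a b : (cochains2 A X x).augIdeal) :
    evalEdge e ((cochains2 A X x).mulBar a b) =
      evalVertex (X.δ 1 e) a * evalEdge e b + evalEdge e a * evalVertex (X.δ 0 e) b := rfl

@[simp] lemma evalTri_mulBar (s : X _⦋2⦌) (a b : (cochains2 A X x).augIdeal) :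
    evalTri s ((cochains2 A X x).mulBar a b) = evalVertex (X.δ 1 (X.δ 2 s)) a * evalTri s b +
      evalEdge (X.δ 2 s) a * evalEdge (X.δ 0 s) b +
        evalTri s a * evalVertex (X.δ 0 (X.δ 0 s)) b := rfl

lemma evalVertex_root (a : (cochains2 A X x).augIdeal) : evalVertex x a = 0 := c0_incl a

lemma sgnFull_cochains2 (c : Cochains2 X A) :
    ((cochains2 A X x).sgnFull c : Cochains2 X A) =
      -(Cochains2.proj X A 0 c).1 + (Cochains2.proj X A 1 c).1 - (Cochains2.proj X A 2 c).1 := by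
  let f : Cochains2 X A →ₗ[A] Cochains2 X A := (cochains2 A X x).sgnFull
  have h : c = (Cochains2.proj X A 0 c).1 + (Cochains2.proj X A 1 c).1 +
      (Cochains2.proj X A 2 c).1 := by ext <;> simp
  have e : ∀ n, f (Cochains2.proj X A n c).1 = (-1 : A) ^ (n + 1) • (Cochains2.proj X A n c).1 :=
    fun n => AugDGA.sgnFull_of_mem (C := cochains2 A X x) (Cochains2.proj X A n c).2
  change f c = _
  conv_lhs => rw [h]
  rw [map_add, map_add, e, e, e]
  ext <;> simp [sub_eq_add_neg, pow_succ]

@[simp] lemma evalVertex_sgn (v : X _⦋0⦌) (a : (cochains2 A X x).augIdeal) :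
    evalVertex v ((cochains2 A X x).sgn a) = - evalVertex v a := by
  have key : ∀ c : Cochains2 X A, Cochains2.c0 ((cochains2 A X x).sgnFull c) v = - c.c0 v := by
    intro c
    rw [sgnFull_cochains2]
    simp [sub_eq_add_neg]
  exact key _

@[simp] lemma evalEdge_sgn (e : X _⦋1⦌) (a : (cochains2 A X x).augIdeal) :
    evalEdge e ((cochains2 A X x).sgn a) = evalEdge e a := by
  have key : ∀ c : Cochains2 X A, Cochains2.c1 ((cochains2 A X x).sgnFull c) e = c.c1 e := by
    intro c
    rw [sgnFull_cochains2]
    simp [sub_eq_add_neg]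
  exact key _

@[simp] lemma evalTri_sgn (s : X _⦋2⦌) (a : (cochains2 A X x).augIdeal) :
    evalTri s ((cochains2 A X x).sgn a) = - evalTri s a := by
  have key : ∀ c : Cochains2 X A, Cochains2.c2 ((cochains2 A X x).sgnFull c) s = - c.c2 s := by
    intro c
    rw [sgnFull_cochains2]
    simp [sub_eq_add_neg]
  exact key _

/-- The cochain of augmentation zero with given values. -/
noncomputable def mkAug (c : Cochains2 X A) (h : c.c0 x = 0) : (cochains2 A X x).augIdeal :=
  (cochains2 A X x).toAugIdeal c h

@[simp] lemma evalVertex_mkAug (v : X _⦋0⦌) (c : Cochains2 X A) (h : c.c0 x = 0) :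
    evalVertex v (mkAug c h) = c.c0 v := rfl

@[simp] lemma evalEdge_mkAug (e : X _⦋1⦌) (c : Cochains2 X A) (h : c.c0 x = 0) :
    evalEdge e (mkAug c h) = c.c1 e := rfl

@[simp] lemma evalTri_mkAug (s : X _⦋2⦌) (c : Cochains2 X A) (h : c.c0 x = 0) :
    evalTri s (mkAug c h) = c.c2 s := rfl

variable (A) in
/-- The contraction of the cochain algebra that a spanning tree gives. -/
noncomputable def RootedTree.contraction (T : RootedTree X x) : (cochains2 A X x).Contraction where
  h :=
    { toFun := fun a => mkAug ⟨T.potential A fun e => evalEdge e a, 0, 0, fun _ => rfl,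
        fun _ _ => rfl⟩ (T.potential_root A _)
      map_add' := fun a b => augIdeal_ext (fun v => by
        simp only [evalVertex_mkAug, map_add]
        exact congrFun (map_add (T.potential A) (fun e => evalEdge e a) (fun e => evalEdge e b)) v)
        (fun e => by simp) (fun s => by simp)
      map_smul' := fun r a => augIdeal_ext (fun v => by
        simp only [evalVertex_mkAug, map_smul]
        exact congrFun (map_smul (T.potential A) r (fun e => evalEdge e a)) v)
        (fun e => by simp) (fun s => by simp) }
  h_mem a := incl_mem_grading.2 ⟨fun h => (h rfl).elim, fun _ _ => rfl, fun _ _ => rfl⟩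
  h_of_mem n hn a ha := by
    have : (fun e => evalEdge e a) = 0 := funext ((incl_mem_grading.1 ha).2.1 hn)
    refine augIdeal_ext (fun v => ?_) (fun e => rfl) (fun e => rfl)
    change T.potential A (fun e => evalEdge e a) v = _
    rw [this]
    simp
  h_sgn a := augIdeal_ext (fun v => by
    change T.potential A (fun e => evalEdge e _) v = T.potential A (fun e => evalEdge e a) v
    simp) (fun e => rfl) (fun e => rfl)
  h_d a ha := by
    rw [incl_mem_grading] at ha
    refine augIdeal_ext (fun v => ?_) (fun e => (ha.2.1 (by simp) e).symm)
      (fun s => (ha.2.2 (by simp) s).symm)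
    exact (congrFun (T.eq_potential A (f := fun v => evalVertex v a) (evalVertex_root a)
      (fun v _ => by simp)) v).symm

lemma RootedTree.mem_letters {T : RootedTree X x} {a : (cochains2 A X x).augIdeal} :
    a ∈ (T.contraction A).letters ↔ (cochains2 A X x).incl a ∈ (cochains2 A X x).grading 1 ∧
      ∀ v, v ≠ x → evalEdge (T.edge v) a = 0 := by
  refine and_congr_right fun h => ?_
  have : a ∈ LinearMap.ker (T.contraction A).h ↔ T.potential A (fun e => evalEdge e a) = 0 :=
    ⟨fun h => funext fun v => congrArg (evalVertex v) h,
      fun h => augIdeal_ext (fun v => congrFun h v) (fun e => rfl) (fun s => rfl)⟩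
  refine this.trans ⟨fun h v hv => ?_, fun h => ?_⟩
  · have := T.potential_edge A (fun e => evalEdge e a) v hv
    simpa [h] using this.symm
  · exact (T.eq_potential A rfl fun v hv => by simp [h v hv]).symm

end Evaluation

section Operators

variable {A : Type v} [CommRing A] {X : SSet.{u}} {x : X _⦋0⦌}

/-- The contraction of the first letter with a vertex. -/
noncomputable def vertexOp (v : X _⦋0⦌) : (cochains2 A X x).Bar →ₗ[A] (cochains2 A X x).Bar :=
  (cochains2 A X x).contr (evalVertex v)

/-- The contraction of the first letter with an edge. -/
noncomputable def edgeOp (e : X _⦋1⦌) : (cochains2 A X x).Bar →ₗ[A] (cochains2 A X x).Bar :=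
  (cochains2 A X x).contr (evalEdge e)

/-- The contraction of the first letter with a triangle. -/
noncomputable def triOp (s : X _⦋2⦌) : (cochains2 A X x).Bar →ₗ[A] (cochains2 A X x).Bar :=
  (cochains2 A X x).contr (evalTri s)

@[simp] lemma vertexOp_one (v : X _⦋0⦌) : vertexOp v (cochains2 A X x).barOne = 0 := by
  simp [vertexOp]
@[simp] lemma vertexOp_cons (v : X _⦋0⦌) (a : (cochains2 A X x).augIdeal)
    (u : (cochains2 A X x).Bar) :
    vertexOp v ((cochains2 A X x).barCons a u) = evalVertex v a • u := by simp [vertexOp]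
@[simp] lemma edgeOp_one (e : X _⦋1⦌) : edgeOp e (cochains2 A X x).barOne = 0 := by
  simp [edgeOp]
@[simp] lemma edgeOp_cons (e : X _⦋1⦌) (a : (cochains2 A X x).augIdeal)
    (u : (cochains2 A X x).Bar) :
    edgeOp e ((cochains2 A X x).barCons a u) = evalEdge e a • u := by simp [edgeOp]
@[simp] lemma triOp_one (s : X _⦋2⦌) : triOp s (cochains2 A X x).barOne = 0 := by
  simp [triOp]
@[simp] lemma triOp_cons (s : X _⦋2⦌) (a : (cochains2 A X x).augIdeal)
    (u : (cochains2 A X x).Bar) :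
    triOp s ((cochains2 A X x).barCons a u) = evalTri s a • u := by simp [triOp]

lemma edgeOp_mulHead (e : X _⦋1⦌) (c : (cochains2 A X x).augIdeal) (u : (cochains2 A X x).Bar) :
    edgeOp e ((cochains2 A X x).mulHead c u) =
      evalVertex (X.δ 1 e) c • edgeOp e u + evalEdge e c • vertexOp (X.δ 0 e) u := by
  suffices h : edgeOp e ∘ₗ (cochains2 A X x).mulHead c = evalVertex (X.δ 1 e) c • edgeOp e +
    evalEdge e c • vertexOp (X.δ 0 e) from LinearMap.congr_fun h u
  exact AugDGA.bar_ext (by simp) fun a u _ => by simp [add_smul, mul_smul]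

lemma triOp_mulHead (s : X _⦋2⦌) (c : (cochains2 A X x).augIdeal) (u : (cochains2 A X x).Bar) :
    triOp s ((cochains2 A X x).mulHead c u) = evalVertex (X.δ 1 (X.δ 2 s)) c • triOp s u +
      evalEdge (X.δ 2 s) c • edgeOp (X.δ 0 s) u +
        evalTri s c • vertexOp (X.δ 0 (X.δ 0 s)) u := by
  suffices h : triOp s ∘ₗ (cochains2 A X x).mulHead c =
    evalVertex (X.δ 1 (X.δ 2 s)) c • triOp s + evalEdge (X.δ 2 s) c • edgeOp (X.δ 0 s) +
      evalTri s c • vertexOp (X.δ 0 (X.δ 0 s)) from LinearMap.congr_fun h u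
  exact AugDGA.bar_ext (by simp) fun a u _ => by simp [add_smul, mul_smul]

lemma edgeOp_barDiff (e : X _⦋1⦌) (u : (cochains2 A X x).Bar) :
    edgeOp e ((cochains2 A X x).barDiff u) = (cochains2 A X x).barDiff (edgeOp e u) -
      vertexOp (X.δ 0 e) u + vertexOp (X.δ 1 e) u + edgeOp e (vertexOp (X.δ 1 e) u) -
        vertexOp (X.δ 0 e) (edgeOp e u) := by
  suffices h : edgeOp e ∘ₗ (cochains2 A X x).barDiff = (cochains2 A X x).barDiff ∘ₗ edgeOp e -
      vertexOp (X.δ 0 e) + vertexOp (X.δ 1 e) + edgeOp e ∘ₗ vertexOp (X.δ 1 e) -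
        vertexOp (X.δ 0 e) ∘ₗ edgeOp e from LinearMap.congr_fun h u
  refine AugDGA.bar_ext (by simp) fun a u _ => ?_
  simp [AugDGA.barDiff_cons, edgeOp_mulHead, sub_smul]
  abel

/-- The span of the tensors with letters of degree `1`. -/
noncomputable def degreeOne (A : Type v) [CommRing A] (X : SSet.{u}) (x : X _⦋0⦌) :
    Submodule A (cochains2 A X x).augIdeal :=
  ((cochains2 A X x).grading 1).comap (cochains2 A X x).incl

/-- The letters that vanish on the vertices. -/
noncomputable def reduced (A : Type v) [CommRing A] (X : SSet.{u}) (x : X _⦋0⦌) :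
    Submodule A (cochains2 A X x).augIdeal := ⨅ v, LinearMap.ker (evalVertex v)

lemma mem_degreeOne {a : (cochains2 A X x).augIdeal} : a ∈ degreeOne A X x ↔
    (∀ v, evalVertex v a = 0) ∧ (∀ s, evalTri s a = 0) := by
  refine incl_mem_grading.trans ⟨fun h => ⟨h.1 (by simp), h.2.2 (by simp)⟩,
    fun h => ⟨fun _ => h.1, fun h => (h rfl).elim, fun _ => h.2⟩⟩

lemma mem_reduced {a : (cochains2 A X x).augIdeal} : a ∈ reduced A X x ↔
    ∀ v, evalVertex v a = 0 := by simp [reduced]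

lemma degreeOne_le_reduced : degreeOne A X x ≤ reduced A X x :=
  fun _ h => mem_reduced.2 (mem_degreeOne.1 h).1

lemma vertexOp_of_mem {n : ℕ} {u : (cochains2 A X x).Bar}
    (hu : u ∈ (cochains2 A X x).barSpan (reduced A X x) n) (v : X _⦋0⦌) : vertexOp v u = 0 := by
  have := AugDGA.barSpan_le_of (C := cochains2 A X x) (M := reduced A X x)
    (S := fun _ => LinearMap.ker (vertexOp v)) (fun _ => by simp)
    (fun a ha n u _ => by simp [mem_reduced.1 ha v]) n
  exact this hu

lemma sgn_of_mem_degreeOne {a : (cochains2 A X x).augIdeal} (ha : a ∈ degreeOne A X x) :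
    (cochains2 A X x).sgn a = a := by
  rw [mem_degreeOne] at ha
  exact augIdeal_ext (by simp [ha]) (by simp) (by simp [ha])

lemma triOp_barDiff {n : ℕ} {u : (cochains2 A X x).Bar}
    (hu : u ∈ (cochains2 A X x).barSpan (degreeOne A X x) n) (s : X _⦋2⦌) :
    triOp s ((cochains2 A X x).barDiff u) = edgeOp (X.δ 1 s) u - edgeOp (X.δ 0 s) u -
      edgeOp (X.δ 2 s) u - edgeOp (X.δ 0 s) (edgeOp (X.δ 2 s) u) := by
  have := AugDGA.barSpan_le_of (C := cochains2 A X x) (M := degreeOne A X x)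
    (S := fun n => (cochains2 A X x).barSpan (degreeOne A X x) n ⊓
      LinearMap.eqLocus (triOp s ∘ₗ (cochains2 A X x).barDiff) (edgeOp (X.δ 1 s) -
        edgeOp (X.δ 0 s) - edgeOp (X.δ 2 s) - edgeOp (X.δ 0 s) ∘ₗ edgeOp (X.δ 2 s)))
    (fun m => ⟨AugDGA.barOne_mem_barSpan _ _, by simp [LinearMap.mem_eqLocus]⟩)
    (fun a ha m u hu => ⟨AugDGA.barCons_mem_barSpan ha hu.1, by
      have ha' := mem_degreeOne.1 ha
      have hv := vertexOp_of_mem (AugDGA.barSpan_mono_left degreeOne_le_reduced _ hu.1)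
      simp [LinearMap.mem_eqLocus, AugDGA.barDiff_cons, sgn_of_mem_degreeOne ha, triOp_mulHead,
        ha', hv, sub_smul, add_smul]
      abel⟩) n
  exact (this hu).2

end Operators

end LetterBraiding

namespace LetterBraiding

set_option linter.unusedSectionVars false
set_option maxSynthPendingDepth 3

section FiniteTypeFunctionals

variable {A : Type v} [CommRing A] {R : Type w} [Ring R] [Algebra A R] (I : Ideal R)
  [I.IsTwoSided]

variable (A) in
/-- The functionals that vanish on `I ^ n`. -/
def killingPow (n : ℕ) : Submodule A (Module.Dual A R) where
  carrier := {φ | ∀ x ∈ I ^ n, φ x = 0}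
  add_mem' ha hb x hx := by simp [ha x hx, hb x hx]
  zero_mem' := by simp
  smul_mem' a φ h x hx := by simp [h x hx]

lemma killingPow_mono : Monotone (killingPow A I) :=
  fun _ _ h _ hφ x hx => hφ x (Ideal.pow_le_pow_right h hx)

variable (A) in
/-- The functionals that vanish on some power of `I`. -/
def finiteTypeDual : Submodule A (Module.Dual A R) where
  carrier := {φ | ∃ n, φ ∈ killingPow A I n}
  add_mem' := by
    rintro a b ⟨m, hm⟩ ⟨n, hn⟩
    exact ⟨max m n, add_mem (killingPow_mono I (le_max_left _ _) hm)
      (killingPow_mono I (le_max_right _ _) hn)⟩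
  zero_mem' := ⟨0, zero_mem _⟩
  smul_mem' a _ := fun ⟨n, hn⟩ => ⟨n, Submodule.smul_mem _ a hn⟩

variable {I}

lemma mul_mem_pow {m n : ℕ} {x y : R} (hx : x ∈ I ^ m) (hy : y ∈ I ^ n) : x * y ∈ I ^ (m + n) := by
  rw [Ideal.IsTwoSided.pow_add]
  exact Ideal.mul_mem_mul hx hy

variable (I)

variable [IsDomain A]

variable (A) in
/-- The elements with a nonzero multiple in `I ^ n`. -/
def torsionPow (n : ℕ) : Submodule A R where
  carrier := {x | ∃ a : A, a ≠ 0 ∧ a • x ∈ I ^ n}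
  add_mem' := by
    rintro x y ⟨a, ha, hx⟩ ⟨b, hb, hy⟩
    refine ⟨a * b, mul_ne_zero ha hb, ?_⟩
    rw [smul_add, mul_smul, mul_smul, smul_comm a b x]
    exact add_mem (Submodule.smul_of_tower_mem _ b hx) (Submodule.smul_of_tower_mem _ a hy)
  zero_mem' := ⟨1, one_ne_zero, by simp⟩
  smul_mem' r x := by
    rintro ⟨a, ha, hx⟩
    refine ⟨a, ha, ?_⟩
    rw [smul_comm]
    exact Submodule.smul_of_tower_mem _ r hx

variable {I}

lemma mem_torsionPow {n : ℕ} {x : R} : x ∈ torsionPow A I n ↔ ∃ a : A, a ≠ 0 ∧ a • x ∈ I ^ n :=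
  Iff.rfl

lemma torsionPow_anti : Antitone (torsionPow A I) :=
  fun _ _ h _ ⟨a, ha, hx⟩ => ⟨a, ha, Ideal.pow_le_pow_right h hx⟩

lemma mem_torsionPow_of_mem {n : ℕ} {x : R} (hx : x ∈ I ^ n) : x ∈ torsionPow A I n :=
  ⟨1, one_ne_zero, by simpa using hx⟩

lemma eq_zero_of_mem_torsionPow {n : ℕ} {x : R} (hx : x ∈ torsionPow A I n) {φ : Module.Dual A R}
    (hφ : φ ∈ killingPow A I n) : φ x = 0 := by
  obtain ⟨a, ha, hx⟩ := hx
  have := hφ _ hx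
  rw [map_smul, smul_eq_mul] at this
  exact (mul_eq_zero.1 this).resolve_left ha

lemma mul_mem_torsionPow {m n : ℕ} {x y : R} (hx : x ∈ torsionPow A I m) (hy : y ∈ I ^ n) :
    x * y ∈ torsionPow A I (m + n) := by
  obtain ⟨a, ha, hx⟩ := hx
  exact ⟨a, ha, by rw [← smul_mul_assoc]; exact mul_mem_pow hx hy⟩

instance (n : ℕ) : Module.IsTorsionFree A (R ⧸ torsionPow A I n) := by
  rw [Module.isTorsionFree_iff_smul_eq_zero]
  intro r m hr
  by_cases h0 : r = 0
  · exact .inl h0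
  · refine .inr ?_
    obtain ⟨x, rfl⟩ := Submodule.mkQ_surjective _ m
    rw [← map_smul, Submodule.mkQ_apply, Submodule.Quotient.mk_eq_zero] at hr
    obtain ⟨a, ha, hx⟩ := hr
    rw [Submodule.mkQ_apply, Submodule.Quotient.mk_eq_zero]
    exact ⟨a * r, mul_ne_zero ha h0, by rwa [mul_smul]⟩

lemma finite_quotient_torsionPow {n : ℕ} (h : Module.Finite A (R ⧸ I ^ n)) :
    Module.Finite A (R ⧸ torsionPow A I n) := by
  let f : (R ⧸ I ^ n) →ₗ[A] (R ⧸ torsionPow A I n) :=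
    { toFun := Quotient.map' id fun x y hxy => by
        rw [Submodule.quotientRel_def] at hxy ⊢
        exact mem_torsionPow_of_mem hxy
      map_add' := by rintro ⟨x⟩ ⟨y⟩; rfl
      map_smul' := by rintro r ⟨x⟩; rfl }
  refine Module.Finite.of_surjective f ?_
  rintro ⟨x⟩
  exact ⟨Submodule.Quotient.mk x, rfl⟩

variable [IsPrincipalIdealRing A]

lemma mem_torsionPow_iff {n : ℕ} (h : Module.Finite A (R ⧸ I ^ n)) {x : R} :
    x ∈ torsionPow A I n ↔ ∀ φ ∈ killingPow A I n, φ x = 0 := by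
  refine ⟨fun hx φ hφ => eq_zero_of_mem_torsionPow hx hφ, fun hx => ?_⟩
  have := finite_quotient_torsionPow h
  rw [← Submodule.Quotient.mk_eq_zero, ← Submodule.mkQ_apply]
  obtain ⟨k, b⟩ := Module.basisOfFiniteTypeTorsionFree' (R := A) (M := R ⧸ torsionPow A I n)
  refine b.repr.injective ?_
  rw [map_zero]
  ext i
  refine hx (b.coord i ∘ₗ (torsionPow A I n).mkQ) fun y hy => ?_
  rw [LinearMap.comp_apply, Submodule.mkQ_apply,
    (Submodule.Quotient.mk_eq_zero _).2 (mem_torsionPow_of_mem hy), map_zero]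

/-- Approximate dual bases: modulo elements with a multiple in `I ^ n`, the identity is a finite sum
of tensors of functionals and elements that are compatible with the filtrations. -/
theorem exists_dual_basis (h : ∀ n, Module.Finite A (R ⧸ I ^ n)) (n : ℕ) :
    ∃ (ι : Type) (_ : Fintype ι) (b : ι → Module.Dual A R) (q : ι → R) (l : ι → ℕ),
      (∀ j, b j ∈ killingPow A I (l j + 1)) ∧ (∀ j, q j ∈ torsionPow A I (l j)) ∧
      (∀ j, l j < n) ∧ ∀ x, x - ∑ j, b j x • q j ∈ torsionPow A I n := by
  induction n with
  | zero =>
    exact ⟨Empty, inferInstance, Empty.elim, Empty.elim, Empty.elim, fun j => j.elim,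
      fun j => j.elim, fun j => j.elim, fun x => mem_torsionPow_of_mem (by
        rw [Submodule.pow_zero, Ideal.one_eq_top]; trivial)⟩
  | succ n ih =>
    obtain ⟨ι, _, b, q, l, hb, hq, hl, hx⟩ := ih
    have := finite_quotient_torsionPow (h (n + 1))
    let V := (torsionPow A I n).map (torsionPow A I (n + 1)).mkQ
    obtain ⟨k, c⟩ := Module.basisOfFiniteTypeTorsionFree' (R := A) (M := V)
    have hc : ∀ i, ∃ y ∈ torsionPow A I n, (torsionPow A I (n + 1)).mkQ y = c i := fun i => (c i).2
    choose y hy hyc using hc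
    let rem : R →ₗ[A] torsionPow A I n := LinearMap.codRestrict _
      (LinearMap.id - ∑ j, (b j).smulRight (q j)) fun x => by
        simpa using hx x
    have hrem : ∀ x, (rem x : R) = x - ∑ j, b j x • q j := fun x => by simp [rem]
    let f : R →ₗ[A] V := ((torsionPow A I (n + 1)).mkQ.submoduleMap (torsionPow A I n)) ∘ₗ rem
    refine ⟨ι ⊕ Fin k, inferInstance, Sum.elim b fun i => c.coord i ∘ₗ f, Sum.elim q y,
      Sum.elim l fun _ => n, ?_, ?_, ?_, fun x => ?_⟩
    · rintro (j | i)
      · exact hb j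
      · intro x hxn
        have : f x = 0 := by
          refine Subtype.val_injective ?_
          have e : (rem x : R) = x := by
            rw [hrem, Finset.sum_eq_zero, sub_zero]
            intro j _
            rw [hb j x (Ideal.pow_le_pow_right (by have := hl j; simp; omega) hxn), zero_smul]
          change (torsionPow A I (n + 1)).mkQ (rem x) = 0
          rw [e, Submodule.mkQ_apply, Submodule.Quotient.mk_eq_zero]
          exact mem_torsionPow_of_mem hxn
        change c.coord i (f x) = 0
        rw [this, map_zero]
    · rintro (j | i)
      · exact hq j
      · exact hy i
    · rintro (j | i)
      · exact (hl j).trans (Nat.lt_succ_self n)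
      · exact Nat.lt_succ_self n
    · rw [Fintype.sum_sum_type, ← sub_sub]
      simp only [Sum.elim_inl, Sum.elim_inr]
      rw [← hrem, ← Submodule.Quotient.mk_eq_zero, ← Submodule.mkQ_apply, map_sub, map_sum]
      have := congrArg Subtype.val (c.sum_repr (f x))
      rw [Submodule.coe_sum] at this
      rw [sub_eq_zero]
      refine Eq.trans ?_ (this.symm.trans (Finset.sum_congr rfl fun i _ => ?_))
      · rfl
      · rw [map_smul, hyc]
        rfl

end FiniteTypeFunctionals

section Coassociativity

variable {A : Type v} [CommRing A] {M : Type w} [AddCommMonoid M] [Module A M]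
  (Δ : M →ₗ[A] M ⊗[A] M) (α β γ : M →ₗ[A] A)

lemma lid_map_assoc_rTensor {μ : M →ₗ[A] A}
    (h : ∀ m, ((TensorProduct.lid A A).toLinearMap ∘ₗ TensorProduct.map α β) (Δ m) = μ m)
    (t : M ⊗[A] M) : TensorProduct.lid A A (TensorProduct.map α
      ((TensorProduct.lid A A).toLinearMap ∘ₗ TensorProduct.map β γ)
      (TensorProduct.assoc A M M M (Δ.rTensor M t))) =
        TensorProduct.lid A A (TensorProduct.map μ γ t) := by
  induction t with
  | zero => simp
  | add t t' ht ht' => simp only [map_add, ht, ht']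
  | tmul f g =>
    rw [LinearMap.rTensor_tmul, TensorProduct.map_tmul, ← h]
    generalize Δ f = p
    induction p with
    | zero => simp
    | add t t' ht ht' => simp only [map_add, TensorProduct.add_tmul, ht, ht']
    | tmul f f' => simp [mul_assoc]

lemma lid_map_lTensor {μ : M →ₗ[A] A} {δ : M ⊗[A] M →ₗ[A] A} (h : ∀ m, δ (Δ m) = μ m)
    (t : M ⊗[A] M) : TensorProduct.lid A A (TensorProduct.map α δ (Δ.lTensor M t)) =
        TensorProduct.lid A A (TensorProduct.map α μ t) := by
  induction t with
  | zero => simp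
  | add t t' ht ht' => simp only [map_add, ht, ht']
  | tmul f g => simp [h]

end Coassociativity

section Coproduct

variable {A : Type v} [CommRing A] {R : Type w} [Ring R] [Algebra A R] (I : Ideal R)
  [I.IsTwoSided]

variable (A) in
/-- The evaluation of a functional of finite type. -/
noncomputable def dualEval (x : R) : finiteTypeDual A I →ₗ[A] A :=
  Module.Dual.eval A R x ∘ₗ (finiteTypeDual A I).subtype

@[simp] lemma dualEval_apply (x : R) (φ : finiteTypeDual A I) : dualEval A I x φ = φ.1 x := rfl

variable (A) in
/-- The evaluation of a tensor of functionals at a pair of elements. -/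
noncomputable def pairEval (x y : R) : finiteTypeDual A I ⊗[A] finiteTypeDual A I →ₗ[A] A :=
  (TensorProduct.lid A A).toLinearMap ∘ₗ TensorProduct.map (dualEval A I x) (dualEval A I y)

@[simp] lemma pairEval_tmul (x y : R) (φ ψ : finiteTypeDual A I) :
    pairEval A I x y (φ ⊗ₜ ψ) = φ.1 x * ψ.1 y := by simp [pairEval]

variable [IsDomain A] [IsPrincipalIdealRing A]

variable {I}

lemma eq_zero_of_dualEval (φ : finiteTypeDual A I) (h : ∀ x, dualEval A I x φ = 0) : φ = 0 :=
  Subtype.val_injective (LinearMap.ext h)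

lemma eq_zero_of_pairEval (t : finiteTypeDual A I ⊗[A] finiteTypeDual A I)
    (h : ∀ x y, pairEval A I x y t = 0) : t = 0 :=
  tensor_eq_zero_of_separating (dualEval A I) (dualEval A I) eq_zero_of_dualEval
    eq_zero_of_dualEval t h

lemma eq_of_pairEval {t t' : finiteTypeDual A I ⊗[A] finiteTypeDual A I}
    (h : ∀ x y, pairEval A I x y t = pairEval A I x y t') : t = t' :=
  sub_eq_zero.1 (eq_zero_of_pairEval _ fun x y => by rw [map_sub, h, sub_self])

/-- The translate of a functional that vanishes on `I ^ n` by an element of `torsionPow A I l`. -/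
lemma comp_mulLeft_mem_killingPow {n l : ℕ} {φ : Module.Dual A R} (hφ : φ ∈ killingPow A I n)
    {q : R} (hq : q ∈ torsionPow A I l) :
    φ ∘ₗ LinearMap.mulLeft A q ∈ killingPow A I (n - l) := fun y hy =>
  eq_zero_of_mem_torsionPow (torsionPow_anti (by omega) (mul_mem_torsionPow hq hy)) hφ

lemma exists_coproduct (h : ∀ n, Module.Finite A (R ⧸ I ^ n)) {n : ℕ} {φ : Module.Dual A R}
    (hφ : φ ∈ killingPow A I (n + 1)) : ∃ t : finiteTypeDual A I ⊗[A] finiteTypeDual A I,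
      (∀ x y, pairEval A I x y t = φ (x * y)) ∧
      t ∈ ⨆ (i : ℕ) (j : ℕ) (_ : i + j = n), LinearMap.range (TensorProduct.map
        ((killingPow A I (i + 1)).comap (finiteTypeDual A I).subtype).subtype
        ((killingPow A I (j + 1)).comap (finiteTypeDual A I).subtype).subtype) := by
  obtain ⟨ι, _, b, q, l, hb, hq, hl, hx⟩ := exists_dual_basis h (n + 1)
  let b' : ι → finiteTypeDual A I := fun j => ⟨b j, _, hb j⟩
  let c' : ι → finiteTypeDual A I := fun j => ⟨φ ∘ₗ LinearMap.mulLeft A (q j), _,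
    comp_mulLeft_mem_killingPow hφ (hq j)⟩
  refine ⟨∑ j, b' j ⊗ₜ c' j, fun x y => ?_, Submodule.sum_mem _ fun j _ => ?_⟩
  · have := eq_zero_of_mem_torsionPow (mul_mem_torsionPow (hx x)
      (show y ∈ I ^ 0 by rw [Submodule.pow_zero, Ideal.one_eq_top]; trivial)) hφ
    rw [sub_mul, map_sub, sub_eq_zero] at this
    rw [this, map_sum, Finset.sum_mul, map_sum]
    exact Finset.sum_congr rfl fun j _ => by simp [b', c']
  · have hj := hl j
    refine Submodule.mem_iSup_of_mem (l j) (Submodule.mem_iSup_of_mem (n - l j)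
      (Submodule.mem_iSup_of_mem (by omega) ?_))
    refine ⟨⟨b' j, hb j⟩ ⊗ₜ ⟨c' j, ?_⟩, rfl⟩
    have := comp_mulLeft_mem_killingPow hφ (hq j)
    rwa [show n + 1 - l j = n - l j + 1 by omega] at this

variable (A I) in
/-- The coproduct of functionals of finite type that is dual to the product. -/
noncomputable def dualComul (h : ∀ n, Module.Finite A (R ⧸ I ^ n)) :
    finiteTypeDual A I →ₗ[A] finiteTypeDual A I ⊗[A] finiteTypeDual A I :=
  let E : finiteTypeDual A I ⊗[A] finiteTypeDual A I →ₗ[A] (R → R → A) :=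
    LinearMap.pi fun x => LinearMap.pi fun y => pairEval A I x y
  have hE : Function.Injective E := fun _ _ h => eq_of_pairEval fun x y =>
    congrFun (congrFun h x) y
  let F : finiteTypeDual A I →ₗ[A] LinearMap.range E := LinearMap.codRestrict _
    (LinearMap.pi fun x => LinearMap.pi fun y => dualEval A I (x * y)) (by
      rintro ⟨φ, n, hφ⟩
      obtain ⟨t, ht, -⟩ := exists_coproduct h (killingPow_mono I n.le_succ hφ)
      exact ⟨t, funext fun x => funext fun y => ht x y⟩)
  (LinearEquiv.ofInjective E hE).symm.toLinearMap ∘ₗ F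

lemma pairEval_dualComul (h : ∀ n, Module.Finite A (R ⧸ I ^ n)) (φ : finiteTypeDual A I)
    (x y : R) : pairEval A I x y (dualComul A I h φ) = φ.1 (x * y) := by
  have := LinearEquiv.ofInjective_symm_apply (f := (LinearMap.pi fun x => LinearMap.pi fun y =>
    pairEval A I x y : finiteTypeDual A I ⊗[A] finiteTypeDual A I →ₗ[A] (R → R → A)))
    (h := fun _ _ h => eq_of_pairEval fun x y => congrFun (congrFun h x) y)
    (LinearMap.codRestrict _ (LinearMap.pi fun x => LinearMap.pi fun y => dualEval A I (x * y)) (by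
      rintro ⟨φ, n, hφ⟩
      obtain ⟨t, ht, -⟩ := exists_coproduct h (killingPow_mono I n.le_succ hφ)
      exact ⟨t, funext fun x => funext fun y => ht x y⟩) φ)
  exact congrFun (congrFun this x) y

lemma dualComul_mem (h : ∀ n, Module.Finite A (R ⧸ I ^ n)) {n : ℕ} (φ : finiteTypeDual A I)
    (hφ : φ.1 ∈ killingPow A I (n + 1)) : dualComul A I h φ ∈
      ⨆ (i : ℕ) (j : ℕ) (_ : i + j = n), LinearMap.range (TensorProduct.map
        ((killingPow A I (i + 1)).comap (finiteTypeDual A I).subtype).subtype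
        ((killingPow A I (j + 1)).comap (finiteTypeDual A I).subtype).subtype) := by
  obtain ⟨t, ht, hm⟩ := exists_coproduct h hφ
  rwa [eq_of_pairEval (t := dualComul A I h φ) (t' := t) fun x y => by
    rw [pairEval_dualComul, ht]]

variable (A I) in
/-- The coalgebra of functionals of finite type. -/
noncomputable abbrev dualCoalgebra (h : ∀ n, Module.Finite A (R ⧸ I ^ n)) :
    Coalgebra A (finiteTypeDual A I) where
  comul := dualComul A I h
  counit := dualEval A I 1
  coassoc := by
    refine LinearMap.ext fun φ => sub_eq_zero.1 (tensor_eq_zero_of_separating (dualEval A I)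
      (fun p : R × R => pairEval A I p.1 p.2) eq_zero_of_dualEval
      (fun t ht => eq_zero_of_pairEval t fun x y => ht (x, y)) _ fun x ⟨y, z⟩ => ?_)
    rw [map_sub, map_sub, sub_eq_zero]
    refine (lid_map_assoc_rTensor (μ := dualEval A I (x * y)) (dualComul A I h) _ _ _
      (pairEval_dualComul h · x y) _).trans (Eq.trans ?_ (lid_map_lTensor
        (μ := dualEval A I (y * z)) (dualComul A I h) _ (pairEval_dualComul h · y z) _).symm)
    exact (pairEval_dualComul h φ (x * y) z).trans ((congrArg φ.1 (mul_assoc x y z)).trans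
      (pairEval_dualComul h φ x (y * z)).symm)
  rTensor_counit_comp_comul := by
    refine LinearMap.ext fun φ => (TensorProduct.lid A _).injective (Subtype.val_injective
      (LinearMap.ext fun y => ?_))
    have : φ.1 y = φ.1 (1 * y) := by rw [one_mul]
    simp only [LinearMap.comp_apply, TensorProduct.mk_apply, TensorProduct.lid_tmul, one_smul]
    rw [this, ← pairEval_dualComul h]
    generalize dualComul A I h φ = t
    induction t with
    | zero => simp
    | add t t' ht ht' => simp only [map_add, Submodule.coe_add, LinearMap.add_apply, ht, ht']
    | tmul f g => simp
  lTensor_counit_comp_comul := by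
    refine LinearMap.ext fun φ => (TensorProduct.rid A _).injective (Subtype.val_injective
      (LinearMap.ext fun y => ?_))
    have : φ.1 y = φ.1 (y * 1) := by rw [mul_one]
    simp only [LinearMap.comp_apply, LinearMap.flip_apply, TensorProduct.mk_apply,
      TensorProduct.rid_tmul, one_smul]
    rw [this, ← pairEval_dualComul h]
    generalize dualComul A I h φ = t
    induction t with
    | zero => simp
    | add t t' ht ht' => simp only [map_add, Submodule.coe_add, LinearMap.add_apply, ht, ht']
    | tmul f g => simp [mul_comm]

end Coproduct

section Completion

variable {A : Type v} [CommRing A] [IsDomain A] [IsPrincipalIdealRing A]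

lemma isArtinianRing_quotient_span {a : A} (ha : a ≠ 0) : IsArtinianRing (A ⧸ Ideal.span {a}) := by
  have : Ring.KrullDimLE 0 (A ⧸ Ideal.span {a}) := by
    refine Ring.KrullDimLE.mk₀ fun P hP => ?_
    have hs := Ideal.Quotient.mk_surjective (I := Ideal.span {a})
    have h1 : (P.comap (Ideal.Quotient.mk (Ideal.span {a}))).IsPrime := Ideal.comap_isPrime _ _
    have h2 : P.comap (Ideal.Quotient.mk (Ideal.span {a})) ≠ ⊥ := fun h => ha (by
      have : a ∈ P.comap (Ideal.Quotient.mk (Ideal.span {a})) := by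
        rw [Ideal.mem_comap, Ideal.Quotient.eq_zero_iff_mem.2 (Ideal.mem_span_singleton_self a)]
        exact zero_mem _
      rw [h] at this
      exact this)
    have h3 := h1.isMaximal h2
    have := Ideal.map_eq_top_or_isMaximal_of_surjective _ hs h3
    rw [Ideal.map_comap_of_surjective _ hs] at this
    exact this.resolve_left hP.ne_top
  exact IsNoetherianRing.isArtinianRing_of_krullDimLE_zero

lemma isArtinian_of_smul_eq_zero {M : Type*} [AddCommGroup M] [Module A M] [Module.Finite A M]
    {a : A} (ha : a ≠ 0) (h : ∀ m : M, a • m = 0) : IsArtinian A M := by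
  have := isArtinianRing_quotient_span ha
  have : IsArtinian A (A ⧸ Ideal.span {a}) :=
    isArtinian_of_surjective_algebraMap (R := A ⧸ Ideal.span {a}) Ideal.Quotient.mk_surjective
  obtain ⟨k, s, hs⟩ := Module.Finite.exists_fin (R := A) (M := M)
  let f : (Fin k → A ⧸ Ideal.span {a}) →ₗ[A] M := LinearMap.lsum A _ A fun i =>
    (Ideal.span {a}).liftQ (LinearMap.toSpanSingleton A M (s i)) (by
      rw [Ideal.span, Submodule.span_singleton_le_iff_mem]
      exact h (s i))
  refine isArtinian_of_surjective _ f ?_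
  rw [← LinearMap.range_eq_top, eq_top_iff, ← hs, Submodule.span_le]
  rintro _ ⟨i, rfl⟩
  refine ⟨Pi.single i (Ideal.Quotient.mk _ 1), ?_⟩
  simp only [f, LinearMap.lsum_piSingle]
  exact one_smul A (s i)

variable {R : Type w} [Ring R] [Algebra A R] {I : Ideal R} [I.IsTwoSided]

lemma exists_torsionPow_le (h : ∀ n, Module.Finite A (R ⧸ I ^ n)) (n : ℕ) :
    ∃ m, n ≤ m ∧ ∀ k, ∀ x ∈ torsionPow A I m, ∃ y ∈ torsionPow A I k, x - y ∈ I ^ n := by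
  have := h n
  let p : R →ₗ[A] (R ⧸ I ^ n) := (Submodule.mkQ (I ^ n)).restrictScalars A
  let W := (torsionPow A I n).map p
  obtain ⟨a, ha, hW⟩ : ∃ a : A, a ≠ 0 ∧ ∀ w : W, a • w = 0 := by
    obtain ⟨k, s, hs⟩ := Module.Finite.exists_fin (R := A) (M := W)
    have : ∀ i, ∃ a : A, a ≠ 0 ∧ a • s i = 0 := by
      intro i
      obtain ⟨x, ⟨a, ha, hx⟩, hxs⟩ := (s i).2
      refine ⟨a, ha, Subtype.val_injective ?_⟩
      rw [Submodule.coe_smul, ← hxs, ← map_smul]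
      exact (Submodule.Quotient.mk_eq_zero _).2 hx
    choose a ha hs' using this
    refine ⟨∏ i, a i, Finset.prod_ne_zero_iff.2 fun i _ => ha i, fun w => ?_⟩
    have hw : w ∈ Submodule.span A (Set.range s) := by rw [hs]; trivial
    induction hw using Submodule.span_induction with
    | zero => simp
    | add x y _ _ hx hy => rw [smul_add, hx, hy, add_zero]
    | smul r x _ hx => rw [smul_comm, hx, smul_zero]
    | mem x hx =>
      obtain ⟨i, rfl⟩ := hx
      rw [← Finset.prod_erase_mul _ _ (Finset.mem_univ i), mul_smul, hs', smul_zero]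
  have := isArtinian_of_smul_eq_zero ha hW
  obtain ⟨m, hm⟩ := IsArtinian.monotone_stabilizes (R := A) (M := W)
    ⟨fun k => OrderDual.toDual (((torsionPow A I k).map p).comap W.subtype),
      fun i j hij => Submodule.comap_mono (Submodule.map_mono (torsionPow_anti hij))⟩
  refine ⟨max m n, le_max_right _ _, fun k x hx => ?_⟩
  by_cases hk : k ≤ max m n
  · exact ⟨x, torsionPow_anti hk hx, by simp⟩
  · have e := (hm (max m n) (le_max_left _ _)).symm.trans (hm k (by omega))
    have : (⟨p x, x, torsionPow_anti (le_max_right _ _) hx, rfl⟩ : W) ∈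
        ((torsionPow A I (max m n)).map p).comap W.subtype := ⟨x, hx, rfl⟩
    have e' : ((torsionPow A I (max m n)).map p).comap W.subtype =
      ((torsionPow A I k).map p).comap W.subtype := e
    rw [e'] at this
    obtain ⟨y, hy, hxy⟩ := this
    exact ⟨y, hy, (Submodule.Quotient.eq _).1 hxy.symm⟩

lemma exists_represent (h : ∀ n, Module.Finite A (R ⧸ I ^ n)) (f : finiteTypeDual A I →ₗ[A] A)
    (n : ℕ) : ∃ x : R, ∀ φ (hφ : φ ∈ killingPow A I n), φ x = f ⟨φ, n, hφ⟩ := by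
  obtain ⟨ι, _, b, q, l, hb, hq, hl, hx⟩ := exists_dual_basis h n
  refine ⟨∑ j, f ⟨b j, _, hb j⟩ • q j, fun φ hφ => ?_⟩
  have : (⟨φ, n, hφ⟩ : finiteTypeDual A I) = ∑ j, φ (q j) • ⟨b j, _, hb j⟩ := by
    refine Subtype.val_injective (LinearMap.ext fun x => ?_)
    have := eq_zero_of_mem_torsionPow (hx x) hφ
    rw [map_sub, sub_eq_zero] at this
    simp [this, mul_comm]
  rw [this]
  simp [mul_comm]

/-- Every functional on the functionals of finite type is given by a compatible sequence, which
can be chosen small if the functional vanishes on many functionals. -/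
theorem exists_sequence (h : ∀ n, Module.Finite A (R ⧸ I ^ n)) (n : ℕ) :
    ∃ m, ∀ f : finiteTypeDual A I →ₗ[A] A, (∀ φ, φ.1 ∈ killingPow A I m → f φ = 0) →
      ∃ x : ℕ → R, (∀ k, x (k + 1) - x k ∈ I ^ k) ∧ x n ∈ I ^ n ∧
        ∀ k φ (hφ : φ ∈ killingPow A I k), φ (x k) = f ⟨φ, k, hφ⟩ := by
  choose m hnm hm using exists_torsionPow_le (A := A) h
  refine ⟨m n, fun f hf => ?_⟩
  have step : ∀ k (x : R), (∀ φ (hφ : φ ∈ killingPow A I (m k)), φ x = f ⟨φ, _, hφ⟩) →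
      ∃ y : R, (∀ φ (hφ : φ ∈ killingPow A I (m (k + 1))), φ y = f ⟨φ, _, hφ⟩) ∧
        y - x ∈ I ^ k := by
    intro k x hx
    obtain ⟨z, hz⟩ := exists_represent h f (max (m k) (m (k + 1)))
    have hzx : z - x ∈ torsionPow A I (m k) := by
      rw [mem_torsionPow_iff (h _)]
      intro φ hφ
      rw [map_sub, hx φ hφ, hz φ (killingPow_mono I (le_max_left _ _) hφ), sub_self]
    obtain ⟨s, hs, hzs⟩ := hm k (m (k + 1)) _ hzx
    refine ⟨z - s, fun φ hφ => ?_, by rwa [sub_right_comm]⟩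
    rw [map_sub, hz φ (killingPow_mono I (le_max_right _ _) hφ), eq_zero_of_mem_torsionPow hs hφ,
      sub_zero]
  choose! y hy hyx using step
  let s : ℕ → R := fun j => Nat.rec 0 (fun j x => y (n + j) x) j
  have hs : ∀ j, ∀ φ (hφ : φ ∈ killingPow A I (m (n + j))), φ (s j) = f ⟨φ, _, hφ⟩ := by
    intro j
    induction j with
    | zero =>
      intro φ hφ
      have : f ⟨φ, _, hφ⟩ = 0 := hf _ hφ
      rw [this]
      exact map_zero φ
    | succ j ih => exact hy (n + j) (s j) ih
  have hs' : ∀ j, s (j + 1) - s j ∈ I ^ (n + j) := fun j => hyx (n + j) (s j) (hs j)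
  refine ⟨s, fun k => Ideal.pow_le_pow_right (by omega) (hs' k), ?_, fun k φ hφ => ?_⟩
  · have : ∀ j, s j ∈ I ^ n := by
      intro j
      induction j with
      | zero => exact zero_mem _
      | succ j ih =>
        have := add_mem (Ideal.pow_le_pow_right (I := I) (Nat.le_add_right n j) (hs' j)) ih
        rwa [sub_add_cancel] at this
    exact this n
  · exact hs k φ (killingPow_mono I ((Nat.le_add_left k n).trans (hnm _)) hφ)

end Completion

end LetterBraiding

namespace LetterBraiding

set_option linter.unusedSectionVars false
set_option maxSynthPendingDepth 3

section GroupAlgebra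

variable (A : Type v) [CommRing A] (G : Type w) [Group G]

/-- The augmentation ideal of a group algebra. -/
noncomputable def groupAugIdeal : Ideal (MonoidAlgebra A G) :=
  RingHom.ker (MonoidAlgebra.lift A A G 1)

instance : (groupAugIdeal A G).IsTwoSided := inferInstanceAs (RingHom.ker _).IsTwoSided

variable {A G}

lemma of_sub_one_mem (g : G) : MonoidAlgebra.of A G g - 1 ∈ groupAugIdeal A G := by
  rw [groupAugIdeal, RingHom.mem_ker, map_sub, MonoidAlgebra.lift_of,
    map_one (MonoidAlgebra.lift A A G 1)]
  simp

lemma mem_span_of_mem_groupAugIdeal {x : MonoidAlgebra A G} (hx : x ∈ groupAugIdeal A G) :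
    x ∈ Submodule.span A (Set.range fun g : G => MonoidAlgebra.of A G g - 1) := by
  have key : ∀ x : MonoidAlgebra A G, x - algebraMap A _ (MonoidAlgebra.lift A A G 1 x) ∈
      Submodule.span A (Set.range fun g : G => MonoidAlgebra.of A G g - 1) := by
    intro x
    induction x using MonoidAlgebra.induction_on with
    | of g =>
      rw [MonoidAlgebra.lift_of]
      rw [MonoidHom.one_apply, map_one (algebraMap A (MonoidAlgebra A G))]
      exact Submodule.subset_span (Set.mem_range_self g)
    | add x y hx hy => rw [map_add, map_add, add_sub_add_comm]; exact add_mem hx hy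
    | smul r x hx =>
      rw [map_smul, smul_eq_mul, map_mul, ← Algebra.smul_def, ← smul_sub]
      exact Submodule.smul_mem _ r hx
  have := key x
  rwa [show MonoidAlgebra.lift A A G 1 x = 0 from hx, map_zero, sub_zero] at this

lemma exists_finite_mod_sq (hG : Group.FG G) : ∃ L : Submodule A (MonoidAlgebra A G), L.FG ∧
    (∀ y ∈ L, y ∈ groupAugIdeal A G) ∧
    ∀ x ∈ groupAugIdeal A G, ∃ y ∈ L, x - y ∈ groupAugIdeal A G ^ 2 := by
  obtain ⟨S, hS⟩ := (Monoid.fg_def.1 (Group.fg_iff_monoid_fg.1 hG))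
  refine ⟨Submodule.span A ((fun g : G => MonoidAlgebra.of A G g - 1) '' (S : Set G)),
    Submodule.fg_span (S.finite_toSet.image _), fun y hy => ?_, fun x hx => ?_⟩
  · have : Submodule.span A ((fun g : G => MonoidAlgebra.of A G g - 1) '' (S : Set G)) ≤
        (groupAugIdeal A G).restrictScalars A := by
      rw [Submodule.span_le]
      rintro _ ⟨g, -, rfl⟩
      exact of_sub_one_mem g
    exact this hy
  · set L := Submodule.span A ((fun g : G => MonoidAlgebra.of A G g - 1) '' (S : Set G)) with hL
    have h2 : groupAugIdeal A G ^ 2 = groupAugIdeal A G * groupAugIdeal A G := by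
      rw [Ideal.IsTwoSided.pow_succ, Submodule.pow_one]
    have hg : ∀ g : G, ∃ y ∈ L, MonoidAlgebra.of A G g - 1 - y ∈ groupAugIdeal A G ^ 2 := by
      intro g
      have : g ∈ Submonoid.closure (S : Set G) := by rw [hS]; trivial
      induction this using Submonoid.closure_induction with
      | mem g hg => exact ⟨_, Submodule.subset_span ⟨g, hg, rfl⟩, by rw [sub_self]; exact zero_mem _⟩
      | one => exact ⟨0, zero_mem _, by
        rw [map_one (MonoidAlgebra.of A G), sub_self, sub_zero]; exact zero_mem _⟩
      | mul g g' _ _ h h' =>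
        obtain ⟨y, hy, h⟩ := h
        obtain ⟨y', hy', h'⟩ := h'
        refine ⟨y + y', add_mem hy hy', ?_⟩
        have : MonoidAlgebra.of A G (g * g') - 1 - (y + y') =
            (MonoidAlgebra.of A G g - 1) * (MonoidAlgebra.of A G g' - 1) +
            (MonoidAlgebra.of A G g - 1 - y) + (MonoidAlgebra.of A G g' - 1 - y') := by
          rw [map_mul]; noncomm_ring
        rw [this]
        refine add_mem (add_mem ?_ h) h'
        rw [h2]
        exact Ideal.mul_mem_mul (of_sub_one_mem g) (of_sub_one_mem g')
    have hx' := mem_span_of_mem_groupAugIdeal hx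
    clear hx
    induction hx' using Submodule.span_induction with
    | mem x hx => obtain ⟨g, rfl⟩ := hx; exact hg g
    | zero => exact ⟨0, zero_mem _, by simp⟩
    | add x x' _ _ h h' =>
      obtain ⟨y, hy, h⟩ := h
      obtain ⟨y', hy', h'⟩ := h'
      exact ⟨y + y', add_mem hy hy', by rw [add_sub_add_comm]; exact add_mem h h'⟩
    | smul r x _ h =>
      obtain ⟨y, hy, h⟩ := h
      exact ⟨r • y, Submodule.smul_mem _ r hy, by
        rw [← smul_sub]; exact Submodule.smul_of_tower_mem _ r h⟩

lemma exists_finite_mod_pow (hG : Group.FG G) (n : ℕ) : ∃ L : Submodule A (MonoidAlgebra A G),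
    L.FG ∧ (∀ y ∈ L, y ∈ groupAugIdeal A G ^ n) ∧
    ∀ x ∈ groupAugIdeal A G ^ n, ∃ y ∈ L, x - y ∈ groupAugIdeal A G ^ (n + 1) := by
  induction n with
  | zero =>
    have h0 : groupAugIdeal A G ^ 0 = ⊤ := by rw [Submodule.pow_zero, Ideal.one_eq_top]
    refine ⟨A ∙ 1, Submodule.fg_span_singleton _, fun y _ => by rw [h0]; trivial, fun x _ => ?_⟩
    refine ⟨MonoidAlgebra.lift A A G 1 x • 1, Submodule.smul_mem _ _
      (Submodule.mem_span_singleton_self 1), ?_⟩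
    rw [zero_add, Submodule.pow_one, groupAugIdeal, RingHom.mem_ker, map_sub, map_smul,
      map_one (MonoidAlgebra.lift A A G 1)]
    simp
  | succ n ih =>
    obtain ⟨L, hL, hLI, h⟩ := ih
    obtain ⟨L₁, hL₁, hLI₁, h₁⟩ := exists_finite_mod_sq (A := A) hG
    have e : groupAugIdeal A G ^ (n + 1) = groupAugIdeal A G * groupAugIdeal A G ^ n :=
      Ideal.IsTwoSided.pow_succ _
    refine ⟨L₁ * L, hL₁.mul hL, fun y hy => ?_, fun x hx => ?_⟩
    · rw [e]
      exact Submodule.mul_induction_on hy (fun a ha b hb => Ideal.mul_mem_mul (hLI₁ a ha) (hLI b hb))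
        fun _ _ => add_mem
    · rw [e] at hx
      refine Submodule.smul_induction_on hx (fun a ha b hb => ?_) fun x x' hx hx' => ?_
      · obtain ⟨y, hy, h⟩ := h b hb
        obtain ⟨y₁, hy₁, h₁⟩ := h₁ a ha
        refine ⟨y₁ * y, Submodule.mul_mem_mul hy₁ hy, ?_⟩
        have : a • b - y₁ * y = (a - y₁) * b + y₁ * (b - y) := by
          rw [smul_eq_mul]; noncomm_ring
        rw [this]
        refine add_mem ?_ ?_
        · have := mul_mem_pow h₁ hb
          rwa [show 2 + n = n + 1 + 1 by ring] at this
        · have := mul_mem_pow (m := 1) (by rw [Submodule.pow_one]; exact hLI₁ _ hy₁) h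
          rwa [show 1 + (n + 1) = n + 1 + 1 by ring] at this
      · obtain ⟨y, hy, h⟩ := hx
        obtain ⟨y', hy', h'⟩ := hx'
        exact ⟨y + y', add_mem hy hy', by rw [add_sub_add_comm]; exact add_mem h h'⟩

lemma finite_quotient_pow (hG : Group.FG G) (n : ℕ) :
    Module.Finite A (MonoidAlgebra A G ⧸ groupAugIdeal A G ^ n) := by
  have key : ∀ n, ∃ L : Submodule A (MonoidAlgebra A G), L.FG ∧
      ∀ x, ∃ y ∈ L, x - y ∈ groupAugIdeal A G ^ n := by
    intro n
    induction n with
    | zero => exact ⟨⊥, Submodule.fg_bot, fun x => ⟨0, zero_mem _, by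
        rw [Submodule.pow_zero, Ideal.one_eq_top]; trivial⟩⟩
    | succ n ih =>
      obtain ⟨L, hL, h⟩ := ih
      obtain ⟨L', hL', -, h'⟩ := exists_finite_mod_pow (A := A) hG n
      refine ⟨L ⊔ L', hL.sup hL', fun x => ?_⟩
      obtain ⟨y, hy, hxy⟩ := h x
      obtain ⟨y', hy', hxy'⟩ := h' _ hxy
      exact ⟨y + y', add_mem (Submodule.mem_sup_left hy) (Submodule.mem_sup_right hy'), by
        rwa [← sub_sub]⟩
  obtain ⟨L, hL, h⟩ := key n
  let p : MonoidAlgebra A G →ₗ[A] (MonoidAlgebra A G ⧸ groupAugIdeal A G ^ n) :=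
    (Submodule.mkQ _).restrictScalars A
  refine ⟨?_⟩
  have : L.map p = ⊤ := by
    rw [eq_top_iff]
    rintro z -
    obtain ⟨x, rfl⟩ := Submodule.mkQ_surjective _ z
    obtain ⟨y, hy, hxy⟩ := h x
    exact ⟨y, hy, ((Submodule.Quotient.eq _).2 hxy).symm⟩
  rw [← this]
  exact hL.map p

end GroupAlgebra

section Unipotent

variable {A : Type v} [CommRing A] {M : Type w} [AddCommGroup M] [Module A M]

/-- The automorphism `1 + N` for a locally nilpotent endomorphism `N`. -/
noncomputable def unipotent (N : M →ₗ[A] M) (h : ∀ m, ∃ n : ℕ, (N ^ n) m = 0) : M ≃ₗ[A] M :=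
  LinearEquiv.ofBijective (LinearMap.id + N) (by
    constructor
    · rw [← LinearMap.ker_eq_bot, LinearMap.ker_eq_bot']
      intro m hm
      have hm : N m = - m := eq_neg_of_add_eq_zero_right hm
      have key : ∀ n : ℕ, (N ^ n) m = (-1 : A) ^ n • m := by
        intro n
        induction n with
        | zero => simp
        | succ n ih =>
          rw [pow_succ', Module.End.mul_apply, ih, map_smul, hm, pow_succ, mul_smul, neg_one_smul]
      obtain ⟨n, hn⟩ := h m
      rw [key] at hn
      have : ((-1 : A) ^ n * (-1) ^ n) • m = 0 := by rw [mul_smul, hn, smul_zero]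
      rwa [← mul_pow, neg_one_mul, neg_neg, one_pow, one_smul] at this
    · intro m
      obtain ⟨n, hn⟩ := h m
      induction n generalizing m with
      | zero => exact ⟨0, by rw [map_zero]; exact hn.symm⟩
      | succ n ih =>
        obtain ⟨y, hy⟩ := ih (N m) (by rwa [pow_succ, Module.End.mul_apply] at hn)
        refine ⟨m - y, ?_⟩
        rw [map_sub, hy]
        simp)

end Unipotent

open Simplicial

/-- The relations of the edge path group of a simplicial set with a spanning tree. -/
def RootedTree.rels {X : SSet.{u}} {x : X _⦋0⦌} (T : RootedTree X x) :
    Set (FreeGroup (X _⦋1⦌)) :=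
  {r | (∃ s : X _⦋2⦌, r = FreeGroup.of (X.δ 2 s) * FreeGroup.of (X.δ 0 s) *
    (FreeGroup.of (X.δ 1 s))⁻¹) ∨ ∃ v, v ≠ x ∧ r = FreeGroup.of (T.edge v)}

/-- The structure that exhibits a group as the edge path group of a simplicial set. -/
structure EdgePathGroup (X : SSet.{u}) (x : X _⦋0⦌) (G : Type w) [Group G] where
  tree : RootedTree X x
  g : X _⦋1⦌ → G
  g_tri : ∀ s, g (X.δ 1 s) = g (X.δ 2 s) * g (X.δ 0 s)
  g_tree : ∀ v, v ≠ x → g (tree.edge v) = 1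
  closure_range : Subgroup.closure (Set.range g) = ⊤
  ρ : G →* PresentedGroup tree.rels
  ρ_g : ∀ e, ρ (g e) = PresentedGroup.of e

namespace EdgePathGroup

variable {X : SSet.{u}} {x : X _⦋0⦌} {G : Type w} [Group G] (E : EdgePathGroup X x G)

lemma exists_lift {Γ : Type*} [Group Γ] (c : X _⦋1⦌ → Γ)
    (h_tri : ∀ s, c (X.δ 1 s) = c (X.δ 2 s) * c (X.δ 0 s))
    (h_tree : ∀ v, v ≠ x → c (E.tree.edge v) = 1) : ∃ f : G →* Γ, ∀ e, f (E.g e) = c e := by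
  have h : ∀ r ∈ E.tree.rels, FreeGroup.lift c r = 1 := by
    rintro r (⟨s, rfl⟩ | ⟨v, hv, rfl⟩)
    · simp [h_tri]
    · simp [h_tree v hv]
  exact ⟨(PresentedGroup.toGroup h).comp E.ρ, fun e => by
    rw [MonoidHom.comp_apply, E.ρ_g, PresentedGroup.toGroup.of]⟩

lemma g_degenerate (v : X _⦋0⦌) : E.g (X.σ 0 v) = 1 := by
  have := E.g_tri (X.σ 0 (X.σ 0 v))
  rw [Cochains2.δ1_σ0', Cochains2.δ2_σ0', Cochains2.δ0_σ0', Cochains2.δ1_σ0] at this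
  exact left_eq_mul.1 this

@[elab_as_elim]
lemma induction {p : G → Prop} (y : G) (one : p 1) (mul : ∀ g h, p g → p h → p (g * h))
    (inv : ∀ g, p g → p g⁻¹) (edge : ∀ e, p (E.g e)) : p y := by
  have : y ∈ Subgroup.closure (Set.range E.g) := by rw [E.closure_range]; trivial
  induction this using Subgroup.closure_induction with
  | mem g hg => obtain ⟨e, rfl⟩ := hg; exact edge e
  | one => exact one
  | mul g h _ _ hg hh => exact mul g h hg hh
  | inv g _ hg => exact inv g hg

end EdgePathGroup

section Representation

variable {A : Type v} [CommRing A] {X : SSet.{u}} {x : X _⦋0⦌}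

lemma edgeOp_mem {M : Submodule A (cochains2 A X x).augIdeal} (e : X _⦋1⦌) {n : ℕ}
    {u : (cochains2 A X x).Bar} (hu : u ∈ (cochains2 A X x).barSpan M n) :
    edgeOp e u ∈ (cochains2 A X x).barSpan M (n - 1) := by
  cases n with
  | zero => rw [edgeOp, AugDGA.contr_of_mem_barSpan_zero _ hu]; exact zero_mem _
  | succ n => exact AugDGA.contr_mem_barSpan _ hu

lemma edgeOp_pow_eq_zero {e : X _⦋1⦌} {n : ℕ}
    {u : (cochains2 A X x).Bar} (hu : u ∈ (cochains2 A X x).barSpan ⊤ n) :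
    ((edgeOp e) ^ (n + 1)) u = 0 := by
  induction n generalizing u with
  | zero => rw [zero_add, pow_one, edgeOp, AugDGA.contr_of_mem_barSpan_zero _ hu]
  | succ n ih =>
    rw [pow_succ, Module.End.mul_apply]
    exact ih (edgeOp_mem e hu)

/-- The operator `1 + ι_e`. -/
noncomputable def edgeAut (e : X _⦋1⦌) : (cochains2 A X x).Bar ≃ₗ[A] (cochains2 A X x).Bar :=
  unipotent (edgeOp e) fun u =>
    let ⟨n, hn⟩ := AugDGA.exists_mem_barSpan u
    ⟨n + 1, edgeOp_pow_eq_zero hn⟩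

@[simp] lemma edgeAut_apply (e : X _⦋1⦌) (u : (cochains2 A X x).Bar) :
    edgeAut e u = u + edgeOp e u := rfl

variable (A) in
/-- The cocycles with letters of degree `1` that vanish on the edges of the tree. -/
noncomputable def RootedTree.normalCocycles (T : RootedTree X x) :
    Submodule A (cochains2 A X x).Bar :=
  (⨆ n, (cochains2 A X x).barSpan (T.contraction A).letters n) ⊓
    LinearMap.ker (cochains2 A X x).barDiff

namespace RootedTree

variable {T : RootedTree X x}

lemma mem_normalCocycles {u : (cochains2 A X x).Bar} : u ∈ T.normalCocycles A ↔
    (∃ n, u ∈ (cochains2 A X x).barSpan (T.contraction A).letters n) ∧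
      (cochains2 A X x).barDiff u = 0 :=
  and_congr (Submodule.mem_iSup_of_directed _ (AugDGA.barSpan_mono _).directed_le) Iff.rfl

lemma letters_le_degreeOne : (T.contraction A).letters ≤ degreeOne A X x := inf_le_left

lemma letters_separated : ∀ a ∈ (T.contraction A).letters, (∀ e, evalEdge e a = 0) → a = 0 := by
  intro a ha h
  have := mem_degreeOne.1 (letters_le_degreeOne ha)
  exact augIdeal_ext (by simp [this]) (by simp [h]) (by simp [this])

lemma edgeOp_tree {v : X _⦋0⦌} (hv : v ≠ x) {n : ℕ} {u : (cochains2 A X x).Bar}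
    (hu : u ∈ (cochains2 A X x).barSpan (T.contraction A).letters n) :
    edgeOp (T.edge v) u = 0 := by
  have := AugDGA.barSpan_le_of (C := cochains2 A X x) (M := (T.contraction A).letters)
    (S := fun _ => LinearMap.ker (edgeOp (T.edge v))) (fun _ => by simp)
    (fun a ha n u _ => by simp [(mem_letters.1 ha).2 v hv]) n
  exact this hu

lemma barDiff_edgeOp {n : ℕ} {u : (cochains2 A X x).Bar}
    (hu : u ∈ (cochains2 A X x).barSpan (reduced A X x) n) (e : X _⦋1⦌) :
    (cochains2 A X x).barDiff (edgeOp e u) = edgeOp e ((cochains2 A X x).barDiff u) := by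
  rw [edgeOp_barDiff, vertexOp_of_mem hu, vertexOp_of_mem hu, vertexOp_of_mem (edgeOp_mem e hu)]
  simp

lemma edgeOp_mem_normalCocycles (e : X _⦋1⦌) {u : (cochains2 A X x).Bar}
    (hu : u ∈ T.normalCocycles A) : edgeOp e u ∈ T.normalCocycles A := by
  rw [mem_normalCocycles] at hu ⊢
  obtain ⟨⟨n, hn⟩, hd⟩ := hu
  refine ⟨⟨_, edgeOp_mem e hn⟩, ?_⟩
  rw [barDiff_edgeOp (AugDGA.barSpan_mono_left (letters_le_degreeOne.trans degreeOne_le_reduced) _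
    hn), hd, map_zero]

variable (A T) in
/-- The operator `1 + ι_e` on normal cocycles. -/
noncomputable def normalAut (e : X _⦋1⦌) : T.normalCocycles A ≃ₗ[A] T.normalCocycles A :=
  unipotent ((edgeOp e).restrict fun _ => edgeOp_mem_normalCocycles e) fun u => by
    obtain ⟨n, hn⟩ := AugDGA.exists_mem_barSpan u.1
    refine ⟨n + 1, Subtype.val_injective ?_⟩
    rw [Module.End.pow_restrict]
    exact edgeOp_pow_eq_zero hn

@[simp] lemma normalAut_apply (e : X _⦋1⦌) (u : T.normalCocycles A) :
    (normalAut A T e u).1 = u.1 + edgeOp e u.1 := rfl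

end RootedTree

namespace EdgePathGroup

variable {G : Type w} [Group G] (E : EdgePathGroup X x G)

lemma exists_rep (A : Type v) [CommRing A] :
    ∃ f : G →* (E.tree.normalCocycles A ≃ₗ[A] E.tree.normalCocycles A)ᵐᵒᵖ,
      ∀ e, f (E.g e) = MulOpposite.op (E.tree.normalAut A e) := by
  refine E.exists_lift _ (fun s => ?_) fun v hv => ?_
  · rw [← MulOpposite.op_mul]
    congr 1
    refine LinearEquiv.ext fun z => Subtype.val_injective ?_
    obtain ⟨⟨n, hn⟩, hd⟩ := RootedTree.mem_normalCocycles.1 z.2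
    have := triOp_barDiff (AugDGA.barSpan_mono_left RootedTree.letters_le_degreeOne _ hn) s
    rw [hd, map_zero] at this
    rw [LinearEquiv.mul_apply]
    simp only [RootedTree.normalAut_apply, map_add]
    rw [← sub_eq_zero, this]
    abel
  · rw [← MulOpposite.op_one]
    congr 1
    refine LinearEquiv.ext fun z => Subtype.val_injective ?_
    obtain ⟨⟨n, hn⟩, hd⟩ := RootedTree.mem_normalCocycles.1 z.2
    rw [RootedTree.normalAut_apply, RootedTree.edgeOp_tree hv hn, add_zero]
    rfl

variable (A) in
/-- The action of the group on the normal cocycles. -/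
noncomputable def rep : G →* (E.tree.normalCocycles A ≃ₗ[A] E.tree.normalCocycles A)ᵐᵒᵖ :=
  (E.exists_rep A).choose

lemma rep_g (e : X _⦋1⦌) : E.rep A (E.g e) = MulOpposite.op (E.tree.normalAut A e) :=
  (E.exists_rep A).choose_spec e

variable (A) in
/-- The right action of the group algebra on the normal cocycles. -/
noncomputable def act : MonoidAlgebra A G →ₐ[A] (Module.End A (E.tree.normalCocycles A))ᵐᵒᵖ :=
  MonoidAlgebra.lift A _ G
    ((MonoidHom.op LinearEquiv.automorphismGroup.toLinearMapMonoidHom).comp (E.rep A))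

lemma act_of (g : G) (z : E.tree.normalCocycles A) :
    (E.act A (MonoidAlgebra.of A G g)).unop z = (E.rep A g).unop z := by
  rw [act, MonoidAlgebra.lift_of]
  rfl

lemma act_mul (y y' : MonoidAlgebra A G) (z : E.tree.normalCocycles A) :
    (E.act A (y * y')).unop z = (E.act A y').unop ((E.act A y).unop z) := by
  rw [map_mul, MulOpposite.unop_mul]
  rfl

lemma act_edge (e : X _⦋1⦌) (z : E.tree.normalCocycles A) :
    ((E.act A (MonoidAlgebra.of A G (E.g e))).unop z).1 = z.1 + edgeOp e z.1 := by
  rw [act_of, rep_g]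
  rfl

variable (A) in
/-- The pairing of the normal cocycles with the group algebra. -/
noncomputable def normalPairing :
    E.tree.normalCocycles A →ₗ[A] Module.Dual A (MonoidAlgebra A G) :=
  LinearMap.mk₂ A (fun z y => (cochains2 A X x).barCounit ((E.act A y).unop z))
    (fun z z' y => by simp) (fun r z y => by simp) (fun z y y' => by simp)
    (fun r z y => by simp)

lemma normalPairing_apply (z : E.tree.normalCocycles A) (y : MonoidAlgebra A G) :
    E.normalPairing A z y = (cochains2 A X x).barCounit ((E.act A y).unop z) := rfl

lemma normalPairing_act (z : E.tree.normalCocycles A) (y y' : MonoidAlgebra A G) :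
    E.normalPairing A ((E.act A y).unop z) y' = E.normalPairing A z (y * y') := by
  rw [normalPairing_apply, normalPairing_apply, act_mul]

lemma normalPairing_one (z : E.tree.normalCocycles A) :
    E.normalPairing A z 1 = (cochains2 A X x).barCounit z := by
  rw [normalPairing_apply, map_one]
  rfl

theorem normalPairing_injective [IsDomain A] [IsPrincipalIdealRing A] :
    Function.Injective (E.normalPairing A) := by
  rw [← LinearMap.ker_eq_bot, LinearMap.ker_eq_bot']
  intro z hz
  obtain ⟨⟨n, hn⟩, hd⟩ := RootedTree.mem_normalCocycles.1 z.2
  refine Subtype.val_injective (AugDGA.eq_zero_of_contrWord evalEdge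
    RootedTree.letters_separated hn fun l => ?_)
  clear hn hd
  induction l generalizing z with
  | nil => exact (E.normalPairing_one z).symm.trans (by rw [hz]; rfl)
  | cons e l ih =>
    have := ih ((E.act A (MonoidAlgebra.of A G (E.g e) - 1)).unop z) (LinearMap.ext fun y => by
      rw [normalPairing_act, hz]; rfl)
    rw [map_sub, map_one, MulOpposite.unop_sub, LinearMap.sub_apply, MulOpposite.unop_one,
      Module.End.one_apply, Submodule.coe_sub, act_edge, add_sub_cancel_left] at this
    exact this

/-- The normal cocycles of weight at most `n`. -/
noncomputable def normalWeight (A : Type v) [CommRing A] (E : EdgePathGroup X x G) (n : ℕ) :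
    Submodule A (E.tree.normalCocycles A) :=
  ((cochains2 A X x).barSpan ⊤ n).comap (E.tree.normalCocycles A).subtype

lemma normalWeight_mono : Monotone (E.normalWeight A) :=
  fun _ _ h => Submodule.comap_mono (AugDGA.barSpan_mono _ h)

lemma rep_sub_mem (g : G) (n : ℕ) (z : E.tree.normalCocycles A) (hz : z ∈ E.normalWeight A n) :
    (n = 0 → (E.rep A g).unop z = z) ∧
      (E.rep A g).unop z - z ∈ E.normalWeight A (n - 1) := by
  induction g using E.induction generalizing n z with
  | one => simp
  | mul g h hg hh =>
    have h1 := hg n z hz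
    have hm : (E.rep A g).unop z ∈ E.normalWeight A n := by
      have := add_mem (normalWeight_mono E (Nat.sub_le n 1) h1.2) hz
      rwa [sub_add_cancel] at this
    have h2 := hh n _ hm
    have e : (E.rep A (g * h)).unop z = (E.rep A h).unop ((E.rep A g).unop z) := by
      rw [map_mul, MulOpposite.unop_mul, LinearEquiv.mul_apply]
    rw [e]
    refine ⟨fun h0 => by rw [h2.1 h0, h1.1 h0], ?_⟩
    have := add_mem h2.2 h1.2
    rwa [sub_add_sub_cancel] at this
  | inv g hg =>
    have e : ∀ y, (E.rep A g⁻¹).unop ((E.rep A g).unop y) = y := by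
      intro y
      rw [map_inv, MulOpposite.unop_inv, ← LinearEquiv.mul_apply, inv_mul_cancel]
      rfl
    have e' : ∀ z, (E.rep A g⁻¹).unop z - z =
        - (E.rep A g⁻¹).unop ((E.rep A g).unop z - z) := fun z => by
      rw [map_sub, e]; abel
    have h0 : ∀ z ∈ E.normalWeight A 0, (E.rep A g⁻¹).unop z = z := fun z hz => by
      rw [← sub_eq_zero, e', (hg 0 z hz).1 rfl, sub_self, map_zero, neg_zero]
    refine ⟨fun h => h0 z (h ▸ hz), ?_⟩
    induction n generalizing z with
    | zero => rw [h0 z hz, sub_self]; exact zero_mem _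
    | succ n ih =>
      rw [e']
      have h1 := (hg (n + 1) z hz).2
      rw [Nat.add_sub_cancel] at h1 ⊢
      have h2 := ih _ h1
      refine neg_mem ?_
      have := add_mem (normalWeight_mono E (Nat.sub_le n 1) h2) h1
      rwa [sub_add_cancel] at this
  | edge e =>
    rw [rep_g]
    refine ⟨fun h0 => ?_, ?_⟩
    · subst h0
      refine Subtype.val_injective ?_
      rw [MulOpposite.unop_op, RootedTree.normalAut_apply, edgeOp,
        AugDGA.contr_of_mem_barSpan_zero _ (show z.1 ∈ (cochains2 A X x).barSpan ⊤ 0 from hz),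
        add_zero]
    · have := edgeOp_mem e hz
      rw [MulOpposite.unop_op]
      change ((E.tree.normalAut A e z).1 - z.1) ∈ (cochains2 A X x).barSpan ⊤ (n - 1)
      rw [RootedTree.normalAut_apply, add_sub_cancel_left]
      exact this

lemma act_mem {y : MonoidAlgebra A G} (hy : y ∈ groupAugIdeal A G) {n : ℕ}
    {z : E.tree.normalCocycles A} (hz : z ∈ E.normalWeight A n) :
    (n = 0 → (E.act A y).unop z = 0) ∧ (E.act A y).unop z ∈ E.normalWeight A (n - 1) := by
  have hy' := mem_span_of_mem_groupAugIdeal hy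
  clear hy
  induction hy' using Submodule.span_induction with
  | mem y hy =>
    obtain ⟨g, rfl⟩ := hy
    have h := E.rep_sub_mem g n z hz
    rw [map_sub, map_one, MulOpposite.unop_sub, LinearMap.sub_apply, MulOpposite.unop_one,
      Module.End.one_apply, act_of]
    exact ⟨fun h0 => by rw [h.1 h0, sub_self], h.2⟩
  | zero => simp
  | add y y' _ _ h h' =>
    rw [map_add, MulOpposite.unop_add, LinearMap.add_apply]
    exact ⟨fun h0 => by rw [h.1 h0, h'.1 h0, add_zero], add_mem h.2 h'.2⟩
  | smul r y _ h =>
    rw [map_smul, MulOpposite.unop_smul, LinearMap.smul_apply]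
    exact ⟨fun h0 => by rw [h.1 h0, smul_zero], Submodule.smul_mem _ r h.2⟩

/-- The cocycles of weight at most `n` pair to zero with `I ^ (n + 1)`. -/
theorem normalPairing_mem {n : ℕ} {z : E.tree.normalCocycles A} (hz : z ∈ E.normalWeight A n) :
    E.normalPairing A z ∈ killingPow A (groupAugIdeal A G) (n + 1) := by
  intro y hy
  rw [Ideal.IsTwoSided.pow_succ] at hy
  induction n generalizing z y with
  | zero =>
    refine Submodule.smul_induction_on hy (fun a ha b _ => ?_) fun y y' h h' => ?_
    · rw [smul_eq_mul, ← normalPairing_act, (E.act_mem ha hz).1 rfl, map_zero]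
      rfl
    · rw [map_add, h, h', add_zero]
  | succ n ih =>
    refine Submodule.smul_induction_on hy (fun a ha b hb => ?_) fun y y' h h' => ?_
    · rw [smul_eq_mul, ← normalPairing_act]
      rw [Ideal.IsTwoSided.pow_succ] at hb
      exact ih (E.act_mem ha hz).2 b hb
    · rw [map_add, h, h', add_zero]

end EdgePathGroup

end Representation

end LetterBraiding

namespace LetterBraiding

set_option linter.unusedSectionVars false
set_option maxSynthPendingDepth 3

section Twisting

variable {A : Type v} [CommRing A] {R : Type w'} [Ring R] [Algebra A R]
variable {P Q Q' : Type*} [AddCommGroup P] [Module A P] [AddCommGroup Q] [Module A Q]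
  [AddCommGroup Q'] [Module A Q']

/-- The extension of a bilinear map to the tensor products with an algebra. -/
noncomputable def tensorMul (R : Type w') [Ring R] [Algebra A R] (β : P →ₗ[A] Q →ₗ[A] Q') :
    P ⊗[A] R →ₗ[A] Q ⊗[A] R →ₗ[A] Q' ⊗[A] R :=
  TensorProduct.map₂ β (LinearMap.mul A R)

@[simp] lemma tensorMul_tmul (β : P →ₗ[A] Q →ₗ[A] Q') (a : P) (r : R) (u : Q) (s : R) :
    tensorMul R β (a ⊗ₜ r) (u ⊗ₜ s) = β a u ⊗ₜ (r * s) := rfl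

/-- The span of the pure tensors with entries in given sets. -/
def tensorSpan (M : Set Q) (J : Set R) : Submodule A (Q ⊗[A] R) :=
  Submodule.span A {z | ∃ u ∈ M, ∃ r ∈ J, z = u ⊗ₜ r}

lemma tmul_mem_tensorSpan {M : Set Q} {J : Set R} {u : Q} {r : R} (hu : u ∈ M) (hr : r ∈ J) :
    u ⊗ₜ[A] r ∈ tensorSpan M J := Submodule.subset_span ⟨u, hu, r, hr, rfl⟩

lemma tensorMul_mem {β : P →ₗ[A] Q →ₗ[A] Q'} {M : Set P} {M' : Set Q} {M'' : Set Q'}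
    {J J' J'' : Set R} (hM : ∀ a ∈ M, ∀ u ∈ M', β a u ∈ M'')
    (hJ : ∀ r ∈ J, ∀ s ∈ J', r * s ∈ J'') {ω : P ⊗[A] R} (hω : ω ∈ tensorSpan M J)
    {U : Q ⊗[A] R} (hU : U ∈ tensorSpan M' J') : tensorMul R β ω U ∈ tensorSpan M'' J'' := by
  have h1 : ∀ a ∈ M, ∀ r ∈ J, tensorMul R β (a ⊗ₜ r) U ∈ tensorSpan M'' J'' := by
    intro a ha r hr
    have : tensorSpan M' J' ≤ (tensorSpan M'' J'').comap (tensorMul R β (a ⊗ₜ r)) := by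
      refine Submodule.span_le.2 ?_
      rintro _ ⟨u, hu, s, hs, rfl⟩
      exact tmul_mem_tensorSpan (hM a ha u hu) (hJ r hr s hs)
    exact this hU
  have : tensorSpan M J ≤ (tensorSpan M'' J'').comap ((tensorMul R β).flip U) := by
    refine Submodule.span_le.2 ?_
    rintro _ ⟨a, ha, r, hr, rfl⟩
    exact h1 a ha r hr
  exact this hω

lemma tensorMul_mem_pow_succ {β : P →ₗ[A] Q →ₗ[A] Q'} {𝔍 : Ideal R} [𝔍.IsTwoSided]
    {ω : P ⊗[A] R} (hω : ω ∈ tensorSpan (Set.univ : Set P) (𝔍 : Set R)) {n : ℕ} {U : Q ⊗[A] R}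
    (hU : U ∈ tensorSpan (Set.univ : Set Q) ((𝔍 ^ n : Ideal R) : Set R)) :
    tensorMul R β ω U ∈ tensorSpan (Set.univ : Set Q') ((𝔍 ^ (n + 1) : Ideal R) : Set R) := by
  rw [Ideal.IsTwoSided.pow_succ]
  exact tensorMul_mem (fun _ _ _ _ => Set.mem_univ _)
    (fun r hr s hs => Ideal.mul_mem_mul hr hs) hω hU

/-- The slice of a tensor by a functional on the second factor. -/
noncomputable def slice (ψ : R →ₗ[A] A) : Q ⊗[A] R →ₗ[A] Q :=
  (TensorProduct.rid A Q).toLinearMap ∘ₗ ψ.lTensor Q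

@[simp] lemma slice_tmul (ψ : R →ₗ[A] A) (u : Q) (r : R) : slice ψ (u ⊗ₜ[A] r) = ψ r • u := by
  simp [slice]

lemma slice_lTensor (ψ : R →ₗ[A] A) (x : R) (U : Q ⊗[A] R) :
    slice ψ ((LinearMap.mulLeft A x).lTensor Q U) = slice (ψ ∘ₗ LinearMap.mulLeft A x) U := by
  induction U with
  | zero => simp
  | add U V hU hV => rw [map_add, map_add, hU, hV, map_add]
  | tmul u r => simp

lemma slice_rTensor (ψ : R →ₗ[A] A) (f : Q →ₗ[A] Q') (U : Q ⊗[A] R) :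
    slice ψ (f.rTensor R U) = f (slice ψ U) := by
  induction U with
  | zero => simp
  | add U V hU hV => rw [map_add, map_add, hU, hV, map_add, map_add]
  | tmul u r => simp

lemma slice_mem {M : Submodule A Q} {J : Set R} {U : Q ⊗[A] R} (hU : U ∈ tensorSpan M J)
    (ψ : R →ₗ[A] A) : slice ψ U ∈ M := by
  have : tensorSpan (M : Set Q) J ≤ M.comap (slice ψ) := by
    refine Submodule.span_le.2 ?_
    rintro _ ⟨u, hu, r, -, rfl⟩
    simpa using M.smul_mem _ hu
  exact this hU

/-- The value in `R` of a tensor at a functional. -/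
noncomputable def evalTensor (R : Type w') [Ring R] [Algebra A R] (α : Q →ₗ[A] A) :
    Q ⊗[A] R →ₗ[A] R :=
  (TensorProduct.lid A R).toLinearMap ∘ₗ α.rTensor R

@[simp] lemma evalTensor_tmul (α : Q →ₗ[A] A) (u : Q) (r : R) :
    evalTensor R α (u ⊗ₜ[A] r) = α u • r := by simp [evalTensor]

lemma evalTensor_mem {M : Set Q} {J : Submodule A R} {U : Q ⊗[A] R} (hU : U ∈ tensorSpan M J)
    (α : Q →ₗ[A] A) : evalTensor R α U ∈ J := by
  have : tensorSpan M (J : Set R) ≤ J.comap (evalTensor R α) := by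
    refine Submodule.span_le.2 ?_
    rintro _ ⟨u, -, r, hr, rfl⟩
    simpa using J.smul_mem _ hr
  exact this hU

lemma evalTensor_eq_zero {M : Submodule A Q} {J : Set R} {U : Q ⊗[A] R}
    (hU : U ∈ tensorSpan M J) {α : Q →ₗ[A] A} (hα : ∀ u ∈ M, α u = 0) : evalTensor R α U = 0 := by
  have : tensorSpan (M : Set Q) J ≤ LinearMap.ker (evalTensor R α) := by
    refine Submodule.span_le.2 ?_
    rintro _ ⟨u, hu, r, -, rfl⟩
    simp [hα u hu]
  exact this hU

lemma rTensor_eq_self {M : Submodule A Q} {J : Set R} {U : Q ⊗[A] R}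
    (hU : U ∈ tensorSpan M J) {f : Q →ₗ[A] Q} (hf : ∀ u ∈ M, f u = u) : f.rTensor R U = U := by
  have : tensorSpan (M : Set Q) J ≤ LinearMap.eqLocus (f.rTensor R) LinearMap.id := by
    refine Submodule.span_le.2 ?_
    rintro _ ⟨u, hu, r, -, rfl⟩
    simp [LinearMap.mem_eqLocus, hf u hu]
  exact this hU

lemma evalTensor_rTensor (α : Q' →ₗ[A] A) (f : Q →ₗ[A] Q') (U : Q ⊗[A] R) :
    evalTensor R α (f.rTensor R U) = evalTensor R (α ∘ₗ f) U := by
  induction U with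
  | zero => simp
  | add U V hU hV => rw [map_add, map_add, hU, hV, map_add]
  | tmul u r => simp

lemma evalTensor_map (α : Q →ₗ[A] A) {R' : Type*} [Ring R'] [Algebra A R'] (f : R →ₗ[A] R')
    (U : Q ⊗[A] R) : evalTensor R' α (f.lTensor Q U) = f (evalTensor R α U) := by
  induction U with
  | zero => simp
  | add U V hU hV => rw [map_add, map_add, hU, hV, map_add, map_add]
  | tmul u r => simp

namespace AugDGA

variable {C : AugDGA.{v, w} A}

lemma rTensor_barDiff_tensorMul (ω : C.augIdeal ⊗[A] R) (U : C.Bar ⊗[A] R) :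
    C.barDiff.rTensor R (tensorMul R C.barCons ω U) =
      - tensorMul R C.barCons (C.dBar.rTensor R ω) U +
        tensorMul R C.barCons (C.sgn.rTensor R ω) (C.barDiff.rTensor R U) -
          tensorMul R C.mulHead (C.sgn.rTensor R ω) U := by
  induction ω with
  | zero => simp
  | add ω ω' h h' => simp only [map_add, LinearMap.add_apply, h, h']; abel
  | tmul a r =>
    induction U with
    | zero => simp
    | add U V hU hV => simp only [map_add, hU, hV]; abel
    | tmul u s =>
      simp only [tensorMul_tmul, LinearMap.rTensor_tmul, barDiff_cons, sub_tmul, add_tmul, neg_tmul]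

lemma mulHead_tensorMul (ω ω' : C.augIdeal ⊗[A] R) (U : C.Bar ⊗[A] R) :
    tensorMul R C.mulHead ω (tensorMul R C.barCons ω' U) =
      tensorMul R C.barCons (tensorMul R C.mulBar ω ω') U := by
  induction ω with
  | zero => simp
  | add _ _ h h' => simp only [map_add, LinearMap.add_apply, h, h']
  | tmul a r =>
    induction ω' with
    | zero => simp
    | add _ _ h h' => simp only [map_add, LinearMap.add_apply, h, h']
    | tmul b s =>
      induction U with
      | zero => simp
      | add _ _ h h' => simp only [map_add, h, h']
      | tmul u t => simp [mul_assoc]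

lemma mulHead_tensorMul_one (ω : C.augIdeal ⊗[A] R) (r : R) :
    tensorMul R C.mulHead ω (C.barOne ⊗ₜ r) = 0 := by
  induction ω with
  | zero => simp
  | add _ _ h h' => simp only [map_add, LinearMap.add_apply, h, h', add_zero]
  | tmul a r => simp

lemma contr_tensorMul (α : C.augIdeal →ₗ[A] A) (ω : C.augIdeal ⊗[A] R) (U : C.Bar ⊗[A] R) :
    (C.contr α).rTensor R (tensorMul R C.barCons ω U) =
      (LinearMap.mulLeft A (evalTensor R α ω)).lTensor C.Bar U := by
  induction U with
  | zero => simp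
  | add _ _ h h' => simp only [map_add, h, h']
  | tmul u s =>
    induction ω with
    | zero => simp
    | add _ _ h h' =>
      simp only [map_add, LinearMap.add_apply, h, h', LinearMap.lTensor_tmul,
        LinearMap.mulLeft_apply, add_mul, tmul_add]
    | tmul a r => simp [smul_tmul]

/-- The partial sums `1 + ω + ω | ω + ⋯` of tensors in an element `ω` of degree `1` with
coefficients in an algebra. -/
noncomputable def barExp (ω : C.augIdeal ⊗[A] R) : ℕ → C.Bar ⊗[A] R
  | 0 => 0
  | n + 1 => C.barOne ⊗ₜ 1 + tensorMul R C.barCons ω (barExp ω n)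

lemma barExp_mem {M : Submodule A C.augIdeal} {ω : C.augIdeal ⊗[A] R}
    (hω : ω ∈ tensorSpan (M : Set C.augIdeal) (Set.univ : Set R)) (n : ℕ) :
    barExp ω (n + 1) ∈ tensorSpan (C.barSpan M n : Set C.Bar) (Set.univ : Set R) := by
  have one : ∀ n, C.barOne ⊗ₜ[A] (1 : R) ∈
      tensorSpan (C.barSpan M n : Set C.Bar) (Set.univ : Set R) := fun n =>
    tmul_mem_tensorSpan (barOne_mem_barSpan M n) trivial
  induction n with
  | zero => simpa [barExp] using one 0
  | succ n ih =>
    exact add_mem (one _) (tensorMul_mem (fun a ha u hu => barCons_mem_barSpan ha hu)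
      (fun _ _ _ _ => Set.mem_univ _) hω ih)

lemma barExp_succ_sub_mem {𝔍 : Ideal R} [𝔍.IsTwoSided] {ω : C.augIdeal ⊗[A] R}
    (hω : ω ∈ tensorSpan (Set.univ : Set C.augIdeal) (𝔍 : Set R)) (n : ℕ) :
    barExp ω (n + 1) - barExp ω n ∈
      tensorSpan (Set.univ : Set C.Bar) ((𝔍 ^ n : Ideal R) : Set R) := by
  induction n with
  | zero =>
    rw [show barExp ω (0 + 1) - barExp ω 0 = C.barOne ⊗ₜ 1 by simp [barExp]]
    exact tmul_mem_tensorSpan trivial (by rw [Submodule.pow_zero, Ideal.one_eq_top]; trivial)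
  | succ n ih =>
    rw [barExp, barExp, add_sub_add_left_eq_sub, ← map_sub]
    exact tensorMul_mem_pow_succ hω ih

/-- The Maurer-Cartan equation, for elements of degree `1`. -/
def IsMaurerCartan (ω : C.augIdeal ⊗[A] R) : Prop :=
  C.sgn.rTensor R ω = ω ∧ C.dBar.rTensor R ω + tensorMul R C.mulBar ω ω = 0

lemma barDiff_barExp_mem {𝔍 : Ideal R} [𝔍.IsTwoSided] {ω : C.augIdeal ⊗[A] R}
    (hω : ω ∈ tensorSpan (Set.univ : Set C.augIdeal) (𝔍 : Set R)) (h : IsMaurerCartan ω) (n : ℕ) :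
    C.barDiff.rTensor R (barExp ω n) ∈
      tensorSpan (Set.univ : Set C.Bar) ((𝔍 ^ n : Ideal R) : Set R) := by
  induction n with
  | zero => rw [barExp, map_zero]; exact zero_mem _
  | succ n ih =>
    have e : C.barDiff.rTensor R (barExp ω (n + 1)) =
        tensorMul R C.mulHead ω (barExp ω (n + 1) - barExp ω n) +
          tensorMul R C.barCons ω (C.barDiff.rTensor R (barExp ω n)) := by
      rw [map_sub]
      conv_rhs => rw [barExp]
      rw [barExp, map_add, map_add, mulHead_tensorMul, rTensor_barDiff_tensorMul, h.1,
        eq_neg_of_add_eq_zero_left h.2]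
      rw [mulHead_tensorMul_one]
      simp
      abel
    rw [e]
    exact add_mem (tensorMul_mem_pow_succ hω (barExp_succ_sub_mem hω n))
      (tensorMul_mem_pow_succ hω ih)

lemma tensorSpan_bot {M : Set Q} {U : Q ⊗[A] R}
    (hU : U ∈ tensorSpan M ((⊥ : Ideal R) : Set R)) : U = 0 := by
  have : tensorSpan M ((⊥ : Ideal R) : Set R) ≤ (⊥ : Submodule A (Q ⊗[A] R)) := by
    refine Submodule.span_le.2 ?_
    rintro _ ⟨u, -, r, hr, rfl⟩
    rw [show r = 0 from hr, tmul_zero]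
    exact zero_mem _
  exact this hU

variable {𝔍 : Ideal R} [𝔍.IsTwoSided] {ω : C.augIdeal ⊗[A] R}

lemma barDiff_slice_barExp
    (hω : ω ∈ tensorSpan (Set.univ : Set C.augIdeal) (𝔍 : Set R)) (h : IsMaurerCartan ω) {n : ℕ}
    (hn : 𝔍 ^ n = ⊥) (ψ : R →ₗ[A] A) : C.barDiff (slice ψ (barExp ω n)) = 0 := by
  have := barDiff_barExp_mem hω h n
  rw [hn] at this
  rw [← slice_rTensor, tensorSpan_bot this, map_zero]

lemma contr_slice_barExp
    (hω : ω ∈ tensorSpan (Set.univ : Set C.augIdeal) (𝔍 : Set R)) {n : ℕ}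
    (hn : 𝔍 ^ n = ⊥) (ψ : R →ₗ[A] A) (α : C.augIdeal →ₗ[A] A) :
    C.contr α (slice ψ (barExp ω n)) =
      slice (ψ ∘ₗ LinearMap.mulLeft A (evalTensor R α ω)) (barExp ω n) := by
  have := barExp_succ_sub_mem hω n
  rw [hn] at this
  rw [← slice_rTensor, ← sub_eq_zero.1 (tensorSpan_bot this), barExp, map_add, contr_tensorMul,
    LinearMap.rTensor_tmul, contr_one, zero_tmul, zero_add, slice_lTensor]
  exact congrArg _ (sub_eq_zero.1 (tensorSpan_bot this)).symm

lemma barCounit_slice_barExp (ω : C.augIdeal ⊗[A] R) (n : ℕ) (ψ : R →ₗ[A] A) :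
    C.barCounit (slice ψ (barExp ω (n + 1))) = ψ 1 := by
  have key : ∀ ω (U : C.Bar ⊗[A] R),
      C.barCounit.rTensor R (tensorMul R C.barCons ω U) = 0 := by
    intro ω U
    induction U with
    | zero => simp
    | add _ _ h h' => simp only [map_add, h, h', add_zero]
    | tmul u s =>
      induction ω with
      | zero => simp
      | add _ _ h h' => simp only [map_add, LinearMap.add_apply, h, h', add_zero]
      | tmul a r => simp
  rw [← slice_rTensor, barExp, map_add, key]
  simp

namespace Hom

variable {C' : AugDGA.{v, w''} A} (F : Hom C C')

lemma rTensor_barMap_barExp (ω : C.augIdeal ⊗[A] R) (n : ℕ) :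
    F.barMap.rTensor R (barExp ω n) = barExp (F.mapAug.rTensor R ω) n := by
  have key : ∀ ω (U : C.Bar ⊗[A] R), F.barMap.rTensor R (tensorMul R C.barCons ω U) =
      tensorMul R C'.barCons (F.mapAug.rTensor R ω) (F.barMap.rTensor R U) := by
    intro ω U
    induction U with
    | zero => simp
    | add _ _ h h' => simp only [map_add, h, h']
    | tmul u s =>
      induction ω with
      | zero => simp
      | add _ _ h h' =>
        simp only [map_add, LinearMap.add_apply, h, h']
      | tmul a r => simp
  induction n with
  | zero => simp [barExp]
  | succ n ih => rw [barExp, barExp, map_add, key, ih]; simp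

lemma rTensor_sgn (ω : C.augIdeal ⊗[A] R) :
    C'.sgn.rTensor R (F.mapAug.rTensor R ω) = F.mapAug.rTensor R (C.sgn.rTensor R ω) := by
  rw [← LinearMap.comp_apply, ← LinearMap.comp_apply, ← LinearMap.rTensor_comp,
    ← LinearMap.rTensor_comp]
  congr 2
  exact LinearMap.ext fun a => (F.mapAug_sgn a).symm

lemma rTensor_dBar (ω : C.augIdeal ⊗[A] R) :
    C'.dBar.rTensor R (F.mapAug.rTensor R ω) = F.mapAug.rTensor R (C.dBar.rTensor R ω) := by
  rw [← LinearMap.comp_apply, ← LinearMap.comp_apply, ← LinearMap.rTensor_comp,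
    ← LinearMap.rTensor_comp]
  congr 2
  exact LinearMap.ext fun a => (F.mapAug_dBar a).symm

lemma tensorMul_mapAug (ω ω' : C.augIdeal ⊗[A] R) :
    tensorMul R C'.mulBar (F.mapAug.rTensor R ω) (F.mapAug.rTensor R ω') =
      F.mapAug.rTensor R (tensorMul R C.mulBar ω ω') := by
  induction ω with
  | zero => simp
  | add _ _ h h' => simp only [map_add, LinearMap.add_apply, h, h']
  | tmul a r =>
    induction ω' with
    | zero => simp
    | add _ _ h h' => simp only [map_add, h, h']
    | tmul b s => simp [mapAug_mulBar]

lemma isMaurerCartan_map {ω : C.augIdeal ⊗[A] R} (h : IsMaurerCartan ω) :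
    IsMaurerCartan (F.mapAug.rTensor R ω) :=
  ⟨by rw [F.rTensor_sgn, h.1], by rw [F.rTensor_dBar, F.tensorMul_mapAug, ← map_add, h.2, map_zero]⟩

end Hom

end AugDGA

end Twisting

end LetterBraiding

namespace LetterBraiding

set_option linter.unusedSectionVars false
set_option maxSynthPendingDepth 3

open Simplicial

section Holonomy

variable {X : SSet.{u}} {x : X _⦋0⦌} (T : RootedTree X x) {Γ : Type*} [Group Γ] (c : X _⦋1⦌ → Γ)

/-- The holonomy of a word in the edges, each completed to a loop by paths in the tree. -/
noncomputable def RootedTree.hol : FreeGroup (X _⦋1⦌) →* Γ :=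
  FreeGroup.lift fun e => T.sol c (X.δ 1 e) * c e * (T.sol c (X.δ 0 e))⁻¹

namespace RootedTree

@[simp] lemma hol_of (e : X _⦋1⦌) : T.hol c (FreeGroup.of e) =
    T.sol c (X.δ 1 e) * c e * (T.sol c (X.δ 0 e))⁻¹ := by simp [hol]

variable {c}

lemma sol_mem {S : Subgroup Γ} (h : ∀ e, c e ∈ S) (v : X _⦋0⦌) : T.sol c v ∈ S := by
  refine T.induction (p := fun v => T.sol c v ∈ S) (by rw [sol_root]; exact one_mem _)
    (fun v hv hp => ?_) (fun v hv hp => ?_) v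
  · rw [T.sol_edge c v hv]
    exact mul_mem hp (h _)
  · rw [T.sol_edge c v hv] at hp
    exact (Subgroup.mul_mem_cancel_right S (h _)).1 hp

lemma hol_mem {S : Subgroup Γ} (h : ∀ e, c e ∈ S) (W : FreeGroup (X _⦋1⦌)) : T.hol c W ∈ S := by
  refine FreeGroup.range_lift_le ?_ ⟨W, rfl⟩
  rintro _ ⟨e, rfl⟩
  exact mul_mem (mul_mem (T.sol_mem h _) (h e)) (inv_mem (T.sol_mem h _))

lemma sol_map {Γ' : Type*} [Group Γ'] (f : Γ →* Γ') (v : X _⦋0⦌) :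
    f (T.sol c v) = T.sol (fun e => f (c e)) v :=
  congrFun (T.eq_sol (c := fun e => f (c e)) (f := fun v => f (T.sol c v)) (by simp)
    fun v hv => by rw [T.sol_edge c v hv, map_mul]) v

lemma hol_map {Γ' : Type*} [Group Γ'] (f : Γ →* Γ') (W : FreeGroup (X _⦋1⦌)) :
    f (T.hol c W) = T.hol (fun e => f (c e)) W := by
  suffices h : f.comp (T.hol c) = T.hol (fun e => f (c e)) from DFunLike.congr_fun h W
  ext e
  simp [sol_map]

lemma sol_of_tree (h : ∀ v, v ≠ x → c (T.edge v) = 1) (v : X _⦋0⦌) : T.sol c v = 1 :=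
  (congrFun (T.eq_sol (f := fun _ => 1) rfl fun v hv => by rw [h v hv, one_mul]) v).symm

lemma hol_of_tree (h : ∀ v, v ≠ x → c (T.edge v) = 1) : T.hol c = FreeGroup.lift c := by
  ext e
  simp [T.sol_of_tree h]

end RootedTree

variable {A : Type v} [CommRing A]

/-- The operator of a word on the bar construction. -/
noncomputable def RootedTree.barHol (W : FreeGroup (X _⦋1⦌)) :
    (cochains2 A X x).Bar ≃ₗ[A] (cochains2 A X x).Bar :=
  (T.hol (fun e => MulOpposite.op (edgeAut (A := A) (x := x) e)) W).unop

namespace RootedTree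

/-- A family of tensors on which the edges act through a group determines the operators of
words. -/
lemma barHol_intertwine {K : Type*} (f : K → (cochains2 A X x).Bar) (c : X _⦋1⦌ → Γ)
    (ρ : Γ →* (Equiv.Perm K)ᵐᵒᵖ) (h : ∀ e k, edgeAut e (f k) = f ((ρ (c e)).unop k))
    (W : FreeGroup (X _⦋1⦌)) (k : K) :
    T.barHol W (f k) = f ((ρ (T.hol c W)).unop k) := by
  let S : Subgroup (((cochains2 A X x).Bar ≃ₗ[A] (cochains2 A X x).Bar)ᵐᵒᵖ × Γ) :=
    { carrier := {p | ∀ k, p.1.unop (f k) = f ((ρ p.2).unop k)}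
      mul_mem' := fun {p q} hp hq k => by
        have hp : ∀ k, p.1.unop (f k) = f ((ρ p.2).unop k) := hp
        have hq : ∀ k, q.1.unop (f k) = f ((ρ q.2).unop k) := hq
        rw [Prod.fst_mul, Prod.snd_mul, MulOpposite.unop_mul, LinearEquiv.mul_apply, hp, hq,
          map_mul]
        rfl
      one_mem' := fun k => by simp
      inv_mem' := fun {p} hp k => by
        have hp : ∀ k, p.1.unop (f k) = f ((ρ p.2).unop k) := hp
        have : p.1.unop (f ((ρ p.2⁻¹).unop k)) = f k := by
          rw [hp, ← Equiv.Perm.mul_apply, ← MulOpposite.unop_mul, ← map_mul]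
          simp
        rw [← this, Prod.fst_inv, MulOpposite.unop_inv, ← LinearEquiv.mul_apply, inv_mul_cancel]
        rfl }
  let p := fun e => (MulOpposite.op (edgeAut (A := A) (x := x) e), c e)
  have h1 : (T.hol p W).1 = T.hol (fun e => MulOpposite.op (edgeAut e)) W :=
    T.hol_map (c := p)
      (MonoidHom.fst ((cochains2 A X x).Bar ≃ₗ[A] (cochains2 A X x).Bar)ᵐᵒᵖ Γ) W
  have h2 : (T.hol p W).2 = T.hol c W := T.hol_map (c := p)
    (MonoidHom.snd ((cochains2 A X x).Bar ≃ₗ[A] (cochains2 A X x).Bar)ᵐᵒᵖ Γ) W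
  have : (T.hol p W).1.unop (f k) = f ((ρ (T.hol p W).2).unop k) :=
    T.hol_mem (S := S) (c := p) h W k
  rwa [h1, h2] at this

lemma edgeAut_barDiff (e : X _⦋1⦌) (u : (cochains2 A X x).Bar) :
    edgeAut e ((cochains2 A X x).barDiff u - vertexOp (X.δ 1 e) u) =
      (cochains2 A X x).barDiff (edgeAut e u) - vertexOp (X.δ 0 e) (edgeAut e u) := by
  simp only [edgeAut_apply, map_sub, map_add, edgeOp_barDiff]
  abel

lemma vertexOp_root (u : (cochains2 A X x).Bar) : vertexOp x u = 0 := by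
  have : evalVertex x = (0 : (cochains2 A X x).augIdeal →ₗ[A] A) :=
    LinearMap.ext evalVertex_root
  suffices h : vertexOp (A := A) (x := x) x = 0 from LinearMap.congr_fun h u
  exact AugDGA.bar_ext (by simp) fun a u _ => by simp [this]

variable (A) in
/-- The transport along the tree. -/
noncomputable def transport (v : X _⦋0⦌) : (cochains2 A X x).Bar ≃ₗ[A] (cochains2 A X x).Bar :=
  (T.sol (fun e => MulOpposite.op (edgeAut (A := A) (x := x) e)) v).unop

lemma transport_barDiff (v : X _⦋0⦌) (u : (cochains2 A X x).Bar) :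
    T.transport A v ((cochains2 A X x).barDiff u) =
      (cochains2 A X x).barDiff (T.transport A v u) - vertexOp v (T.transport A v u) := by
  have key : ∀ v, v ≠ x → ∀ u : (cochains2 A X x).Bar, T.transport A (X.δ 0 (T.edge v)) u =
      edgeAut (T.edge v) (T.transport A (X.δ 1 (T.edge v)) u) := by
    intro v hv u
    rw [transport, T.sol_edge _ v hv]
    rfl
  refine T.induction (p := fun v => ∀ u, T.transport A v ((cochains2 A X x).barDiff u) =
      (cochains2 A X x).barDiff (T.transport A v u) - vertexOp v (T.transport A v u))
    (fun u => ?_) (fun v hv hp u => ?_) (fun v hv hp u => ?_) v u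
  · rw [vertexOp_root, sub_zero, transport, sol_root]
    rfl
  · rw [key v hv, key v hv, hp, edgeAut_barDiff]
  · have := hp u
    rw [key v hv, key v hv, ← edgeAut_barDiff] at this
    exact (edgeAut _).injective this

lemma barHol_barDiff (W : FreeGroup (X _⦋1⦌)) (u : (cochains2 A X x).Bar) :
    T.barHol W ((cochains2 A X x).barDiff u) = (cochains2 A X x).barDiff (T.barHol W u) := by
  have inv : ∀ φ : (cochains2 A X x).Bar ≃ₗ[A] (cochains2 A X x).Bar,
      (∀ u, φ ((cochains2 A X x).barDiff u) = (cochains2 A X x).barDiff (φ u)) →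
      ∀ u, φ⁻¹ ((cochains2 A X x).barDiff u) = (cochains2 A X x).barDiff (φ⁻¹ u) := by
    intro φ h u
    apply φ.injective
    rw [h, ← LinearEquiv.mul_apply, ← LinearEquiv.mul_apply, mul_inv_cancel]
    rfl
  induction W using FreeGroup.induction_on generalizing u with
  | C1 => rw [barHol, map_one]; rfl
  | of e =>
    rw [barHol, hol_of]
    have h0 : ∀ u, (T.transport A (X.δ 0 e)) ((T.transport A (X.δ 0 e))⁻¹ u) = u := fun u => by
      rw [← LinearEquiv.mul_apply, mul_inv_cancel]; rfl
    change (T.transport A (X.δ 0 e))⁻¹ (edgeAut e (T.transport A (X.δ 1 e)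
      ((cochains2 A X x).barDiff u))) = (cochains2 A X x).barDiff
        ((T.transport A (X.δ 0 e))⁻¹ (edgeAut e (T.transport A (X.δ 1 e) u)))
    apply (T.transport A (X.δ 0 e)).injective
    rw [h0, transport_barDiff, edgeAut_barDiff, transport_barDiff, h0]
  | inv_of e h =>
    rw [barHol, map_inv, MulOpposite.unop_inv]
    exact inv _ h u
  | mul W W' h h' =>
    rw [barHol, map_mul, MulOpposite.unop_mul, LinearEquiv.mul_apply]
    exact (congrArg _ (h u)).trans (h' _)

lemma barCounit_barHol_barDiff (W : FreeGroup (X _⦋1⦌)) (u : (cochains2 A X x).Bar) :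
    (cochains2 A X x).barCounit (T.barHol W ((cochains2 A X x).barDiff u)) = 0 := by
  rw [barHol_barDiff, AugDGA.barCounit_barDiff]

end RootedTree

end Holonomy

namespace EdgePathGroup

variable {A : Type v} [CommRing A] {X : SSet.{u}} {x : X _⦋0⦌} {G : Type w} [Group G]
  (E : EdgePathGroup X x G)

lemma exists_word (y : G) : ∃ W, FreeGroup.lift E.g W = y := by
  have : y ∈ (FreeGroup.lift E.g).range := by
    rw [FreeGroup.range_lift_eq_closure, E.closure_range]
    trivial
  exact this

lemma hol_map_g {Γ : Type*} [Group Γ] (f : G →* Γ) (W : FreeGroup (X _⦋1⦌)) :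
    E.tree.hol (fun e => f (E.g e)) W = f (FreeGroup.lift E.g W) := by
  rw [← E.tree.hol_map, E.tree.hol_of_tree E.g_tree]

variable {Y : SSet.{u'}} {y : Y _⦋0⦌}

lemma barHol_normal (T : RootedTree Y y)
    (β : (cochains2 A X x).Bar →ₗ[A] (cochains2 A Y y).Bar) (f : Y _⦋1⦌ → X _⦋1⦌)
    (hβ : ∀ e u, edgeOp e (β u) = β (edgeOp (f e) u)) (hT : ∀ v, v ≠ y → E.g (f (T.edge v)) = 1)
    (W : FreeGroup (Y _⦋1⦌)) (z : E.tree.normalCocycles A) :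
    T.barHol W (β z.1) = β ((E.rep A (FreeGroup.lift (fun e => E.g (f e)) W)).unop z).1 := by
  have := T.barHol_intertwine (fun z : E.tree.normalCocycles A => β z.1) (fun e => E.g (f e))
    ((MonoidHom.op (MulAction.toPermHom (E.tree.normalCocycles A ≃ₗ[A] E.tree.normalCocycles A)
      (E.tree.normalCocycles A))).comp (E.rep A)) (fun e k => by
      rw [edgeAut_apply, hβ, ← map_add]
      change _ = β ((E.rep A (E.g (f e))).unop k).1
      rw [rep_g]
      rfl) W z
  rwa [T.hol_of_tree hT] at this

lemma barCounit_barHol_normal (T : RootedTree Y y)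
    (β : (cochains2 A X x).Bar →ₗ[A] (cochains2 A Y y).Bar) (f : Y _⦋1⦌ → X _⦋1⦌)
    (hβ : ∀ e u, edgeOp e (β u) = β (edgeOp (f e) u)) (hT : ∀ v, v ≠ y → E.g (f (T.edge v)) = 1)
    (hc : ∀ u, (cochains2 A Y y).barCounit (β u) = (cochains2 A X x).barCounit u)
    (W : FreeGroup (Y _⦋1⦌)) (z : E.tree.normalCocycles A) :
    (cochains2 A Y y).barCounit (T.barHol W (β z.1)) = E.normalPairing A z
      (MonoidAlgebra.of A G (FreeGroup.lift (fun e => E.g (f e)) W)) := by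
  rw [E.barHol_normal T β f hβ hT, hc, normalPairing_apply, act_of]

end EdgePathGroup

section MaurerCartan

variable {A : Type v} [CommRing A] {X : SSet.{u}} {x : X _⦋0⦌} {R : Type w'} [Ring R] [Algebra A R]

/-- The right translations of functionals by units. -/
def dualTranslate (A : Type v) [CommRing A] (R : Type w') [Ring R] [Algebra A R] :
    Rˣ →* (Equiv.Perm (R →ₗ[A] A))ᵐᵒᵖ where
  toFun r := MulOpposite.op
    { toFun := fun ψ => ψ ∘ₗ LinearMap.mulLeft A r.1
      invFun := fun ψ => ψ ∘ₗ LinearMap.mulLeft A (r⁻¹).1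
      left_inv := fun ψ => by ext; simp
      right_inv := fun ψ => by ext; simp }
  map_one' := by
    rw [← MulOpposite.op_one]
    congr 1
    ext
    simp
  map_mul' r s := by
    rw [← MulOpposite.op_mul]
    congr 1
    ext
    simp

lemma barCounit_barHol_barExp (T : RootedTree X x) {𝔍 : Ideal R} [𝔍.IsTwoSided]
    {ω : (cochains2 A X x).augIdeal ⊗[A] R} (hω : ω ∈ tensorSpan (Set.univ) (𝔍 : Set R)) {n : ℕ}
    (hn : 𝔍 ^ (n + 1) = ⊥) {c : X _⦋1⦌ → Rˣ} (hc : ∀ e, (c e : R) = 1 + evalTensor R (evalEdge e) ω)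
    (ψ : R →ₗ[A] A) (W : FreeGroup (X _⦋1⦌)) :
    (cochains2 A X x).barCounit (T.barHol W (slice ψ (AugDGA.barExp ω (n + 1)))) =
      ψ (T.hol c W) := by
  have := T.barHol_intertwine (fun ψ : R →ₗ[A] A => slice ψ (AugDGA.barExp ω (n + 1))) c
    (dualTranslate A R) (fun e ψ => by
      rw [edgeAut_apply, edgeOp, AugDGA.contr_slice_barExp hω hn]
      change _ = slice (ψ ∘ₗ LinearMap.mulLeft A (c e).1) _
      rw [hc, ← LinearMap.add_apply]
      congr 1
      refine TensorProduct.ext' fun u r => ?_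
      simp [add_mul, add_smul]) W ψ
  rw [this, AugDGA.barCounit_slice_barExp]
  change ψ ((T.hol c W).1 * 1) = _
  rw [mul_one]

lemma tensorSpan_mono {Q : Type*} [AddCommGroup Q] [Module A Q] {M M' : Set Q} {J J' : Set R}
    (h : M ⊆ M') (h' : J ⊆ J') : tensorSpan (A := A) M J ≤ tensorSpan M' J' := by
  refine Submodule.span_mono ?_
  rintro _ ⟨u, hu, r, hr, rfl⟩
  exact ⟨u, h hu, r, h' hr, rfl⟩

lemma evalTensor_tensorMul (s : X _⦋2⦌) {J : Set R} {ω : (cochains2 A X x).augIdeal ⊗[A] R}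
    (hω : ω ∈ tensorSpan (degreeOne A X x : Set (cochains2 A X x).augIdeal) J) :
    evalTensor R (evalTri s) (tensorMul R (cochains2 A X x).mulBar ω ω) =
      evalTensor R (evalEdge (X.δ 2 s)) ω * evalTensor R (evalEdge (X.δ 0 s)) ω := by
  have key : ∀ a ∈ degreeOne A X x, ∀ r, ∀ ω ∈ tensorSpan (A := A)
      (degreeOne A X x : Set (cochains2 A X x).augIdeal) J,
      evalTensor R (evalTri s) (tensorMul R (cochains2 A X x).mulBar (a ⊗ₜ r) ω) =
      evalTensor R (evalEdge (X.δ 2 s)) (a ⊗ₜ r) * evalTensor R (evalEdge (X.δ 0 s)) ω := by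
    intro a ha r ω hω
    have : tensorSpan (A := A) (degreeOne A X x : Set (cochains2 A X x).augIdeal) J ≤
        LinearMap.eqLocus (evalTensor R (evalTri s) ∘ₗ
          tensorMul R (cochains2 A X x).mulBar (a ⊗ₜ r)) (LinearMap.mulLeft A
            (evalTensor R (evalEdge (X.δ 2 s)) (a ⊗ₜ r)) ∘ₗ
              evalTensor R (evalEdge (X.δ 0 s))) := by
      refine Submodule.span_le.2 ?_
      rintro _ ⟨b, hb, t, -, rfl⟩
      have ha' := mem_degreeOne.1 ha
      have hb' := mem_degreeOne.1 hb
      simp only [SetLike.mem_coe, LinearMap.mem_eqLocus, LinearMap.comp_apply, tensorMul_tmul,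
        evalTensor_tmul, evalTri_mulBar, ha'.1, ha'.2, zero_mul, add_zero, zero_add,
        LinearMap.mulLeft_apply]
      exact (smul_mul_smul_comm _ _ _ _).symm
    exact this hω
  have : tensorSpan (A := A) (degreeOne A X x : Set (cochains2 A X x).augIdeal) J ≤
      LinearMap.eqLocus (evalTensor R (evalTri s) ∘ₗ
        (tensorMul R (cochains2 A X x).mulBar).flip ω) (LinearMap.mulRight A
          (evalTensor R (evalEdge (X.δ 0 s)) ω) ∘ₗ evalTensor R (evalEdge (X.δ 2 s))) := by
    refine Submodule.span_le.2 ?_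
    rintro _ ⟨b, hb, t, -, rfl⟩
    exact key b hb t ω hω
  exact this hω

lemma evalVertex_tensorMul (ω ω' : (cochains2 A X x).augIdeal ⊗[A] R) (v : X _⦋0⦌) :
    evalTensor R (evalVertex v) (tensorMul R (cochains2 A X x).mulBar ω ω') =
      evalTensor R (evalVertex v) ω * evalTensor R (evalVertex v) ω' := by
  induction ω with
  | zero => simp
  | add _ _ h h' => simp only [map_add, LinearMap.add_apply, h, h', add_mul]
  | tmul a r =>
    induction ω' with
    | zero => simp
    | add _ _ h h' => simp only [map_add, h, h', mul_add]
    | tmul b t =>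
      simp only [tensorMul_tmul, evalTensor_tmul, evalVertex_mulBar, smul_mul_smul_comm]

lemma evalEdge_tensorMul (ω ω' : (cochains2 A X x).augIdeal ⊗[A] R) (e : X _⦋1⦌) :
    evalTensor R (evalEdge e) (tensorMul R (cochains2 A X x).mulBar ω ω') =
      evalTensor R (evalVertex (X.δ 1 e)) ω * evalTensor R (evalEdge e) ω' +
        evalTensor R (evalEdge e) ω * evalTensor R (evalVertex (X.δ 0 e)) ω' := by
  induction ω with
  | zero => simp
  | add _ _ h h' => simp only [map_add, LinearMap.add_apply, h, h', add_mul]; abel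
  | tmul a r =>
    induction ω' with
    | zero => simp
    | add _ _ h h' => simp only [map_add, h, h', mul_add]; abel
    | tmul b t =>
      simp only [tensorMul_tmul, evalTensor_tmul, evalEdge_mulBar', smul_mul_smul_comm, add_smul]

lemma evalTensor_add {Q : Type*} [AddCommGroup Q] [Module A Q] (α β : Q →ₗ[A] A) (U : Q ⊗[A] R) :
    evalTensor R (α + β) U = evalTensor R α U + evalTensor R β U := by
  simp only [evalTensor, LinearMap.rTensor_add, LinearMap.comp_apply, LinearMap.add_apply, map_add]

lemma evalTensor_sub {Q : Type*} [AddCommGroup Q] [Module A Q] (α β : Q →ₗ[A] A) (U : Q ⊗[A] R) :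
    evalTensor R (α - β) U = evalTensor R α U - evalTensor R β U := by
  simp only [evalTensor, LinearMap.rTensor_sub, LinearMap.comp_apply, LinearMap.sub_apply, map_sub]

/-- The Maurer-Cartan equation on a triangle. -/
lemma AugDGA.IsMaurerCartan.triangle {J : Set R} {ω : (cochains2 A X x).augIdeal ⊗[A] R}
    (hω : ω ∈ tensorSpan (degreeOne A X x : Set (cochains2 A X x).augIdeal) J)
    (h : AugDGA.IsMaurerCartan ω) (s : X _⦋2⦌) :
    1 + evalTensor R (evalEdge (X.δ 1 s)) ω = (1 + evalTensor R (evalEdge (X.δ 2 s)) ω) *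
      (1 + evalTensor R (evalEdge (X.δ 0 s)) ω) := by
  have h2 := congrArg (evalTensor R (evalTri s)) h.2
  have e : evalTri s ∘ₗ (cochains2 A X x).dBar =
    evalEdge (X.δ 0 s) - evalEdge (X.δ 1 s) + evalEdge (X.δ 2 s) := rfl
  rw [map_add, evalTensor_tensorMul s hω, evalTensor_rTensor, e, evalTensor_add, evalTensor_sub,
    map_zero] at h2
  have : evalTensor R (evalEdge (X.δ 1 s)) ω = evalTensor R (evalEdge (X.δ 0 s)) ω +
      evalTensor R (evalEdge (X.δ 2 s)) ω +
        evalTensor R (evalEdge (X.δ 2 s)) ω * evalTensor R (evalEdge (X.δ 0 s)) ω := by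
    rw [← sub_eq_zero, ← neg_eq_zero, ← h2]; abel
  rw [this]
  noncomm_ring

/-- Over a principal ideal domain, cochains with coefficients in a finite module are determined by
their values. -/
theorem eq_zero_of_evalTensor [IsDomain A] [IsPrincipalIdealRing A] [Module.Finite A R]
    {ω : (cochains2 A X x).augIdeal ⊗[A] R} (h0 : ∀ v, evalTensor R (evalVertex v) ω = 0)
    (h1 : ∀ e, evalTensor R (evalEdge e) ω = 0) (h2 : ∀ s, evalTensor R (evalTri s) ω = 0) :
    ω = 0 := by
  obtain ⟨k, p, hp⟩ := Module.Finite.exists_fin' A R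
  have hb : ∃ b : Fin k → (cochains2 A X x).augIdeal, ω = ∑ j, b j ⊗ₜ p (Pi.single j 1) := by
    clear h0 h1 h2
    induction ω with
    | zero => exact ⟨0, by simp⟩
    | add _ _ h h' =>
      obtain ⟨b, rfl⟩ := h
      obtain ⟨b', rfl⟩ := h'
      exact ⟨b + b', by simp [add_tmul, Finset.sum_add_distrib]⟩
    | tmul a r =>
      obtain ⟨y, rfl⟩ := hp r
      refine ⟨fun j => y j • a, ?_⟩
      conv_lhs => rw [pi_eq_sum_univ' y]
      rw [map_sum, tmul_sum]
      refine Finset.sum_congr rfl fun j _ => ?_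
      rw [map_smul, tmul_smul, smul_tmul']
  obtain ⟨b, rfl⟩ := hb
  have hev : ∀ α : (cochains2 A X x).augIdeal →ₗ[A] A,
      evalTensor R α (∑ j, b j ⊗ₜ p (Pi.single j 1)) = p fun j => α (b j) := by
    intro α
    conv_rhs => rw [pi_eq_sum_univ' fun j => α (b j)]
    simp only [map_sum, evalTensor_tmul, map_smul]
  simp only [hev] at h0 h1 h2
  obtain ⟨m, κ⟩ := Submodule.basisOfPid (Pi.basisFun A (Fin k)) (LinearMap.ker p)
  have hz : ∀ (i : Fin m) (y : Fin k → A) (hy : p y = 0), y = 0 → κ.repr ⟨y, hy⟩ i = 0 := by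
    rintro i _ hy rfl
    have : (⟨0, hy⟩ : LinearMap.ker p) = 0 := rfl
    rw [this, map_zero]
    rfl
  let β : Fin m → (cochains2 A X x).augIdeal := fun i => mkAug
    ⟨fun v => κ.repr ⟨_, h0 v⟩ i, fun e => κ.repr ⟨_, h1 e⟩ i, fun s => κ.repr ⟨_, h2 s⟩ i,
      fun v => hz i _ _ (funext fun j => Cochains2.c1_σ _ v),
      fun l e => hz i _ _ (funext fun j => Cochains2.c2_σ _ l e)⟩
    (hz i _ _ (funext fun j => evalVertex_root _))
  have hβ : ∀ j, b j = ∑ i, (κ i).1 j • β i := by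
    intro j
    have hr : ∀ (y : Fin k → A) (hy : p y = 0), y j = ∑ i, (κ i).1 j * κ.repr ⟨y, hy⟩ i := by
      intro y hy
      have := congrArg (fun z : LinearMap.ker p => z.1 j) (κ.sum_repr ⟨y, hy⟩)
      simp only [Submodule.coe_sum, Finset.sum_apply, Submodule.coe_smul, Pi.smul_apply,
        smul_eq_mul] at this
      rw [← this]
      exact Finset.sum_congr rfl fun i _ => mul_comm _ _
    refine augIdeal_ext (fun v => ?_) (fun e => ?_) (fun s => ?_)
    · rw [map_sum]
      simp only [map_smul, smul_eq_mul]
      exact hr _ (h0 v)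
    · rw [map_sum]
      simp only [map_smul, smul_eq_mul]
      exact hr _ (h1 e)
    · rw [map_sum]
      simp only [map_smul, smul_eq_mul]
      exact hr _ (h2 s)
  simp only [hβ, sum_tmul]
  rw [Finset.sum_comm]
  refine Finset.sum_eq_zero fun i _ => ?_
  have : p (κ i).1 = 0 := (κ i).2
  rw [pi_eq_sum_univ' (κ i).1, map_sum] at this
  simp only [map_smul] at this
  rw [← tmul_zero (R := A) R (β i), ← this, tmul_sum]
  exact Finset.sum_congr rfl fun j _ => by rw [smul_tmul]

/-- The universal solution of the Maurer-Cartan equation with a given holonomy. -/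
theorem EdgePathGroup.exists_isMaurerCartan [IsDomain A] [IsPrincipalIdealRing A]
    [Module.Finite A R] {G : Type w} [Group G] (E : EdgePathGroup X x G) (γ : G →* R)
    (𝔍 : Ideal R) (h𝔍 : ∀ g, γ g - 1 ∈ 𝔍) : ∃ ω : (cochains2 A X x).augIdeal ⊗[A] R,
      ω ∈ tensorSpan ((E.tree.contraction A).letters : Set (cochains2 A X x).augIdeal) (𝔍 : Set R) ∧
      (∀ e, evalTensor R (evalEdge e) ω = γ (E.g e) - 1) ∧ AugDGA.IsMaurerCartan ω := by
  obtain ⟨k, p, hp⟩ := Module.Finite.exists_fin' A (𝔍.restrictScalars A)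
  have hs : ∃ q : 𝔍.restrictScalars A → (Fin k → A), (∀ r, p (q r) = r) ∧ q 0 = 0 := by
    classical
    choose q hq using hp
    refine ⟨fun r => if r = 0 then 0 else q r, fun r => ?_, by simp⟩
    by_cases hr : r = 0 <;> simp [hr, hq]
  obtain ⟨q, hq, hq0⟩ := hs
  have hq1 : ∀ e, E.g e = 1 → q ⟨γ (E.g e) - 1, h𝔍 _⟩ = 0 := by
    intro e he
    rw [← hq0]
    congr 1
    exact Subtype.ext (by simp [he])
  let a : Fin k → (cochains2 A X x).augIdeal := fun j => mkAug
    ⟨0, fun e => q ⟨γ (E.g e) - 1, h𝔍 _⟩ j, 0, fun v => by rw [hq1 _ (E.g_degenerate v)]; rfl,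
      fun _ _ => rfl⟩ rfl
  have ha : ∀ j, a j ∈ (E.tree.contraction A).letters := fun j => RootedTree.mem_letters.2
    ⟨incl_mem_grading.2 ⟨fun _ _ => rfl, fun h => (h rfl).elim, fun _ _ => rfl⟩, fun v hv => by
      change q ⟨γ (E.g (E.tree.edge v)) - 1, h𝔍 _⟩ j = 0
      rw [hq1 _ (E.g_tree v hv)]; rfl⟩
  have hω : ∑ j, a j ⊗ₜ[A] (p (Pi.single j 1)).1 ∈ tensorSpan
      ((E.tree.contraction A).letters : Set (cochains2 A X x).augIdeal) (𝔍 : Set R) :=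
    sum_mem fun j _ => tmul_mem_tensorSpan (ha j) (p (Pi.single j 1)).2
  have hd := tensorSpan_mono (A := A) (RootedTree.letters_le_degreeOne (T := E.tree))
    (le_refl (𝔍 : Set R)) hω
  have he : ∀ e, evalTensor R (evalEdge e) (∑ j, a j ⊗ₜ[A] (p (Pi.single j 1)).1) =
      γ (E.g e) - 1 := by
    intro e
    have := congrArg Subtype.val (hq ⟨γ (E.g e) - 1, h𝔍 _⟩)
    rw [pi_eq_sum_univ' (q _), map_sum, Submodule.coe_sum] at this
    simp only [map_smul, Submodule.coe_smul] at this
    rw [map_sum]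
    simp only [evalTensor_tmul]
    exact this
  refine ⟨_, hω, he, rTensor_eq_self hd fun u hu => sgn_of_mem_degreeOne hu, ?_⟩
  have hv := fun v => evalTensor_eq_zero hd (α := evalVertex v)
    fun u hu => (mem_degreeOne.1 hu).1 v
  generalize (∑ j, a j ⊗ₜ[A] (p (Pi.single j 1)).1) = ω at *
  refine eq_zero_of_evalTensor (fun v => ?_) (fun e => ?_) (fun s => ?_)
  · rw [map_add, evalTensor_rTensor, evalVertex_tensorMul, hv, zero_mul, add_zero,
      show evalVertex v ∘ₗ (cochains2 A X x).dBar = 0 from rfl]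
    simp [evalTensor]
  · rw [map_add, evalTensor_rTensor, evalEdge_tensorMul, hv, hv, zero_mul, mul_zero, add_zero,
      add_zero, show evalEdge e ∘ₗ (cochains2 A X x).dBar =
        evalVertex (X.δ 0 e) - evalVertex (X.δ 1 e) from rfl, evalTensor_sub, hv, hv, sub_zero]
  · rw [map_add, evalTensor_rTensor, evalTensor_tensorMul s hd,
      show evalTri s ∘ₗ (cochains2 A X x).dBar =
        evalEdge (X.δ 0 s) - evalEdge (X.δ 1 s) + evalEdge (X.δ 2 s) from rfl,
      evalTensor_add, evalTensor_sub, he, he, he, E.g_tri, map_mul]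
    noncomm_ring

end MaurerCartan

end LetterBraiding

namespace LetterBraiding

set_option linter.unusedSectionVars false
set_option maxSynthPendingDepth 3

open Simplicial

section MapPow

variable {R : Type w} {S : Type w'} [Ring R] [Ring S]

lemma exists_mem_pow_of_mem_map_pow {f : R →+* S} (hf : Function.Surjective f) {I : Ideal R}
    [I.IsTwoSided] [(I.map f).IsTwoSided] {n : ℕ} {y : S} (hy : y ∈ I.map f ^ n) :
    ∃ x ∈ I ^ n, f x = y := by
  induction n generalizing y with
  | zero =>
    obtain ⟨x, rfl⟩ := hf y
    exact ⟨x, by rw [Submodule.pow_zero, Ideal.one_eq_top]; trivial, rfl⟩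
  | succ n ih =>
    rw [Ideal.IsTwoSided.pow_succ] at hy
    refine Submodule.smul_induction_on hy (fun a ha b hb => ?_) fun y y' hy hy' => ?_
    · obtain ⟨a, ha', rfl⟩ := (Ideal.mem_map_iff_of_surjective f hf).1 ha
      obtain ⟨b, hb', rfl⟩ := ih hb
      exact ⟨a * b, by rw [Ideal.IsTwoSided.pow_succ]; exact Ideal.mul_mem_mul ha' hb',
        by rw [map_mul, smul_eq_mul]⟩
    · obtain ⟨x, hx, rfl⟩ := hy
      obtain ⟨x', hx', rfl⟩ := hy'
      exact ⟨x + x', add_mem hx hx', map_add f x x'⟩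

lemma map_quotientMk_pow (I : Ideal R) [I.IsTwoSided] (n : ℕ) :
    (I.map (Ideal.Quotient.mk (I ^ n))) ^ n = ⊥ := by
  rw [eq_bot_iff]
  intro y hy
  obtain ⟨x, hx, rfl⟩ := exists_mem_pow_of_mem_map_pow Ideal.Quotient.mk_surjective hy
  exact Ideal.Quotient.eq_zero_iff_mem.2 hx

end MapPow

namespace EdgePathGroup

variable {A : Type v} [CommRing A] {X : SSet.{u}} {x : X _⦋0⦌} {G : Type w} [Group G]
  (E : EdgePathGroup X x G)

lemma normalCocycles_le_Z0 : E.tree.normalCocycles A ≤ (cochains2 A X x).Z0 := fun _ hz =>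
  have h := RootedTree.mem_normalCocycles.1 hz
  ⟨(E.tree.contraction A).letters_mem_barDeg h.1.choose_spec, h.2⟩

variable (A) in
/-- The class of a normal cocycle. -/
noncomputable def normalClass : E.tree.normalCocycles A →ₗ[A] (cochains2 A X x).H0 :=
  (cochains2 A X x).cls ∘ₗ Submodule.inclusion E.normalCocycles_le_Z0

lemma cls_eq_cls_iff {C : AugDGA.{v, w'} A} {z z' : C.Z0} :
    C.cls z = C.cls z' ↔ ∃ w ∈ C.barDeg (-1), C.barDiff w = z.1 - z'.1 :=
  (Submodule.Quotient.eq _).trans Iff.rfl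

lemma exists_normalClass {n : ℕ} {T : (cochains2 A X x).H0}
    (hT : T ∈ (cochains2 A X x).weightFiltration n) :
    ∃ z ∈ E.normalWeight A n, E.normalClass A z = T := by
  obtain ⟨z, hz, rfl⟩ := AugDGA.mem_weightFiltration.1 hT
  obtain ⟨w, hw, h⟩ := (E.tree.contraction A).exists_normalized z.2.1 hz z.2.2
  have hn : z.1 - (cochains2 A X x).barDiff w ∈ E.tree.normalCocycles A :=
    RootedTree.mem_normalCocycles.2 ⟨⟨n, h⟩, by
      rw [map_sub, (cochains2 A X x).barDiff_barDiff, sub_zero]; exact z.2.2⟩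
  refine ⟨⟨_, hn⟩, AugDGA.barSpan_mono_left le_top _ h, (cls_eq_cls_iff.2 ⟨w, hw, ?_⟩).symm⟩
  exact (sub_sub_cancel _ _).symm

lemma exists_mem_weightFiltration {C : AugDGA.{v, w'} A} (T : C.H0) :
    ∃ n, T ∈ C.weightFiltration n := by
  obtain ⟨z, rfl⟩ := Submodule.mkQ_surjective _ T
  obtain ⟨n, hn⟩ := AugDGA.exists_mem_barSpan z.1
  exact ⟨n, AugDGA.mem_weightFiltration.2 ⟨z, hn, rfl⟩⟩

lemma normalPairing_of (z : E.tree.normalCocycles A) (W : FreeGroup (X _⦋1⦌)) :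
    E.normalPairing A z (MonoidAlgebra.of A G (FreeGroup.lift E.g W)) =
      (cochains2 A X x).barCounit (E.tree.barHol W z.1) :=
  (E.barCounit_barHol_normal E.tree LinearMap.id id (fun _ _ => rfl) E.g_tree (fun _ => rfl)
    W z).symm

lemma dual_ext {φ ψ : Module.Dual A (MonoidAlgebra A G)}
    (h : ∀ W, φ (MonoidAlgebra.of A G (FreeGroup.lift E.g W)) =
      ψ (MonoidAlgebra.of A G (FreeGroup.lift E.g W))) : φ = ψ := by
  refine LinearMap.ext fun y => ?_
  induction y using MonoidAlgebra.induction_on with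
  | of g => obtain ⟨W, rfl⟩ := E.exists_word g; exact h W
  | add x y hx hy => rw [map_add, map_add, hx, hy]
  | smul r x hx => rw [map_smul, map_smul, hx]

variable [IsDomain A] [IsPrincipalIdealRing A]

lemma normalClass_bijective : Function.Bijective (E.normalClass A) := by
  refine ⟨?_, fun T => ?_⟩
  · rw [← LinearMap.ker_eq_bot, LinearMap.ker_eq_bot']
    intro z hz
    refine E.normalPairing_injective ?_
    obtain ⟨w, -, hw⟩ := cls_eq_cls_iff.1 (hz.trans (map_zero (cochains2 A X x).cls).symm)
    have hw : (cochains2 A X x).barDiff w = z.1 := hw.trans (sub_zero _)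
    rw [map_zero]
    refine E.dual_ext fun W => ?_
    rw [normalPairing_of, ← hw, RootedTree.barCounit_barHol_barDiff]
    rfl
  · obtain ⟨n, hn⟩ := exists_mem_weightFiltration T
    obtain ⟨z, -, hz⟩ := E.exists_normalClass hn
    exact ⟨z, hz⟩

variable (A) in
/-- Every class has a unique normal representative. -/
noncomputable def normalEquiv : E.tree.normalCocycles A ≃ₗ[A] (cochains2 A X x).H0 :=
  LinearEquiv.ofBijective (E.normalClass A) E.normalClass_bijective

lemma normalEquiv_apply (z : E.tree.normalCocycles A) :
    E.normalEquiv A z = (cochains2 A X x).cls ⟨z.1, E.normalCocycles_le_Z0 z.2⟩ := rfl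

variable (A) in
/-- The pairing of bar cohomology with the group algebra. -/
noncomputable def pairing : (cochains2 A X x).H0 →ₗ[A] Module.Dual A (MonoidAlgebra A G) :=
  E.normalPairing A ∘ₗ (E.normalEquiv A).symm.toLinearMap

lemma pairing_normalEquiv (z : E.tree.normalCocycles A) :
    E.pairing A (E.normalEquiv A z) = E.normalPairing A z := by simp [pairing]

lemma pairing_cls (z : (cochains2 A X x).Z0) (W : FreeGroup (X _⦋1⦌)) :
    E.pairing A ((cochains2 A X x).cls z) (MonoidAlgebra.of A G (FreeGroup.lift E.g W)) =
      (cochains2 A X x).barCounit (E.tree.barHol W z.1) := by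
  obtain ⟨y, hy⟩ := (E.normalEquiv A).surjective ((cochains2 A X x).cls z)
  rw [← hy, pairing_normalEquiv, normalPairing_of]
  rw [normalEquiv_apply] at hy
  obtain ⟨w, -, hw⟩ := cls_eq_cls_iff.1 hy
  rw [← sub_eq_zero, ← map_sub, ← map_sub]
  change (cochains2 A X x).barCounit (E.tree.barHol W (y.1 - z.1)) = 0
  have hw : (cochains2 A X x).barDiff w = y.1 - z.1 := hw
  rw [← hw, RootedTree.barCounit_barHol_barDiff]

lemma pairing_injective : Function.Injective (E.pairing A) :=
  E.normalPairing_injective.comp (E.normalEquiv A).symm.injective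

lemma pairing_one (T : (cochains2 A X x).H0) : E.pairing A T 1 = (cochains2 A X x).counitH0 T := by
  obtain ⟨z, rfl⟩ := (E.normalEquiv A).surjective T
  rw [pairing_normalEquiv, normalPairing_one]
  rfl

lemma exists_normal_of_functional (hG : Group.FG G) {n : ℕ} {φ : Module.Dual A (MonoidAlgebra A G)}
    (hφ : φ ∈ killingPow A (groupAugIdeal A G) (n + 1)) :
    ∃ z ∈ E.normalWeight A n, E.normalPairing A z = φ := by
  let I := groupAugIdeal A G
  let R := MonoidAlgebra A G ⧸ I ^ (n + 1)
  let π : MonoidAlgebra A G →ₐ[A] R := Ideal.Quotient.mkₐ A (I ^ (n + 1))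
  have : RingHomSurjective (Ideal.Quotient.mk (I ^ (n + 1))) := ⟨Ideal.Quotient.mk_surjective⟩
  have : Module.Finite A R := finite_quotient_pow hG (n + 1)
  let γ : G →* R := (π : MonoidAlgebra A G →* R).comp (MonoidAlgebra.of A G)
  let 𝔍 := I.map (Ideal.Quotient.mk (I ^ (n + 1)))
  have h𝔍 : 𝔍 ^ (n + 1) = ⊥ := map_quotientMk_pow I (n + 1)
  obtain ⟨ω, hω, hωe, hMC⟩ := E.exists_isMaurerCartan (A := A) γ 𝔍 fun g => by
    have : γ g - 1 = Ideal.Quotient.mk (I ^ (n + 1)) (MonoidAlgebra.of A G g - 1) := by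
      rw [map_sub, map_one (Ideal.Quotient.mk (I ^ (n + 1)))]
      rfl
    rw [this]
    exact Ideal.mem_map_of_mem _ (of_sub_one_mem g)
  let ψ : R →ₗ[A] A :=
    { toFun := Quotient.lift φ fun x y hxy => by
        have := hφ (x - y) ((Submodule.quotientRel_def _).1 hxy)
        rwa [map_sub, sub_eq_zero] at this
      map_add' := by rintro ⟨x⟩ ⟨y⟩; exact map_add φ x y
      map_smul' := by rintro r ⟨x⟩; exact map_smul φ r x }
  have hω' := tensorSpan_mono (A := A) (Set.subset_univ _) (le_refl (𝔍 : Set R)) hω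
  have hz : slice ψ (AugDGA.barExp ω (n + 1)) ∈
      (cochains2 A X x).barSpan (E.tree.contraction A).letters n :=
    slice_mem (AugDGA.barExp_mem (tensorSpan_mono (A := A) (le_refl _) (Set.subset_univ _) hω) n) ψ
  refine ⟨⟨_, RootedTree.mem_normalCocycles.2 ⟨⟨n, hz⟩,
    AugDGA.barDiff_slice_barExp hω' hMC h𝔍 ψ⟩⟩, AugDGA.barSpan_mono_left le_top _ hz,
    E.dual_ext fun W => ?_⟩
  rw [normalPairing_of]
  refine (barCounit_barHol_barExp E.tree hω' h𝔍 (c := fun e => γ.toHomUnits (E.g e))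
    (fun e => by rw [hωe]; simp) ψ W).trans ?_
  rw [E.hol_map_g γ.toHomUnits]
  rfl

lemma mem_weightFiltration_iff (hG : Group.FG G) {n : ℕ} {T : (cochains2 A X x).H0} :
    T ∈ (cochains2 A X x).weightFiltration n ↔
      E.pairing A T ∈ killingPow A (groupAugIdeal A G) (n + 1) := by
  refine ⟨fun hT => ?_, fun hT => ?_⟩
  · obtain ⟨z, hz, rfl⟩ := E.exists_normalClass hT
    have := E.pairing_normalEquiv z
    exact this ▸ E.normalPairing_mem hz
  · obtain ⟨z, hz, h⟩ := E.exists_normal_of_functional hG hT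
    rw [← pairing_normalEquiv] at h
    rw [← E.pairing_injective h]
    exact AugDGA.mem_weightFiltration.2 ⟨⟨z.1, E.normalCocycles_le_Z0 z.2⟩, hz, rfl⟩

lemma pairing_mem_finiteTypeDual (hG : Group.FG G) (T : (cochains2 A X x).H0) :
    E.pairing A T ∈ finiteTypeDual A (groupAugIdeal A G) := by
  obtain ⟨n, hn⟩ := exists_mem_weightFiltration T
  exact ⟨_, (E.mem_weightFiltration_iff hG).1 hn⟩

/-- The bar cohomology is the space of functionals of finite type on the group algebra. -/
noncomputable def dualEquiv (A : Type v) [CommRing A] [IsDomain A] [IsPrincipalIdealRing A]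
    (hG : Group.FG G) :
    (cochains2 A X x).H0 ≃ₗ[A] finiteTypeDual A (groupAugIdeal A G) :=
  LinearEquiv.ofBijective ((E.pairing A).codRestrict _ (E.pairing_mem_finiteTypeDual hG))
    ⟨fun _ _ h => E.pairing_injective (congrArg Subtype.val h), fun ⟨φ, n, hφ⟩ => by
      obtain ⟨z, hz, h⟩ := E.exists_normal_of_functional hG (killingPow_mono _ n.le_succ hφ)
      exact ⟨E.normalEquiv A z, Subtype.val_injective ((E.pairing_normalEquiv z).trans h)⟩⟩

@[simp] lemma dualEquiv_apply (hG : Group.FG G) (T : (cochains2 A X x).H0) :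
    (E.dualEquiv A hG T).1 = E.pairing A T := rfl

section Functoriality

variable {Y : SSet.{u}} {y : Y _⦋0⦌} (E' : EdgePathGroup Y y G)

open Opposite

lemma edgeOp_barMap_pullback (f : X ⟶ Y) (h : f.app (op ⦋0⦌) x = y) (e : X _⦋1⦌)
    (z : (cochains2 A Y y).Bar) :
    edgeOp e ((pullback A f h).barMap z) =
      (pullback A f h).barMap (edgeOp (f.app (op ⦋1⦌) e) z) := by
  suffices key : edgeOp e ∘ₗ (pullback A f h).barMap =
      (pullback A f h).barMap ∘ₗ edgeOp (f.app (op ⦋1⦌) e) from LinearMap.congr_fun key z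
  refine AugDGA.bar_ext (by simp) fun a u _ => ?_
  have : evalEdge e ((pullback A f h).mapAug a) = evalEdge (f.app (op ⦋1⦌) e) a := rfl
  simp [this]

lemma barCounit_barMap {C : AugDGA.{v, w'} A} {C' : AugDGA.{v, w''} A} (F : AugDGA.Hom C C')
    (z : C.Bar) : C'.barCounit (F.barMap z) = C.barCounit z := by
  suffices key : C'.barCounit ∘ₗ F.barMap = C.barCounit from LinearMap.congr_fun key z
  exact AugDGA.bar_ext (by simp) fun a u _ => by simp

/-- The pairing is natural. -/
theorem pairing_pullback (f : X ⟶ Y) (h : f.app (op ⦋0⦌) x = y)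
    (hg : ∀ e, E.g e = E'.g (f.app (op ⦋1⦌) e)) (T : (cochains2 A Y y).H0) :
    E.pairing A ((pullback A f h).mapH0 T) = E'.pairing A T := by
  obtain ⟨z, rfl⟩ := (E'.normalEquiv A).surjective T
  refine E.dual_ext fun W => ?_
  have e : (pullback A f h).mapH0 (E'.normalEquiv A z) = (cochains2 A X x).cls
    ((pullback A f h).mapZ0 ⟨z.1, E'.normalCocycles_le_Z0 z.2⟩) := rfl
  rw [e, pairing_cls, pairing_normalEquiv]
  refine (E'.barCounit_barHol_normal E.tree (pullback A f h).barMap (f.app (op ⦋1⦌))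
    (edgeOp_barMap_pullback f h) (fun v hv => by rw [← hg, E.g_tree v hv])
    (barCounit_barMap _) W z).trans ?_
  simp only [← hg]

theorem mapH0_pullback_bijective (hG : Group.FG G) (f : X ⟶ Y) (h : f.app (op ⦋0⦌) x = y)
    (hg : ∀ e, E.g e = E'.g (f.app (op ⦋1⦌) e)) :
    Function.Bijective (pullback A f h).mapH0 := by
  have : (pullback A f h).mapH0 = ((E'.dualEquiv A hG).trans (E.dualEquiv A hG).symm).toLinearMap :=
    LinearMap.ext fun T => (E.dualEquiv A hG).injective (Subtype.val_injective
      ((E.pairing_pullback E' f h hg T).trans (by simp)))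
  rw [this]
  exact LinearEquiv.bijective _

end Functoriality

section LetterNumber

lemma barPoly_coeff_one (e : X _⦋1⦌) (z : (cochains2 A X x).Bar) :
    (barPoly e z).coeff 1 = (cochains2 A X x).barCounit (edgeOp e z) := by
  suffices key : Polynomial.lcoeff A 1 ∘ₗ barPoly e = (cochains2 A X x).barCounit ∘ₗ edgeOp e from
    LinearMap.congr_fun key z
  have h1 : barPoly (A := A) (x := x) e (cochains2 A X x).barOne = 1 := by
    rw [AugDGA.barOne, barPoly_ofWeight]
    simp
  have hc : ∀ (a : (cochains2 A X x).augIdeal) u,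
      barPoly e ((cochains2 A X x).barCons a u) = Polynomial.C (evalEdge e a) * Polynomial.X *
        barPoly e u := by
    intro a u
    suffices key : barPoly e ∘ₗ (cochains2 A X x).barCons a =
        LinearMap.mulLeft A (Polynomial.C (evalEdge e a) * Polynomial.X) ∘ₗ barPoly e from
      LinearMap.congr_fun key u
    refine (cochains2 A X x).bar_hom_ext fun p c => ?_
    simp only [LinearMap.comp_apply, AugDGA.barCons_ofWeight, barPoly_ofWeight,
      LinearMap.mulLeft_apply, Fin.prod_univ_succ, Fin.cons_zero, Fin.cons_succ]
    rw [Polynomial.C_mul_X_eq_monomial, Polynomial.monomial_mul_monomial, add_comm]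
  have h0 : ∀ z, (barPoly e z).coeff 0 = (cochains2 A X x).barCounit z := by
    intro z
    suffices key : Polynomial.lcoeff A 0 ∘ₗ barPoly e = (cochains2 A X x).barCounit from
      LinearMap.congr_fun key z
    refine AugDGA.bar_ext (by simp [h1]) fun a u _ => ?_
    simp [hc, mul_assoc]
  refine AugDGA.bar_ext ?_ fun a u _ => ?_
  · simp [h1, Polynomial.coeff_one]
  · simp [hc, mul_assoc, h0]

lemma pairing_g {e : X _⦋1⦌} (h₀ : X.δ 0 e = x) (h₁ : X.δ 1 e = x) (T : (cochains2 A X x).H0) :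
    E.pairing A T (MonoidAlgebra.of A G (E.g e)) =
      (cochains2 A X x).counitH0 T + letterNumber h₀ h₁ T := by
  obtain ⟨z, rfl⟩ := (E.normalEquiv A).surjective T
  have h : letterNumber h₀ h₁ (E.normalEquiv A z) = (cochains2 A X x).barCounit (edgeOp e z.1) :=
    barPoly_coeff_one e z.1
  rw [pairing_normalEquiv, normalPairing_apply, act_edge, map_add, h]
  rfl

end LetterNumber

end EdgePathGroup

end LetterBraiding

namespace LetterBraiding

set_option linter.unusedSectionVars false
set_option maxSynthPendingDepth 3

open Simplicial

namespace EdgePathGroup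

variable {A : Type v} [CommRing A] {X : SSet.{u}} {x : X _⦋0⦌} {G : Type w} [Group G]
  (E : EdgePathGroup X x G)

variable (A) in
/-- The product of the elements `g e - 1` along a word in the edges. -/
noncomputable def wordElement (l : List (X _⦋1⦌)) : MonoidAlgebra A G :=
  l.foldr (fun e y => (MonoidAlgebra.of A G (E.g e) - 1) * y) 1

lemma contrWord_normal (l : List (X _⦋1⦌)) (z : E.tree.normalCocycles A) :
    AugDGA.contrWord evalEdge l z.1 = ((E.act A (E.wordElement A l)).unop z).1 := by
  induction l generalizing z with
  | nil => rw [show E.wordElement A [] = 1 from rfl, map_one]; rfl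
  | cons e l ih =>
    have h : ((E.act A (MonoidAlgebra.of A G (E.g e) - 1)).unop z).1 = edgeOp e z.1 := by
      rw [map_sub, map_one, MulOpposite.unop_sub, LinearMap.sub_apply, MulOpposite.unop_one,
        Module.End.one_apply, Submodule.coe_sub, act_edge, add_sub_cancel_left]
    rw [show E.wordElement A (e :: l) = (MonoidAlgebra.of A G (E.g e) - 1) * E.wordElement A l
      from rfl, act_mul, ← ih, h]
    rfl

lemma barCounit_contrWord_normal (l : List (X _⦋1⦌)) (z : E.tree.normalCocycles A) :
    (cochains2 A X x).barCounit (AugDGA.contrWord evalEdge l z.1) =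
      E.normalPairing A z (E.wordElement A l) := by
  rw [contrWord_normal]
  rfl

lemma contrWord_deconcat {C : AugDGA.{v, w'} A} {ι : Type*} (α : ι → C.augIdeal →ₗ[A] A)
    (l : List ι) (u : C.Bar) :
    TensorProduct.map (AugDGA.contrWord α l) LinearMap.id (C.deconcat u) =
      C.deconcat (AugDGA.contrWord α l u) := by
  induction l generalizing u with
  | nil => simp [AugDGA.contrWord]
  | cons i l ih =>
    rw [AugDGA.contrWord, LinearMap.comp_apply, ← ih, ← AugDGA.contr_deconcat,
      ← LinearMap.comp_apply (TensorProduct.map _ _) (TensorProduct.map _ _),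
      ← TensorProduct.map_comp, LinearMap.comp_id]

/-- The functional on tensors that a pair of words gives. -/
noncomputable def wordPair (C : AugDGA.{v, w'} A) {ι : Type*} (α : ι → C.augIdeal →ₗ[A] A)
    (l l' : List ι) : C.Bar ⊗[A] C.Bar →ₗ[A] A :=
  (TensorProduct.lid A A).toLinearMap ∘ₗ TensorProduct.map
    (C.barCounit ∘ₗ AugDGA.contrWord α l) (C.barCounit ∘ₗ AugDGA.contrWord α l')

lemma wordPair_deconcat {C : AugDGA.{v, w'} A} {ι : Type*} (α : ι → C.augIdeal →ₗ[A] A)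
    (l l' : List ι) (u : C.Bar) : wordPair C α l l' (C.deconcat u) =
      C.barCounit (AugDGA.contrWord α l' (AugDGA.contrWord α l u)) := by
  have h : TensorProduct.map (C.barCounit ∘ₗ AugDGA.contrWord α l)
      (C.barCounit ∘ₗ AugDGA.contrWord α l') =
        TensorProduct.map LinearMap.id (C.barCounit ∘ₗ AugDGA.contrWord α l') ∘ₗ
          TensorProduct.map C.barCounit LinearMap.id ∘ₗ
            TensorProduct.map (AugDGA.contrWord α l) LinearMap.id := by
    rw [← TensorProduct.map_comp, ← TensorProduct.map_comp]
    rfl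
  rw [wordPair, h]
  simp only [LinearMap.comp_apply, contrWord_deconcat]
  conv_rhs => rw [← AugDGA.barCounit_deconcat (C := C) (u := AugDGA.contrWord α l u)]
  generalize TensorProduct.map C.barCounit LinearMap.id
    (C.deconcat (AugDGA.contrWord α l u)) = t
  induction t with
  | zero => simp
  | add t t' h h' => simp only [map_add, h, h']
  | tmul a b => simp

variable [IsDomain A] [IsPrincipalIdealRing A]

/-- Pairs of words separate the tensors of tensors with separated letters. -/
lemma eq_of_wordPair {C : AugDGA.{v, w'} A} {ι : Type*} {α : ι → C.augIdeal →ₗ[A] A}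
    {M : Submodule A C.augIdeal} (hα : ∀ a ∈ M, (∀ i, α i a = 0) → a = 0)
    {V : Submodule A C.Bar} (hV : ∀ u ∈ V, ∃ n, u ∈ C.barSpan M n) {s t : C.Bar ⊗[A] C.Bar}
    (hs : s ∈ LinearMap.range (TensorProduct.map V.subtype V.subtype))
    (ht : t ∈ LinearMap.range (TensorProduct.map V.subtype V.subtype))
    (h : ∀ l l', wordPair C α l l' s = wordPair C α l l' t) : s = t := by
  obtain ⟨s, rfl⟩ := hs
  obtain ⟨t, rfl⟩ := ht
  suffices s - t = 0 by rw [sub_eq_zero.1 this]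
  have sep : ∀ u : V, (∀ l, (C.barCounit ∘ₗ AugDGA.contrWord α l ∘ₗ V.subtype) u = 0) → u = 0 := by
    intro u hu
    obtain ⟨n, hn⟩ := hV u.1 u.2
    exact Subtype.val_injective (AugDGA.eq_zero_of_contrWord α hα hn hu)
  refine tensor_eq_zero_of_separating _ _ sep sep _ fun l l' => ?_
  have key : ∀ t : V ⊗[A] V, TensorProduct.lid A A (TensorProduct.map
      (C.barCounit ∘ₗ AugDGA.contrWord α l ∘ₗ V.subtype)
      (C.barCounit ∘ₗ AugDGA.contrWord α l' ∘ₗ V.subtype) t) =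
        wordPair C α l l' (TensorProduct.map V.subtype V.subtype t) := by
    intro t
    induction t with
    | zero => simp
    | add t t' h h' => simp only [map_add, h, h']
    | tmul a b => simp [wordPair]
  rw [key, map_sub, map_sub, h, sub_self]

lemma finite_quotient_groupAugIdeal (A : Type v) [CommRing A] (hG : Group.FG G) (n : ℕ) :
    Module.Finite A (MonoidAlgebra A G ⧸ groupAugIdeal A G ^ n) :=
  finite_quotient_pow hG n

variable (A) in
/-- The coproduct of bar cohomology. -/
noncomputable def comulH0 (hG : Group.FG G) :
    (cochains2 A X x).H0 →ₗ[A] (cochains2 A X x).H0 ⊗[A] (cochains2 A X x).H0 :=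
  TensorProduct.map (E.dualEquiv A hG).symm.toLinearMap (E.dualEquiv A hG).symm.toLinearMap ∘ₗ
    dualComul A (groupAugIdeal A G) (finite_quotient_groupAugIdeal A hG) ∘ₗ
      (E.dualEquiv A hG).toLinearMap

variable (A) in
/-- The coalgebra structure of bar cohomology. -/
noncomputable abbrev coalgebraH0 (hG : Group.FG G) : Coalgebra A (cochains2 A X x).H0 :=
  letI := dualCoalgebra A (groupAugIdeal A G) (finite_quotient_groupAugIdeal A hG)
  letI : CoalgebraStruct A (cochains2 A X x).H0 :=
    { comul := E.comulH0 A hG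
      counit := (cochains2 A X x).counitH0 }
  CoalgEquiv.toCoalgebra (A := finiteTypeDual A (groupAugIdeal A G))
    { (E.dualEquiv A hG).symm with
      counit_comp := LinearMap.ext fun φ => by
        obtain ⟨T, rfl⟩ := (E.dualEquiv A hG).surjective φ
        refine Eq.trans ?_ (E.pairing_one T).symm
        exact congrArg _ ((E.dualEquiv A hG).symm_apply_apply T)
      map_comp_comul := LinearMap.ext fun φ => by
        refine (congrArg (fun φ => TensorProduct.map (E.dualEquiv A hG).symm.toLinearMap
          (E.dualEquiv A hG).symm.toLinearMap (dualComul A _ _ φ))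
            ((E.dualEquiv A hG).apply_symm_apply φ)).symm }

theorem isBarCoproduct_comulH0 (hG : Group.FG G) :
    (cochains2 A X x).IsBarCoproduct (E.comulH0 A hG) := by
  intro z
  obtain ⟨n, hn⟩ := exists_mem_weightFiltration ((cochains2 A X x).cls z)
  obtain ⟨y, hy, hyz⟩ := E.exists_normalClass hn
  obtain ⟨w, hw, hwz⟩ := cls_eq_cls_iff.1 hyz.symm
  let i := Submodule.inclusion (E.normalCocycles_le_Z0 (A := A))
  let N : finiteTypeDual A (groupAugIdeal A G) →ₗ[A] E.tree.normalCocycles A :=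
    (E.normalEquiv A).symm.toLinearMap ∘ₗ (E.dualEquiv A hG).symm.toLinearMap
  let δ := dualComul A (groupAugIdeal A G) (finite_quotient_groupAugIdeal A hG)
    (E.dualEquiv A hG ((cochains2 A X x).cls z))
  refine ⟨TensorProduct.map (i ∘ₗ N) (i ∘ₗ N) δ, ?_, (cochains2 A X x).deconcat w,
    AugDGA.deconcat_mem_barDeg₂ _ hw, ?_⟩
  · rw [← LinearMap.comp_apply, ← TensorProduct.map_comp]
    have : (cochains2 A X x).cls ∘ₗ i ∘ₗ N = (E.dualEquiv A hG).symm.toLinearMap :=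
      LinearMap.ext fun φ => (E.normalEquiv A).apply_symm_apply _
    rw [this]
    rfl
  · rw [← AugDGA.deconcat_barDiff, hwz, map_sub]
    congr 1
    obtain ⟨⟨m, hm⟩, -⟩ := RootedTree.mem_normalCocycles.1 y.2
    let V : Submodule A (cochains2 A X x).Bar :=
      ⨆ n, (cochains2 A X x).barSpan (E.tree.contraction A).letters n
    have hV : ∀ u ∈ V, ∃ n, u ∈ (cochains2 A X x).barSpan (E.tree.contraction A).letters n :=
      fun u hu => (Submodule.mem_iSup_of_directed _ (AugDGA.barSpan_mono _).directed_le).1 hu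
    refine eq_of_wordPair (α := evalEdge) RootedTree.letters_separated hV ?_ ?_ fun l l' => ?_
    · obtain ⟨t, ht⟩ := AugDGA.deconcat_mem_barSpan _ hm
      change (cochains2 A X x).deconcat y.1 ∈ _
      rw [← ht]
      have hle : (cochains2 A X x).barSpan (E.tree.contraction A).letters m ≤ V := le_iSup _ m
      refine ⟨TensorProduct.map (Submodule.inclusion hle) (Submodule.inclusion hle) t, ?_⟩
      rw [← LinearMap.comp_apply, ← TensorProduct.map_comp]
      rfl
    · rw [← LinearMap.comp_apply, ← TensorProduct.map_comp]
      have hle : E.tree.normalCocycles A ≤ V := inf_le_left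
      refine ⟨TensorProduct.map (Submodule.inclusion hle ∘ₗ N) (Submodule.inclusion hle ∘ₗ N) δ, ?_⟩
      rw [← LinearMap.comp_apply, ← TensorProduct.map_comp]
      rfl
    · have h1 : (cochains2 A X x).Z0.subtype ∘ₗ i ∘ₗ N =
        (E.tree.normalCocycles A).subtype ∘ₗ N := rfl
      have hδ : ∀ δ, wordPair (cochains2 A X x) evalEdge l l' (TensorProduct.map
          ((E.tree.normalCocycles A).subtype ∘ₗ N) ((E.tree.normalCocycles A).subtype ∘ₗ N) δ) =
          pairEval A (groupAugIdeal A G) (E.wordElement A l) (E.wordElement A l') δ := by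
        intro δ
        have hN : ∀ φ, E.normalPairing A (N φ) = φ.1 := fun φ => by
          rw [← pairing_normalEquiv]
          change E.pairing A (E.normalEquiv A ((E.normalEquiv A).symm _)) = _
          rw [LinearEquiv.apply_symm_apply]
          exact congrArg Subtype.val ((E.dualEquiv A hG).apply_symm_apply φ)
        induction δ with
        | zero => simp
        | add t t' h h' => simp only [map_add, h, h']
        | tmul a b =>
          simp only [wordPair, TensorProduct.map_tmul, LinearMap.comp_apply, pairEval_tmul,
            Submodule.subtype_apply, barCounit_contrWord_normal, hN, LinearEquiv.coe_coe,
            TensorProduct.lid_tmul, smul_eq_mul]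
      rw [← LinearMap.comp_apply (TensorProduct.map _ _), ← TensorProduct.map_comp, h1, hδ,
        pairEval_dualComul]
      change wordPair (cochains2 A X x) evalEdge l l' ((cochains2 A X x).deconcat y.1) = _
      rw [wordPair_deconcat, contrWord_normal, barCounit_contrWord_normal, normalPairing_act,
        ← hyz, ← pairing_normalEquiv]
      rfl

theorem isCoalgebraFiltration_comulH0 (hG : Group.FG G) :
    IsCoalgebraFiltration (E.comulH0 A hG) (cochains2 A X x).weightFiltration := by
  refine ⟨fun m n h T hT => ?_, exists_mem_weightFiltration, fun n T hT => ?_⟩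
  · rw [E.mem_weightFiltration_iff hG] at hT ⊢
    exact killingPow_mono _ (by omega) hT
  · rw [E.mem_weightFiltration_iff hG] at hT
    have := dualComul_mem (finite_quotient_groupAugIdeal A hG) (E.dualEquiv A hG T) hT
    have h2 := Submodule.mem_map_of_mem (f := TensorProduct.map
      (E.dualEquiv A hG).symm.toLinearMap (E.dualEquiv A hG).symm.toLinearMap) this
    refine (?_ : Submodule.map _ _ ≤ _) h2
    simp only [Submodule.map_iSup]
    refine iSup_mono fun i => iSup_mono fun j => iSup_mono fun hij => ?_
    rintro _ ⟨_, ⟨t, rfl⟩, rfl⟩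
    have hr : ∀ i, ∀ φ ∈ (killingPow A (groupAugIdeal A G) (i + 1)).comap
        (finiteTypeDual A (groupAugIdeal A G)).subtype,
        (E.dualEquiv A hG).symm.toLinearMap φ ∈ (cochains2 A X x).weightFiltration i := by
      intro i φ hφ
      rw [E.mem_weightFiltration_iff hG, ← E.dualEquiv_apply hG, LinearEquiv.coe_coe,
        LinearEquiv.apply_symm_apply]
      exact hφ
    refine ⟨TensorProduct.map ((E.dualEquiv A hG).symm.toLinearMap.restrict (hr i))
      ((E.dualEquiv A hG).symm.toLinearMap.restrict (hr j)) t, ?_⟩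
    rw [← LinearMap.comp_apply, ← LinearMap.comp_apply, ← TensorProduct.map_comp,
      ← TensorProduct.map_comp]
    rfl

end EdgePathGroup

end LetterBraiding

namespace LetterBraiding

set_option linter.unusedSectionVars false
set_option maxSynthPendingDepth 3

section Limit

variable (A : Type v) [CommRing A] {R : Type w} [Ring R] [Algebra A R] (I : Ideal R)
  [I.IsTwoSided]

/-- The completion with respect to the powers of an ideal. -/
noncomputable def adicLimit : Subalgebra A (∀ n : ℕ, R ⧸ I ^ n) where
  carrier := {s | ∀ m n (h : m ≤ n), Ideal.Quotient.factor (Ideal.pow_le_pow_right h) (s n) = s m}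
  mul_mem' := fun ha hb m n h => by simp [ha m n h, hb m n h]
  add_mem' := fun ha hb m n h => by simp [ha m n h, hb m n h]
  algebraMap_mem' := fun a m n h => rfl

variable {A I}

lemma adicLimit_mk_eq (s : adicLimit A I) {m n : ℕ} (h : m ≤ n) {x : R}
    (hx : Ideal.Quotient.mk (I ^ n) x = s.1 n) : Ideal.Quotient.mk (I ^ m) x = s.1 m := by
  rw [← s.2 m n h, ← hx]
  rfl

lemma exists_mk_eq (s : adicLimit A I) (n : ℕ) : ∃ x, Ideal.Quotient.mk (I ^ n) x = s.1 n :=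
  Ideal.Quotient.mk_surjective _

/-- The element of the completion that a compatible sequence represents. -/
noncomputable def ofSequence (x : ℕ → R) (h : ∀ k, x (k + 1) - x k ∈ I ^ k) : adicLimit A I :=
  ⟨fun k => Ideal.Quotient.mk (I ^ k) (x k), fun m n hmn => by
    change Ideal.Quotient.mk (I ^ m) (x n) = Ideal.Quotient.mk (I ^ m) (x m)
    rw [Ideal.Quotient.eq]
    induction n, hmn using Nat.le_induction with
    | base => rw [sub_self]; exact zero_mem _
    | succ n hmn ih =>
      rw [← sub_add_sub_cancel]
      exact add_mem (Ideal.pow_le_pow_right hmn (h n)) ih⟩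

/-- The value of a functional of finite type on an element of the completion. -/
noncomputable def limitValue (s : adicLimit A I) (φ : finiteTypeDual A I) : A :=
  φ.1 (exists_mk_eq s φ.2.choose).choose

lemma apply_eq_of_mk_eq {n : ℕ} {φ : Module.Dual A R} (hφ : φ ∈ killingPow A I n) {x y : R}
    (h : Ideal.Quotient.mk (I ^ n) x = Ideal.Quotient.mk (I ^ n) y) : φ x = φ y := by
  rw [← sub_eq_zero, ← map_sub]
  exact hφ _ (Ideal.Quotient.eq.1 h)

lemma limitValue_eq (s : adicLimit A I) (φ : finiteTypeDual A I) {n : ℕ}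
    (hφ : φ.1 ∈ killingPow A I n) {x : R} (hx : Ideal.Quotient.mk (I ^ n) x = s.1 n) :
    limitValue s φ = φ.1 x := by
  have hk := φ.2.choose_spec
  have hy := (exists_mk_eq s φ.2.choose).choose_spec
  rw [limitValue]
  generalize (exists_mk_eq s φ.2.choose).choose = y at *
  generalize φ.2.choose = k at *
  rcases le_total k n with h | h
  · exact apply_eq_of_mk_eq hk (hy.trans (adicLimit_mk_eq s h hx).symm)
  · exact apply_eq_of_mk_eq hφ ((adicLimit_mk_eq s h hy).trans hx.symm)

/-- The evaluation of functionals of finite type on an element of the completion. -/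
noncomputable def limitEval (s : adicLimit A I) : finiteTypeDual A I →ₗ[A] A where
  toFun := limitValue s
  map_add' φ ψ := by
    obtain ⟨m, hm⟩ := φ.2
    obtain ⟨n, hn⟩ := ψ.2
    have hm := killingPow_mono I (le_max_left m n) hm
    have hn := killingPow_mono I (le_max_right m n) hn
    obtain ⟨x, hx⟩ := exists_mk_eq s (max m n)
    rw [limitValue_eq s φ hm hx, limitValue_eq s ψ hn hx,
      limitValue_eq s (φ + ψ) (add_mem hm hn) hx]
    rfl
  map_smul' a φ := by
    obtain ⟨m, hm⟩ := φ.2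
    obtain ⟨x, hx⟩ := exists_mk_eq s m
    rw [limitValue_eq s φ hm hx, limitValue_eq s (a • φ) (Submodule.smul_mem _ a hm) hx]
    rfl

lemma limitEval_eq (s : adicLimit A I) (φ : finiteTypeDual A I) {n : ℕ}
    (hφ : φ.1 ∈ killingPow A I n) {x : R} (hx : Ideal.Quotient.mk (I ^ n) x = s.1 n) :
    limitEval s φ = φ.1 x := limitValue_eq s φ hφ hx

lemma exists_limitEval_map_eq (s s' : adicLimit A I)
    (t : finiteTypeDual A I ⊗[A] finiteTypeDual A I) : ∃ N, ∀ n, N ≤ n → ∀ x y,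
      Ideal.Quotient.mk (I ^ n) x = s.1 n → Ideal.Quotient.mk (I ^ n) y = s'.1 n →
        LinearMap.mul' A A (TensorProduct.map (limitEval s) (limitEval s') t) =
          pairEval A I x y t := by
  induction t with
  | zero => exact ⟨0, fun n _ x y _ _ => by simp⟩
  | add t t' h h' =>
    obtain ⟨N, hN⟩ := h
    obtain ⟨N', hN'⟩ := h'
    exact ⟨max N N', fun n hn x y hx hy => by
      rw [map_add, map_add, map_add, hN n (le_of_max_le_left hn) x y hx hy,
        hN' n (le_of_max_le_right hn) x y hx hy]⟩
  | tmul φ ψ =>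
    obtain ⟨m, hm⟩ := φ.2
    obtain ⟨k, hk⟩ := ψ.2
    refine ⟨max m k, fun n hn x y hx hy => ?_⟩
    rw [TensorProduct.map_tmul, LinearMap.mul'_apply, pairEval_tmul,
      limitEval_eq s φ (killingPow_mono I (le_of_max_le_left hn) hm) hx,
      limitEval_eq s' ψ (killingPow_mono I (le_of_max_le_right hn) hk) hy]

variable [IsDomain A] [IsPrincipalIdealRing A]
  {H : Type w'} [AddCommGroup H] [Module A H] [Coalgebra A H] [Coalgebra A (finiteTypeDual A I)]
  (Φ : H ≃ₗc[A] finiteTypeDual A I)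
  (hΔ : ∀ (φ : finiteTypeDual A I) x y, pairEval A I x y (Coalgebra.comul φ) = φ.1 (x * y))
  (hε : ∀ φ : finiteTypeDual A I, Coalgebra.counit (R := A) φ = φ.1 1)

/-- The homomorphism from the completion to the convolution algebra. -/
noncomputable def limitHom : adicLimit A I →ₐ[A] WithConv (H →ₗ[A] A) where
  toFun s := WithConv.toConv (limitEval s ∘ₗ (Φ : H →ₗ[A] finiteTypeDual A I))
  map_one' := by
    refine congrArg WithConv.toConv (LinearMap.ext fun T => ?_)
    obtain ⟨n, hn⟩ := (Φ T).2
    have h := limitEval_eq (1 : adicLimit A I) (Φ T) hn (x := 1) rfl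
    rw [← hε] at h
    exact h.trans (CoalgHomClass.counit_comp_apply Φ T)
  map_mul' s s' := by
    refine congrArg WithConv.toConv (LinearMap.ext fun T => ?_)
    obtain ⟨m, hm⟩ := (Φ T).2
    obtain ⟨N, hN⟩ := exists_limitEval_map_eq s s' (Coalgebra.comul (Φ T))
    obtain ⟨x, hx⟩ := exists_mk_eq s (max m N)
    obtain ⟨y, hy⟩ := exists_mk_eq s' (max m N)
    have h1 := limitEval_eq (s * s') (Φ T) (killingPow_mono I (le_max_left m N) hm) (x := x * y)
      (by rw [map_mul, hx, hy]; rfl)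
    have h2 := hN _ (le_max_right m N) x y hx hy
    rw [hΔ, ← h1] at h2
    refine h2.symm.trans ?_
    have h3 : Coalgebra.comul (Φ T) = TensorProduct.map (Φ : H →ₗ[A] finiteTypeDual A I)
      (Φ : H →ₗ[A] finiteTypeDual A I) (Coalgebra.comul T) :=
        (CoalgHomClass.map_comp_comul_apply Φ T).symm
    rw [h3, ← LinearMap.comp_apply (TensorProduct.map _ _), ← TensorProduct.map_comp]
    rfl
  map_zero' := by
    refine congrArg WithConv.toConv (LinearMap.ext fun T => ?_)
    obtain ⟨n, hn⟩ := (Φ T).2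
    exact (limitEval_eq (0 : adicLimit A I) (Φ T) hn (x := 0) rfl).trans (map_zero _)
  map_add' s s' := by
    refine congrArg WithConv.toConv (LinearMap.ext fun T => ?_)
    obtain ⟨n, hn⟩ := (Φ T).2
    obtain ⟨x, hx⟩ := exists_mk_eq s n
    obtain ⟨y, hy⟩ := exists_mk_eq s' n
    exact (limitEval_eq (s + s') (Φ T) hn (x := x + y) (by rw [map_add, hx, hy]; rfl)).trans
      ((map_add _ _ _).trans (congrArg₂ _ (limitEval_eq s (Φ T) hn hx).symm
        (limitEval_eq s' (Φ T) hn hy).symm))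
  commutes' a := by
    refine congrArg WithConv.toConv (LinearMap.ext fun T => ?_)
    obtain ⟨n, hn⟩ := (Φ T).2
    have h := limitEval_eq (algebraMap A (adicLimit A I) a) (Φ T) hn (x := a • 1)
      (by rw [← Algebra.algebraMap_eq_smul_one]; rfl)
    rw [map_smul, ← hε] at h
    refine h.trans ?_
    rw [CoalgHomClass.counit_comp_apply Φ T]
    rfl

lemma limitHom_apply (s : adicLimit A I) (T : H) {n : ℕ} (hT : (Φ T).1 ∈ killingPow A I n) {x : R}
    (hx : Ideal.Quotient.mk (I ^ n) x = s.1 n) :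
    (limitHom Φ hΔ hε s).ofConv T = (Φ T).1 x := limitEval_eq s (Φ T) hT hx

theorem exists_limitHom_eq (h : ∀ n, Module.Finite A (R ⧸ I ^ n)) (n : ℕ) :
    ∃ m, ∀ f : WithConv (H →ₗ[A] A), (∀ T, (Φ T).1 ∈ killingPow A I m → f.ofConv T = 0) →
      ∃ s : adicLimit A I, s.1 n = 0 ∧ limitHom Φ hΔ hε s = f := by
  obtain ⟨m, hm⟩ := exists_sequence (A := A) h n
  refine ⟨m, fun f hf => ?_⟩
  obtain ⟨x, hx, hxn, hxf⟩ := hm (f.ofConv ∘ₗ (Φ : H ≃ₗ[A] finiteTypeDual A I).symm.toLinearMap)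
    fun φ hφ => hf _ (by
      have : Φ ((Φ : H ≃ₗ[A] finiteTypeDual A I).symm φ) = φ :=
        (Φ : H ≃ₗ[A] finiteTypeDual A I).apply_symm_apply φ
      rwa [LinearEquiv.coe_coe, this])
  refine ⟨ofSequence x hx, Ideal.Quotient.eq_zero_iff_mem.2 hxn,
    congrArg WithConv.toConv (LinearMap.ext fun T => ?_)⟩
  obtain ⟨k, hk⟩ := (Φ T).2
  refine (limitEval_eq (ofSequence x hx) (Φ T) hk rfl).trans ((hxf k _ hk).trans ?_)
  exact congrArg f.ofConv ((Φ : H ≃ₗ[A] finiteTypeDual A I).symm_apply_apply T)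

theorem limitHom_surjective (h : ∀ n, Module.Finite A (R ⧸ I ^ n)) :
    Function.Surjective (limitHom Φ hΔ hε) := by
  intro f
  obtain ⟨m, hm⟩ := exists_limitHom_eq Φ hΔ hε h 0
  obtain ⟨x, hx⟩ := exists_represent h
    (f.ofConv ∘ₗ (Φ : H ≃ₗ[A] finiteTypeDual A I).symm.toLinearMap) m
  let s₀ : adicLimit A I := ofSequence (fun _ => x) fun k => by rw [sub_self]; exact zero_mem _
  obtain ⟨s, -, hs⟩ := hm (f - limitHom Φ hΔ hε s₀) fun T hT => by
    have h1 := limitHom_apply Φ hΔ hε s₀ T hT rfl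
    have h2 : (Φ T).1 x = f.ofConv T := (hx _ hT).trans
      (congrArg f.ofConv ((Φ : H ≃ₗ[A] finiteTypeDual A I).symm_apply_apply T))
    change f.ofConv T - (limitHom Φ hΔ hε s₀).ofConv T = 0
    rw [h1, ← h2, sub_self]
  exact ⟨s + s₀, by rw [map_add, hs, sub_add_cancel]⟩

theorem limitHom_vanish_iff (h : ∀ n, Module.Finite A (R ⧸ I ^ n)) (n : ℕ)
    (s : adicLimit A I) : (∀ T, (Φ T).1 ∈ killingPow A I n → (limitHom Φ hΔ hε s).ofConv T = 0) ↔
      ∃ a : A, a ≠ 0 ∧ a • s.1 n = 0 := by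
  obtain ⟨x, hx⟩ := exists_mk_eq s n
  have h1 : (∃ a : A, a ≠ 0 ∧ a • s.1 n = 0) ↔ x ∈ torsionPow A I n := by
    rw [mem_torsionPow]
    refine exists_congr fun a => and_congr_right fun _ => ?_
    rw [← hx, ← Ideal.Quotient.eq_zero_iff_mem]
    rfl
  rw [h1, mem_torsionPow_iff (h n)]
  refine ⟨fun hs φ hφ => ?_, fun hs T hT => ?_⟩
  · obtain ⟨T, hT⟩ := (Φ : H ≃ₗ[A] finiteTypeDual A I).surjective ⟨φ, n, hφ⟩
    have hT : Φ T = ⟨φ, n, hφ⟩ := hT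
    have hT' : (Φ T).1 ∈ killingPow A I n := by rw [hT]; exact hφ
    have := hs T hT'
    rw [limitHom_apply Φ hΔ hε s T hT' hx, hT] at this
    exact this
  · rw [limitHom_apply Φ hΔ hε s T hT hx]
    exact hs _ hT

theorem limitHom_injective (h : ∀ n, Module.Finite A (R ⧸ I ^ n))
    (htf : ∀ n, Module.IsTorsionFree A (R ⧸ I ^ n)) :
    Function.Injective (limitHom Φ hΔ hε) := by
  rw [injective_iff_map_eq_zero]
  intro s hs
  refine Subtype.val_injective (funext fun n => ?_)
  obtain ⟨a, ha, has⟩ := (limitHom_vanish_iff Φ hΔ hε h n s).1 fun T _ => by rw [hs]; rfl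
  have := htf n
  exact (Module.isTorsionFree_iff_smul_eq_zero.1 (htf n) a _ has).resolve_left ha

end Limit

end LetterBraiding

namespace LetterBraiding

set_option linter.unusedSectionVars false
set_option maxSynthPendingDepth 3

open Simplicial

namespace AugDGA.Hom

variable {A : Type v} [CommRing A] {C : AugDGA.{v, w} A} {C' : AugDGA.{v, w'} A}

/-- The inverse of a bijective homomorphism. -/
noncomputable def symm (F : Hom C C') (hF : Function.Bijective F.toAlgHom) : Hom C' C where
  toAlgHom := (AlgEquiv.ofBijective F.toAlgHom hF).symm
  map_grading n c hc := by
    obtain ⟨b, rfl⟩ := hF.2 c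
    change (AlgEquiv.ofBijective F.toAlgHom hF).symm (AlgEquiv.ofBijective F.toAlgHom hF b) ∈ _
    rw [AlgEquiv.symm_apply_apply]
    have h : ∀ (b : C.carrier) (k : ℕ), F.toAlgHom (DirectSum.decompose C.grading b k) =
        DirectSum.decompose C'.grading (F.toAlgHom b) k := by
      clear hc b
      intro b k
      induction b using DirectSum.Decomposition.inductionOn C.grading with
      | zero => simp
      | @homogeneous m a =>
        by_cases hk : m = k
        · subst hk
          rw [DirectSum.decompose_of_mem_same _ a.2,
            DirectSum.decompose_of_mem_same _ (F.map_grading m a a.2)]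
        · rw [DirectSum.decompose_of_mem_ne _ a.2 hk,
            DirectSum.decompose_of_mem_ne _ (F.map_grading m a a.2) hk, map_zero]
      | add a b ha hb =>
        simp only [DirectSum.decompose_add, map_add, DirectSum.add_apply, Submodule.coe_add, ha, hb]
    have hb : b = DirectSum.decompose C.grading b n := by
      apply hF.1
      rw [h, DirectSum.decompose_of_mem_same _ hc]
    rw [hb]
    exact SetLike.coe_mem _
  map_d c := by
    obtain ⟨b, rfl⟩ := hF.2 c
    apply hF.1
    change (AlgEquiv.ofBijective F.toAlgHom hF) ((AlgEquiv.ofBijective F.toAlgHom hF).symm _) =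
      F.toAlgHom (C.d ((AlgEquiv.ofBijective F.toAlgHom hF).symm
        (AlgEquiv.ofBijective F.toAlgHom hF b)))
    rw [AlgEquiv.apply_symm_apply, AlgEquiv.symm_apply_apply, F.map_d]
  map_aug c := by
    obtain ⟨b, rfl⟩ := hF.2 c
    change C.aug ((AlgEquiv.ofBijective F.toAlgHom hF).symm
        (AlgEquiv.ofBijective F.toAlgHom hF b)) = _
    rw [AlgEquiv.symm_apply_apply, F.map_aug]

lemma symm_mapAug (F : Hom C C') (hF : Function.Bijective F.toAlgHom) (a : C.augIdeal) :
    (F.symm hF).mapAug (F.mapAug a) = a :=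
  C.incl_injective ((AlgEquiv.ofBijective F.toAlgHom hF).symm_apply_apply _)

end AugDGA.Hom

section Nilpotent

variable {R : Type w} [Ring R] {𝔍 : Ideal R} [𝔍.IsTwoSided]

lemma exists_unit_eq {n : ℕ} (hn : 𝔍 ^ n = ⊥) {r : R} (hr : r ∈ 𝔍) : ∃ c : Rˣ, (c : R) = 1 + r := by
  have h : ∀ k, r ^ k ∈ 𝔍 ^ k := by
    intro k
    induction k with
    | zero => rw [Submodule.pow_zero, Ideal.one_eq_top]; trivial
    | succ k ih => rw [Ideal.IsTwoSided.pow_succ, pow_succ']; exact Ideal.mul_mem_mul hr ih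
  have h0 : IsNilpotent r := ⟨n, by have := h n; rwa [hn] at this⟩
  exact h0.isUnit_one_add

/-- The units that are congruent to `1` modulo an ideal. -/
def congruenceUnits (𝔍 : Ideal R) [𝔍.IsTwoSided] : Subgroup Rˣ where
  carrier := {c | (c : R) - 1 ∈ 𝔍}
  one_mem' := by simp
  mul_mem' {a b} ha hb := by
    have : ((a * b : Rˣ) : R) - 1 = (a - 1) * b + (b - 1) := by push_cast; noncomm_ring
    change ((a * b : Rˣ) : R) - 1 ∈ 𝔍
    rw [this]
    exact add_mem (Ideal.mul_mem_right _ _ ha) hb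
  inv_mem' {a} ha := by
    have : ((a⁻¹ : Rˣ) : R) - 1 = - ((a⁻¹ : Rˣ) * ((a : R) - 1)) := by
      rw [mul_sub, Units.inv_mul]; noncomm_ring
    change ((a⁻¹ : Rˣ) : R) - 1 ∈ 𝔍
    rw [this]
    exact neg_mem (Ideal.mul_mem_left _ _ ha)

end Nilpotent

variable {A : Type v} [CommRing A] {X : SSet.{u}} {x : X _⦋0⦌} {R : Type w'} [Ring R] [Algebra A R]

lemma RootedTree.hol_eq_of_gauge (T : RootedTree X x) {Γ : Type*} [Group Γ] {c c' : X _⦋1⦌ → Γ}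
    {f : X _⦋0⦌ → Γ} (hx : f x = 1) (h : ∀ e, f (X.δ 1 e) * c e = c' e * f (X.δ 0 e)) :
    T.hol c = T.hol c' := by
  have hs : ∀ v, T.sol c v = T.sol c' v * f v := fun v => by
    refine (congrFun (T.eq_sol (c := c) (f := fun v => T.sol c' v * f v) (by simp [hx])
      fun v hv => ?_) v).symm
    rw [T.sol_edge c' v hv, mul_assoc, ← h, mul_assoc]
  ext e
  rw [hol_of, hol_of, hs, hs, mul_inv_rev, mul_assoc (T.sol c' _), h]
  group

lemma evalTri_tensorMul (ω ω' : (cochains2 A X x).augIdeal ⊗[A] R) (s : X _⦋2⦌) :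
    evalTensor R (evalTri s) (tensorMul R (cochains2 A X x).mulBar ω ω') =
      evalTensor R (evalVertex (X.δ 1 (X.δ 2 s))) ω * evalTensor R (evalTri s) ω' +
        evalTensor R (evalEdge (X.δ 2 s)) ω * evalTensor R (evalEdge (X.δ 0 s)) ω' +
          evalTensor R (evalTri s) ω * evalTensor R (evalVertex (X.δ 0 (X.δ 0 s))) ω' := by
  induction ω with
  | zero => simp
  | add _ _ h h' => simp only [map_add, LinearMap.add_apply, h, h', add_mul]; abel
  | tmul a r =>
    induction ω' with
    | zero => simp
    | add _ _ h h' => simp only [map_add, h, h', mul_add]; abel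
    | tmul b t =>
      simp only [tensorMul_tmul, evalTensor_tmul, evalTri_mulBar, smul_mul_smul_comm, add_smul]

/-- The solutions of the Maurer-Cartan equation with coefficients in an ideal. -/
def IsFlat (𝔍 : Ideal R) (ω : (cochains2 A X x).augIdeal ⊗[A] R) : Prop :=
  ω ∈ tensorSpan (degreeOne A X x : Set (cochains2 A X x).augIdeal) (𝔍 : Set R) ∧
    AugDGA.IsMaurerCartan ω

namespace IsFlat

variable {𝔍 : Ideal R} {ω : (cochains2 A X x).augIdeal ⊗[A] R}

lemma evalVertex_eq (h : IsFlat 𝔍 ω) (v : X _⦋0⦌) : evalTensor R (evalVertex v) ω = 0 :=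
  evalTensor_eq_zero h.1 fun _ hu => (mem_degreeOne.1 hu).1 v

lemma evalTri_eq (h : IsFlat 𝔍 ω) (s : X _⦋2⦌) : evalTensor R (evalTri s) ω = 0 :=
  evalTensor_eq_zero h.1 fun _ hu => (mem_degreeOne.1 hu).2 s

lemma mem_univ (h : IsFlat 𝔍 ω) : ω ∈ tensorSpan (Set.univ) (𝔍 : Set R) :=
  tensorSpan_mono (A := A) (Set.subset_univ _) le_rfl h.1

lemma evalEdge_mem (h : IsFlat 𝔍 ω) (e : X _⦋1⦌) : evalTensor R (evalEdge e) ω ∈ 𝔍 :=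
  evalTensor_mem (J := 𝔍.restrictScalars A) h.1 (evalEdge e)

lemma exists_units [𝔍.IsTwoSided] (h : IsFlat 𝔍 ω) {n : ℕ} (hn : 𝔍 ^ n = ⊥) :
    ∃ c : X _⦋1⦌ → Rˣ, ∀ e, (c e : R) = 1 + evalTensor R (evalEdge e) ω := by
  choose c hc using fun e => exists_unit_eq hn (h.evalEdge_mem e)
  exact ⟨c, hc⟩

lemma map {Y : SSet.{u'}} {y : Y _⦋0⦌} (h : IsFlat 𝔍 ω)
    (F : AugDGA.Hom (cochains2 A X x) (cochains2 A Y y)) : IsFlat 𝔍 (F.mapAug.rTensor R ω) := by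
  refine ⟨?_, F.isMaurerCartan_map h.2⟩
  have : tensorSpan (A := A) (degreeOne A X x : Set (cochains2 A X x).augIdeal) (𝔍 : Set R) ≤
      (tensorSpan (degreeOne A Y y : Set (cochains2 A Y y).augIdeal) (𝔍 : Set R)).comap
        (F.mapAug.rTensor R) := by
    refine Submodule.span_le.2 ?_
    rintro _ ⟨a, ha, r, hr, rfl⟩
    exact tmul_mem_tensorSpan (F.map_grading 1 _ ha) hr
  exact this h.1

lemma ext [IsDomain A] [IsPrincipalIdealRing A] [Module.Finite A R] (h : IsFlat 𝔍 ω)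
    {ω' : (cochains2 A X x).augIdeal ⊗[A] R} (h' : IsFlat 𝔍 ω')
    (he : ∀ e, evalTensor R (evalEdge e) ω = evalTensor R (evalEdge e) ω') : ω = ω' := by
  rw [← sub_eq_zero]
  refine eq_zero_of_evalTensor (fun v => ?_) (fun e => ?_) (fun s => ?_)
  · rw [map_sub, h.evalVertex_eq, h'.evalVertex_eq, sub_zero]
  · rw [map_sub, he, sub_self]
  · rw [map_sub, h.evalTri_eq, h'.evalTri_eq, sub_zero]

lemma mapCoeff (h : IsFlat 𝔍 ω) {R' : Type*} [Ring R'] [Algebra A R'] {𝔍' : Ideal R'}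
    (ρ : R →ₐ[A] R') (hρ : ∀ r ∈ 𝔍, ρ r ∈ 𝔍') :
    IsFlat 𝔍' (ρ.toLinearMap.lTensor (cochains2 A X x).augIdeal ω) := by
  have h1 : ∀ f : (cochains2 A X x).augIdeal →ₗ[A] (cochains2 A X x).augIdeal, ∀ ω,
      f.rTensor R' (ρ.toLinearMap.lTensor _ ω) = ρ.toLinearMap.lTensor _ (f.rTensor R ω) := by
    intro f ω
    rw [← LinearMap.comp_apply, ← LinearMap.comp_apply, LinearMap.rTensor_comp_lTensor,
      LinearMap.lTensor_comp_rTensor]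
  have h2 : ∀ ω ω' : (cochains2 A X x).augIdeal ⊗[A] R,
      tensorMul R' (cochains2 A X x).mulBar (ρ.toLinearMap.lTensor _ ω)
        (ρ.toLinearMap.lTensor _ ω') =
          ρ.toLinearMap.lTensor _ (tensorMul R (cochains2 A X x).mulBar ω ω') := by
    intro ω ω'
    induction ω with
    | zero => simp
    | add _ _ h h' => simp only [map_add, LinearMap.add_apply, h, h']
    | tmul a r =>
      induction ω' with
      | zero => simp
      | add _ _ h h' => simp only [map_add, h, h']
      | tmul b t => simp
  refine ⟨?_, by rw [h1, h.2.1], by rw [h1, h2, ← map_add, h.2.2, map_zero]⟩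
  have : tensorSpan (A := A) (degreeOne A X x : Set (cochains2 A X x).augIdeal) (𝔍 : Set R) ≤
      (tensorSpan (degreeOne A X x : Set (cochains2 A X x).augIdeal) (𝔍' : Set R')).comap
        (ρ.toLinearMap.lTensor _) := by
    refine Submodule.span_le.2 ?_
    rintro _ ⟨a, ha, r, hr, rfl⟩
    exact tmul_mem_tensorSpan ha (hρ r hr)
  exact this h.1

end IsFlat

/-- The condition that `1 + U` is a gauge transformation from `ω` to `ω'`. -/
def IsGauge (U ω ω' : (cochains2 A X x).augIdeal ⊗[A] R) : Prop :=
  (cochains2 A X x).dBar.rTensor R U = ω - ω' + tensorMul R (cochains2 A X x).mulBar U ω -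
    tensorMul R (cochains2 A X x).mulBar ω' U

lemma IsGauge.edge {U ω ω' : (cochains2 A X x).augIdeal ⊗[A] R} {𝔍 : Ideal R} (h : IsFlat 𝔍 ω)
    (h' : IsFlat 𝔍 ω') (hU : IsGauge U ω ω') (e : X _⦋1⦌) :
    (1 + evalTensor R (evalVertex (X.δ 1 e)) U) * (1 + evalTensor R (evalEdge e) ω) =
      (1 + evalTensor R (evalEdge e) ω') * (1 + evalTensor R (evalVertex (X.δ 0 e)) U) := by
  have h2 := congrArg (evalTensor R (evalEdge e)) hU
  rw [evalTensor_rTensor, show evalEdge e ∘ₗ (cochains2 A X x).dBar =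
    evalVertex (X.δ 0 e) - evalVertex (X.δ 1 e) from rfl, evalTensor_sub, map_sub, map_add,
    map_sub, evalEdge_tensorMul, evalEdge_tensorMul, h.evalVertex_eq, h'.evalVertex_eq] at h2
  generalize evalTensor R (evalVertex (X.δ 0 e)) U = a at *
  generalize evalTensor R (evalVertex (X.δ 1 e)) U = b at *
  generalize evalTensor R (evalEdge e) U = t at *
  generalize evalTensor R (evalEdge e) ω = w at *
  generalize evalTensor R (evalEdge e) ω' = w' at *
  have h3 : (1 + b) * (1 + w) - (1 + w') * (1 + a) =
      (w - w' + (b * w + t * 0) - (0 * t + w' * a)) - (a - b) := by noncomm_ring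
  rw [← sub_eq_zero, h3, h2, sub_self]

lemma IsGauge.map {Y : SSet.{u'}} {y : Y _⦋0⦌} {U ω ω' : (cochains2 A X x).augIdeal ⊗[A] R}
    (hU : IsGauge U ω ω') (F : AugDGA.Hom (cochains2 A X x) (cochains2 A Y y)) :
    IsGauge (F.mapAug.rTensor R U) (F.mapAug.rTensor R ω) (F.mapAug.rTensor R ω') := by
  rw [IsGauge, F.rTensor_dBar, F.tensorMul_mapAug, F.tensorMul_mapAug, hU]
  simp only [map_add, map_sub]

/-- Cochains of degree `0` with coefficients in an ideal that is a finite module. -/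
lemma exists_evalVertex_eq (A : Type v) [CommRing A] [IsNoetherianRing A] {R : Type w'} [Ring R]
    [Algebra A R] [Module.Finite A R] {𝔍 : Ideal R} {f : X _⦋0⦌ → R}
    (hf : ∀ v, f v ∈ 𝔍) (hx : f x = 0) : ∃ U : (cochains2 A X x).augIdeal ⊗[A] R,
      U ∈ tensorSpan (Set.univ) (𝔍 : Set R) ∧ (∀ v, evalTensor R (evalVertex v) U = f v) ∧
      (∀ e, evalTensor R (evalEdge e) U = 0) ∧ ∀ s, evalTensor R (evalTri s) U = 0 := by
  classical
  obtain ⟨k, p, hp⟩ := Module.Finite.exists_fin' A (𝔍.restrictScalars A)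
  choose q hq using fun v => hp ⟨f v, hf v⟩
  let a : Fin k → (cochains2 A X x).augIdeal := fun j => mkAug
    ⟨fun v => if v = x then 0 else q v j, 0, 0, fun _ => rfl, fun _ _ => rfl⟩ (if_pos rfl)
  refine ⟨∑ j, a j ⊗ₜ[A] (p (Pi.single j 1)).1,
    sum_mem fun j _ => tmul_mem_tensorSpan (Set.mem_univ _) (p (Pi.single j 1)).2,
    fun v => ?_, fun e => ?_, fun s => ?_⟩
  · rw [map_sum]
    simp only [evalTensor_tmul]
    by_cases hv : v = x
    · subst hv
      rw [hx]
      exact Finset.sum_eq_zero fun j _ => by rw [evalVertex_root, zero_smul]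
    · have := congrArg Subtype.val (hq v)
      rw [pi_eq_sum_univ' (q v), map_sum, Submodule.coe_sum] at this
      simp only [map_smul, Submodule.coe_smul] at this
      rw [← this]
      refine Finset.sum_congr rfl fun j _ => ?_
      rw [evalVertex_mkAug]
      change (if v = x then 0 else q v j) • _ = _
      rw [if_neg hv]
  · rw [map_sum]
    exact Finset.sum_eq_zero fun j _ => by simp [a]
  · rw [map_sum]
    exact Finset.sum_eq_zero fun j _ => by simp [a]

/-- A function on the vertices that intertwines the values on the edges is a gauge
transformation. -/
lemma isGauge_of_edge [IsDomain A] [IsPrincipalIdealRing A] [Module.Finite A R] {𝔍 : Ideal R}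
    {U ω ω' : (cochains2 A X x).augIdeal ⊗[A] R} (h : IsFlat 𝔍 ω) (h' : IsFlat 𝔍 ω')
    (hU₁ : ∀ e, evalTensor R (evalEdge e) U = 0) (hU₂ : ∀ s, evalTensor R (evalTri s) U = 0)
    (hU : ∀ e, (1 + evalTensor R (evalVertex (X.δ 1 e)) U) * (1 + evalTensor R (evalEdge e) ω) =
      (1 + evalTensor R (evalEdge e) ω') * (1 + evalTensor R (evalVertex (X.δ 0 e)) U)) :
    IsGauge U ω ω' := by
  rw [IsGauge, ← sub_eq_zero]
  refine eq_zero_of_evalTensor (fun v => ?_) (fun e => ?_) (fun s => ?_)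
  · rw [map_sub, map_sub, map_add, map_sub, evalTensor_rTensor, evalVertex_tensorMul,
      evalVertex_tensorMul, h.evalVertex_eq, h'.evalVertex_eq,
      show evalVertex v ∘ₗ (cochains2 A X x).dBar = 0 from rfl]
    simp [evalTensor]
  · have := hU e
    rw [map_sub, map_sub, map_add, map_sub, evalTensor_rTensor, evalEdge_tensorMul,
      evalEdge_tensorMul, h.evalVertex_eq, h'.evalVertex_eq,
      show evalEdge e ∘ₗ (cochains2 A X x).dBar =
        evalVertex (X.δ 0 e) - evalVertex (X.δ 1 e) from rfl, evalTensor_sub]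
    generalize evalTensor R (evalVertex (X.δ 0 e)) U = a at *
    generalize evalTensor R (evalVertex (X.δ 1 e)) U = b at *
    generalize evalTensor R (evalEdge e) U = t at *
    generalize evalTensor R (evalEdge e) ω = w at *
    generalize evalTensor R (evalEdge e) ω' = w' at *
    have h3 : a - b - (w - w' + (b * w + t * 0) - (0 * t + w' * a)) =
        (1 + w') * (1 + a) - (1 + b) * (1 + w) := by noncomm_ring
    rw [h3, this, sub_self]
  · rw [map_sub, map_sub, map_add, map_sub, evalTensor_rTensor, evalTri_tensorMul,
      evalTri_tensorMul, h.evalTri_eq, h'.evalTri_eq, h.evalVertex_eq, h'.evalVertex_eq, hU₁, hU₁,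
      hU₂, show evalTri s ∘ₗ (cochains2 A X x).dBar =
        evalEdge (X.δ 0 s) - evalEdge (X.δ 1 s) + evalEdge (X.δ 2 s) from rfl,
      evalTensor_add, evalTensor_sub, hU₁, hU₁, hU₁]
    simp

end LetterBraiding

namespace LetterBraiding

set_option linter.unusedSectionVars false
set_option maxSynthPendingDepth 3

open Simplicial

section GaugeHolonomy

variable {A : Type v} [CommRing A] {X : SSet.{u}} {x : X _⦋0⦌} {R : Type w'} [Ring R] [Algebra A R]
  {𝔍 : Ideal R} [𝔍.IsTwoSided]

lemma hol_eq_of_isGauge (T : RootedTree X x) {n : ℕ} (hn : 𝔍 ^ n = ⊥)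
    {U ω ω' : (cochains2 A X x).augIdeal ⊗[A] R} (h : IsFlat 𝔍 ω) (h' : IsFlat 𝔍 ω')
    (hU : IsGauge U ω ω') (hU' : U ∈ tensorSpan (Set.univ) (𝔍 : Set R)) {c c' : X _⦋1⦌ → Rˣ}
    (hc : ∀ e, (c e : R) = 1 + evalTensor R (evalEdge e) ω)
    (hc' : ∀ e, (c' e : R) = 1 + evalTensor R (evalEdge e) ω') : T.hol c = T.hol c' := by
  choose f hf using fun v => exists_unit_eq hn
    (evalTensor_mem (J := 𝔍.restrictScalars A) hU' (evalVertex (A := A) (x := x) v))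
  refine T.hol_eq_of_gauge (f := f) ?_ fun e => ?_
  · ext
    rw [hf, show (evalVertex x : (cochains2 A X x).augIdeal →ₗ[A] A) = 0 from
      LinearMap.ext fun a => evalVertex_root a]
    simp [evalTensor]
  · ext
    rw [Units.val_mul, Units.val_mul, hf, hf, hc, hc']
    exact hU.edge h h' e

lemma exists_isGauge [IsDomain A] [IsPrincipalIdealRing A] [Module.Finite A R]
    (T : RootedTree X x)
    {ω η : (cochains2 A X x).augIdeal ⊗[A] R} (h : IsFlat 𝔍 ω) (h' : IsFlat 𝔍 η) {c : X _⦋1⦌ → Rˣ}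
    (hc : ∀ e, (c e : R) = 1 + evalTensor R (evalEdge e) ω)
    (hη : ∀ e, (T.hol c (FreeGroup.of e) : R) = 1 + evalTensor R (evalEdge e) η) :
    ∃ U ∈ tensorSpan (A := A) (Set.univ) (𝔍 : Set R), IsGauge U ω η := by
  have hs : ∀ v, ((T.sol c v : Rˣ) : R) - 1 ∈ 𝔍 := T.sol_mem (S := congruenceUnits 𝔍) fun e => by
    change (c e : R) - 1 ∈ 𝔍
    rw [hc, add_sub_cancel_left]
    exact h.evalEdge_mem e
  obtain ⟨U, hU, hU₀, hU₁, hU₂⟩ := exists_evalVertex_eq A hs (by rw [T.sol_root]; simp)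
  refine ⟨U, hU, isGauge_of_edge h h' hU₁ hU₂ fun e => ?_⟩
  rw [hU₀, hU₀, ← hc, ← hη, add_sub_cancel, add_sub_cancel, ← Units.val_mul, ← Units.val_mul,
    T.hol_of, inv_mul_cancel_right]

lemma IsFlat.slice_mem_Z0 {n : ℕ} (hn : 𝔍 ^ (n + 1) = ⊥) {ω : (cochains2 A X x).augIdeal ⊗[A] R}
    (h : IsFlat 𝔍 ω) (ψ : R →ₗ[A] A) : slice ψ (AugDGA.barExp ω (n + 1)) ∈ (cochains2 A X x).Z0 :=
  ⟨AugDGA.barSpan_le_of (S := fun _ => (cochains2 A X x).barDeg 0) (fun _ => AugDGA.barOne_mem_barDeg)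
    (fun a (ha : a ∈ degreeOne A X x) _ _ hu => AugDGA.barCons_mem_barDeg (n := 1) ha hu (by simp)) n
    (slice_mem (AugDGA.barExp_mem (tensorSpan_mono (A := A) (le_refl _) (Set.subset_univ _) h.1) n) ψ),
    AugDGA.barDiff_slice_barExp h.mem_univ h.2 hn ψ⟩

end GaugeHolonomy

section Truncation

variable (A : Type v) [CommRing A] (G : Type w) [Group G]

/-- The quotient of the group algebra by a power of the augmentation ideal. -/
noncomputable abbrev TruncRing (n : ℕ) := MonoidAlgebra A G ⧸ groupAugIdeal A G ^ n

instance (n : ℕ) : RingHomSurjective (Ideal.Quotient.mk (groupAugIdeal A G ^ n)) :=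
  ⟨Ideal.Quotient.mk_surjective⟩

/-- The augmentation ideal of the truncated group algebra. -/
noncomputable abbrev truncIdeal (n : ℕ) : Ideal (TruncRing A G n) :=
  (groupAugIdeal A G).map (Ideal.Quotient.mk (groupAugIdeal A G ^ n))

/-- The group elements in the truncated group algebra. -/
noncomputable def truncOf (n : ℕ) : G →* TruncRing A G n :=
  ((Ideal.Quotient.mkₐ A (groupAugIdeal A G ^ n) : MonoidAlgebra A G →ₐ[A] TruncRing A G n) :
    MonoidAlgebra A G →* TruncRing A G n).comp (MonoidAlgebra.of A G)

variable {A G}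

lemma truncOf_apply (n : ℕ) (g : G) :
    truncOf A G n g = Ideal.Quotient.mk (groupAugIdeal A G ^ n) (MonoidAlgebra.of A G g) := rfl

lemma truncOf_sub_one_mem (n : ℕ) (g : G) : truncOf A G n g - 1 ∈ truncIdeal A G n := by
  have : truncOf A G n g - 1 =
      Ideal.Quotient.mk (groupAugIdeal A G ^ n) (MonoidAlgebra.of A G g - 1) := by
    rw [map_sub, map_one (Ideal.Quotient.mk _), truncOf_apply]
  rw [this]
  exact Ideal.mem_map_of_mem _ (of_sub_one_mem g)

lemma truncRing_hom_ext {n : ℕ} {S : Type*} [Semiring S] [Algebra A S]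
    {θ θ' : TruncRing A G n →ₐ[A] S} (h : ∀ g, θ (truncOf A G n g) = θ' (truncOf A G n g)) :
    θ = θ' := by
  refine AlgHom.ext fun y => ?_
  obtain ⟨y, rfl⟩ := Ideal.Quotient.mk_surjective y
  change (θ.comp (Ideal.Quotient.mkₐ A _)) y = (θ'.comp (Ideal.Quotient.mkₐ A _)) y
  induction y using MonoidAlgebra.induction_on with
  | of g => exact h g
  | add a b ha hb => rw [map_add, map_add, ha, hb]
  | smul r a ha => rw [map_smul, map_smul, ha]

lemma exists_mem_of_mem_truncIdeal {n : ℕ} {r : TruncRing A G n} (hr : r ∈ truncIdeal A G n) :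
    ∃ y ∈ groupAugIdeal A G, Ideal.Quotient.mk _ y = r :=
  (Ideal.mem_map_iff_of_surjective _ Ideal.Quotient.mk_surjective).1 hr

lemma exists_truncRing_functional {n : ℕ} {φ : Module.Dual A (MonoidAlgebra A G)}
    (hφ : φ ∈ killingPow A (groupAugIdeal A G) n) :
    ∃ ψ : TruncRing A G n →ₗ[A] A, ∀ a, ψ (Ideal.Quotient.mk _ a) = φ a :=
  ⟨{  toFun := Quotient.lift φ fun x y hxy => by
        have := hφ (x - y) ((Submodule.quotientRel_def _).1 hxy)
        rwa [map_sub, sub_eq_zero] at this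
      map_add' := by rintro ⟨x⟩ ⟨y⟩; exact map_add φ x y
      map_smul' := by rintro r ⟨x⟩; exact map_smul φ r x }, fun _ => rfl⟩

lemma exists_truncRing_hom {R : Type w'} [Ring R] [Algebra A R] {𝔍 : Ideal R} [𝔍.IsTwoSided]
    {n : ℕ} (hn : 𝔍 ^ n = ⊥) (f : G →* Rˣ) (hf : ∀ g, f g ∈ congruenceUnits 𝔍) :
    ∃ θ : TruncRing A G n →ₐ[A] R, (∀ g, θ (truncOf A G n g) = f g) ∧
      ∀ y ∈ truncIdeal A G n, θ y ∈ 𝔍 := by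
  let L : MonoidAlgebra A G →ₐ[A] R := MonoidAlgebra.lift A R G ((Units.coeHom R).comp f)
  have hL : groupAugIdeal A G ≤ 𝔍.comap L := by
    intro y hy
    have : Submodule.span A (Set.range fun g : G => MonoidAlgebra.of A G g - 1) ≤
        (𝔍.restrictScalars A).comap L.toLinearMap := by
      refine Submodule.span_le.2 ?_
      rintro _ ⟨g, rfl⟩
      change L (MonoidAlgebra.of A G g - 1) ∈ 𝔍
      rw [map_sub, map_one L, MonoidAlgebra.lift_of]
      exact hf g
    exact this (mem_span_of_mem_groupAugIdeal hy)
  have hpow : ∀ k, groupAugIdeal A G ^ k ≤ (𝔍 ^ k).comap L := by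
    intro k
    induction k with
    | zero => rw [Submodule.pow_zero, Submodule.pow_zero, Ideal.one_eq_top, Ideal.one_eq_top]; simp
    | succ k ih =>
      rw [Ideal.IsTwoSided.pow_succ, Ideal.IsTwoSided.pow_succ, Ideal.mul_le]
      intro a ha b hb
      change L (a * b) ∈ 𝔍 * 𝔍 ^ k
      rw [map_mul]
      exact Ideal.mul_mem_mul (hL ha) (ih hb)
  refine ⟨Ideal.Quotient.liftₐ _ L fun y hy => ?_, fun g => ?_, fun y hy => ?_⟩
  · have := hpow n hy
    rwa [hn] at this
  · exact MonoidAlgebra.lift_of _ _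
  · obtain ⟨y, hy', rfl⟩ := exists_mem_of_mem_truncIdeal hy
    exact hL hy'

end Truncation

namespace EdgePathGroup

variable {A : Type v} [CommRing A] [IsDomain A] [IsPrincipalIdealRing A]
  {X : SSet.{u}} {x : X _⦋0⦌} {G : Type w} [Group G] (E : EdgePathGroup X x G)

/-- The algebra homomorphism that a flat form induces. -/
lemma exists_holonomy {R : Type w'} [Ring R] [Algebra A R] {𝔍 : Ideal R} [𝔍.IsTwoSided]
    {n : ℕ} (hn : 𝔍 ^ n = ⊥) {ω : (cochains2 A X x).augIdeal ⊗[A] R} (h : IsFlat 𝔍 ω) :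
    ∃ θ : TruncRing A G n →ₐ[A] R, (∀ y ∈ truncIdeal A G n, θ y ∈ 𝔍) ∧ ∀ c : X _⦋1⦌ → Rˣ,
      (∀ e, (c e : R) = 1 + evalTensor R (evalEdge e) ω) →
        ∀ W, θ (truncOf A G n (FreeGroup.lift E.g W)) = (E.tree.hol c W : R) := by
  obtain ⟨c, hc⟩ := h.exists_units hn
  obtain ⟨f, hf⟩ := E.exists_lift (fun e => E.tree.hol c (FreeGroup.of e)) (fun s => by
      have h1 : c (X.δ 1 s) = c (X.δ 2 s) * c (X.δ 0 s) := Units.ext (by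
        rw [Units.val_mul, hc, hc, hc]; exact h.2.triangle h.1 s)
      simp only [RootedTree.hol_of, h1]
      rw [Cochains2.δ1_δ2, Cochains2.δ0_δ1, Cochains2.δ0_δ2]
      group) (fun v hv => by
      rw [RootedTree.hol_of, ← E.tree.sol_edge c v hv]
      group)
  have hfW : ∀ W, f (FreeGroup.lift E.g W) = E.tree.hol c W := by
    have : f.comp (FreeGroup.lift E.g) = E.tree.hol c := by
      ext e
      simp [hf]
    exact DFunLike.congr_fun this
  obtain ⟨θ, hθ, hθ'⟩ := exists_truncRing_hom (A := A) hn f fun g => by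
    obtain ⟨W, rfl⟩ := E.exists_word g
    rw [hfW]
    refine E.tree.hol_mem (fun e => ?_) W
    change (c e : R) - 1 ∈ 𝔍
    rw [hc, add_sub_cancel_left]
    exact h.evalEdge_mem e
  refine ⟨θ, hθ', fun c' hc' W => ?_⟩
  rw [show c' = c from funext fun e => Units.ext ((hc' e).trans (hc e).symm), hθ, hfW]

variable [hG : Group.FG G]

instance (n : ℕ) : Module.Finite A (TruncRing A G n) := finite_quotient_pow hG n

lemma exists_universal (A : Type v) [CommRing A] [IsDomain A] [IsPrincipalIdealRing A] (n : ℕ) :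
    ∃ ω : (cochains2 A X x).augIdeal ⊗[A] TruncRing A G n, IsFlat (truncIdeal A G n) ω ∧
      ∀ e, evalTensor _ (evalEdge e) ω = truncOf A G n (E.g e) - 1 := by
  obtain ⟨ω, hω, hωe, hMC⟩ := E.exists_isMaurerCartan (A := A) (truncOf A G n) (truncIdeal A G n)
    (truncOf_sub_one_mem n)
  exact ⟨ω, ⟨tensorSpan_mono (A := A) RootedTree.letters_le_degreeOne le_rfl hω, hMC⟩, hωe⟩

/-- The universal flat form with coefficients in a truncated group algebra. -/
noncomputable def universal (A : Type v) [CommRing A] [IsDomain A] [IsPrincipalIdealRing A]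
    (n : ℕ) : (cochains2 A X x).augIdeal ⊗[A] TruncRing A G n := (E.exists_universal A n).choose

lemma universal_isFlat (n : ℕ) : IsFlat (truncIdeal A G n) (E.universal A n) :=
  (E.exists_universal A n).choose_spec.1

lemma evalTensor_universal (n : ℕ) (e : X _⦋1⦌) :
    evalTensor _ (evalEdge e) (E.universal A n) = truncOf A G n (E.g e) - 1 :=
  (E.exists_universal A n).choose_spec.2 e

lemma truncIdeal_pow (n : ℕ) : truncIdeal A G n ^ n = ⊥ := map_quotientMk_pow _ n

lemma lTensor_universal {m n : ℕ} (h : m ≤ n) :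
    (Ideal.Quotient.factorₐ A (Ideal.pow_le_pow_right h) :
      TruncRing A G n →ₐ[A] TruncRing A G m).toLinearMap.lTensor _ (E.universal A n) =
        E.universal A m := by
  refine ((E.universal_isFlat n).mapCoeff _ fun r hr => ?_).ext (E.universal_isFlat m) fun e => ?_
  · obtain ⟨y, hy, rfl⟩ := exists_mem_of_mem_truncIdeal hr
    exact Ideal.mem_map_of_mem _ hy
  · rw [evalTensor_map, evalTensor_universal, evalTensor_universal]
    rw [map_sub]
    congr 1

variable {Y : SSet.{u'}} {y : Y _⦋0⦌} {G' : Type w''} [Group G'] (E' : EdgePathGroup Y y G')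
  [hG' : Group.FG G'] (F : AugDGA.Hom (cochains2 A X x) (cochains2 A Y y))

/-- The homomorphism of truncated group algebras that a homomorphism of cochain algebras
induces. -/
noncomputable def transfer (n : ℕ) : TruncRing A G' n →ₐ[A] TruncRing A G n :=
  (E'.exists_holonomy (truncIdeal_pow n) ((E.universal_isFlat n).map F)).choose

lemma transfer_mem {n : ℕ} {r : TruncRing A G' n} (hr : r ∈ truncIdeal A G' n) :
    E.transfer E' F n r ∈ truncIdeal A G n :=
  (E'.exists_holonomy (truncIdeal_pow n) ((E.universal_isFlat n).map F)).choose_spec.1 r hr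

lemma transfer_truncOf {n : ℕ} {c : Y _⦋1⦌ → (TruncRing A G n)ˣ}
    (hc : ∀ e, (c e : TruncRing A G n) =
      1 + evalTensor _ (evalEdge e) (F.mapAug.rTensor _ (E.universal A n)))
    (W : FreeGroup (Y _⦋1⦌)) :
    E.transfer E' F n (truncOf A G' n (FreeGroup.lift E'.g W)) = (E'.tree.hol c W : _) :=
  (E'.exists_holonomy (truncIdeal_pow n) ((E.universal_isFlat n).map F)).choose_spec.2 c hc W

lemma factor_transfer {m n : ℕ} (h : m ≤ n) (r : TruncRing A G' n) :
    Ideal.Quotient.factorₐ A (Ideal.pow_le_pow_right h) (E.transfer E' F n r) =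
      E.transfer E' F m (Ideal.Quotient.factorₐ A (Ideal.pow_le_pow_right h) r) := by
  refine DFunLike.congr_fun (f := (Ideal.Quotient.factorₐ A (Ideal.pow_le_pow_right h) :
      TruncRing A G n →ₐ[A] TruncRing A G m).comp (E.transfer E' F n))
    (g := (E.transfer E' F m).comp (Ideal.Quotient.factorₐ A (Ideal.pow_le_pow_right h)))
    (truncRing_hom_ext fun g => ?_) r
  obtain ⟨W, rfl⟩ := E'.exists_word g
  obtain ⟨c, hc⟩ := ((E.universal_isFlat n).map F).exists_units (truncIdeal_pow n)
  let ρ : TruncRing A G n →ₐ[A] TruncRing A G m :=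
    Ideal.Quotient.factorₐ A (Ideal.pow_le_pow_right h)
  have hc' : ∀ e, (Units.map (ρ : TruncRing A G n →* TruncRing A G m) (c e) : TruncRing A G m) =
      1 + evalTensor _ (evalEdge e) (F.mapAug.rTensor _ (E.universal A m)) := by
    intro e
    rw [← E.lTensor_universal h, ← LinearMap.comp_apply (LinearMap.rTensor _ _),
      LinearMap.rTensor_comp_lTensor, ← LinearMap.lTensor_comp_rTensor, LinearMap.comp_apply,
      evalTensor_map]
    change ρ (c e) = 1 + ρ _
    rw [hc, map_add, map_one]
  change ρ (E.transfer E' F n _) = E.transfer E' F m (truncOf A G' m (FreeGroup.lift E'.g W))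
  rw [E.transfer_truncOf E' F hc, E.transfer_truncOf E' F hc', ← E'.tree.hol_map]
  rfl

lemma transfer_transfer (hF : Function.Bijective F.toAlgHom) (n : ℕ) :
    (E.transfer E' F n).comp (E'.transfer E (F.symm hF) n) = AlgHom.id A _ := by
  refine truncRing_hom_ext fun g => ?_
  obtain ⟨W, rfl⟩ := E.exists_word g
  have h1 := (E.universal_isFlat (A := A) n).map F
  have h2 := (E'.universal_isFlat (A := A) n).map (F.symm hF)
  obtain ⟨c, hc⟩ := h1.exists_units (truncIdeal_pow n)
  obtain ⟨c', hc'⟩ := h2.exists_units (truncIdeal_pow n)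
  let θ := E.transfer E' F n
  have h3 := (E'.universal_isFlat (A := A) n).mapCoeff θ fun r hr => E.transfer_mem E' F hr
  obtain ⟨U, hU, hg⟩ := exists_isGauge E'.tree h1 h3 hc fun e => by
    rw [evalTensor_map, evalTensor_universal, ← E.transfer_truncOf E' F hc, FreeGroup.lift_apply_of]
    change θ _ = 1 + θ _
    rw [map_sub, map_one θ, add_sub_cancel]
  have hU' : (F.symm hF).mapAug.rTensor _ U ∈
      tensorSpan (A := A) (Set.univ) (truncIdeal A G n : Set (TruncRing A G n)) := by
    have : tensorSpan (A := A) (Set.univ : Set (cochains2 A Y y).augIdeal)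
        (truncIdeal A G n : Set (TruncRing A G n)) ≤
          (tensorSpan (Set.univ) (truncIdeal A G n : Set (TruncRing A G n))).comap
            ((F.symm hF).mapAug.rTensor _) := by
      refine Submodule.span_le.2 ?_
      rintro _ ⟨a, ha, r, hr, rfl⟩
      exact tmul_mem_tensorSpan (Set.mem_univ _) hr
    exact this hU
  have h4 := hg.map (F.symm hF)
  have h5 : (F.symm hF).mapAug.rTensor _ (F.mapAug.rTensor _ (E.universal A n)) =
      E.universal A n := by
    rw [← LinearMap.comp_apply, ← LinearMap.rTensor_comp,
      show (F.symm hF).mapAug ∘ₗ F.mapAug = LinearMap.id from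
        LinearMap.ext (F.symm_mapAug hF), LinearMap.rTensor_id]
    rfl
  rw [h5] at h4
  have h6 := hol_eq_of_isGauge E.tree (truncIdeal_pow n) (E.universal_isFlat n)
    (h3.map (F.symm hF)) h4 hU' (c := fun e => (truncOf A G n).toHomUnits (E.g e))
    (c' := fun e => Units.map (θ : TruncRing A G' n →* TruncRing A G n) (c' e))
    (fun e => by rw [evalTensor_universal, MonoidHom.coe_toHomUnits, add_sub_cancel]) fun e => by
      rw [← LinearMap.comp_apply (LinearMap.rTensor _ _),
        LinearMap.rTensor_comp_lTensor, ← LinearMap.lTensor_comp_rTensor, LinearMap.comp_apply,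
        evalTensor_map]
      change θ (c' e) = 1 + θ _
      rw [hc', map_add, map_one θ]
  change θ (E'.transfer E (F.symm hF) n (truncOf A G n (FreeGroup.lift E.g W))) =
    truncOf A G n (FreeGroup.lift E.g W)
  rw [E'.transfer_truncOf E (F.symm hF) hc']
  have h7 := E.hol_map_g (truncOf A G n).toHomUnits W
  rw [h6] at h7
  have h8 := E.tree.hol_map (c := c') (Units.map (θ : TruncRing A G' n →* TruncRing A G n)) W
  exact congrArg Units.val (h8.trans h7)

lemma symm_symm (hF : Function.Bijective F.toAlgHom)
    (hF' : Function.Bijective (F.symm hF).toAlgHom) : (F.symm hF).symm hF' = F := by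
  have : ∀ {F F' : AugDGA.Hom (cochains2 A X x) (cochains2 A Y y)},
      F.toAlgHom = F'.toAlgHom → F = F' := by
    rintro ⟨⟩ ⟨⟩ rfl; rfl
  refine this (AlgHom.ext fun a => hF'.1 ?_)
  change (F.symm hF).toAlgHom ((AlgEquiv.ofBijective (F.symm hF).toAlgHom hF').symm a) =
    (AlgEquiv.ofBijective F.toAlgHom hF).symm (AlgEquiv.ofBijective F.toAlgHom hF a)
  rw [AlgEquiv.symm_apply_apply]
  exact (AlgEquiv.ofBijective (F.symm hF).toAlgHom hF').apply_symm_apply a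

/-- The isomorphism of truncated group algebras that an isomorphism of cochain algebras
induces. -/
noncomputable def transferEquiv (hF : Function.Bijective F.toAlgHom) (n : ℕ) :
    TruncRing A G' n ≃ₐ[A] TruncRing A G n :=
  AlgEquiv.ofAlgHom (E.transfer E' F n) (E'.transfer E (F.symm hF) n)
    (E.transfer_transfer E' F hF n) (by
      have hF' : Function.Bijective (F.symm hF).toAlgHom :=
        (AlgEquiv.ofBijective F.toAlgHom hF).symm.bijective
      have := E'.transfer_transfer E (F.symm hF) hF' n
      rwa [symm_symm F hF hF'] at this)

theorem pairing_mapH0 {n : ℕ} {T : (cochains2 A X x).H0}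
    (hT : T ∈ (cochains2 A X x).weightFiltration n) {a : MonoidAlgebra A G}
    {b : MonoidAlgebra A G'} (h : E.transfer E' F (n + 1)
      (Ideal.Quotient.mk (groupAugIdeal A G' ^ (n + 1)) b) =
        Ideal.Quotient.mk (groupAugIdeal A G ^ (n + 1)) a) :
    E.pairing A T a = E'.pairing A (F.mapH0 T) b := by
  have hφ := (E.mem_weightFiltration_iff hG).1 hT
  obtain ⟨ψ, hψ⟩ := exists_truncRing_functional hφ
  have hf := E.universal_isFlat (A := A) (n + 1)
  have hf' := hf.map F
  have h1 : T = (cochains2 A X x).cls ⟨_, hf.slice_mem_Z0 (truncIdeal_pow _) ψ⟩ := by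
    refine E.pairing_injective (E.dual_ext fun W => ?_)
    rw [pairing_cls]
    refine ((barCounit_barHol_barExp E.tree hf.mem_univ (truncIdeal_pow _)
      (c := fun e => (truncOf A G (n + 1)).toHomUnits (E.g e))
      (fun e => by rw [evalTensor_universal]; simp) ψ W).trans ?_).symm
    rw [E.hol_map_g (truncOf A G (n + 1)).toHomUnits]
    exact hψ _
  have h2 : F.mapH0 T = (cochains2 A Y y).cls ⟨_, hf'.slice_mem_Z0 (truncIdeal_pow _) ψ⟩ := by
    rw [h1]
    change (cochains2 A Y y).cls _ = _
    congr 1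
    refine Subtype.ext ?_
    change F.barMap (slice ψ _) = slice ψ _
    rw [← slice_rTensor, F.rTensor_barMap_barExp]
  have h3 : E'.pairing A (F.mapH0 T) =
      ψ ∘ₗ (E.transfer E' F (n + 1)).toLinearMap ∘ₗ (Ideal.Quotient.mkₐ A _).toLinearMap := by
    refine E'.dual_ext fun W => ?_
    obtain ⟨c, hc⟩ := hf'.exists_units (truncIdeal_pow _)
    rw [h2, pairing_cls]
    refine (barCounit_barHol_barExp E'.tree hf'.mem_univ (truncIdeal_pow _) hc ψ W).trans ?_
    rw [← E.transfer_truncOf E' F hc]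
    rfl
  rw [h3]
  change _ = ψ (E.transfer E' F (n + 1) (Ideal.Quotient.mk _ b))
  rw [h, hψ]

end EdgePathGroup

section Limit

variable {A : Type v} [CommRing A] {R : Type w} [Ring R] [Algebra A R] {I : Ideal R}
  [I.IsTwoSided] {R' : Type w'} [Ring R'] [Algebra A R'] {I' : Ideal R'} [I'.IsTwoSided]

/-- The homomorphism of completions that compatible homomorphisms induce. -/
noncomputable def adicLimitMap (θ : ∀ n, R ⧸ I ^ n →ₐ[A] R' ⧸ I' ^ n)
    (h : ∀ m n (hmn : m ≤ n) r, Ideal.Quotient.factor (Ideal.pow_le_pow_right hmn) (θ n r) =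
      θ m (Ideal.Quotient.factor (Ideal.pow_le_pow_right hmn) r)) :
    adicLimit A I →ₐ[A] adicLimit A I' where
  toFun s := ⟨fun n => θ n (s.1 n), fun m n hmn => by rw [h m n hmn, s.2 m n hmn]⟩
  map_one' := Subtype.ext (funext fun n => map_one (θ n))
  map_mul' s t := Subtype.ext (funext fun n => map_mul (θ n) _ _)
  map_zero' := Subtype.ext (funext fun n => map_zero (θ n))
  map_add' s t := Subtype.ext (funext fun n => map_add (θ n) _ _)
  commutes' a := Subtype.ext (funext fun n => (θ n).commutes a)

/-- The isomorphism of completions that compatible isomorphisms induce. -/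
noncomputable def adicLimitEquiv (θ : ∀ n, (R ⧸ I ^ n) ≃ₐ[A] R' ⧸ I' ^ n)
    (h : ∀ m n (hmn : m ≤ n) r, Ideal.Quotient.factor (Ideal.pow_le_pow_right hmn) (θ n r) =
      θ m (Ideal.Quotient.factor (Ideal.pow_le_pow_right hmn) r)) :
    adicLimit A I ≃ₐ[A] adicLimit A I' :=
  AlgEquiv.ofAlgHom (adicLimitMap (fun n => (θ n : R ⧸ I ^ n →ₐ[A] R' ⧸ I' ^ n)) h)
    (adicLimitMap (fun n => ((θ n).symm : R' ⧸ I' ^ n →ₐ[A] R ⧸ I ^ n)) fun m n hmn r => by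
      apply (θ m).injective
      obtain ⟨r, rfl⟩ := (θ n).surjective r
      change θ m (Ideal.Quotient.factor _ ((θ n).symm (θ n r))) = θ m ((θ m).symm _)
      rw [AlgEquiv.symm_apply_apply, AlgEquiv.apply_symm_apply, h m n hmn])
    (AlgHom.ext fun s => Subtype.ext (funext fun n => (θ n).apply_symm_apply _))
    (AlgHom.ext fun s => Subtype.ext (funext fun n => (θ n).symm_apply_apply _))

end Limit

namespace EdgePathGroup

theorem exists_completion_equiv {A : Type v} [CommRing A] [IsDomain A] [IsPrincipalIdealRing A]
    {X : SSet.{u}} {x : X _⦋0⦌} {G : Type w} [Group G] [Group.FG G] (E : EdgePathGroup X x G)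
    {Y : SSet.{u'}} {y : Y _⦋0⦌} {G' : Type w''} [Group G'] [Group.FG G']
    (E' : EdgePathGroup Y y G') (F : AugDGA.Hom (cochains2 A X x) (cochains2 A Y y))
    (hF : Function.Bijective F.toAlgHom) :
    ∃ Θ : adicLimit A (groupAugIdeal A G') ≃ₐ[A] adicLimit A (groupAugIdeal A G),
      (∀ n s, (Θ s).1 n = 0 ↔ s.1 n = 0) ∧
      ∀ n, ∀ T ∈ (cochains2 A X x).weightFiltration n, ∀ (s : adicLimit A (groupAugIdeal A G'))
        (a : MonoidAlgebra A G) (b : MonoidAlgebra A G'),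
        Ideal.Quotient.mk _ a = (Θ s).1 (n + 1) → Ideal.Quotient.mk _ b = s.1 (n + 1) →
          E.pairing A T a = E'.pairing A (F.mapH0 T) b :=
  ⟨adicLimitEquiv (E.transferEquiv E' F hF) fun _ _ hmn r => E.factor_transfer E' F hmn r,
    fun n s => map_eq_zero_iff _ (E.transferEquiv E' F hF n).injective,
    fun n T hT s a b ha hb => E.pairing_mapH0 E' F hT (by rw [ha, hb]; rfl)⟩

end EdgePathGroup

end LetterBraiding

namespace LetterBraiding

set_option linter.unusedSectionVars false
set_option maxSynthPendingDepth 3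

open Simplicial Opposite

section AffineSimplices

variable {E : Type*} [AddCommGroup E] [Module ℝ E] [TopologicalSpace E] [ContinuousAdd E]
  [ContinuousSMul ℝ E] {s : Set E} (hs : Convex ℝ s)

/-- The affine simplex with given vertices in a convex set. -/
noncomputable def affineSimplex {n : ℕ} (a : Fin (n + 1) → s) :
    C(stdSimplex ℝ (Fin (n + 1)), s) where
  toFun t := ⟨∑ i, t i • (a i : E),
    hs.sum_mem (fun i _ => t.2.1 i) t.2.2 (fun i _ => (a i).2)⟩
  continuous_toFun := by
    refine Continuous.subtype_mk (continuous_finsetSum _ fun i _ => ?_) _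
    exact ((continuous_apply i).comp continuous_subtype_val).smul continuous_const

lemma affineSimplex_coe {n : ℕ} (a : Fin (n + 1) → s) (t : stdSimplex ℝ (Fin (n + 1))) :
    (affineSimplex hs a t : E) = ∑ i, t i • (a i : E) := rfl

lemma affineSimplex_map {m n : ℕ} (f : Fin (m + 1) → Fin (n + 1)) (a : Fin (n + 1) → s)
    (t : stdSimplex ℝ (Fin (m + 1))) :
    affineSimplex hs a (stdSimplex.map f t) = affineSimplex hs (a ∘ f) t := by
  classical
  refine Subtype.ext ?_
  rw [affineSimplex_coe, affineSimplex_coe]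
  simp only [stdSimplex.map_coe, FunOnFinite.linearMap_apply_apply, Finset.sum_smul]
  rw [← Finset.sum_fiberwise Finset.univ f fun i => t i • ((a ∘ f) i : E)]
  refine Finset.sum_congr rfl fun j _ => Finset.sum_congr rfl fun i hi => ?_
  rw [Function.comp_apply, (Finset.mem_filter.1 hi).2]

lemma affineSimplex_vertex {n : ℕ} (a : Fin (n + 1) → s) (i : Fin (n + 1)) :
    affineSimplex hs a (stdSimplex.vertex i) = a i := by
  refine Subtype.ext ?_
  rw [affineSimplex_coe]
  simp [Pi.single_apply]

lemma affineSimplex_stdSimplex {n : ℕ} (t : stdSimplex ℝ (Fin (n + 1))) :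
    affineSimplex (convex_stdSimplex ℝ (Fin (n + 1))) (fun i => stdSimplex.vertex i) t = t := by
  refine Subtype.ext (funext fun j => ?_)
  rw [affineSimplex_coe, Finset.sum_apply]
  simp [Pi.single_apply]
  rfl

variable {Z : TopCat.{u}}

/-- The singular simplex that is affine in a convex set. -/
noncomputable def affineSing (Q : C(s, Z)) {n : ℕ} (a : Fin (n + 1) → s) :
    (TopCat.toSSet.obj Z) _⦋n⦌ :=
  (Z.toSSetObjEquiv (op ⦋n⦌)).symm (Q.comp (affineSimplex hs a))

lemma toSSetObjEquiv_affineSing (Q : C(s, Z)) {n : ℕ} (a : Fin (n + 1) → s)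
    (t : stdSimplex ℝ (Fin (n + 1))) :
    Z.toSSetObjEquiv (op ⦋n⦌) (affineSing hs Q a) t = Q (affineSimplex hs a t) := rfl

lemma sing_ext {n : ℕ} {σ τ : (TopCat.toSSet.obj Z) _⦋n⦌}
    (h : ∀ t : stdSimplex ℝ (Fin (n + 1)), Z.toSSetObjEquiv (op ⦋n⦌) σ t =
      Z.toSSetObjEquiv (op ⦋n⦌) τ t) : σ = τ :=
  (Z.toSSetObjEquiv (op ⦋n⦌)).injective (ContinuousMap.ext h)

lemma δ_affineSing (Q : C(s, Z)) {n : ℕ} (a : Fin (n + 2) → s) (i : Fin (n + 2)) :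
    (TopCat.toSSet.obj Z).δ i (affineSing hs Q a) = affineSing hs Q (a ∘ i.succAbove) :=
  sing_ext fun t => by
    rw [toSSetObjEquiv_affineSing, ← affineSimplex_map]
    rfl

lemma affineSing_congr {E' : Type*} [AddCommGroup E'] [Module ℝ E'] [TopologicalSpace E']
    [ContinuousAdd E'] [ContinuousSMul ℝ E'] {s' : Set E'} (hs' : Convex ℝ s') {Q : C(s, Z)}
    {Q' : C(s', Z)} {n : ℕ} {a : Fin (n + 1) → s} {a' : Fin (n + 1) → s'}
    (h : ∀ t, Q (affineSimplex hs a t) = Q' (affineSimplex hs' a' t)) :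
    affineSing hs Q a = affineSing hs' Q' a' :=
  sing_ext h

/-- A singular simplex, as a map on the standard simplex. -/
noncomputable abbrev singMap {n : ℕ} (σ : (TopCat.toSSet.obj Z) _⦋n⦌) :
    C(stdSimplex ℝ (Fin (n + 1)), Z) := Z.toSSetObjEquiv (op ⦋n⦌) σ

lemma affineSing_singMap {n : ℕ} (σ : (TopCat.toSSet.obj Z) _⦋n⦌) :
    affineSing (convex_stdSimplex ℝ (Fin (n + 1))) (singMap σ) (fun i => stdSimplex.vertex i) =
      σ :=
  sing_ext fun t => by rw [toSSetObjEquiv_affineSing, affineSimplex_stdSimplex]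

/-- The cocycles on the edges of a simplicial set with values in a group. -/
def IsCocycle {X : SSet.{u}} {Γ : Type*} [Group Γ] (h : X _⦋1⦌ → Γ) : Prop :=
  ∀ s : X _⦋2⦌, h (X.δ 1 s) = h (X.δ 2 s) * h (X.δ 0 s)

variable {Γ : Type*} [Group Γ] {h : (TopCat.toSSet.obj Z) _⦋1⦌ → Γ}


lemma IsCocycle.affineSing_mul (hh : IsCocycle h) (Q : C(s, Z)) (a b c : s) :
    h (affineSing hs Q ![a, c]) = h (affineSing hs Q ![a, b]) * h (affineSing hs Q ![b, c]) := by
  have := hh (affineSing hs Q ![a, b, c])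
  rw [δ_affineSing, δ_affineSing, δ_affineSing] at this
  have e1 : ![a, b, c] ∘ Fin.succAbove 1 = ![a, c] := by funext i; fin_cases i <;> rfl
  have e2 : ![a, b, c] ∘ Fin.succAbove 2 = ![a, b] := by funext i; fin_cases i <;> rfl
  have e0 : ![a, b, c] ∘ Fin.succAbove 0 = ![b, c] := by funext i; fin_cases i <;> rfl
  rwa [e1, e2, e0] at this

end AffineSimplices

section Paths

variable {E : Type*} [AddCommGroup E] [Module ℝ E] [TopologicalSpace E] [ContinuousAdd E]
  [ContinuousSMul ℝ E] {s : Set E} (hs : Convex ℝ s) {Z : TopCat.{u}}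

/-- A path, as an edge of the singular simplicial set. -/
noncomputable def pathEdge {a b : Z} (γ : Path a b) : (TopCat.toSSet.obj Z) _⦋1⦌ :=
  affineSing (convex_Icc (0 : ℝ) 1) γ.toContinuousMap ![0, 1]

lemma affineSimplex_zero_one (t : stdSimplex ℝ (Fin 2)) :
    affineSimplex (convex_Icc (0 : ℝ) 1) ![0, 1] t = stdSimplexHomeomorphUnitInterval t := by
  refine Subtype.ext ?_
  rw [affineSimplex_coe, Fin.sum_univ_two]
  simp [stdSimplexHomeomorphUnitInterval, stdSimplexEquivIcc]
  rfl

lemma singMap_pathEdge {a b : Z} (γ : Path a b) (t : stdSimplex ℝ (Fin 2)) :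
    singMap (pathEdge γ) t = γ (stdSimplexHomeomorphUnitInterval t) := by
  rw [← affineSimplex_zero_one]
  rfl

variable {Γ : Type*} [Group Γ] {h : (TopCat.toSSet.obj Z) _⦋1⦌ → Γ}

namespace IsCocycle

lemma affineSing_self (hh : IsCocycle h) (Q : C(s, Z)) (a : s) :
    h (affineSing hs Q ![a, a]) = 1 :=
  left_eq_mul.1 (hh.affineSing_mul hs Q a a a)

lemma affineSing_symm (hh : IsCocycle h) (Q : C(s, Z)) (a b : s) :
    h (affineSing hs Q ![b, a]) = (h (affineSing hs Q ![a, b]))⁻¹ := by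
  rw [eq_inv_iff_mul_eq_one, ← hh.affineSing_mul, hh.affineSing_self]

lemma pathEdge_refl (hh : IsCocycle h) (a : Z) : h (pathEdge (Path.refl a)) = 1 := by
  rw [← hh.affineSing_self (convex_Icc (0 : ℝ) 1) (Path.refl a).toContinuousMap 0]
  exact congrArg h (affineSing_congr _ _ fun t => rfl)

lemma pathEdge_symm (hh : IsCocycle h) {a b : Z} (γ : Path a b) :
    h (pathEdge γ.symm) = (h (pathEdge γ))⁻¹ := by
  rw [pathEdge, pathEdge, ← hh.affineSing_symm]
  refine congrArg h (affineSing_congr _ _ fun t => congrArg γ (Subtype.ext ?_))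
  have := stdSimplex.add_eq_one t
  rw [affineSimplex_coe, Fin.sum_univ_two, unitInterval.coe_symm_eq, affineSimplex_coe,
    Fin.sum_univ_two]
  simp
  linarith

lemma pathEdge_trans (hh : IsCocycle h) {a b c : Z} (γ : Path a b) (γ' : Path b c) :
    h (pathEdge (γ.trans γ')) = h (pathEdge γ) * h (pathEdge γ') := by
  have h2 : (2⁻¹ : ℝ) ∈ unitInterval := ⟨by norm_num, by norm_num⟩
  rw [pathEdge, hh.affineSing_mul (convex_Icc (0 : ℝ) 1) _ 0 ⟨2⁻¹, h2⟩ 1]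
  congr 2 <;> refine affineSing_congr _ _ fun t => ?_
  · have h1 := stdSimplex.add_eq_one t
    have h3 : ((affineSimplex (convex_Icc (0 : ℝ) 1) ![0, ⟨2⁻¹, h2⟩] t : Set.Icc (0 : ℝ) 1) : ℝ) =
        t 1 / 2 := by
      rw [affineSimplex_coe, Fin.sum_univ_two]; simp; ring
    have h4 : ((affineSimplex (convex_Icc (0 : ℝ) 1) ![0, 1] t : Set.Icc (0 : ℝ) 1) : ℝ) = t 1 := by
      rw [affineSimplex_coe, Fin.sum_univ_two]; simp
    change (γ.trans γ') _ = γ _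
    rw [Path.trans_apply, dif_pos (by rw [h3]; linarith [stdSimplex.le_one t 1])]
    exact congrArg γ (Subtype.ext (by simp only [h3, h4]; ring))
  · have h1 := stdSimplex.add_eq_one t
    have h3 : ((affineSimplex (convex_Icc (0 : ℝ) 1) ![⟨2⁻¹, h2⟩, 1] t : Set.Icc (0 : ℝ) 1) : ℝ) =
        (1 + t 1) / 2 := by
      rw [affineSimplex_coe, Fin.sum_univ_two]; simp; linarith
    have h4 : ((affineSimplex (convex_Icc (0 : ℝ) 1) ![0, 1] t : Set.Icc (0 : ℝ) 1) : ℝ) = t 1 := by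
      rw [affineSimplex_coe, Fin.sum_univ_two]; simp
    change (γ.trans γ') _ = γ' _
    rw [Path.trans_apply]
    split_ifs with h5
    · have h6 : t 1 = 0 := by
        rw [h3] at h5
        exact le_antisymm (by linarith) (stdSimplex.zero_le t 1)
      rw [show affineSimplex (convex_Icc (0 : ℝ) 1) ![0, 1] t = 0 from Subtype.ext (h4.trans h6),
        γ'.source]
      convert γ.target using 2
      refine Subtype.ext ?_
      simp only [h3, h6]
      norm_num
    · exact congrArg γ' (Subtype.ext (by simp only [h3, h4]; ring))

lemma pathEdge_congr (hh : IsCocycle h) {a b : Z} {γ γ' : Path a b} (H : γ.Homotopic γ') :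
    h (pathEdge γ) = h (pathEdge γ') := by
  obtain ⟨F⟩ := H
  have hK : Convex ℝ (Set.Icc (0 : ℝ × ℝ) 1) := convex_Icc _ _
  let p : Set.Icc (0 : ℝ × ℝ) 1 → unitInterval × unitInterval := fun q =>
    (⟨q.1.1, q.2.1.1, q.2.2.1⟩, ⟨q.1.2, q.2.1.2, q.2.2.2⟩)
  have hp : Continuous p := by fun_prop
  let Q : C(Set.Icc (0 : ℝ × ℝ) 1, Z) := ⟨fun q => F (p q), F.continuous.comp hp⟩
  let k : unitInterval → unitInterval → Set.Icc (0 : ℝ × ℝ) 1 := fun i j =>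
    ⟨(i.1, j.1), ⟨i.2.1, j.2.1⟩, ⟨i.2.2, j.2.2⟩⟩
  have haff : ∀ (i j i' j' : unitInterval) (t : stdSimplex ℝ (Fin 2)),
      p (affineSimplex hK ![k i j, k i' j'] t) =
        (affineSimplex (convex_Icc (0 : ℝ) 1) ![i, i'] t,
          affineSimplex (convex_Icc (0 : ℝ) 1) ![j, j'] t) := by
    intro i j i' j' t
    refine Prod.ext (Subtype.ext ?_) (Subtype.ext ?_)
    · change (affineSimplex hK ![k i j, k i' j'] t : ℝ × ℝ).1 = _
      rw [affineSimplex_coe, affineSimplex_coe, Fin.sum_univ_two, Fin.sum_univ_two]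
      rfl
    · change (affineSimplex hK ![k i j, k i' j'] t : ℝ × ℝ).2 = _
      rw [affineSimplex_coe, affineSimplex_coe, Fin.sum_univ_two, Fin.sum_univ_two]
      rfl
  have hself : ∀ (j : unitInterval) (t : stdSimplex ℝ (Fin 2)),
      affineSimplex (convex_Icc (0 : ℝ) 1) ![j, j] t = j := by
    intro j t
    refine Subtype.ext ?_
    rw [affineSimplex_coe, Fin.sum_univ_two]
    have := stdSimplex.add_eq_one t
    simp only [Matrix.cons_val_zero, Matrix.cons_val_one, ← add_smul, this, one_smul]
  have hside : ∀ (j : unitInterval) (c : Z), (∀ i, F (i, j) = c) →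
      h (affineSing hK Q ![k 0 j, k 1 j]) = 1 := by
    intro j c hc
    rw [← hh.affineSing_self (convex_Icc (0 : ℝ) 1) (ContinuousMap.const _ c) 0]
    refine congrArg h (affineSing_congr _ _ fun t => ?_)
    change F (p _) = c
    rw [haff, hself, hc]
  have e1 : h (pathEdge γ) = h (affineSing hK Q ![k 0 0, k 0 1]) := by
    refine congrArg h (affineSing_congr _ _ fun t => ?_)
    change _ = F (p _)
    rw [haff, hself, F.apply_zero]
  have e2 : h (pathEdge γ') = h (affineSing hK Q ![k 1 0, k 1 1]) := by
    refine congrArg h (affineSing_congr _ _ fun t => ?_)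
    change _ = F (p _)
    rw [haff, hself, F.apply_one]
  have h1 := hside 0 a (fun i => by rw [F.source])
  have h2 := hside 1 b (fun i => by rw [F.target])
  have h3 := hh.affineSing_mul hK Q (k 0 0) (k 0 1) (k 1 1)
  rw [hh.affineSing_mul hK Q (k 0 0) (k 1 0) (k 1 1), h1, h2, one_mul, mul_one] at h3
  rw [e1, e2, h3]

end IsCocycle

end Paths

end LetterBraiding

namespace LetterBraiding

set_option linter.unusedSectionVars false
set_option maxSynthPendingDepth 3

open Simplicial Opposite

lemma RootedTree.isCocycle_of {X : SSet.{u}} {x : X _⦋0⦌} (T : RootedTree X x) :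
    IsCocycle fun e => (PresentedGroup.of e : PresentedGroup T.rels) := fun s =>
  (mul_inv_eq_one.1 (PresentedGroup.one_of_mem (Or.inl ⟨s, rfl⟩))).symm

lemma RootedTree.of_edge {X : SSet.{u}} {x : X _⦋0⦌} (T : RootedTree X x) {v : X _⦋0⦌}
    (hv : v ≠ x) : (PresentedGroup.of (T.edge v) : PresentedGroup T.rels) = 1 :=
  PresentedGroup.one_of_mem (Or.inr ⟨v, hv, rfl⟩)

section SegmentPaths

variable {E : Type*} [AddCommGroup E] [Module ℝ E] [TopologicalSpace E] [IsTopologicalAddGroup E]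
  [ContinuousSMul ℝ E] {s : Set E} (hs : Convex ℝ s) {Z : TopCat.{u}}

/-- The segment between two points of a convex set. -/
noncomputable def segment (a b : s) : Path a b where
  toFun t := affineSimplex hs ![a, b] (stdSimplexHomeomorphUnitInterval.symm t)
  continuous_toFun := by fun_prop
  source' := by
    rw [← stdSimplexHomeomorphUnitInterval_zero, Homeomorph.symm_apply_apply, affineSimplex_vertex]
    rfl
  target' := by
    rw [← stdSimplexHomeomorphUnitInterval_one, Homeomorph.symm_apply_apply, affineSimplex_vertex]
    rfl

lemma segment_trans (a b c : s) :
    ((segment hs a b).trans (segment hs b c)).Homotopic (segment hs a c) := by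
  have := hs.contractibleSpace ⟨_, a.2⟩
  exact SimplyConnectedSpace.paths_homotopic _ _

variable {x : Z} (p : ∀ y, Path.Homotopic.Quotient x y)

/-- The class of a path, completed to a loop by given classes of paths. -/
noncomputable def pathClass {a b : Z} (γ : Path a b) : (FundamentalGroup Z x)ᵐᵒᵖ :=
  MulOpposite.op (FundamentalGroup.fromPath
    (((p a).trans (Path.Homotopic.Quotient.mk γ)).trans (p b).symm))

lemma pathClass_congr {a b a' b' : Z} {γ : Path a b} {γ' : Path a' b'} (h : ∀ t, γ t = γ' t) :
    pathClass p γ = pathClass p γ' := by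
  obtain rfl : a = a' := by simpa using h 0
  obtain rfl : b = b' := by simpa using h 1
  obtain rfl : γ = γ' := Path.ext (funext h)
  rfl

lemma pathClass_eq_of_homotopic {a b : Z} {γ γ' : Path a b} (h : γ.Homotopic γ') :
    pathClass p γ = pathClass p γ' := by
  rw [pathClass, pathClass, show Path.Homotopic.Quotient.mk γ = Path.Homotopic.Quotient.mk γ' from
    Quotient.sound h]

lemma pathClass_trans {a b c : Z} (γ : Path a b) (γ' : Path b c) :
    pathClass p (γ.trans γ') = pathClass p γ * pathClass p γ' := by
  have key : ∀ (P : FundamentalGroupoid.mk x ⟶ ⟨a⟩) (Q : FundamentalGroupoid.mk x ⟶ ⟨b⟩)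
      (R : FundamentalGroupoid.mk x ⟶ ⟨c⟩) (g : FundamentalGroupoid.mk a ⟶ ⟨b⟩)
      (g' : FundamentalGroupoid.mk b ⟶ ⟨c⟩), (P ≫ g ≫ g') ≫ inv R =
        ((P ≫ g) ≫ inv Q) ≫ (Q ≫ g') ≫ inv R := by
    intro P Q R g g'
    simp
  have := key (p a) (p b) (p c) (Path.Homotopic.Quotient.mk γ) (Path.Homotopic.Quotient.mk γ')
  simp only [← Groupoid.inv_eq_inv] at this
  exact congrArg MulOpposite.op this

/-- The edges of the singular simplicial set, as paths. -/
noncomputable def edgePath (e : (TopCat.toSSet.obj Z) _⦋1⦌) :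
    Path (singMap e (stdSimplex.vertex 0)) (singMap e (stdSimplex.vertex 1)) where
  toFun t := singMap e (stdSimplexHomeomorphUnitInterval.symm t)
  continuous_toFun := by fun_prop
  source' := by
    rw [← stdSimplexHomeomorphUnitInterval_zero, Homeomorph.symm_apply_apply]
  target' := by
    rw [← stdSimplexHomeomorphUnitInterval_one, Homeomorph.symm_apply_apply]

lemma pathClass_affineSing (Q : C(s, Z)) (a b : s) :
    pathClass p (edgePath (affineSing hs Q ![a, b])) =
      pathClass p ((segment hs a b).map Q.continuous) :=
  pathClass_congr p fun _ => rfl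

lemma isCocycle_pathClass : IsCocycle fun e : (TopCat.toSSet.obj Z) _⦋1⦌ =>
    pathClass p (edgePath e) := by
  intro σ
  have h : ∀ (i : Fin 3) (j k : Fin 3), (i.succAbove 0 = j) → i.succAbove 1 = k →
      (TopCat.toSSet.obj Z).δ i σ = affineSing (convex_stdSimplex ℝ (Fin 3)) (singMap σ)
        ![stdSimplex.vertex j, stdSimplex.vertex k] := by
    rintro i _ _ rfl rfl
    conv_lhs => rw [← affineSing_singMap σ, δ_affineSing]
    congr 1
    funext k; fin_cases k <;> rfl
  have h' : ∀ i j k : Fin 3, i.succAbove 0 = j → i.succAbove 1 = k →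
      pathClass p (edgePath ((TopCat.toSSet.obj Z).δ i σ)) =
        pathClass p ((segment (convex_stdSimplex ℝ (Fin 3)) (stdSimplex.vertex j)
          (stdSimplex.vertex k)).map (singMap σ).continuous) := by
    intro i j k hj hk
    rw [h i j k hj hk]
    exact pathClass_affineSing _ _ _ _ _
  beta_reduce
  rw [h' 1 0 2 rfl rfl, h' 2 0 1 rfl rfl, h' 0 1 2 rfl rfl]
  rw [← pathClass_trans, ← Path.map_trans]
  exact (pathClass_eq_of_homotopic p ((segment_trans _ _ _ _).map (singMap σ))).symm

lemma edgePath_pathEdge {a b : Z} (γ : Path a b) (t : unitInterval) :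
    edgePath (pathEdge γ) t = γ t := by
  change singMap (pathEdge γ) _ = _
  rw [singMap_pathEdge, Homeomorph.apply_symm_apply]

lemma pathEdge_edgePath (e : (TopCat.toSSet.obj Z) _⦋1⦌) : pathEdge (edgePath e) = e :=
  sing_ext fun t => by
    change singMap (pathEdge _) t = _
    rw [singMap_pathEdge]
    change singMap e _ = _
    rw [Homeomorph.symm_apply_apply]

lemma pathClass_edgePath_pathEdge {a b : Z} (γ : Path a b) :
    pathClass p (edgePath (pathEdge γ)) = pathClass p γ :=
  pathClass_congr p (edgePath_pathEdge γ)

lemma δ_one_pathEdge {a b : Z} (γ : Path a b) :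
    (TopCat.toSSet.obj Z).δ 1 (pathEdge γ) = TopCat.toSSetObj₀Equiv.symm a := by
  rw [pathEdge, δ_affineSing]
  refine sing_ext fun t => ?_
  obtain rfl := Subsingleton.elim t (stdSimplex.vertex 0)
  rw [toSSetObjEquiv_affineSing, affineSimplex_vertex]
  exact γ.source

lemma δ_zero_pathEdge {a b : Z} (γ : Path a b) :
    (TopCat.toSSet.obj Z).δ 0 (pathEdge γ) = TopCat.toSSetObj₀Equiv.symm b := by
  rw [pathEdge, δ_affineSing]
  refine sing_ext fun t => ?_
  obtain rfl := Subsingleton.elim t (stdSimplex.vertex 0)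
  rw [toSSetObjEquiv_affineSing, affineSimplex_vertex]
  exact γ.target

open Classical in
/-- The tree in the singular simplicial set whose edges are given paths from the base point. -/
noncomputable def starTree : RootedTree (TopCat.toSSet.obj Z) (TopCat.toSSetObj₀Equiv.symm x) where
  parent _ := TopCat.toSSetObj₀Equiv.symm x
  edge v := pathEdge (p (TopCat.toSSetObj₀Equiv v)).out
  rank v := if v = TopCat.toSSetObj₀Equiv.symm x then 0 else 1
  rank_parent v hv := by simp [hv]
  ends v _ := Or.inl ⟨δ_one_pathEdge _, (δ_zero_pathEdge _).trans (Equiv.symm_apply_apply _ _)⟩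

lemma pathClass_out (hp : p x = Path.Homotopic.Quotient.refl x) (y : Z) :
    pathClass p (p y).out = 1 := by
  have : Path.Homotopic.Quotient.mk (p y).out = p y := Quotient.out_eq _
  rw [pathClass, this, hp]
  have key : ∀ (P : FundamentalGroupoid.mk x ⟶ ⟨y⟩), (𝟙 (FundamentalGroupoid.mk x) ≫ P) ≫ inv P =
      𝟙 _ := by
    intro P
    simp
  have := key (p y)
  simp only [← Groupoid.inv_eq_inv] at this
  exact congrArg MulOpposite.op this

lemma pathClass_loop (hp : p x = Path.Homotopic.Quotient.refl x) (γ : Path x x) :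
    pathClass p γ = MulOpposite.op (FundamentalGroup.fromPath (Path.Homotopic.Quotient.mk γ)) := by
  rw [pathClass, hp]
  have key : ∀ (g : FundamentalGroupoid.mk x ⟶ ⟨x⟩), (𝟙 (FundamentalGroupoid.mk x) ≫ g) ≫
      inv (𝟙 _) = g := by
    intro P
    simp
  have := key (Path.Homotopic.Quotient.mk γ)
  simp only [← Groupoid.inv_eq_inv] at this
  exact congrArg MulOpposite.op this

variable {Γ : Type*} [Group Γ] {h : (TopCat.toSSet.obj Z) _⦋1⦌ → Γ}

/-- The homomorphism on the fundamental group that a cocycle induces. -/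
noncomputable def IsCocycle.hom (hh : IsCocycle h) (x : Z) : (FundamentalGroup Z x)ᵐᵒᵖ →* Γ where
  toFun g := Quotient.lift (fun γ : Path x x => h (pathEdge γ))
    (fun _ _ H => hh.pathEdge_congr H) (FundamentalGroup.toPath g.unop)
  map_one' := hh.pathEdge_refl x
  map_mul' a b := by
    obtain ⟨γ, hγ⟩ := Quotient.exists_rep (FundamentalGroup.toPath a.unop)
    obtain ⟨γ', hγ'⟩ := Quotient.exists_rep (FundamentalGroup.toPath b.unop)
    have : FundamentalGroup.toPath (a * b).unop =
        Path.Homotopic.Quotient.mk (γ.trans γ') := by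
      change Path.Homotopic.Quotient.trans (FundamentalGroup.toPath a.unop)
        (FundamentalGroup.toPath b.unop) = _
      rw [← hγ, ← hγ']
      rfl
    rw [this, ← hγ, ← hγ']
    exact hh.pathEdge_trans γ γ'

lemma IsCocycle.hom_pathClass (hh : IsCocycle h) {a b : Z} (γ : Path a b) :
    hh.hom x (pathClass p γ) =
      h (pathEdge (p a).out) * h (pathEdge γ) * (h (pathEdge (p b).out))⁻¹ := by
  rw [← hh.pathEdge_symm, ← hh.pathEdge_trans, ← hh.pathEdge_trans]
  have : pathClass p γ = MulOpposite.op (FundamentalGroup.fromPath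
      (Path.Homotopic.Quotient.mk (((p a).out.trans γ).trans (p b).out.symm))) := by
    have h1 : ∀ y, Path.Homotopic.Quotient.mk (p y).out = p y := fun y => Quotient.out_eq _
    rw [Path.Homotopic.Quotient.mk_trans, Path.Homotopic.Quotient.mk_trans,
      Path.Homotopic.Quotient.mk_symm, h1, h1]
    rfl
  rw [this]
  rfl

/-- The fundamental group of a space is the edge path group of its singular simplicial set. -/
noncomputable def singGroup (hp : p x = Path.Homotopic.Quotient.refl x) :
    EdgePathGroup (TopCat.toSSet.obj Z) (TopCat.toSSetObj₀Equiv.symm x)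
      (FundamentalGroup Z x)ᵐᵒᵖ where
  tree := starTree p
  g e := pathClass p (edgePath e)
  g_tri := isCocycle_pathClass p
  g_tree v _ := (pathClass_edgePath_pathEdge p _).trans (pathClass_out p hp _)
  closure_range := by
    rw [eq_top_iff]
    rintro g -
    refine Subgroup.subset_closure ?_
    obtain ⟨γ, hγ⟩ := Quotient.exists_rep (FundamentalGroup.toPath g.unop)
    exact ⟨pathEdge γ, (pathClass_edgePath_pathEdge p γ).trans
      ((pathClass_loop p hp γ).trans (congrArg MulOpposite.op hγ))⟩
  ρ := (starTree p).isCocycle_of.hom x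
  ρ_g e := by
    have h1 : ∀ y, (PresentedGroup.of (pathEdge (p y).out) :
        PresentedGroup (starTree p).rels) = 1 := by
      intro y
      by_cases hy : TopCat.toSSetObj₀Equiv.symm y = TopCat.toSSetObj₀Equiv.symm x
      · obtain rfl := TopCat.toSSetObj₀Equiv.symm.injective hy
        have : Path.Homotopic.Quotient.mk (p y).out = Path.Homotopic.Quotient.mk (Path.refl y) :=
          (Quotient.out_eq (p y)).trans hp
        exact ((starTree p).isCocycle_of.pathEdge_congr (Quotient.exact this)).trans
          ((starTree p).isCocycle_of.pathEdge_refl y)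
      · have := (starTree p).of_edge hy
        rwa [show (starTree p).edge (TopCat.toSSetObj₀Equiv.symm y) = pathEdge (p y).out by
          rw [starTree]; exact congrArg (fun z => pathEdge (p z).out)
            (Equiv.apply_symm_apply _ _)] at this
    rw [IsCocycle.hom_pathClass, h1, h1, one_mul, inv_one, mul_one, pathEdge_edgePath]

end SegmentPaths

end LetterBraiding

namespace LetterBraiding

set_option linter.unusedSectionVars false
set_option maxSynthPendingDepth 3

open Simplicial Opposite

section Realization

variable {X : SSet.{u}}

/-- The map from the standard simplex to the geometric realization that a simplex defines. -/
noncomputable def real {n : ℕ} (σ : X _⦋n⦌) :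
    C(stdSimplex ℝ (Fin (n + 1)), SSet.toTop.obj X) :=
  singMap ((sSetTopAdj.unit.app X).app _ σ)

lemma real_map {m n : ℕ} (f : ⦋m⦌ ⟶ ⦋n⦌) (σ : X _⦋n⦌) (t : stdSimplex ℝ (Fin (m + 1))) :
    real (X.map f.op σ) t = real σ (stdSimplex.map f.toOrderHom t) := by
  have := NatTrans.naturality_apply (sSetTopAdj.unit.app X) f.op σ
  exact congrArg (fun τ => singMap τ t) this

lemma exists_desc {W : TopCat.{u}} (φ : ∀ n, X _⦋n⦌ → C(stdSimplex ℝ (Fin (n + 1)), W))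
    (hφ : ∀ {m n : ℕ} (f : ⦋m⦌ ⟶ ⦋n⦌) (σ : X _⦋n⦌) (t : stdSimplex ℝ (Fin (m + 1))),
      φ m (X.map f.op σ) t = φ n σ (stdSimplex.map f.toOrderHom t)) :
    ∃ F : C(SSet.toTop.obj X, W), ∀ n (σ : X _⦋n⦌) t, F (real σ t) = φ n σ t := by
  let ψ : X ⟶ TopCat.toSSet.obj W :=
    { app := fun m => ↾fun σ => (W.toSSetObjEquiv m).symm (φ m.unop.len σ)
      naturality := by
        intro m n f
        ext σ
        exact (W.toSSetObjEquiv n).injective (ContinuousMap.ext fun t => hφ f.unop σ t) }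
  let F := (sSetTopAdj.homEquiv X W).symm ψ
  have hF : sSetTopAdj.unit.app X ≫ TopCat.toSSet.map F = ψ :=
    (Adjunction.homEquiv_unit (adj := sSetTopAdj) ..).symm.trans (Equiv.apply_symm_apply _ _)
  refine ⟨F.hom, fun n σ t => ?_⟩
  have := congrArg (fun θ : X ⟶ TopCat.toSSet.obj W => singMap (θ.app (op ⦋n⦌) σ) t) hF
  exact this

lemma realization_hom_ext {W : TopCat.{u}} {F F' : C(SSet.toTop.obj X, W)}
    (h : ∀ n (σ : X _⦋n⦌) t, F (real σ t) = F' (real σ t)) : F = F' := by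
  have : TopCat.ofHom F = TopCat.ofHom F' := by
    refine (sSetTopAdj.homEquiv X W).injective ?_
    rw [Adjunction.homEquiv_unit, Adjunction.homEquiv_unit]
    ext m σ
    exact (W.toSSetObjEquiv m).injective (ContinuousMap.ext fun t => h m.unop.len σ t)
  exact congrArg TopCat.Hom.hom this

lemma exists_real_eq (q : SSet.toTop.obj X) : ∃ n, ∃ σ : X _⦋n⦌, ∃ t, real σ t = q := by
  let F : C(SSet.toTop.obj X, TopCat.trivial.obj (ULift.{u} Prop)) :=
    ⟨fun q => (⟨∃ n, ∃ σ : X _⦋n⦌, ∃ t, real σ t = q⟩ : ULift Prop), continuous_top⟩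
  let F' : C(SSet.toTop.obj X, TopCat.trivial.obj (ULift.{u} Prop)) :=
    ⟨fun q => (⟨True⟩ : ULift Prop), continuous_top⟩
  have h : F = F' := realization_hom_ext fun n σ t =>
    congrArg ULift.up (propext ⟨fun _ => trivial, fun _ => ⟨n, σ, t, rfl⟩⟩)
  have h2 := congrArg (fun G : C(SSet.toTop.obj X, TopCat.trivial.obj (ULift.{u} Prop)) =>
    (G q : ULift Prop).down) h
  exact h2.mpr trivial

lemma exists_desc_fun {W : Type u} (φ : ∀ n, X _⦋n⦌ → stdSimplex ℝ (Fin (n + 1)) → W)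
    (hφ : ∀ {m n : ℕ} (f : ⦋m⦌ ⟶ ⦋n⦌) (σ : X _⦋n⦌) (t : stdSimplex ℝ (Fin (m + 1))),
      φ m (X.map f.op σ) t = φ n σ (stdSimplex.map f.toOrderHom t)) :
    ∃ F : SSet.toTop.obj X → W, ∀ n (σ : X _⦋n⦌) t, F (real σ t) = φ n σ t := by
  obtain ⟨F, hF⟩ := exists_desc (X := X) (W := TopCat.trivial.obj W)
    (fun n σ => ⟨φ n σ, continuous_top⟩) hφ
  exact ⟨F, hF⟩

lemma isOpen_realization {U : Set (SSet.toTop.obj X)}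
    (h : ∀ n (σ : X _⦋n⦌), IsOpen (real σ ⁻¹' U)) : IsOpen U := by
  obtain ⟨F, hF⟩ := exists_desc (X := X) (W := TopCat.of (ULift.{u} Prop))
    (fun n σ => ⟨fun t => ⟨real σ t ∈ U⟩, continuous_uliftUp.comp (continuous_Prop.2 (h n σ))⟩)
    (fun f σ t => congrArg (fun q => (⟨q ∈ U⟩ : ULift Prop)) (real_map f σ t))
  have h1 : ∀ q, (F q).down = (q ∈ U) := by
    intro q
    obtain ⟨n, σ, t, rfl⟩ := exists_real_eq q
    exact congrArg ULift.down (hF n σ t)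
  have h2 : Continuous fun q => (F q).down := continuous_uliftDown.comp F.continuous
  rw [funext h1] at h2
  exact continuous_Prop.1 h2

lemma isClosed_realization {D : Set (SSet.toTop.obj X)}
    (h : ∀ n (σ : X _⦋n⦌), IsClosed (real σ ⁻¹' D)) : IsClosed D :=
  isOpen_compl_iff.1 (isOpen_realization fun n σ => (h n σ).isOpen_compl)

end Realization

section NormalForm

/-- The interior points of the standard simplex. -/
def IsInterior {n : ℕ} (t : stdSimplex ℝ (Fin (n + 1))) : Prop := ∀ i, 0 < t i

lemma stdSimplex_map_apply {m n : ℕ} (f : Fin (m + 1) → Fin (n + 1))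
    (t : stdSimplex ℝ (Fin (m + 1))) (j : Fin (n + 1)) :
    stdSimplex.map f t j = ∑ i with f i = j, t i := by
  rw [stdSimplex.map_coe, FunOnFinite.linearMap_apply_apply]

lemma stdSimplex_map_apply_pos {m n : ℕ} {f : Fin (m + 1) → Fin (n + 1)}
    {t : stdSimplex ℝ (Fin (m + 1))} (ht : IsInterior t) {j : Fin (n + 1)} :
    0 < stdSimplex.map f t j ↔ j ∈ Set.range f := by
  rw [stdSimplex_map_apply]
  constructor
  · intro h
    obtain ⟨i, hi, -⟩ := Finset.exists_ne_zero_of_sum_ne_zero h.ne'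
    exact ⟨i, (Finset.mem_filter.1 hi).2⟩
  · rintro ⟨i, rfl⟩
    exact Finset.sum_pos (fun i _ => ht i) ⟨i, by simp⟩

lemma stdSimplex_map_injective {m n : ℕ} {f : Fin (m + 1) → Fin (n + 1)}
    (hf : Function.Injective f) : Function.Injective (stdSimplex.map (S := ℝ) f) := by
  intro s t h
  refine stdSimplex.ext (funext fun i => ?_)
  have := DFunLike.congr_fun h (f i)
  rw [stdSimplex_map_apply, stdSimplex_map_apply] at this
  simpa only [hf.eq_iff, Finset.filter_eq', Finset.mem_univ, if_true, Finset.sum_singleton]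
    using this

lemma exists_isInterior {n : ℕ} (b : stdSimplex ℝ (Fin (n + 1))) :
    ∃ (k : ℕ) (γ : ⦋k⦌ ⟶ ⦋n⦌) (b' : stdSimplex ℝ (Fin (k + 1))), k ≤ n ∧
      Function.Injective γ.toOrderHom ∧ IsInterior b' ∧
      stdSimplex.map γ.toOrderHom b' = b := by
  classical
  let s : Finset (Fin (n + 1)) := Finset.univ.filter fun i => 0 < b i
  have hs : s.Nonempty := by
    by_contra h
    have h1 : ∀ i, b i = 0 := fun i => le_antisymm
      (not_lt.1 fun hi => h ⟨i, Finset.mem_filter.2 ⟨Finset.mem_univ i, hi⟩⟩)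
      (stdSimplex.zero_le b i)
    have h2 := stdSimplex.sum_eq_one b
    simp [h1] at h2
  obtain ⟨k, hk⟩ : ∃ k, s.card = k + 1 := ⟨s.card - 1, by have := hs.card_pos; omega⟩
  let e := s.orderEmbOfFin hk
  have hsum : ∀ (g : Fin (n + 1) → ℝ), (∀ i, i ∉ s → g i = 0) → ∑ i, g (e i) = ∑ i, g i := by
    intro g hg
    refine (Finset.sum_map Finset.univ e.toEmbedding g).symm.trans ?_
    refine Finset.sum_subset (Finset.subset_univ _) fun i _ hi => hg i fun his => hi ?_
    have : i ∈ Set.range e := by rw [Finset.range_orderEmbOfFin]; exact his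
    obtain ⟨j, rfl⟩ := this
    exact Finset.mem_map_of_mem _ (Finset.mem_univ j)
  have h0 : ∀ i, i ∉ s → b i = 0 := fun i hi => le_antisymm
    (not_lt.1 fun h => hi (Finset.mem_filter.2 ⟨Finset.mem_univ i, h⟩)) (stdSimplex.zero_le b i)
  refine ⟨k, SimplexCategory.Hom.mk e.toOrderHom, ⟨fun i => b (e i), fun i =>
    stdSimplex.zero_le b _, (hsum b h0).trans (stdSimplex.sum_eq_one b)⟩, ?_, e.injective, fun i =>
    (Finset.mem_filter.1 (s.orderEmbOfFin_mem hk i)).2, ?_⟩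
  · have := s.card_le_univ
    rw [Fintype.card_fin] at this
    omega
  · refine stdSimplex.ext (funext fun j => ?_)
    rw [stdSimplex_map_apply, Finset.sum_filter]
    change ∑ i, (if e i = j then b (e i) else 0) = b j
    rw [hsum (fun i => if i = j then b i else 0) (fun i hi => by simp [h0 i hi])]
    simp

lemma exists_factor {k l n : ℕ} (γ : ⦋k⦌ ⟶ ⦋n⦌) (ι : ⦋l⦌ ⟶ ⦋n⦌)
    (hι : Function.Injective ι.toOrderHom)
    (h : Set.range γ.toOrderHom = Set.range ι.toOrderHom) :
    ∃ e : ⦋k⦌ ⟶ ⦋l⦌, Epi e ∧ γ = e ≫ ι := by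
  have h1 : ∀ i, ∃ j, ι.toOrderHom j = γ.toOrderHom i := fun i => by
    have : γ.toOrderHom i ∈ Set.range ι.toOrderHom := h ▸ ⟨i, rfl⟩
    exact this
  choose e he using h1
  have hmono : Monotone e := fun i j hij => by
    refine (ι.toOrderHom.monotone.strictMono_of_injective hι).le_iff_le.1 ?_
    rw [he, he]
    exact γ.toOrderHom.monotone hij
  refine ⟨SimplexCategory.Hom.mk ⟨e, hmono⟩, SimplexCategory.epi_iff_surjective.2 fun j => ?_, ?_⟩
  · obtain ⟨i, hi⟩ : ι.toOrderHom j ∈ Set.range γ.toOrderHom := h ▸ ⟨j, rfl⟩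
    exact ⟨i, hι ((he i).trans hi)⟩
  · ext i : 3
    exact (he i).symm

variable {X : SSet.{u}}

/-- The points `(σ, b)` and `(z, c)` of simplices have the same image in the realization, and `z` is
nondegenerate and `c` interior. -/
def IsNormalForm {n d : ℕ} (σ : X _⦋n⦌) (b : stdSimplex ℝ (Fin (n + 1))) (z : X _⦋d⦌)
    (c : stdSimplex ℝ (Fin (d + 1))) : Prop :=
  z ∈ X.nonDegenerate d ∧ ∃ (k : ℕ) (γ : ⦋k⦌ ⟶ ⦋n⦌) (s : ⦋k⦌ ⟶ ⦋d⦌)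
    (b' : stdSimplex ℝ (Fin (k + 1))), Epi s ∧ IsInterior b' ∧
      stdSimplex.map γ.toOrderHom b' = b ∧ stdSimplex.map s.toOrderHom b' = c ∧
      X.map γ.op σ = X.map s.op z

lemma stdSimplex_map_comp {k m n : ℕ} (f : ⦋k⦌ ⟶ ⦋m⦌) (g : ⦋m⦌ ⟶ ⦋n⦌)
    (t : stdSimplex ℝ (Fin (k + 1))) : stdSimplex.map (f ≫ g).toOrderHom t =
      stdSimplex.map g.toOrderHom (stdSimplex.map f.toOrderHom t) := by
  rw [stdSimplex.map_comp_apply, SimplexCategory.comp_toOrderHom, OrderHom.comp_coe]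

lemma isInterior_map {m n : ℕ} {f : ⦋m⦌ ⟶ ⦋n⦌} (hf : Epi f) {t : stdSimplex ℝ (Fin (m + 1))}
    (ht : IsInterior t) : IsInterior (stdSimplex.map f.toOrderHom t) := fun j =>
  (stdSimplex_map_apply_pos ht).2 (SimplexCategory.epi_iff_surjective.1 hf j)

namespace IsNormalForm

variable {n d : ℕ} {σ : X _⦋n⦌} {b : stdSimplex ℝ (Fin (n + 1))} {z : X _⦋d⦌}
    {c : stdSimplex ℝ (Fin (d + 1))}

lemma isInterior (h : IsNormalForm σ b z c) : IsInterior c := by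
  obtain ⟨-, k, γ, s, b', hs, hb', -, rfl, -⟩ := h
  exact isInterior_map hs hb'

lemma real_eq (h : IsNormalForm σ b z c) : real z c = real σ b := by
  obtain ⟨-, k, γ, s, b', -, -, rfl, rfl, h⟩ := h
  rw [← real_map, ← real_map, h]

lemma of_map {m : ℕ} (f : ⦋n⦌ ⟶ ⦋m⦌) {τ : X _⦋m⦌} (h : IsNormalForm (X.map f.op τ) b z c) :
    IsNormalForm τ (stdSimplex.map f.toOrderHom b) z c := by
  obtain ⟨hz, k, γ, s, b', hs, hb', rfl, hc, h⟩ := h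
  refine ⟨hz, k, γ ≫ f, s, b', hs, hb', stdSimplex_map_comp γ f b', hc, ?_⟩
  rw [← h, op_comp, Functor.map_comp]
  rfl

lemma self (hz : z ∈ X.nonDegenerate d) (hc : IsInterior c) : IsNormalForm z c z c :=
  ⟨hz, d, 𝟙 _, 𝟙 _, c, inferInstance, hc, stdSimplex.map_id_apply c, stdSimplex.map_id_apply c,
    rfl⟩

end IsNormalForm

/-- The normal form of a point of a simplex is unique. -/
lemma exists_isNormalForm {n : ℕ} (σ : X _⦋n⦌) (b : stdSimplex ℝ (Fin (n + 1))) :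
    ∃ p : Σ d, X _⦋d⦌ × stdSimplex ℝ (Fin (d + 1)), IsNormalForm σ b p.2.1 p.2.2 ∧
      ∀ (d : ℕ) (z : X _⦋d⦌) (c : stdSimplex ℝ (Fin (d + 1))), IsNormalForm σ b z c →
        p = ⟨d, z, c⟩ := by
  obtain ⟨l, ι, b₁, -, hι, hb₁, rfl⟩ := exists_isInterior b
  obtain ⟨m, r, hr, w, hw⟩ := X.exists_nonDegenerate (X.map ι.op σ)
  refine ⟨⟨m, w.1, stdSimplex.map r.toOrderHom b₁⟩, ⟨w.2, l, ι, r, b₁, hr, hb₁, rfl, rfl, hw⟩, ?_⟩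
  rintro d z c ⟨hz, k, γ, s, b', hs, hb', hb, rfl, h⟩
  obtain ⟨e, he, rfl⟩ := exists_factor γ ι hι (by
    ext j
    rw [← stdSimplex_map_apply_pos hb', ← stdSimplex_map_apply_pos hb₁, hb])
  have hb₂ : stdSimplex.map e.toOrderHom b' = b₁ :=
    stdSimplex_map_injective hι ((stdSimplex_map_comp e ι b').symm.trans hb)
  have h1 : X.map s.op z = X.map (e ≫ r).op w.1 := by
    rw [← h, op_comp, op_comp, Functor.map_comp, Functor.map_comp]
    exact congrArg (X.map e.op) hw
  have her : Epi (e ≫ r) := epi_comp e r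
  obtain rfl := X.unique_nonDegenerate_dim _ (e ≫ r) w h1 s ⟨z, hz⟩ rfl
  obtain rfl := X.unique_nonDegenerate_simplex _ (e ≫ r) w h1 s ⟨z, hz⟩ rfl
  obtain rfl := X.unique_nonDegenerate_map _ (e ≫ r) _ h1 s ⟨z, hz⟩ rfl
  rw [← hb₂, ← stdSimplex_map_comp]

lemma exists_normalForm (X : SSet.{u}) :
    ∃ F : SSet.toTop.obj X → Σ d, X _⦋d⦌ × stdSimplex ℝ (Fin (d + 1)),
      (∀ q, (F q).2.1 ∈ X.nonDegenerate _ ∧ IsInterior (F q).2.2 ∧ real (F q).2.1 (F q).2.2 = q) ∧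
      (∀ (d : ℕ) (z : X _⦋d⦌) (c : stdSimplex ℝ (Fin (d + 1))), z ∈ X.nonDegenerate d →
        IsInterior c → F (real z c) = ⟨d, z, c⟩) ∧
      ∀ (n : ℕ) (σ : X _⦋n⦌) (b : stdSimplex ℝ (Fin (n + 1))),
        IsNormalForm σ b (F (real σ b)).2.1 (F (real σ b)).2.2 := by
  choose φ hφ hφ' using fun n : ℕ => exists_isNormalForm (X := X) (n := n)
  obtain ⟨F, hF⟩ := exists_desc_fun φ fun f σ t =>
    (hφ' _ _ _ _ _ _ (hφ _ (X.map f.op σ) t).of_map).symm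
  have h3 : ∀ (n : ℕ) (σ : X _⦋n⦌) (b : stdSimplex ℝ (Fin (n + 1))),
      IsNormalForm σ b (F (real σ b)).2.1 (F (real σ b)).2.2 := fun n σ b => by
    rw [hF]
    exact hφ n σ b
  refine ⟨F, fun q => ?_, fun d z c hz hc => ?_, h3⟩
  · obtain ⟨n, σ, b, rfl⟩ := exists_real_eq q
    exact ⟨(h3 n σ b).1, (h3 n σ b).isInterior, (h3 n σ b).real_eq⟩
  · rw [hF]
    exact hφ' d z c d z c (IsNormalForm.self hz hc)

/-- The normal form of a point of the realization. -/
noncomputable def normalForm (q : SSet.toTop.obj X) :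
    Σ d, X _⦋d⦌ × stdSimplex ℝ (Fin (d + 1)) := (exists_normalForm X).choose q

/-- The dimension of the open cell that contains a point of the realization. -/
noncomputable def cellDim (q : SSet.toTop.obj X) : ℕ := (normalForm q).1

lemma normalForm_nonDegenerate (q : SSet.toTop.obj X) :
    (normalForm q).2.1 ∈ X.nonDegenerate _ := ((exists_normalForm X).choose_spec.1 q).1

lemma normalForm_isInterior (q : SSet.toTop.obj X) : IsInterior (normalForm q).2.2 :=
  ((exists_normalForm X).choose_spec.1 q).2.1

lemma real_normalForm (q : SSet.toTop.obj X) : real (normalForm q).2.1 (normalForm q).2.2 = q :=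
  ((exists_normalForm X).choose_spec.1 q).2.2

lemma normalForm_real {d : ℕ} {z : X _⦋d⦌} (hz : z ∈ X.nonDegenerate d)
    {c : stdSimplex ℝ (Fin (d + 1))} (hc : IsInterior c) : normalForm (real z c) = ⟨d, z, c⟩ :=
  (exists_normalForm X).choose_spec.2.1 d z c hz hc

/-- Every point of a simplex is, with its image in the realization, in a nondegenerate simplex. -/
lemma exists_face {n : ℕ} (σ : X _⦋n⦌) (b : stdSimplex ℝ (Fin (n + 1))) :
    ∃ (k : ℕ) (γ : ⦋k⦌ ⟶ ⦋n⦌) (b' : stdSimplex ℝ (Fin (k + 1))) (d : ℕ) (s : ⦋k⦌ ⟶ ⦋d⦌)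
      (z : X _⦋d⦌), k ≤ n ∧ d ≤ k ∧ Function.Injective γ.toOrderHom ∧ IsInterior b' ∧
        stdSimplex.map γ.toOrderHom b' = b ∧ Epi s ∧ z ∈ X.nonDegenerate d ∧
        X.map γ.op σ = X.map s.op z ∧
        normalForm (real σ b) = ⟨d, z, stdSimplex.map s.toOrderHom b'⟩ := by
  obtain ⟨k, γ, b', hk, hγ, hb', rfl⟩ := exists_isInterior b
  obtain ⟨d, s, hs, z, hz⟩ := X.exists_nonDegenerate (X.map γ.op σ)
  refine ⟨k, γ, b', d, s, z, hk, SimplexCategory.len_le_of_epi s, hγ, hb', rfl, hs, z.2, hz, ?_⟩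
  rw [← real_map, hz, real_map]
  exact normalForm_real z.2 (isInterior_map hs hb')

lemma cellDim_real_le {n : ℕ} (σ : X _⦋n⦌) (b : stdSimplex ℝ (Fin (n + 1))) :
    cellDim (real σ b) ≤ n := by
  obtain ⟨k, γ, b', d, s, z, hk, hd, -, -, -, -, -, -, h⟩ := exists_face σ b
  rw [cellDim, h]
  exact hd.trans hk

lemma cellDim_real_lt {n : ℕ} (σ : X _⦋n⦌) {b : stdSimplex ℝ (Fin (n + 1))}
    (hb : ¬IsInterior b) : cellDim (real σ b) < n := by
  obtain ⟨k, γ, b', d, s, z, hk, hd, hγ, hb', rfl, -, -, -, h⟩ := exists_face σ b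
  rw [cellDim, h]
  refine hd.trans_lt (lt_of_le_of_ne hk ?_)
  rintro rfl
  refine hb fun j => (stdSimplex_map_apply_pos hb').2 ?_
  exact Finite.surjective_of_injective hγ j

end NormalForm

section Closed

variable {X : SSet.{u}}

lemma isClosed_of_nonDegenerate {N : ℕ} {D : Set (SSet.toTop.obj X)}
    (hD : ∀ q ∈ D, cellDim q ≤ N)
    (h : ∀ n ≤ N, ∀ z ∈ X.nonDegenerate n, IsClosed (real z ⁻¹' D)) : IsClosed D := by
  refine isClosed_realization fun n σ => ?_
  let C : (Σ k : Fin (n + 1), ⦋(k : ℕ)⦌ ⟶ ⦋n⦌) → Set (stdSimplex ℝ (Fin (n + 1))) := fun p =>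
    ⋃ (d : Fin (N + 1)) (s : ⦋(p.1 : ℕ)⦌ ⟶ ⦋(d : ℕ)⦌),
      {b | ∃ z ∈ X.nonDegenerate d, X.map p.2.op σ = X.map s.op z ∧ Epi s ∧
        b ∈ stdSimplex.map p.2.toOrderHom '' (stdSimplex.map s.toOrderHom ⁻¹' (real z ⁻¹' D))}
  have hC : real σ ⁻¹' D = ⋃ p, C p := by
    ext b
    simp only [C, Set.mem_iUnion, Set.mem_ofPred_eq]
    constructor
    · intro hb
      obtain ⟨k, γ, b', d, s, z, hk, hd, hγ, hb', rfl, hs, hz, hσ, h⟩ := exists_face σ b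
      have hdN : d ≤ N := by
        have := hD _ hb
        rwa [cellDim, h] at this
      refine ⟨⟨⟨k, by omega⟩, γ⟩, ⟨d, by omega⟩, s, z, hz, hσ, hs, b', ?_, rfl⟩
      rw [Set.mem_preimage, Set.mem_preimage, ← real_map, ← hσ, real_map]
      exact hb
    · rintro ⟨p, d, s, z, hz, hσ, -, b', hb', rfl⟩
      rw [Set.mem_preimage, ← real_map, hσ, real_map]
      exact hb'
  have : ∀ k, Finite (⦋k⦌ ⟶ ⦋n⦌) := inferInstance
  rw [hC]
  refine isClosed_iUnion_of_finite fun p => isClosed_iUnion_of_finite fun d =>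
    isClosed_iUnion_of_finite fun s => ?_
  by_cases hz : ∃ z ∈ X.nonDegenerate d, X.map p.2.op σ = X.map s.op z ∧ Epi s
  · obtain ⟨z, hz, hσ, hs⟩ := hz
    have : {b | ∃ z ∈ X.nonDegenerate d, X.map p.2.op σ = X.map s.op z ∧ Epi s ∧
        b ∈ stdSimplex.map p.2.toOrderHom '' (stdSimplex.map s.toOrderHom ⁻¹' (real z ⁻¹' D))} =
        stdSimplex.map p.2.toOrderHom '' (stdSimplex.map s.toOrderHom ⁻¹' (real z ⁻¹' D)) := by
      ext b
      constructor
      · rintro ⟨z', hz', hσ', -, hb⟩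
        obtain rfl : z' = z := congrArg Subtype.val
          (X.unique_nonDegenerate_simplex _ s ⟨z', hz'⟩ hσ' s ⟨z, hz⟩ hσ)
        exact hb
      · exact fun hb => ⟨z, hz, hσ, hs, hb⟩
    rw [this]
    have hcl := (h d (by omega) z hz).preimage
      (stdSimplex.continuous_map (S := ℝ) s.toOrderHom)
    exact (hcl.isCompact.image (stdSimplex.continuous_map _)).isClosed
  · convert isClosed_empty
    ext b
    simp only [Set.mem_ofPred_eq, Set.mem_empty_iff_false, iff_false]
    rintro ⟨z, h1, h2, h3, -⟩
    exact hz ⟨z, h1, h2, h3⟩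

/-- A function that is continuous on the nondegenerate simplices of dimension at most `N` is
continuous on the skeleton. -/
lemma continuousOn_cellDim_le {W : Type*} [TopologicalSpace W] {N : ℕ} {f : SSet.toTop.obj X → W}
    (h : ∀ n ≤ N, ∀ z ∈ X.nonDegenerate n, Continuous fun b => f (real z b)) :
    ContinuousOn f {q | cellDim q ≤ N} := by
  rw [continuousOn_iff_isClosed]
  intro t ht
  refine ⟨f ⁻¹' t ∩ {q | cellDim q ≤ N}, isClosed_of_nonDegenerate (fun q hq => hq.2)
    fun n hn z hz => ?_, by rw [Set.inter_assoc, Set.inter_self]⟩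
  have : real z ⁻¹' (f ⁻¹' t ∩ {q | cellDim q ≤ N}) = (fun b => f (real z b)) ⁻¹' t := by
    ext b
    exact ⟨fun hb => hb.1, fun hb => ⟨hb, (cellDim_real_le z b).trans hn⟩⟩
  rw [this]
  exact ht.preimage (h n hn z hz)

lemma isClosed_singleton_realization (q : SSet.toTop.obj X) : IsClosed {q} := by
  refine isClosed_of_nonDegenerate (N := cellDim q) (fun p hp => by rw [hp]) fun n hn z hz => ?_
  rcases hn.lt_or_eq with hn | rfl
  · convert isClosed_empty
    ext b
    simp only [Set.mem_preimage, Set.mem_singleton_iff, Set.mem_empty_iff_false, iff_false]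
    rintro rfl
    exact absurd (cellDim_real_le z b) hn.not_ge
  · refine Set.Subsingleton.isClosed fun b hb b' hb' => ?_
    have key : ∀ b, real z b = q → normalForm q = ⟨_, z, b⟩ := by
      intro b hb
      have : IsInterior b := by
        by_contra h
        have := cellDim_real_lt z h
        rw [hb] at this
        exact lt_irrefl _ this
      rw [← normalForm_real hz this, hb]
    have := (key b hb).symm.trans (key b' hb')
    simpa using this

lemma exists_cellDim_le {K : Type*} [TopologicalSpace K] [CompactSpace K]
    (α : C(K, SSet.toTop.obj X)) : ∃ N, ∀ t, cellDim (α t) ≤ N := by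
  by_contra! hα
  choose t ht using hα
  have hcl : ∀ k, IsClosed ((fun j => α (t j)) '' Set.Ici k) := by
    intro k
    refine isClosed_realization fun n σ => ?_
    have h : real σ ⁻¹' ((fun j => α (t j)) '' Set.Ici k) =
        ⋃ j ∈ Set.Ico k n, real σ ⁻¹' {α (t j)} := by
      ext b
      simp only [Set.mem_preimage, Set.mem_image, Set.mem_iUnion, Set.mem_singleton_iff,
        exists_prop]
      constructor
      · rintro ⟨j, hj, h⟩
        refine ⟨j, ⟨hj, (ht j).trans_le ?_⟩, h.symm⟩
        rw [h]
        exact cellDim_real_le σ b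
      · rintro ⟨j, hj, h⟩
        exact ⟨j, hj.1, h.symm⟩
    rw [h]
    exact (Set.finite_Ico k n).isClosed_biUnion fun j _ =>
      (isClosed_singleton_realization _).preimage (real σ).continuous
  obtain ⟨r, hr⟩ := IsCompact.nonempty_iInter_of_sequence_nonempty_isCompact_isClosed
    (fun k => α ⁻¹' ((fun j => α (t j)) '' Set.Ici k))
    (fun k r ⟨j, hj, h⟩ => ⟨j, (Nat.le_succ k).trans hj, h⟩)
    (fun k => ⟨t k, k, le_refl k, rfl⟩) ((hcl 0).preimage α.continuous).isCompact
    (fun k => (hcl k).preimage α.continuous)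
  obtain ⟨j, hj, h⟩ := Set.mem_iInter.1 hr (cellDim (α r))
  have := ht j
  rw [show α (t j) = α r from h] at this
  exact absurd (this.trans_le hj) (lt_irrefl _)

end Closed

end LetterBraiding

namespace LetterBraiding

set_option linter.unusedSectionVars false
set_option maxSynthPendingDepth 3

open Simplicial Opposite

section CellFunctions

variable {X : SSet.{u}}

open Classical in
/-- The function on the realization that is given on the open `n`-cells by a function `F` and
elsewhere by a function `f`. -/
noncomputable def cellFun {W : Type*} (n : ℕ) (F : X _⦋n⦌ → stdSimplex ℝ (Fin (n + 1)) → W)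
    (f : SSet.toTop.obj X → W) (q : SSet.toTop.obj X) : W :=
  if h : ∃ (z : X _⦋n⦌) (c : stdSimplex ℝ (Fin (n + 1))), normalForm q = ⟨n, z, c⟩ then
    F h.choose h.choose_spec.choose else f q

variable {W : Type*} {n : ℕ} {F : X _⦋n⦌ → stdSimplex ℝ (Fin (n + 1)) → W}
    {f : SSet.toTop.obj X → W}

lemma cellFun_eq {q : SSet.toTop.obj X} {z : X _⦋n⦌} {c : stdSimplex ℝ (Fin (n + 1))}
    (h : normalForm q = ⟨n, z, c⟩) : cellFun n F f q = F z c := by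
  have h' : ∃ (z : X _⦋n⦌) (c : stdSimplex ℝ (Fin (n + 1))), normalForm q = ⟨n, z, c⟩ :=
    ⟨z, c, h⟩
  rw [cellFun, dif_pos h']
  have := h.symm.trans h'.choose_spec.choose_spec
  simp only [Sigma.mk.injEq, heq_eq_eq, true_and, Prod.mk.injEq] at this
  exact congrArg₂ F this.1.symm this.2.symm

lemma exists_normalForm_eq {q : SSet.toTop.obj X} (hq : cellDim q = n) :
    ∃ z ∈ X.nonDegenerate n, ∃ c, IsInterior c ∧ normalForm q = ⟨n, z, c⟩ := by
  subst hq
  exact ⟨_, normalForm_nonDegenerate q, _, normalForm_isInterior q, rfl⟩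

lemma cellFun_of_ne {q : SSet.toTop.obj X} (hq : cellDim q ≠ n) : cellFun n F f q = f q := by
  rw [cellFun, dif_neg]
  rintro ⟨z, c, h⟩
  exact hq (congrArg Sigma.fst h)

lemma continuousOn_cellFun [TopologicalSpace W] (h1 : ∀ z ∈ X.nonDegenerate n, Continuous (F z))
    (h2 : ∀ z ∈ X.nonDegenerate n, ∀ b, ¬IsInterior b → F z b = f (real z b))
    (h3 : ∀ k < n, ∀ z ∈ X.nonDegenerate k, Continuous fun b => f (real z b)) :
    ContinuousOn (cellFun n F f) {q | cellDim q ≤ n} := by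
  refine continuousOn_cellDim_le fun k hk z hz => ?_
  rcases hk.lt_or_eq with hk | rfl
  · convert h3 k hk z hz using 2 with b
    exact cellFun_of_ne ((cellDim_real_le z b).trans_lt hk).ne
  · convert h1 z hz using 2 with b
    by_cases hb : IsInterior b
    · exact cellFun_eq (normalForm_real hz hb)
    · rw [h2 z hz b hb]
      exact cellFun_of_ne (cellDim_real_lt z hb).ne

end CellFunctions

section Push

variable {n : ℕ}

/-- The smallest barycentric coordinate. -/
noncomputable def minCoord (c : stdSimplex ℝ (Fin (n + 1))) : ℝ :=
  Finset.univ.inf' Finset.univ_nonempty c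

lemma continuous_minCoord : Continuous (minCoord : stdSimplex ℝ (Fin (n + 1)) → ℝ) :=
  Continuous.finset_inf'_apply _ fun i _ => (continuous_apply i).comp continuous_subtype_val

lemma minCoord_le (c : stdSimplex ℝ (Fin (n + 1))) (i : Fin (n + 1)) : minCoord c ≤ c i :=
  Finset.inf'_le _ (Finset.mem_univ i)

lemma exists_eq_minCoord (c : stdSimplex ℝ (Fin (n + 1))) : ∃ i, c i = minCoord c := by
  obtain ⟨i, -, hi⟩ := Finset.exists_mem_eq_inf' Finset.univ_nonempty c
  exact ⟨i, hi.symm⟩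

lemma minCoord_nonneg (c : stdSimplex ℝ (Fin (n + 1))) : 0 ≤ minCoord c := by
  obtain ⟨i, hi⟩ := exists_eq_minCoord c
  exact hi ▸ stdSimplex.zero_le c i

lemma minCoord_pos {c : stdSimplex ℝ (Fin (n + 1))} (hc : IsInterior c) : 0 < minCoord c := by
  obtain ⟨i, hi⟩ := exists_eq_minCoord c
  exact hi ▸ hc i

lemma minCoord_eq_zero {c : stdSimplex ℝ (Fin (n + 1))} (hc : ¬IsInterior c) : minCoord c = 0 := by
  simp only [IsInterior, not_forall, not_lt] at hc
  obtain ⟨i, hi⟩ := hc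
  exact le_antisymm ((minCoord_le c i).trans hi) (minCoord_nonneg c)

/-- The amount by which all coordinates are diminished when a point is pushed to the boundary. -/
noncomputable def pushAmount (c : stdSimplex ℝ (Fin (n + 1))) : ℝ :=
  min (minCoord c) (1 / (2 * (n + 1)))

lemma pushAmount_nonneg (c : stdSimplex ℝ (Fin (n + 1))) : 0 ≤ pushAmount c :=
  le_min (minCoord_nonneg c) (by positivity)

lemma pushAmount_le (c : stdSimplex ℝ (Fin (n + 1))) : pushAmount c ≤ minCoord c :=
  min_le_left _ _

lemma pushAmount_bound (u : unitInterval) (c : stdSimplex ℝ (Fin (n + 1))) :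
    0 < 1 - (u : ℝ) * ((n + 1) * pushAmount c) := by
  have h1 : (n + 1) * pushAmount c ≤ 1 / 2 := by
    have := mul_le_mul_of_nonneg_left (min_le_right (minCoord c) (1 / (2 * ((n : ℝ) + 1))))
      (by positivity : (0 : ℝ) ≤ n + 1)
    refine this.trans (le_of_eq ?_)
    field_simp
  have h0 : 0 ≤ (n + 1) * pushAmount c := mul_nonneg (by positivity) (pushAmount_nonneg c)
  nlinarith [u.2.1, u.2.2, mul_le_mul u.2.2 h1 h0 zero_le_one]

/-- The homotopy that pushes points of a simplex that are near to the boundary to it. -/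
noncomputable def push (p : stdSimplex ℝ (Fin (n + 1)) × unitInterval) :
    stdSimplex ℝ (Fin (n + 1)) :=
  ⟨fun i => (p.1 i - p.2 * pushAmount p.1) / (1 - p.2 * ((n + 1) * pushAmount p.1)), fun i =>
    div_nonneg (by
      have h1 := (pushAmount_le p.1).trans (minCoord_le p.1 i)
      nlinarith [p.2.2.1, p.2.2.2, pushAmount_nonneg p.1])
      (pushAmount_bound p.2 p.1).le, by
    rw [← Finset.sum_div, Finset.sum_sub_distrib, stdSimplex.sum_eq_one]
    simp only [Finset.sum_const, Finset.card_univ, Fintype.card_fin, nsmul_eq_mul]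
    rw [div_eq_one_iff_eq (pushAmount_bound p.2 p.1).ne']
    push_cast
    ring⟩

lemma push_apply (p : stdSimplex ℝ (Fin (n + 1)) × unitInterval) (i : Fin (n + 1)) :
    push p i = (p.1 i - p.2 * pushAmount p.1) / (1 - p.2 * ((n + 1) * pushAmount p.1)) := rfl

lemma continuous_push : Continuous (push (n := n)) := by
  have h1 : Continuous fun p : stdSimplex ℝ (Fin (n + 1)) × unitInterval => pushAmount p.1 :=
    (continuous_minCoord.comp continuous_fst).min continuous_const
  have h2 : Continuous fun p : stdSimplex ℝ (Fin (n + 1)) × unitInterval => (p.2 : ℝ) :=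
    continuous_subtype_val.comp continuous_snd
  have h3 : ∀ i, Continuous fun p : stdSimplex ℝ (Fin (n + 1)) × unitInterval =>
      (p.1 i - p.2 * pushAmount p.1) / (1 - p.2 * ((n + 1) * pushAmount p.1)) := fun i =>
    (((continuous_apply i).comp (continuous_subtype_val.comp continuous_fst)).sub
      (h2.mul h1)).div (continuous_const.sub (h2.mul (continuous_const.mul h1)))
      fun p => (pushAmount_bound p.2 p.1).ne'
  exact continuous_induced_rng.2 (continuous_pi h3)

lemma push_zero (c : stdSimplex ℝ (Fin (n + 1))) : push (c, 0) = c :=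
  stdSimplex.ext (funext fun i => by simp [push_apply])

lemma push_of_not_isInterior {c : stdSimplex ℝ (Fin (n + 1))} (hc : ¬IsInterior c)
    (u : unitInterval) : push (c, u) = c := by
  have : pushAmount c = 0 := by
    rw [pushAmount, minCoord_eq_zero hc]
    exact min_eq_left (by positivity)
  exact stdSimplex.ext (funext fun i => by simp [push_apply, this])

lemma not_isInterior_push {c : stdSimplex ℝ (Fin (n + 1))}
    (hc : minCoord c < 1 / (2 * (n + 1))) : ¬IsInterior (push (c, 1)) := by
  intro h
  obtain ⟨i, hi⟩ := exists_eq_minCoord c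
  have := h i
  rw [push_apply, show pushAmount c = minCoord c from min_eq_left hc.le] at this
  simp [hi] at this

end Push

section Good

variable {E : Type*} [AddCommGroup E] [Module ℝ E] [TopologicalSpace E] [IsTopologicalAddGroup E]
  [ContinuousSMul ℝ E] {s : Set E} {hs : Convex ℝ s}
  {E' : Type*} [AddCommGroup E'] [Module ℝ E'] [TopologicalSpace E'] [IsTopologicalAddGroup E']
  [ContinuousSMul ℝ E'] {s' : Set E'} {hs' : Convex ℝ s'}
  {Z : TopCat.{u}} {Γ : Type*} [Group Γ] {h : (TopCat.toSSet.obj Z) _⦋1⦌ → Γ}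

lemma affineSing_pair_eq (Q : C(s, Z)) (a b : s) :
    affineSing hs Q ![a, b] = pathEdge ((segment hs a b).map Q.continuous) :=
  sing_ext fun t => by
    rw [toSSetObjEquiv_affineSing]
    change _ = singMap (pathEdge _) t
    rw [singMap_pathEdge]
    change _ = Q (affineSimplex hs ![a, b] (stdSimplexHomeomorphUnitInterval.symm
      (stdSimplexHomeomorphUnitInterval t)))
    rw [Homeomorph.symm_apply_apply]

lemma IsCocycle.affineSing_comp (hh : IsCocycle h) (f : C(s, s')) (Q : C(s', Z)) (a b : s) :
    h (affineSing hs (Q.comp f) ![a, b]) = h (affineSing hs' Q ![f a, f b]) := by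
  have := hs'.contractibleSpace ⟨_, (f a).2⟩
  rw [affineSing_pair_eq, affineSing_pair_eq]
  have hom : ((segment hs a b).map f.continuous).Homotopic (segment hs' (f a) (f b)) :=
    SimplyConnectedSpace.paths_homotopic _ _
  exact hh.pathEdge_congr (hom.map Q)

/-- A family of sets of group elements is parallel along a segment, with respect to the transport
by a cocycle. -/
def IsParallel (h : (TopCat.toSSet.obj Z) _⦋1⦌ → Γ) (c : Z → Set Γ) (hs : Convex ℝ s)
    (Q : C(s, Z)) (a b : s) : Prop :=
  ∀ y, y ∈ c (Q a) ↔ y * h (affineSing hs Q ![a, b]) ∈ c (Q b)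

namespace IsParallel

variable {c : Z → Set Γ}

lemma trans (hh : IsCocycle h) {Q : C(s, Z)} {a₁ a₂ a₃ : s} (h1 : IsParallel h c hs Q a₁ a₂)
    (h2 : IsParallel h c hs Q a₂ a₃) : IsParallel h c hs Q a₁ a₃ := fun y => by
  rw [h1, h2, hh.affineSing_mul hs Q a₁ a₂ a₃, mul_assoc]

lemma symm (hh : IsCocycle h) {Q : C(s, Z)} {a₁ a₂ : s} (h1 : IsParallel h c hs Q a₁ a₂) :
    IsParallel h c hs Q a₂ a₁ := fun y => by
  rw [h1, hh.affineSing_symm, inv_mul_cancel_right]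

lemma comp_iff (hh : IsCocycle h) {f : C(s, s')} {Q : C(s', Z)} {a b : s} :
    IsParallel h c hs (Q.comp f) a b ↔ IsParallel h c hs' Q (f a) (f b) := by
  rw [IsParallel, hh.affineSing_comp (hs' := hs')]
  rfl

end IsParallel

variable {X : SSet.{u}} {h : (TopCat.toSSet.obj (SSet.toTop.obj X)) _⦋1⦌ → Γ}
  {c : SSet.toTop.obj X → Set Γ}

lemma isParallel_of_cellDim_lt (hh : IsCocycle h)
    (hc : ∀ n (σ : X _⦋n⦌) a b, IsParallel h c (convex_stdSimplex ℝ (Fin (n + 1))) (real σ) a b)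
    (N : ℕ) : ∀ (s : Set ℝ) (hs : Convex ℝ s) (Q : C(s, SSet.toTop.obj X)),
      (∀ t, cellDim (Q t) < N) → ∀ a b, IsParallel h c hs Q a b := by
  have hfac : ∀ (s : Set ℝ) (hs : Convex ℝ s) (Q : C(s, SSet.toTop.obj X)) n (σ : X _⦋n⦌)
      (f : C(s, stdSimplex ℝ (Fin (n + 1)))), (∀ t, real σ (f t) = Q t) → ∀ a b,
      IsParallel h c hs Q a b := by
    intro s hs Q n σ f hf a b
    rw [← show (real σ).comp f = Q from ContinuousMap.ext hf]
    exact (IsParallel.comp_iff hh).2 (hc n σ _ _)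
  induction N with
  | zero => exact fun s hs Q hQ a => absurd (hQ a) (Nat.not_lt_zero _)
  | succ n ih =>
    intro s hs Q hQ a b
    have hpre : PreconnectedSpace s := Subtype.preconnectedSpace hs.isPreconnected
    suffices key : ∀ t₀ : s, ∃ U : Set ℝ, IsOpen U ∧ Convex ℝ U ∧ t₀.1 ∈ U ∧
        ∀ t : s, t.1 ∈ U → IsParallel h c hs Q t₀ t by
      refine isPreconnected_univ.induction₂ (fun a b => IsParallel h c hs Q a b)
        (fun t₀ _ => ?_) (fun _ _ _ _ _ _ h1 h2 => h1.trans hh h2)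
        (fun _ _ _ _ h1 => h1.symm hh) (Set.mem_univ a) (Set.mem_univ b)
      obtain ⟨U, hU, -, h0, h1⟩ := key t₀
      rw [nhdsWithin_univ]
      filter_upwards [(hU.preimage continuous_subtype_val).mem_nhds h0] with t ht using h1 t ht
    intro t₀
    have hQ' : ∀ t, cellDim (Q t) ≤ n := fun t => Nat.lt_succ_iff.1 (hQ t)
    have hball : ∀ V : Set s, IsOpen V → t₀ ∈ V → ∃ U : Set ℝ, IsOpen U ∧ Convex ℝ U ∧
        t₀.1 ∈ U ∧ ∀ t : s, t.1 ∈ U → t ∈ V := by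
      intro V hV h0
      obtain ⟨r, hr, hrV⟩ := Metric.isOpen_iff.1 hV t₀ h0
      exact ⟨Metric.ball t₀.1 r, Metric.isOpen_ball, convex_ball _ _, Metric.mem_ball_self hr,
        fun t ht => hrV ht⟩
    by_cases hdim : cellDim (Q t₀) = n
    · obtain ⟨z, hz, c₀, hc₀, hnf⟩ := exists_normalForm_eq hdim
      classical
      let F : X _⦋n⦌ → stdSimplex ℝ (Fin (n + 1)) → Fin (n + 1) → ℝ := fun z' c =>
        if z' = z then minCoord c • ⇑c else 0
      have hF : ContinuousOn (cellFun n F 0) {q | cellDim q ≤ n} := by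
        refine continuousOn_cellFun (fun z' _ => ?_) (fun z' _ b hb => ?_)
          (fun _ _ _ _ => continuous_const)
        · by_cases h : z' = z
          · simp only [F, h, if_true]
            exact continuous_minCoord.smul continuous_subtype_val
          · simp only [F, h, if_false]
            exact continuous_const
        · simp only [F, minCoord_eq_zero hb, zero_smul, ite_self]
          rfl
      let ψ : s → Fin (n + 1) → ℝ := fun t => cellFun n F 0 (Q t)
      have hψ : Continuous ψ := hF.comp_continuous Q.continuous hQ'
      have hψ0 : 0 < ψ t₀ 0 := by
        simp only [ψ, cellFun_eq hnf, F, if_true]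
        exact mul_pos (minCoord_pos hc₀) (hc₀ 0)
      have hψQ : ∀ t, 0 < ψ t 0 → ∃ c, IsInterior c ∧ ψ t = minCoord c • ⇑c ∧ real z c = Q t := by
        intro t ht
        by_cases hd : cellDim (Q t) = n
        · obtain ⟨z', hz', c', hc', hnf'⟩ := exists_normalForm_eq hd
          by_cases hzz : z' = z
          · subst hzz
            refine ⟨c', hc', ?_, ?_⟩
            · simp only [ψ, cellFun_eq hnf', F, if_true]
            · rw [← real_normalForm (Q t), hnf']
          · simp only [ψ, cellFun_eq hnf', F, if_neg hzz] at ht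
            exact absurd ht (lt_irrefl _)
        · simp only [ψ, cellFun_of_ne hd] at ht
          exact absurd ht (lt_irrefl _)
      obtain ⟨U, hU, hUc, h0, hUV⟩ := hball {t | 0 < ψ t 0}
        (isOpen_lt continuous_const ((continuous_apply 0).comp hψ)) hψ0
      refine ⟨U, hU, hUc, h0, fun t ht => ?_⟩
      let ι : C((s ∩ U : Set ℝ), s) := ⟨Set.inclusion Set.inter_subset_left, by fun_prop⟩
      have hsum : ∀ t : (s ∩ U : Set ℝ), ∃ c : stdSimplex ℝ (Fin (n + 1)),
          (∀ i, c i = ψ (ι t) i / ∑ j, ψ (ι t) j) ∧ 0 < ∑ j, ψ (ι t) j ∧ real z c = Q (ι t) := by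
        intro t
        obtain ⟨c, hc, h1, h2⟩ := hψQ (ι t) (hUV _ t.2.2)
        have h3 : ∑ j, ψ (ι t) j = minCoord c := by
          simp only [h1, Pi.smul_apply, smul_eq_mul, ← Finset.mul_sum, stdSimplex.sum_eq_one,
            mul_one]
        refine ⟨c, fun i => ?_, h3 ▸ minCoord_pos hc, h2⟩
        rw [h3, h1, Pi.smul_apply, smul_eq_mul, mul_div_cancel_left₀ _ (minCoord_pos hc).ne']
      choose g hg hg0 hgQ using hsum
      have hgc : Continuous g := by
        refine continuous_induced_rng.2 (continuous_pi fun i => ?_)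
        have h1 : Continuous fun t => ψ (ι t) := hψ.comp ι.continuous
        have h2 : Continuous fun t => ψ (ι t) i / ∑ j, ψ (ι t) j :=
          ((continuous_apply i).comp h1).div
            (continuous_finsetSum _ fun j _ => (continuous_apply j).comp h1) fun t => (hg0 t).ne'
        exact h2.congr fun t => (hg t i).symm
      have := hfac (s ∩ U) (hs.inter hUc) (Q.comp ι) n z ⟨g, hgc⟩ hgQ ⟨t₀, t₀.2, h0⟩ ⟨t, t.2, ht⟩
      exact (IsParallel.comp_iff (hs' := hs) hh).1 this
    · let Fm : X _⦋n⦌ → stdSimplex ℝ (Fin (n + 1)) → ℝ := fun _ => minCoord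
      have hFm : ContinuousOn (cellFun n Fm 0) {q | cellDim q ≤ n} :=
        continuousOn_cellFun (fun _ _ => continuous_minCoord)
          (fun _ _ b hb => minCoord_eq_zero hb) (fun _ _ _ _ => continuous_const)
      let F : X _⦋n⦌ → stdSimplex ℝ (Fin (n + 1)) → C(unitInterval, SSet.toTop.obj X) :=
        fun z c => ⟨fun u => real z (push (c, u)),
          (real z).continuous.comp (continuous_push.comp (by fun_prop))⟩
      have hF : ContinuousOn (cellFun n F (ContinuousMap.const unitInterval))
          {q | cellDim q ≤ n} := by
        refine continuousOn_cellFun (fun z _ => ?_) (fun z _ b hb => ?_) (fun _ _ z _ => ?_)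
        · exact (ContinuousMap.curry (⟨fun p => real z (push p),
            (real z).continuous.comp continuous_push⟩ :
            C(stdSimplex ℝ (Fin (n + 1)) × unitInterval, SSet.toTop.obj X))).continuous
        · exact ContinuousMap.ext fun u => congrArg (real z) (push_of_not_isInterior hb u)
        · exact ContinuousMap.continuous_const'.comp (real z).continuous
      obtain ⟨U, hU, hUc, h0, hUV⟩ := hball {t | cellFun n Fm 0 (Q t) < 1 / (2 * (n + 1))}
        (isOpen_lt (hFm.comp_continuous Q.continuous hQ') continuous_const) (by
          change cellFun n Fm 0 (Q t₀) < _
          rw [cellFun_of_ne hdim]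
          exact (by positivity : (0 : ℝ) < 1 / (2 * (n + 1))))
      refine ⟨U, hU, hUc, h0, fun t ht => ?_⟩
      let ι : C((s ∩ U : Set ℝ), s) := ⟨Set.inclusion Set.inter_subset_left, by fun_prop⟩
      let H : (s ∩ U : Set ℝ) → C(unitInterval, SSet.toTop.obj X) := fun t =>
        cellFun n F (ContinuousMap.const unitInterval) (Q (ι t))
      have hH : Continuous H :=
        hF.comp_continuous (Q.continuous.comp ι.continuous) fun t => hQ' _
      have hH' : ∀ t, (∃ (z : X _⦋n⦌) (c : stdSimplex ℝ (Fin (n + 1))), real z c = Q (ι t) ∧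
          minCoord c < 1 / (2 * (n + 1)) ∧ ∀ u, H t u = real z (push (c, u))) ∨
          cellDim (Q (ι t)) < n ∧ ∀ u, H t u = Q (ι t) := by
        intro t
        by_cases hd : cellDim (Q (ι t)) = n
        · obtain ⟨z, hz, c, hc, hnf⟩ := exists_normalForm_eq hd
          refine Or.inl ⟨z, c, ?_, ?_, fun u => ?_⟩
          · rw [← real_normalForm (Q (ι t)), hnf]
          · have := hUV (ι t) t.2.2
            rwa [Set.mem_ofPred_eq, cellFun_eq hnf] at this
          · simp only [H, cellFun_eq hnf]
            rfl
        · refine Or.inr ⟨lt_of_le_of_ne (hQ' _) hd, fun u => ?_⟩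
          simp only [H, cellFun_of_ne hd]
          rfl
      let K : Set (ℝ × ℝ) := (s ∩ U) ×ˢ Set.Icc 0 1
      have hK : Convex ℝ K := (hs.inter hUc).prod (convex_Icc 0 1)
      let Q₂ : C(K, SSet.toTop.obj X) := ⟨fun p => H ⟨p.1.1, p.2.1⟩ ⟨p.1.2, p.2.2⟩, by
        have h1 : Continuous fun p : K => H ⟨p.1.1, p.2.1⟩ := hH.comp (by fun_prop)
        exact h1.eval (by fun_prop)⟩
      let row : unitInterval → C((s ∩ U : Set ℝ), K) := fun u =>
        ⟨fun t => ⟨(t.1, u.1), t.2, u.2⟩, by fun_prop⟩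
      let col : (s ∩ U : Set ℝ) → C(Set.Icc (0 : ℝ) 1, K) := fun t =>
        ⟨fun u => ⟨(t.1, u.1), t.2, u.2⟩, by fun_prop⟩
      have hcol : ∀ t, IsParallel h c hK Q₂ (col t 0) (col t 1) := by
        intro t
        refine (IsParallel.comp_iff (hs := convex_Icc (0 : ℝ) 1) hh (f := col t)).1 ?_
        rcases hH' t with ⟨z, c', -, -, h1⟩ | ⟨-, h1⟩
        · exact hfac _ _ _ n z ⟨fun u => push (c', u), continuous_push.comp (by fun_prop)⟩
            (fun u => (h1 u).symm) _ _
        · refine hfac _ _ _ _ (normalForm (Q (ι t))).2.1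
            (ContinuousMap.const _ (normalForm (Q (ι t))).2.2) (fun u => ?_) _ _
          exact (real_normalForm _).trans (h1 u).symm
      have hrow : ∀ a b, IsParallel h c hK Q₂ (row 1 a) (row 1 b) := by
        intro a b
        refine (IsParallel.comp_iff (hs := hs.inter hUc) hh (f := row 1)).1 ?_
        refine ih _ _ _ (fun t => ?_) _ _
        change cellDim (H t 1) < n
        rcases hH' t with ⟨z, c', -, h2, h1⟩ | ⟨h2, h1⟩
        · rw [h1]
          exact cellDim_real_lt z (not_isInterior_push h2)
        · rwa [h1]
      have := ((hcol ⟨t₀, t₀.2, h0⟩).trans hh (hrow _ ⟨t, t.2, ht⟩)).trans hh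
        ((hcol ⟨t, t.2, ht⟩).symm hh)
      have h2 := (IsParallel.comp_iff (hs := hs.inter hUc) hh (f := row 0)
        (a := ⟨t₀, t₀.2, h0⟩) (b := ⟨t, t.2, ht⟩)).2 this
      have h3 : Q₂.comp (row 0) = Q.comp ι := by
        refine ContinuousMap.ext fun t => ?_
        change H t 0 = Q (ι t)
        rcases hH' t with ⟨z, c', h4, -, h1⟩ | ⟨-, h1⟩
        · rw [h1, push_zero, h4]
        · exact h1 0
      rw [h3] at h2
      exact (IsParallel.comp_iff (hs' := hs) hh).1 h2

lemma isParallel_path (hh : IsCocycle h)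
    (hc : ∀ n (σ : X _⦋n⦌) a b, IsParallel h c (convex_stdSimplex ℝ (Fin (n + 1))) (real σ) a b)
    {a b : SSet.toTop.obj X} (γ : Path a b) (y : Γ) : y ∈ c a ↔ y * h (pathEdge γ) ∈ c b := by
  obtain ⟨N, hN⟩ := exists_cellDim_le γ.toContinuousMap
  have := isParallel_of_cellDim_lt hh hc (N + 1) (Set.Icc 0 1) (convex_Icc 0 1)
    γ.toContinuousMap (fun t => Nat.lt_succ_iff.2 (hN t)) 0 1 y
  have h0 : γ.toContinuousMap 0 = a := γ.source
  have h1 : γ.toContinuousMap 1 = b := γ.target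
  rw [h0, h1] at this
  exact this

end Good

end LetterBraiding

namespace LetterBraiding

set_option linter.unusedSectionVars false
set_option maxSynthPendingDepth 3

open Simplicial Opposite

variable {X : SSet.{u}}

section Trees

lemma exists_rootedTree (hX : X.IsConnected) (x : X _⦋0⦌) : Nonempty (RootedTree X x) := by
  classical
  let adj : X _⦋1⦌ → X _⦋0⦌ → X _⦋0⦌ → Prop := fun e v w =>
    (X.δ 1 e = v ∧ X.δ 0 e = w) ∨ (X.δ 0 e = v ∧ X.δ 1 e = w)
  let reach : ℕ → X _⦋0⦌ → Prop := fun n => Nat.rec (fun v => v = x)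
    (fun _ r v => ∃ w, r w ∧ ∃ e, adj e w v) n
  have hreach : ∀ v, ∃ n, reach n v := by
    intro v
    have h1 : Relation.EqvGen SSet.π₀Rel x v :=
      (SSet.π₀.mk_eq_mk_iff x v).1 (Subsingleton.elim _ _)
    have h2 : ∀ v w, Relation.EqvGen SSet.π₀Rel v w →
        ((∃ n, reach n v) ↔ ∃ n, reach n w) := by
      intro v w h1
      induction h1 with
      | rel v w h =>
        obtain ⟨e⟩ := h
        exact ⟨fun ⟨n, hn⟩ => ⟨n + 1, v, hn, e.edge, Or.inl ⟨e.src_eq, e.tgt_eq⟩⟩,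
          fun ⟨n, hn⟩ => ⟨n + 1, w, hn, e.edge, Or.inr ⟨e.tgt_eq, e.src_eq⟩⟩⟩
      | refl v => rfl
      | symm v w _ ih => exact ih.symm
      | trans v w y _ _ h1 h2 => exact h1.trans h2
    exact (h2 x v h1).1 ⟨0, rfl⟩
  obtain ⟨rank, hr, hr'⟩ : ∃ rank : X _⦋0⦌ → ℕ, (∀ v, reach (rank v) v) ∧
      ∀ v n, reach n v → rank v ≤ n :=
    ⟨fun v => sInf {n | reach n v}, fun v => Nat.sInf_mem (hreach v), fun v n h => Nat.sInf_le h⟩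
  have key : ∀ v, ∃ (w : X _⦋0⦌) (e : X _⦋1⦌), v ≠ x → rank w < rank v ∧ adj e w v := by
    intro v
    by_cases hv : v = x
    · exact ⟨v, X.σ 0 v, fun h => absurd hv h⟩
    · have h := hr v
      generalize rank v = m at h ⊢
      rcases m with _ | n
      · exact absurd h hv
      · obtain ⟨w, hw, e, he⟩ := h
        exact ⟨w, e, fun _ => ⟨Nat.lt_succ_of_le (hr' w n hw), he⟩⟩
  choose parent edge h using key
  exact ⟨⟨parent, edge, rank, fun v hv => (h v hv).1, fun v hv => (h v hv).2⟩⟩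

end Trees

section Vertices

/-- The edges of a simplicial set, as edges of the singular simplicial set of the realization. -/
noncomputable abbrev realEdge (e : X _⦋1⦌) : (TopCat.toSSet.obj (SSet.toTop.obj X)) _⦋1⦌ :=
  (sSetTopAdj.unit.app X).app _ e

/-- The points of the realization that correspond to vertices. -/
noncomputable abbrev realVertex (v : X _⦋0⦌) : SSet.toTop.obj X :=
  TopCat.toSSetObj₀Equiv ((sSetTopAdj.unit.app X).app _ v)

lemma real_eq_realVertex (v : X _⦋0⦌) (t : stdSimplex ℝ (Fin 1)) : real v t = realVertex v := by
  obtain rfl := Subsingleton.elim t default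
  rfl

lemma realVertex_injective : Function.Injective (realVertex (X := X)) := by
  intro v w h
  have key : ∀ v : X _⦋0⦌, normalForm (realVertex v) = ⟨0, v, stdSimplex.vertex 0⟩ := fun v => by
    rw [← real_eq_realVertex v (stdSimplex.vertex 0)]
    refine normalForm_real (by simp) fun i => ?_
    rw [show i = 0 from Subsingleton.elim (α := Fin 1) i 0]
    have := stdSimplex.eq_one_of_unique (S := ℝ) (X := Fin 1) (stdSimplex.vertex 0) 0
    exact this.symm ▸ one_pos
  have := (key v).symm.trans ((congrArg normalForm h).trans (key w))
  simpa using this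

lemma real_vertex_zero (e : X _⦋1⦌) : real e (stdSimplex.vertex 0) = realVertex (X.δ 1 e) := by
  rw [← real_eq_realVertex _ (stdSimplex.vertex 0)]
  refine Eq.trans ?_ (real_map (SimplexCategory.δ 1) e _).symm
  rw [stdSimplex.map_vertex]
  rfl

lemma real_vertex_one (e : X _⦋1⦌) : real e (stdSimplex.vertex 1) = realVertex (X.δ 0 e) := by
  rw [← real_eq_realVertex _ (stdSimplex.vertex 0)]
  refine Eq.trans ?_ (real_map (SimplexCategory.δ 0) e _).symm
  rw [stdSimplex.map_vertex]
  rfl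

lemma joined_realization {x : X _⦋0⦌} (T : RootedTree X x) (q : SSet.toTop.obj X) :
    Joined (realVertex x) q := by
  have hv : ∀ v, Joined (realVertex x) (realVertex v) := by
    have he : ∀ e : X _⦋1⦌, Joined (realVertex (X.δ 1 e)) (realVertex (X.δ 0 e)) := fun e => by
      rw [← real_vertex_zero, ← real_vertex_one]
      exact ⟨edgePath (realEdge e)⟩
    exact T.induction (Joined.refl _) (fun v _ h => h.trans (he _))
      (fun v _ h => h.trans (he _).symm)
  obtain ⟨n, σ, t, rfl⟩ := exists_real_eq q
  refine (hv (X.map (SimplexCategory.const ⦋0⦌ ⦋n⦌ 0).op σ)).trans ?_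
  rw [← real_eq_realVertex _ (stdSimplex.vertex 0), real_map]
  exact ⟨(PathConnectedSpace.somePath _ t).map (real σ).continuous⟩

end Vertices

section Generation

variable {Γ : Type u} [Group Γ] {h : (TopCat.toSSet.obj (SSet.toTop.obj X)) _⦋1⦌ → Γ}

lemma IsCocycle.vertices_mem (N : Subgroup Γ) (hN : ∀ e : X _⦋1⦌, h (realEdge e) ∈ N) {n : ℕ}
    (σ : X _⦋n⦌) (i : Fin (n + 1)) : h (affineSing (convex_stdSimplex ℝ (Fin (n + 1))) (real σ)
      ![stdSimplex.vertex 0, stdSimplex.vertex i]) ∈ N := by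
  have hmono : Monotone ![(0 : Fin (n + 1)), i] := by
    intro a b hab
    fin_cases a <;> fin_cases b <;> simp_all
  let ι : ⦋1⦌ ⟶ ⦋n⦌ := SimplexCategory.Hom.mk ⟨![0, i], hmono⟩
  have := hN (X.map ι.op σ)
  rw [← affineSing_singMap (realEdge (X.map ι.op σ))] at this
  convert this using 2
  refine affineSing_congr _ _ fun t => ?_
  rw [affineSimplex_stdSimplex]
  refine Eq.trans ?_ (real_map ι σ t).symm
  congr 1
  rw [← affineSimplex_stdSimplex (stdSimplex.map _ t), affineSimplex_map]
  congr 2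
  funext j
  fin_cases j <;> rfl

/-- A cocycle on the singular simplicial set of a realization takes paths between vertices into the
subgroup that its values on the edges of the simplicial set generate. -/
lemma IsCocycle.pathEdge_mem (hh : IsCocycle h) (N : Subgroup Γ)
    (hN : ∀ e : X _⦋1⦌, h (realEdge e) ∈ N) {v w : X _⦋0⦌}
    (γ : Path (realVertex v) (realVertex w)) : h (pathEdge γ) ∈ N := by
  let φ : ∀ n, X _⦋n⦌ → stdSimplex ℝ (Fin (n + 1)) → Set Γ := fun n σ t =>
    {y | y * (h (affineSing (convex_stdSimplex ℝ (Fin (n + 1))) (real σ)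
      ![stdSimplex.vertex 0, t]))⁻¹ ∈ N}
  obtain ⟨c, hc⟩ := exists_desc_fun φ (by
    intro m n f σ t
    have h1 : real (X.map f.op σ) = (real σ).comp ⟨stdSimplex.map f.toOrderHom,
      stdSimplex.continuous_map _⟩ := ContinuousMap.ext (real_map f σ)
    ext y
    simp only [φ, Set.mem_ofPred_eq]
    rw [h1, hh.affineSing_comp (hs' := convex_stdSimplex ℝ (Fin (n + 1))),
      hh.affineSing_mul _ (real σ) (stdSimplex.vertex 0) (stdSimplex.vertex (f.toOrderHom 0)),
      mul_inv_rev, ← mul_assoc, N.mul_mem_cancel_right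
        (N.inv_mem (IsCocycle.vertices_mem N hN σ (f.toOrderHom 0)))]
    simp only [ContinuousMap.coe_mk, stdSimplex.map_vertex])
  have hpar : ∀ n (σ : X _⦋n⦌) a b,
      IsParallel h c (convex_stdSimplex ℝ (Fin (n + 1))) (real σ) a b := by
    intro n σ a b y
    rw [hc, hc]
    simp only [φ, Set.mem_ofPred_eq]
    rw [hh.affineSing_mul _ (real σ) (stdSimplex.vertex 0) a b, mul_inv_rev, mul_assoc,
      mul_inv_cancel_left]
  have h0 : ∀ v y, y ∈ c (realVertex v) ↔ y ∈ N := by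
    intro v y
    rw [← real_eq_realVertex v (stdSimplex.vertex 0), hc]
    simp only [φ, Set.mem_ofPred_eq]
    rw [hh.affineSing_self, inv_one, mul_one]
  have := isParallel_path hh hpar γ 1
  rw [h0, h0, one_mul] at this
  exact this.1 N.one_mem

end Generation

section SimplicialGroup

lemma pathClass_mul {Z : TopCat.{u}} {x : Z} (p : ∀ y, Path.Homotopic.Quotient x y)
    (l : Z → (FundamentalGroup Z x)ᵐᵒᵖ) {a b : Z} (γ : Path a b) :
    pathClass (fun y => (FundamentalGroup.toPath (l y).unop).trans (p y)) γ =
      l a * pathClass p γ * (l b)⁻¹ := by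
  have key : ∀ (P : FundamentalGroupoid.mk x ⟶ ⟨a⟩) (Q : FundamentalGroupoid.mk x ⟶ ⟨b⟩)
      (g : FundamentalGroupoid.mk a ⟶ ⟨b⟩) (L L' : FundamentalGroupoid.mk x ⟶ ⟨x⟩),
      ((L ≫ P) ≫ g) ≫ inv (L' ≫ Q) = (L ≫ ((P ≫ g) ≫ inv Q)) ≫ inv L' := by
    intro P Q g L L'
    simp
  have := key (p a) (p b) (Path.Homotopic.Quotient.mk γ) (l a).unop (l b).unop
  simp only [← Groupoid.inv_eq_inv] at this
  exact congrArg MulOpposite.op this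

lemma exists_paths {x : X _⦋0⦌} (T : RootedTree X x) :
    ∃ p : ∀ y, Path.Homotopic.Quotient (realVertex x) y,
      p (realVertex x) = Path.Homotopic.Quotient.refl _ ∧
      ∀ v, v ≠ x → pathClass p (edgePath (realEdge (T.edge v))) = 1 := by
  classical
  let p₀ : ∀ y, Path.Homotopic.Quotient (realVertex x) y := fun y =>
    if h : y = realVertex x then h ▸ Path.Homotopic.Quotient.refl y
    else Path.Homotopic.Quotient.mk (joined_realization T y).somePath
  have hp₀ : p₀ (realVertex x) = Path.Homotopic.Quotient.refl _ := by simp [p₀]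
  let c : X _⦋1⦌ → (FundamentalGroup (SSet.toTop.obj X) (realVertex x))ᵐᵒᵖ := fun e =>
    pathClass p₀ (edgePath (realEdge e))
  let l : SSet.toTop.obj X → (FundamentalGroup (SSet.toTop.obj X) (realVertex x))ᵐᵒᵖ :=
    Function.extend realVertex (T.sol c) 1
  have hl : ∀ v, l (realVertex v) = T.sol c v := realVertex_injective.extend_apply _ _
  refine ⟨fun y => (FundamentalGroup.toPath (l y).unop).trans (p₀ y), ?_, fun v hv => ?_⟩
  · beta_reduce
    rw [hl, T.sol_root, hp₀]
    exact Category.id_comp (𝟙 (FundamentalGroupoid.mk (realVertex x)))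
  · refine (pathClass_mul p₀ l _).trans ?_
    have h0 : singMap (realEdge (T.edge v)) (stdSimplex.vertex 0) = _ := real_vertex_zero (T.edge v)
    have h1 : singMap (realEdge (T.edge v)) (stdSimplex.vertex 1) = _ := real_vertex_one (T.edge v)
    rw [(congrArg l h0).trans (hl _), (congrArg l h1).trans (hl _), T.sol_edge c v hv]
    exact mul_inv_cancel (T.sol c _ * c (T.edge v))

/-- The fundamental group of the realization of a simplicial set is its edge path group, if all
cocycles on the edges extend to the singular simplicial set. -/
noncomputable def simplicialGroup {x : X _⦋0⦌} (T : RootedTree X x)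
    (p : ∀ y, Path.Homotopic.Quotient (realVertex x) y)
    (hp : p (realVertex x) = Path.Homotopic.Quotient.refl _)
    (hpT : ∀ v, v ≠ x → pathClass p (edgePath (realEdge (T.edge v))) = 1)
    (h : (TopCat.toSSet.obj (SSet.toTop.obj X)) _⦋1⦌ → PresentedGroup T.rels)
    (hh : IsCocycle h) (hX : ∀ e : X _⦋1⦌, h (realEdge e) = PresentedGroup.of e) :
    EdgePathGroup X x (FundamentalGroup (SSet.toTop.obj X) (realVertex x))ᵐᵒᵖ where
  tree := T
  g e := pathClass p (edgePath (realEdge e))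
  g_tri s := by
    have := isCocycle_pathClass p ((sSetTopAdj.unit.app X).app _ s)
    rw [← SSet.δ_naturality_apply, ← SSet.δ_naturality_apply, ← SSet.δ_naturality_apply] at this
    exact this
  g_tree := hpT
  closure_range := by
    rw [eq_top_iff]
    rintro g -
    obtain ⟨γ, hγ⟩ := Quotient.exists_rep (FundamentalGroup.toPath g.unop)
    have h1 : pathClass p (edgePath (pathEdge γ)) = g := (pathClass_edgePath_pathEdge p γ).trans
      ((pathClass_loop p hp γ).trans (congrArg MulOpposite.op hγ))
    rw [← h1]
    exact (isCocycle_pathClass p).pathEdge_mem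
      (Subgroup.closure (Set.range fun e => pathClass p (edgePath (realEdge e))))
      (fun e => Subgroup.subset_closure ⟨e, rfl⟩) γ
  ρ := hh.hom _
  ρ_g e := by
    have h1 : ∀ e : X _⦋1⦌, hh.hom _ (pathClass p (edgePath (realEdge e))) =
        h (pathEdge (p (realVertex (X.δ 1 e))).out) * PresentedGroup.of e *
          (h (pathEdge (p (realVertex (X.δ 0 e))).out))⁻¹ := by
      intro e
      rw [← real_vertex_zero, ← real_vertex_one, ← hX]
      refine (hh.hom_pathClass p _).trans ?_
      rw [pathEdge_edgePath]
      rfl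
    have h2 : ∀ v, h (pathEdge (p (realVertex v)).out) = 1 := by
      have h3 : ∀ v, v ≠ x → h (pathEdge (p (realVertex (X.δ 1 (T.edge v)))).out) =
          h (pathEdge (p (realVertex (X.δ 0 (T.edge v)))).out) := by
        intro v hv
        have := h1 (T.edge v)
        rw [hpT v hv, map_one, T.of_edge hv, mul_one] at this
        exact mul_inv_eq_one.1 this.symm
      refine T.induction ?_ (fun v hv h => (h3 v hv).symm.trans h) (fun v hv h => (h3 v hv).trans h)
      have : Path.Homotopic.Quotient.mk (p (realVertex x)).out =
          Path.Homotopic.Quotient.mk (Path.refl _) := (Quotient.out_eq (p _)).trans hp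
      exact (hh.pathEdge_congr (Quotient.exact this)).trans (hh.pathEdge_refl _)
    rw [h1, h2, h2, one_mul, inv_one, mul_one]

end SimplicialGroup

end LetterBraiding

namespace LetterBraiding

set_option linter.unusedSectionVars false
set_option maxSynthPendingDepth 3

open Simplicial Opposite MeasureTheory Topology

section CoveringCocycle

/-- A map to the base of a covering with group `Γ` defines a cocycle on the singular simplicial set,
which compares the ends of lifts with the values of a section. -/
lemma exists_isCocycle_of_covering {Y B : Type*} [TopologicalSpace Y] [TopologicalSpace B]
    {Γ : Type*} [Group Γ] [MulAction Γ Y] {q : Y → B} (hq : IsQuotientCoveringMap q Γ)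
    {s : B → Y} (hs : ∀ b, q (s b) = b) {Z : TopCat.{u}} (F : C(Z, B)) :
    ∃ h : (TopCat.toSSet.obj Z) _⦋1⦌ → Γ, IsCocycle h ∧
      ∀ (e : (TopCat.toSSet.obj Z) _⦋1⦌) (φ : C(stdSimplex ℝ (Fin 2), Y)),
        (∀ t, q (φ t) = F (singMap e t)) → ∀ a b : Γ,
        φ (stdSimplex.vertex 0) = a • s (F (singMap e (stdSimplex.vertex 0))) →
        φ (stdSimplex.vertex 1) = b • s (F (singMap e (stdSimplex.vertex 1))) → h e = a⁻¹ * b := by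
  have hcont := hq.toContinuousConstSMul
  have hcancel := hq.isCancelSMul
  have hlift : ∀ {n : ℕ} (σ : (TopCat.toSSet.obj Z) _⦋n⦌) (y : Y),
      q y = F (singMap σ (stdSimplex.vertex 0)) →
      ∃! φ : C(stdSimplex ℝ (Fin (n + 1)), Y), φ (stdSimplex.vertex 0) = y ∧
        q ∘ φ = F.comp (singMap σ) := by
    intro n σ y hy
    have := (convex_stdSimplex ℝ (Fin (n + 1))).contractibleSpace
      ⟨_, (stdSimplex.vertex (S := ℝ) (0 : Fin (n + 1))).2⟩
    have := (convex_stdSimplex ℝ (Fin (n + 1))).locallyPathConnectedSpace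
    exact hq.isCoveringMap.existsUnique_continuousMap_lifts (F.comp (singMap σ)) _ y hy
  have horb : ∀ y b, q y = b → ∃ a : Γ, y = a • s b := by
    intro y b h
    obtain ⟨a, ha⟩ := hq.apply_eq_iff_mem_orbit.1 (h.trans (hs b).symm)
    exact ⟨a, ha.symm⟩
  have hex : ∀ e : (TopCat.toSSet.obj Z) _⦋1⦌, ∃ g : Γ, ∀ φ : C(stdSimplex ℝ (Fin 2), Y),
      (∀ t, q (φ t) = F (singMap e t)) → ∀ a b : Γ,
      φ (stdSimplex.vertex 0) = a • s (F (singMap e (stdSimplex.vertex 0))) →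
      φ (stdSimplex.vertex 1) = b • s (F (singMap e (stdSimplex.vertex 1))) → g = a⁻¹ * b := by
    intro e
    obtain ⟨φ₀, ⟨h0, h0'⟩, huniq⟩ := hlift e (s (F (singMap e (stdSimplex.vertex 0)))) (hs _)
    obtain ⟨g, hg⟩ := horb (φ₀ (stdSimplex.vertex 1)) _ (congrFun h0' _)
    refine ⟨g, fun φ hφ a b ha hb => ?_⟩
    have h1 : (⟨fun t => a⁻¹ • φ t, by fun_prop⟩ : C(stdSimplex ℝ (Fin 2), Y)) = φ₀ := by
      refine huniq _ ⟨?_, funext fun t => ?_⟩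
      · change a⁻¹ • φ _ = _
        rw [ha, inv_smul_smul]
      · exact (hq.map_smul a⁻¹).trans (hφ t)
    have h2 := DFunLike.congr_fun h1 (stdSimplex.vertex 1)
    change a⁻¹ • φ _ = _ at h2
    rw [hb, hg, smul_smul] at h2
    exact (IsCancelSMul.right_cancel _ _ _ h2).symm
  choose h hh using hex
  refine ⟨h, fun σ => ?_, hh⟩
  obtain ⟨φ, ⟨-, hφ⟩, -⟩ := hlift σ (s (F (singMap σ (stdSimplex.vertex 0)))) (hs _)
  have hφ' : ∀ t, q (φ t) = F (singMap σ t) := congrFun hφ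
  choose a ha using fun i : Fin 3 => horb (φ (stdSimplex.vertex i)) _ (hφ' _)
  have key : ∀ i : Fin 3, h ((TopCat.toSSet.obj Z).δ i σ) =
      (a (i.succAbove 0))⁻¹ * a (i.succAbove 1) := by
    intro i
    refine hh _ (φ.comp ⟨stdSimplex.map i.succAbove, stdSimplex.continuous_map _⟩)
      (fun t => hφ' _) _ _ ?_ ?_
    · refine (congrArg φ (stdSimplex.map_vertex _ _)).trans ((ha _).trans ?_)
      rw [TopCat.toSSetObjEquiv_δ_apply, stdSimplex.map_vertex]
    · refine (congrArg φ (stdSimplex.map_vertex _ _)).trans ((ha _).trans ?_)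
      rw [TopCat.toSSetObjEquiv_δ_apply, stdSimplex.map_vertex]
  rw [key, key, key]
  change (a 0)⁻¹ * a 2 = (a 0)⁻¹ * a 1 * ((a 1)⁻¹ * a 2)
  group

end CoveringCocycle

section StepFunctions

/-- Functions on the interval, with the distance that measures where they differ. -/
def IntervalFun (Γ : Type u) : Type u := Set.Ico (0 : ℝ) 1 → Γ

namespace IntervalFun

variable {Γ : Type u}

noncomputable instance : PseudoEMetricSpace (IntervalFun Γ) where
  edist f g := volume (Subtype.val '' {r | f r ≠ g r})
  edist_self f := by simp
  edist_comm f g := by simp only [ne_comm]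
  edist_triangle f g h := by
    refine (measure_mono ?_).trans (measure_union_le _ _)
    rw [← Set.image_union]
    refine Set.image_mono fun r hr => ?_
    by_contra hn
    simp only [Set.mem_union, Set.mem_ofPred_eq, not_or, not_not] at hn
    exact hr (hn.1.trans hn.2)

lemma edist_def (f g : IntervalFun Γ) : edist f g = volume (Subtype.val '' {r | f r ≠ g r}) := rfl

variable [Group Γ]

instance : MulAction Γ (IntervalFun Γ) where
  smul g f := fun r => g * f r
  one_smul f := funext fun r => one_mul (f r)
  mul_smul g h f := funext fun r => mul_assoc g h (f r)

lemma smul_apply (g : Γ) (f : IntervalFun Γ) (r : Set.Ico (0 : ℝ) 1) : (g • f) r = g * f r := rfl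

instance : IsIsometricSMul Γ (IntervalFun Γ) where
  isometry_smul g f f' := by simp [edist_def, smul_apply]

lemma edist_smul {g : Γ} (hg : g ≠ 1) (f : IntervalFun Γ) : edist f (g • f) = 1 := by
  have : {r | f r ≠ (g • f) r} = Set.univ :=
    Set.eq_univ_of_forall fun r h => hg (right_eq_mul.1 h)
  rw [edist_def, this, Set.image_univ, Subtype.range_coe, Real.volume_Ico]
  simp

lemma isQuotientCoveringMap : IsQuotientCoveringMap
    (Quotient.mk (MulAction.orbitRel Γ (IntervalFun Γ))) Γ where
  __ := isQuotientMap_quotient_mk'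
  continuous_const_smul g := continuous_const_smul g
  apply_eq_iff_mem_orbit := Quotient.eq''
  disjoint f := by
    refine ⟨Metric.eball f (1 / 2), Metric.eball_mem_nhds _ (by simp), fun g hg => ?_⟩
    obtain ⟨_, ⟨f', hf', rfl⟩, hf''⟩ := hg
    by_contra hne
    have h1 := edist_smul hne f'
    have h2 : edist f' (g • f') < 1 / 2 + 1 / 2 :=
      (edist_triangle_right f' (g • f') f).trans_lt (ENNReal.add_lt_add hf' hf'')
    rw [h1, ENNReal.add_halves] at h2
    exact lt_irrefl _ h2

end IntervalFun

variable {n : ℕ}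

lemma exists_stepIndex (t : stdSimplex ℝ (Fin (n + 1))) (r : Set.Ico (0 : ℝ) 1) :
    ∃ i, ∀ j, i ≤ j ↔ (r : ℝ) < ∑ k with k ≤ j, t k := by
  have hmono : ∀ i j : Fin (n + 1), i ≤ j → ∑ k with k ≤ i, t k ≤ ∑ k with k ≤ j, t k :=
    fun i j hij => Finset.sum_le_sum_of_subset_of_nonneg
      (fun k hk => by simp only [Finset.mem_filter, Finset.mem_univ, true_and] at *; omega)
      (fun k _ _ => stdSimplex.zero_le t k)
  have hne : (Finset.univ.filter fun j => (r : ℝ) < ∑ k with k ≤ j, t k).Nonempty := by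
    refine ⟨Fin.last n, Finset.mem_filter.2 ⟨Finset.mem_univ _, ?_⟩⟩
    rw [Finset.filter_true_of_mem fun k _ => Fin.le_last k, stdSimplex.sum_eq_one]
    exact r.2.2
  exact ⟨Finset.min' _ hne, fun j => ⟨fun h =>
    (Finset.mem_filter.1 (Finset.min'_mem _ hne)).2.trans_le (hmono _ _ h),
    fun h => Finset.min'_le _ j (Finset.mem_filter.2 ⟨Finset.mem_univ _, h⟩)⟩⟩

/-- The index of the subinterval that contains a point, in the subdivision of the interval that the
barycentric coordinates define. -/
noncomputable def stepIndex (t : stdSimplex ℝ (Fin (n + 1))) (r : Set.Ico (0 : ℝ) 1) :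
    Fin (n + 1) := (exists_stepIndex t r).choose

lemma stepIndex_le_iff {t : stdSimplex ℝ (Fin (n + 1))} {r : Set.Ico (0 : ℝ) 1}
    {j : Fin (n + 1)} : stepIndex t r ≤ j ↔ (r : ℝ) < ∑ k with k ≤ j, t k :=
  (exists_stepIndex t r).choose_spec j

lemma stepIndex_map {m : ℕ} (f : ⦋m⦌ ⟶ ⦋n⦌) (t : stdSimplex ℝ (Fin (m + 1)))
    (r : Set.Ico (0 : ℝ) 1) :
    stepIndex (stdSimplex.map f.toOrderHom t) r = f.toOrderHom (stepIndex t r) := by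
  refine eq_of_forall_ge_iff fun j => ?_
  have hsum : ∑ k with k ≤ j, stdSimplex.map f.toOrderHom t k =
      ∑ i with f.toOrderHom i ≤ j, t i := by
    rw [← Finset.sum_fiberwise_of_maps_to (g := f.toOrderHom)
      (t := Finset.univ.filter fun k => k ≤ j) (by simp)]
    refine Finset.sum_congr rfl fun k hk => ?_
    rw [stdSimplex_map_apply, Finset.filter_filter]
    refine Finset.sum_congr (Finset.filter_congr fun i _ => ?_) fun _ _ => rfl
    exact ⟨fun h => ⟨h ▸ (Finset.mem_filter.1 hk).2, h⟩, fun h => h.2⟩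
  rw [stepIndex_le_iff, hsum]
  constructor
  · intro h
    by_contra! hj
    refine absurd h (not_lt.2 ?_)
    by_cases h0 : stepIndex t r = 0
    · rw [Finset.filter_false_of_mem fun i _ hi => ?_, Finset.sum_empty]
      · exact r.2.1
      · rw [h0] at hj
        exact absurd (hj.trans_le (f.toOrderHom.monotone (Fin.zero_le i))) (not_lt.2 hi)
    · obtain ⟨i, hi⟩ := Fin.exists_succ_eq.2 h0
      have h1 : ¬stepIndex t r ≤ i.castSucc := by
        rw [← hi, not_le]
        exact Fin.castSucc_lt_succ
      rw [stepIndex_le_iff, not_lt] at h1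
      refine le_trans (Finset.sum_le_sum_of_subset_of_nonneg (fun k hk => ?_)
        fun k _ _ => stdSimplex.zero_le t k) h1
      simp only [Finset.mem_filter, Finset.mem_univ, true_and] at hk ⊢
      by_contra! hk'
      have : stepIndex t r ≤ k := by
        rw [← hi]
        exact Fin.castSucc_lt_iff_succ_le.1 hk'
      exact absurd (hj.trans_le (f.toOrderHom.monotone this)) (not_lt.2 hk)
  · intro h
    refine (stepIndex_le_iff.1 (le_refl (stepIndex t r))).trans_le
      (Finset.sum_le_sum_of_subset_of_nonneg (fun k hk => ?_) fun k _ _ => stdSimplex.zero_le t k)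
    simp only [Finset.mem_filter, Finset.mem_univ, true_and] at hk ⊢
    exact (f.toOrderHom.monotone hk).trans h

/-- The step function on the interval with given values, whose steps have the lengths that the
barycentric coordinates prescribe. -/
noncomputable def stepFun {Γ : Type u} (c : Fin (n + 1) → Γ) (t : stdSimplex ℝ (Fin (n + 1))) :
    IntervalFun Γ := fun r => c (stepIndex t r)

lemma continuous_stepFun {Γ : Type u} (c : Fin (n + 1) → Γ) : Continuous (stepFun c) := by
  refine continuous_iff_continuousAt.2 fun t₀ => tendsto_iff_edist_tendsto_0.2 ?_
  let S : Fin (n + 1) → stdSimplex ℝ (Fin (n + 1)) → ℝ := fun j t => ∑ k with k ≤ j, t k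
  have hS : ∀ j, Continuous (S j) := fun j => continuous_finsetSum _ fun k _ =>
    (continuous_apply k).comp continuous_subtype_val
  have hle : ∀ t, edist (stepFun c t) (stepFun c t₀) ≤
      ∑ j, ENNReal.ofReal (abs (S j t₀ - S j t)) := by
    intro t
    have hsub : Subtype.val '' {r | c (stepIndex t r) ≠ c (stepIndex t₀ r)} ⊆
        ⋃ j ∈ (Finset.univ : Finset (Fin (n + 1))), Set.uIcc (S j t) (S j t₀) := by
      rintro _ ⟨r, hr, rfl⟩
      by_contra hn
      simp only [Set.mem_iUnion, Finset.mem_univ, exists_prop, true_and, not_exists] at hn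
      refine hr (congrArg c (eq_of_forall_ge_iff fun j => ?_))
      rw [stepIndex_le_iff, stepIndex_le_iff]
      have := hn j
      rw [Set.mem_uIcc] at this
      push Not at this
      change (r : ℝ) < S j t ↔ (r : ℝ) < S j t₀
      constructor
      · intro h
        by_contra! h'
        exact absurd (this.2 h') (not_lt.2 h.le)
      · intro h
        by_contra! h'
        exact absurd (this.1 h') (not_lt.2 h.le)
    refine (measure_mono hsub).trans ((measure_biUnion_finset_le _ _).trans ?_)
    simp only [Real.volume_interval, le_refl]
  have hcont : Continuous fun t => ∑ j, ENNReal.ofReal (abs (S j t₀ - S j t)) :=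
    continuous_finsetSum _ fun j _ =>
      ENNReal.continuous_ofReal.comp ((continuous_const.sub (hS j)).abs)
  have h0 := hcont.tendsto t₀
  simp only [sub_self, abs_zero, ENNReal.ofReal_zero, Finset.sum_const_zero] at h0
  exact tendsto_of_tendsto_of_tendsto_of_le_of_le tendsto_const_nhds h0 (fun t => zero_le) hle

end StepFunctions

section Extension

variable {X : SSet.{u}} {Γ : Type u} [Group Γ] {c : X _⦋1⦌ → Γ}

open SimplexCategory in
lemma IsCocycle.mkOfLe_mul (hc : IsCocycle c) {n : ℕ} (σ : X _⦋n⦌) (i j k : Fin (n + 1))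
    (hij : i ≤ j) (hjk : j ≤ k) : c (X.map (mkOfLe i k (hij.trans hjk)).op σ) =
      c (X.map (mkOfLe i j hij).op σ) * c (X.map (mkOfLe j k hjk).op σ) := by
  have key : ∀ (l : Fin 3) (a b : Fin (n + 1)) (hab : a ≤ b),
      SimplexCategory.δ l ≫ mkOfLeComp i j k hij hjk = mkOfLe a b hab →
      X.δ l (X.map (mkOfLeComp i j k hij hjk).op σ) = X.map (mkOfLe a b hab).op σ := by
    intro l a b hab h
    rw [← h, op_comp, Functor.map_comp]
    rfl
  have := hc (X.map (mkOfLeComp i j k hij hjk).op σ)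
  rwa [key 1 i k _ (Hom.ext_one_left _ _), key 2 i j hij (Hom.ext_one_left _ _),
    key 0 j k hjk (Hom.ext_one_left _ _)] at this

open SimplexCategory in
/-- A cocycle on the edges of a simplicial set extends to the singular simplicial set of the
realization. -/
lemma IsCocycle.exists_extension (hc : IsCocycle c) :
    ∃ h : (TopCat.toSSet.obj (SSet.toTop.obj X)) _⦋1⦌ → Γ, IsCocycle h ∧
      ∀ e : X _⦋1⦌, h (realEdge e) = c e := by
  have hone : ∀ {n : ℕ} (σ : X _⦋n⦌) (i : Fin (n + 1)), c (X.map (mkOfLe i i le_rfl).op σ) = 1 :=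
    fun σ i => left_eq_mul.1 (hc.mkOfLe_mul σ i i i le_rfl le_rfl)
  let val : ∀ {n : ℕ}, X _⦋n⦌ → Fin (n + 1) → Γ := fun σ i =>
    c (X.map (mkOfLe 0 i (Fin.zero_le i)).op σ)
  have hval : ∀ {m n : ℕ} (f : ⦋m⦌ ⟶ ⦋n⦌) (σ : X _⦋n⦌) (i : Fin (m + 1)),
      val (X.map f.op σ) i = (val σ (f.toOrderHom 0))⁻¹ * val σ (f.toOrderHom i) := by
    intro m n f σ i
    have h1 : mkOfLe 0 i (Fin.zero_le i) ≫ f = mkOfLe (f.toOrderHom 0) (f.toOrderHom i)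
        (f.toOrderHom.monotone (Fin.zero_le i)) := Hom.ext_one_left _ _
    have h2 : X.map (mkOfLe 0 i (Fin.zero_le i)).op (X.map f.op σ) = X.map (mkOfLe
        (f.toOrderHom 0) (f.toOrderHom i) (f.toOrderHom.monotone (Fin.zero_le i))).op σ := by
      rw [← h1, op_comp, Functor.map_comp]
      rfl
    rw [eq_inv_mul_iff_mul_eq]
    simp only [val, h2]
    exact (hc.mkOfLe_mul σ 0 (f.toOrderHom 0) (f.toOrderHom i) _ _).symm
  let step : ∀ {n : ℕ}, X _⦋n⦌ → stdSimplex ℝ (Fin (n + 1)) → IntervalFun Γ := fun σ =>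
    stepFun (val σ)
  have hstep : ∀ {n : ℕ} (σ : X _⦋n⦌), Continuous (step σ) := fun σ => continuous_stepFun (val σ)
  let q : IntervalFun Γ → Quotient (MulAction.orbitRel Γ (IntervalFun Γ)) := Quotient.mk _
  have hq : IsQuotientCoveringMap q Γ := IntervalFun.isQuotientCoveringMap
  obtain ⟨F, hF⟩ := exists_desc (X := X)
    (W := TopCat.of (Quotient (MulAction.orbitRel Γ (IntervalFun Γ))))
    (fun n σ => ⟨fun t => q (step σ t), hq.continuous.comp (hstep σ)⟩) (by
      intro m n f σ t
      refine hq.apply_eq_iff_mem_orbit.2 ⟨(val σ (f.toOrderHom 0))⁻¹, funext fun r => ?_⟩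
      change _ * val σ (stepIndex (stdSimplex.map f.toOrderHom t) r) =
        val (X.map f.op σ) (stepIndex t r)
      rw [stepIndex_map, hval])
  let y₀ : IntervalFun Γ := fun _ => 1
  classical
  let s : Quotient (MulAction.orbitRel Γ (IntervalFun Γ)) → IntervalFun Γ := fun b =>
    if b = q y₀ then y₀ else b.out
  have hs : ∀ b, q (s b) = b := by
    intro b
    by_cases hb : b = q y₀
    · simp only [s, hb, if_true]
    · simp only [s, hb, if_false]
      exact Quotient.out_eq b
  obtain ⟨h, hh, hh'⟩ := exists_isCocycle_of_covering hq hs F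
  refine ⟨h, hh, fun e => ?_⟩
  have hstepe : ∀ (e : X _⦋1⦌) (i : Fin 2), step e (stdSimplex.vertex i) = val e i • y₀ := by
    intro e i
    refine funext fun r => ?_
    have : stepIndex (stdSimplex.vertex i) r = i := by
      refine eq_of_forall_ge_iff fun j => ?_
      rw [stepIndex_le_iff, Finset.sum_congr rfl fun k _ => by rw [stdSimplex.vertex_coe],
        Finset.sum_pi_single']
      by_cases hij : i ≤ j
      · simpa [hij] using r.2.2
      · simpa [hij] using r.2.1
    rw [IntervalFun.smul_apply, mul_one]
    change val e (stepIndex _ r) = _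
    rw [this]
  have hFv : ∀ i : Fin 2, F (singMap (realEdge e) (stdSimplex.vertex i)) = q y₀ := by
    intro i
    refine (hF 1 e (stdSimplex.vertex i)).trans ?_
    change q (step e (stdSimplex.vertex i)) = q y₀
    rw [hstepe]
    exact hq.map_smul _
  have hsv : s (q y₀) = y₀ := if_pos rfl
  rw [hh' (realEdge e) ⟨step e, hstep e⟩ (fun t => (hF 1 e t).symm) (val e 0) (val e 1)
    (by rw [hFv, hsv]; exact hstepe e 0) (by rw [hFv, hsv]; exact hstepe e 1)]
  have h1 : val e 0 = 1 := hone e 0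
  have h2 : val e 1 = c e := by
    have : mkOfLe (0 : Fin 2) 1 (Fin.zero_le 1) = 𝟙 ⦋1⦌ := Hom.ext_one_left _ _
    simp only [val, this]
    rw [op_id, CategoryTheory.Functor.map_id]
    rfl
  rw [h1, h2, inv_one, one_mul]

end Extension

end LetterBraiding

namespace LetterBraiding

set_option linter.unusedSectionVars false
set_option maxSynthPendingDepth 3

open Simplicial Opposite

namespace PointedModel

variable (P : PointedModel.{u})

lemma loopEdge_edge (γ : Path P.base P.base) : (P.loopEdge γ).edge = pathEdge γ := by
  refine sing_ext fun t => ?_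
  refine Eq.trans ?_ (singMap_pathEdge γ t).symm
  rfl

/-- The fundamental group of a pointed model is its edge path group. -/
lemma exists_edgePathGroup (hP : P.IsConnected) :
    ∃ (p : ∀ y, Path.Homotopic.Quotient P.base y) (hp : p P.base = Path.Homotopic.Quotient.refl _)
      (E : EdgePathGroup P.sset P.vertex P.Pi1),
      ∀ e, E.g e = (singGroup p hp).g (P.toSing.app (op ⦋1⦌) e) := by
  cases P with
  | space X x =>
    have : PathConnectedSpace X := hP
    classical
    let p : ∀ y : X, Path.Homotopic.Quotient x y := fun y =>
      if h : y = x then h ▸ Path.Homotopic.Quotient.refl y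
      else Path.Homotopic.Quotient.mk (PathConnectedSpace.somePath x y)
    have hp : p x = Path.Homotopic.Quotient.refl _ := by simp [p]
    exact ⟨p, hp, singGroup p hp, fun _ => rfl⟩
  | simplicial X x =>
    obtain ⟨T⟩ := exists_rootedTree hP x
    obtain ⟨p, hp, hpT⟩ := exists_paths T
    obtain ⟨h, hh, hX⟩ := T.isCocycle_of.exists_extension
    exact ⟨p, hp, simplicialGroup T p hp hpT h hh hX, fun _ => rfl⟩

variable {P} (A : Type v) [CommRing A] [IsDomain A] [IsPrincipalIdealRing A]

lemma comparison_bijective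
    {p : ∀ y, Path.Homotopic.Quotient P.base y} {hp : p P.base = Path.Homotopic.Quotient.refl _}
    {E : EdgePathGroup P.sset P.vertex P.Pi1}
    (hE : ∀ e, E.g e = (singGroup p hp).g (P.toSing.app (op ⦋1⦌) e)) (hG : Group.FG P.Pi1) :
    Function.Bijective (P.comparison A) :=
  E.mapH0_pullback_bijective (singGroup p hp) hG P.toSing P.toSing_vertex hE

lemma isLetterPairing_pairing
    {p : ∀ y, Path.Homotopic.Quotient P.base y} {hp : p P.base = Path.Homotopic.Quotient.refl _}
    {E : EdgePathGroup P.sset P.vertex P.Pi1}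
    (hE : ∀ e, E.g e = (singGroup p hp).g (P.toSing.app (op ⦋1⦌) e)) :
    P.IsLetterPairing A (E.pairing A) := by
  intro T γ
  have h1 : (singGroup p hp).g (P.loopEdge γ).edge = P.loopClass γ := by
    rw [loopEdge_edge]
    exact (pathClass_edgePath_pathEdge p γ).trans (pathClass_loop p hp γ)
  rw [← h1]
  refine (LinearMap.congr_fun (E.pairing_pullback (singGroup p hp) P.toSing P.toSing_vertex hE T)
    _).trans ?_
  exact (singGroup p hp).pairing_g _ _ T

lemma eq_of_isLetterPairing
    {p : ∀ y, Path.Homotopic.Quotient P.base y} {hp : p P.base = Path.Homotopic.Quotient.refl _}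
    {E : EdgePathGroup P.sset P.vertex P.Pi1}
    (hE : ∀ e, E.g e = (singGroup p hp).g (P.toSing.app (op ⦋1⦌) e)) (hG : Group.FG P.Pi1)
    {Φ : (P.cochains A).H0 →ₗ[A] Module.Dual A (P.GroupRing A)} (h : P.IsLetterPairing A Φ) :
    Φ = E.pairing A := by
  refine LinearMap.ext fun T => LinearMap.ext fun x => ?_
  obtain ⟨T, rfl⟩ := (comparison_bijective A hE hG).2 T
  induction x using MonoidAlgebra.induction_on with
  | of g =>
    obtain ⟨γ, hγ⟩ := Quotient.exists_rep (FundamentalGroup.toPath g.unop)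
    have : g = P.loopClass γ := congrArg MulOpposite.op hγ.symm
    rw [this, h T γ, isLetterPairing_pairing A hE T γ]
  | add x y hx hy => rw [map_add, map_add, hx, hy]
  | smul a x hx => rw [map_smul, map_smul, hx]

end PointedModel

end LetterBraiding

theorem mainTheorem11 (A : Type v) [CommRing A] [IsDomain A] [IsPrincipalIdealRing A] :
    (∀ P : LetterBraiding.PointedModel.{u}, P.IsConnected → Group.FG P.Pi1 →
      Function.Bijective (P.comparison A) ∧
      ∃ (_ : Coalgebra A (P.cochains A).H0) (_ : Coalgebra A (P.FiniteType A))
        (Φ : (P.cochains A).H0 ≃ₗc[A] P.FiniteType A)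
        (Ψ : P.completion A →ₐ[A] WithConv ((P.cochains A).H0 →ₗ[A] A)),
        ((P.cochains A).IsBarCoproduct Coalgebra.comul ∧
          Coalgebra.counit = (P.cochains A).counitH0 ∧
          LetterBraiding.IsCoalgebraFiltration Coalgebra.comul (P.cochains A).weightFiltration) ∧
        (P.IsDualCoproduct A Coalgebra.comul ∧
          ∀ φ : P.FiniteType A, Coalgebra.counit (R := A) φ = φ.1 1) ∧
        (P.IsLetterPairing A
            ((P.FiniteType A).subtype ∘ₗ (Φ : (P.cochains A).H0 →ₗ[A] P.FiniteType A)) ∧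
          ∀ n T, T ∈ (P.cochains A).weightFiltration n ↔ (Φ T).1 ∈ P.killing A (n + 1)) ∧
        (∀ n, ∀ T ∈ (P.cochains A).weightFiltration n, ∀ (s : P.completion A)
          (x : P.GroupRing A), Ideal.Quotient.mk _ x = s.1 (n + 1) →
            (Ψ s).ofConv T = (Φ T).1 x) ∧
        Function.Surjective Ψ ∧
        (∀ n (s : P.completion A),
          (∀ T ∈ (P.cochains A).weightFiltration n, (Ψ s).ofConv T = 0) ↔
            ∃ a : A, a ≠ 0 ∧ a • s.1 (n + 1) = 0) ∧
        (∀ n, ∃ m, ∀ f : WithConv ((P.cochains A).H0 →ₗ[A] A),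
          (∀ T ∈ (P.cochains A).weightFiltration m, f.ofConv T = 0) →
            ∃ s : P.completion A, s.1 n = 0 ∧ Ψ s = f) ∧
        ((∀ n, Module.IsTorsionFree A (P.GroupRing A ⧸ P.augmentationIdeal A ^ n)) →
          Function.Bijective Ψ)) ∧
    ∀ (P : LetterBraiding.PointedModel.{u}) (Q : LetterBraiding.PointedModel.{u'}),
      P.IsConnected → Group.FG P.Pi1 → Q.IsConnected → Group.FG Q.Pi1 →
      ∀ ΦP ΦQ, P.IsLetterPairing A ΦP → Q.IsLetterPairing A ΦQ →
      ∀ F : LetterBraiding.AugDGA.Hom (P.cochains A) (Q.cochains A),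
        Function.Bijective F.toAlgHom →
        ∃ Θ : Q.completion A ≃ₐ[A] P.completion A,
          (∀ n s, (Θ s).1 n = 0 ↔ s.1 n = 0) ∧
          ∀ n, ∀ T ∈ (P.cochains A).weightFiltration n, ∀ (s : Q.completion A)
            (x : P.GroupRing A) (y : Q.GroupRing A),
            Ideal.Quotient.mk _ x = (Θ s).1 (n + 1) → Ideal.Quotient.mk _ y = s.1 (n + 1) →
              ΦP T x = ΦQ (F.mapH0 T) y := by
  refine ⟨fun P hP hG => ?_, fun P Q hP hGP hQ hGQ ΦP ΦQ hΦP hΦQ F hF => ?_⟩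
  · obtain ⟨p, hp, E, hE⟩ := P.exists_edgePathGroup hP
    have hfin := LetterBraiding.EdgePathGroup.finite_quotient_groupAugIdeal A hG
    let c₁ : Coalgebra A (P.cochains A).H0 := E.coalgebraH0 A hG
    let I := LetterBraiding.groupAugIdeal A P.Pi1
    let c₂ : Coalgebra A (LetterBraiding.finiteTypeDual A I) :=
      LetterBraiding.dualCoalgebra A I hfin
    let Φ : (P.cochains A).H0 ≃ₗc[A] LetterBraiding.finiteTypeDual A I :=
      { E.dualEquiv A hG with
        counit_comp := LinearMap.ext fun T => E.pairing_one T
        map_comp_comul := LinearMap.ext fun T => by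
          have key : TensorProduct.map (E.dualEquiv A hG).toLinearMap
              (E.dualEquiv A hG).toLinearMap (E.comulH0 A hG T) =
                LetterBraiding.dualComul A _ hfin (E.dualEquiv A hG T) := by
            rw [LetterBraiding.EdgePathGroup.comulH0, LinearMap.comp_apply,
              ← LinearMap.comp_apply (TensorProduct.map _ _), ← TensorProduct.map_comp,
              LinearEquiv.comp_symm, TensorProduct.map_id]
            rfl
          exact key }
    have hΔ : ∀ (φ : LetterBraiding.finiteTypeDual A I) (x y : P.GroupRing A),
        LetterBraiding.pairEval A I x y (Coalgebra.comul φ) = φ.1 (x * y) :=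
      LetterBraiding.pairEval_dualComul hfin
    have hε : ∀ φ : LetterBraiding.finiteTypeDual A I, Coalgebra.counit (R := A) φ = φ.1 1 := fun φ => rfl
    have hw : ∀ n T, T ∈ (P.cochains A).weightFiltration n ↔ (Φ T).1 ∈ P.killing A (n + 1) :=
      fun n T => E.mem_weightFiltration_iff hG
    let Ψ : LetterBraiding.adicLimit A I →ₐ[A] WithConv ((P.cochains A).H0 →ₗ[A] A) :=
      LetterBraiding.limitHom Φ hΔ hε
    have hΨ : Function.Surjective Ψ := LetterBraiding.limitHom_surjective Φ hΔ hε hfin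
    refine ⟨LetterBraiding.PointedModel.comparison_bijective A hE hG, c₁, c₂, Φ,
      Ψ, ⟨E.isBarCoproduct_comulH0 hG, rfl,
        E.isCoalgebraFiltration_comulH0 hG⟩, ⟨hΔ, hε⟩,
      ⟨LetterBraiding.PointedModel.isLetterPairing_pairing A hE, hw⟩, fun n T hT s x hx =>
        LetterBraiding.limitHom_apply Φ hΔ hε s T ((hw n T).1 hT) hx,
      hΨ, fun n s => ?_, fun n => ?_, fun h =>
        ⟨LetterBraiding.limitHom_injective Φ hΔ hε hfin h, hΨ⟩⟩
    · simp only [hw]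
      exact LetterBraiding.limitHom_vanish_iff Φ hΔ hε hfin (n + 1) s
    · obtain ⟨m, hm⟩ := LetterBraiding.exists_limitHom_eq Φ hΔ hε hfin n
      exact ⟨m, fun f hf => hm f fun T hT => hf T ((hw m T).2 (P.killing_mono A m.le_succ hT))⟩
  · obtain ⟨p, hp, E, hE⟩ := P.exists_edgePathGroup hP
    obtain ⟨p', hp', E', hE'⟩ := Q.exists_edgePathGroup hQ
    rw [LetterBraiding.PointedModel.eq_of_isLetterPairing A hE hGP hΦP,
      LetterBraiding.PointedModel.eq_of_isLetterPairing A hE' hGQ hΦQ]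
    exact E.exists_completion_equiv E' F hF
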